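/- **Setting.** Consider an episodic MDP with horizon $H\ge 1$, state space $\mathcal X$ (a measurable space), countable non-empty action set $\mathcal A$, transition kernels $P^h(\cdot\mid x,a)$, measurable rewards $r^h(x,a,x')\in[0,1]$ ($h\in[H]$), and initial law $\mu$. Rewards are sparse: from every level and state, whatever actions are taken, the total remaining reward is almost surely at most $1$. Let $V_\pi^h,Q_\pi^h$ be the value functions of deterministic (level-dependent, measurable) policies, $V_\star^h=\sup_\pi V_\pi^h$, $Q_\star^h=\sup_\pi Q_\pi^h$, and write $f(x)=\max_a f(x,a)$. At level $h$ put $\mathcal T V(x,a)=\mathbb E[r^h+V(x^{h+1})\mid x,a]$ and $\mathcal T_2V(x,a)=\mathbb E[(r^h+V(x^{h+1}))^2\mid x,a]$. **Function classes.** $\mathcal F^h$ ($h\in[H]$) are finite classes of measurable functions $\mathcal X\times\mathcal A\to[0,L]$, and they are $\epsilon$-complete, $\epsilon\in[0,1]$: for every $h$, for every measurable $V:\mathcal X\to[0,2]$ some $f\in\mathcal F^h$ has $\|f-\mathcal TV\|_\infty\le\epsilon$; for every measurable $V:\mathcal X\to[0,1]$ some $f\in\mathcal F^h$ has $\|f-\mathcal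 T_2V\|_\infty\le\epsilon$; and some $f\in\mathcal F^h$ has $\|f-Q_\star^h\|_\infty\le\epsilon$. Put $\mathcal N=\max_h|\mathcal F^h|$ and, for $\lambda>0$, $$D_{\mathcal F}^2(z;z_{[t-1]},\sigma_{[t-1]})=\sup_{f_1,f_2\in\mathcal F}\frac{(f_1(z)-f_2(z))^2}{\sum_{s<t}\sigma_s^{-2}(f_1(z_s)-f_2(z_s))^2+\lambda},$$ $$\dim_{\alpha,T}(\mathcal F)=\sup_{z_{[T]},\,\sigma_{[T]}\ge\alpha}\sum_{i=1}^T\min\{1,\sigma_i^{-2}D_{\mathcal F}^2(z_i;z_{[i-1]},\sigma_{[i-1]})\},\qquad d_\alpha=\frac1H\sum_{h=1}^H\dim_{\alpha,T}(\mathcal F^h).$$ Assume $d_\alpha\ge1$ (automatic for $\epsilon\le1/2$ and the $\alpha,\lambda$ below). **Parameters.** Let $\lambda=1$, $\alpha=\sqrt{1/(TH)}$, $\delta>0$, $\delta'=\delta/((T+1)(H+1))$, $\mathcal N_b=|\mathcal W|$ for the class $\mathcal W$ below, $P_0=(2\log\frac{4LT}{\alpha}+2)(\log\frac{8L}{\alpha^2}+2)$,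 and $$\upsilon=\sqrt{\log\tfrac{\mathcal N^2P_0}{\delta'}},\quad \iota=3\sqrt{\log\tfrac{\mathcal N\mathcal N_bP_0}{\delta'}},\quad \beta_{t,1}=\sqrt{6\sqrt\lambda+156}\,\upsilon+\sqrt{8tL\epsilon/\alpha^2},$$ $$\dot\iota^2=2\log\tfrac{\mathcal N\mathcal N_b(2\log(18LT)+2)(\log(18L)+2)}{\delta'},\quad \beta_{t,2}=\sqrt{2(24L+21)\dot\iota^2+20tL\epsilon},$$ $$\iota'^2=2\log\tfrac{\mathcal N\mathcal N_b(2\log(32LT)+2)(\log(32L)+2)}{\delta'},\quad \bar\beta_t=\sqrt{8(11L+9)\iota'^2+32tL\epsilon}.$$ **Bonus oracle.** Given $h$, $t$, weights $\sigma_{[t-1]}\ge\alpha$, data $(x_s,a_s,r_s,x_s')_{s<t}$ with $z_s=(x_s,a_s)$, a function $\hat f\in\mathcal F^h$ and a radius $\beta_t$, the oracle $\mathcal B$ returns $b:\mathcal X\times\mathcal A\to\mathbb R_{\ge0}$ in a finite class $\mathcal W$ of measurable functions such that, for all $z$, $b(z)\ge|f(z)-\hat f(z)|$ for every $f\in\mathcal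 F^h$ with $\sum_{s<t}\sigma_s^{-2}(f(z_s)-\hat f(z_s))^2\le\beta_t^2$, and $b(z)\le C\big(D_{\mathcal F^h}(z;z_{[t-1]},\sigma_{[t-1]})\sqrt{\beta_t^2+\lambda}+\epsilon_b\beta_t\big)$, with constants $C>0$, $\epsilon_b\ge0$. It is consistent: if $t<t'$, the weights and data for $t'$ extend those for $t$, and $\hat f,\hat f'\in\mathcal F^h$ are weighted least-squares solutions for these data (with targets $r_s+V(x_s')$ and $r_s+V'(x_s')$ for some $V,V'$), then the bonus for $t'$ is pointwise at most the bonus for $t$. All this holds for both radius sequences $\beta_t=\beta_{t,1}$ and $\beta_t=\beta_{t,2}$. **VOQL** with thresholds $u_t$. In episode $t=1,\dots,T$ put $f_{t,j}^{H+1}=0$ for $j\in\{1,2,-2\}$. In the first episode $f_{1,1}^h=1$, $f_{1,2}^h=2$, $f_{1,-2}^h=0$ for $h\le H$. If $t\ge2$, for $h=H,\dots,1$, with the data of episodes $s<t$: * $\hat f_{t,1}^h$ minimizes $\sum_{s<t}(\bar\sigma_s^h)^{-2}(f(z_s^h)-r_s^h-f_{t,1}^{h+1}(x_s^{h+1}))^2$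 over $f\in\mathcal F^h$; for $j=\pm2$, $\hat f_{t,j}^h$ minimizes $\sum_{s<t}(f(z_s^h)-r_s^h-f_{t,j}^{h+1}(x_s^{h+1}))^2$; $\hat g_t^h$ minimizes $\sum_{s<t}(g(z_s^h)-(r_s^h+f_{t,1}^{h+1}(x_s^{h+1}))^2)^2$; * $b_{t,1}^h$ is the bonus for the weights $\bar\sigma_s^h$, the function $\hat f_{t,1}^h$ and the radius $\beta_{t,1}$; $b_{t,2}^h$ is the bonus for the weights $1$, the function $\hat f_{t,2}^h$ and the radius $\beta_{t,2}$; * $f_{t,1}^h=\min(\hat f_{t,1}^h+b_{t,1}^h+\epsilon,1)$, $f_{t,2}^h=\min(\hat f_{t,2}^h+2b_{t,1}^h+b_{t,2}^h+3\epsilon,2)$, $f_{t,-2}^h=\max(\hat f_{t,-2}^h-b_{t,2}^h-\epsilon,0)$. Then $x_t^1\sim\mu$, and for $h=1,\dots,H$ the action $a_t^h$ maximizes $f_{t,1}^h(x_t^h,\cdot)$ if $f_{t,1}^{h'}(x_t^{h'})\ge f_{t,2}^{h'}(x_t^{h'})-u_t$ for all $h'\le h$, and maximizes $f_{t,2}^h(x_t^h,\cdot)$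 otherwise; $x_t^{h+1}\sim P^h(\cdot\mid x_t^h,a_t^h)$ and $r_t^h=r^h(x_t^h,a_t^h,x_t^{h+1})$. Finally $(\sigma_1^h)^2=4$, for $t\ge2$ $$(\sigma_t^h)^2=\min\Big(4,\ \hat g_t^h(z_t^h)-\hat f_{t,-2}^h(z_t^h)^2+D_{\mathcal F^h}(z_t^h;z_{[t-1]}^h,1)\big(\sqrt{\bar\beta_t^2+\lambda}+2L\sqrt{\beta_{t,2}^2+\lambda}\big)+2(1+L)\epsilon\Big)$$ (a negative value counts as $\sigma_t^h=0$), and $$\bar\sigma_t^h=\max\Big\{\sigma_t^h,\ \alpha,\ \sqrt2\,\iota\sqrt{f_{t,2}^h(z_t^h)-f_{t,-2}^h(z_t^h)},\ 2(\sqrt\upsilon+\iota)\sqrt{D_{\mathcal F^h}(z_t^h;z_{[t-1]}^h,\bar\sigma_{[t-1]}^h)}\Big\}.$$ Ties are broken arbitrarily, depending on the past only. **Regret.** $R_T=\sum_{t\in[T]}\mathbb E_{x^1\sim\mu}[V_\star^1(x^1)-V_t^1]$, where $V_t^1$ is the conditional expectation of $\sum_hr_t^h$ given $x_t^1$ and the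 past episodes, and the outer expectation is over $x_t^1$, given the past episodes. **Theorem.** Write $\Lambda=\log\frac{\mathcal NTH}{\delta}+T^2H\epsilon$, $\ell=\log\frac{\mathcal N\mathcal N_bTH}{\delta}$, $\Lambda_\alpha=\log\frac{\mathcal NTH}{\alpha\delta}+\frac T{\alpha^2}\epsilon$, $\ell_\alpha=\log\frac{\mathcal N\mathcal N_bTH}{\alpha\delta}$. For all $L$, $C>0$ and $K\ge0$ there is $C_0>0$, and for every $C_u\ge C_0$ there is $C_R>0$, such that for all $T\ge1$ and all MDPs, classes, oracles, $\epsilon$, $\epsilon_b$, $\delta$ as above: 1. If $\delta<\frac1{T+10}$ and $u_t=C_u\Big(\frac{\sqrt{\Lambda_\alpha}\,(\ell_\alpha H^{5/2}\sqrt{d_\alpha}+\sqrt t\,H\epsilon_b)}{\sqrt t}+H^2\epsilon+H\delta\Big)$, then $\mathbb E R_T\le C_R\big(\sqrt{\Lambda}\sqrt{THd_\alpha}+\Lambda(\ell^2H^5d_\alpha+T^2\epsilon_b^2)\big)$. 2. If $\delta\le\frac1{H^2+11}$ and $u_t=C_u\Big(\frac{\sqrt{\Lambda_\alpha}\,(\ell_\alpha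 H^{5/2}\sqrt{d_\alpha}+\sqrt t\,H^2\epsilon_b)}{\sqrt t}+H^2\epsilon\Big)$, then $R_T\le C_R\big(\sqrt{\Lambda}\sqrt{THd_\alpha}+\Lambda(\ell^2H^5d_\alpha+T^2\epsilon_b^2)\big)$ with probability at least $1-\delta$. 3. If $TH\epsilon_b\le K$, $\delta<\frac1{T+H^2+11}$ and $u_t=C_u\Big(\frac{\sqrt{\Lambda}\,\ell\sqrt{H^5d_\alpha}}{\sqrt t}+H^2\epsilon+H\delta\Big)$, then $\mathbb E R_T\le C_R\big(\sqrt{\Lambda}\sqrt{THd_\alpha}+\Lambda\,\ell^2H^5d_\alpha\big)$, and with probability at least $1-\delta$ also $R_T\le C_R\big(\sqrt{\Lambda}\sqrt{THd_\alpha}+\Lambda\,\ell^2H^5d_\alpha\big)$. -/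

import Mathlib

open MeasureTheory ProbabilityTheory Set

universe u v w

noncomputable section

/-- A time-inhomogeneous episodic Markov decision process with horizon `H`. The levels are
`1, …, H`; the values of `trans` and `reward` at other levels are never used. -/
structure EpisodicMDP (X A : Type*) [MeasurableSpace X] [MeasurableSpace A] where
  /-- the horizon -/
  H : ℕ
  H_pos : 0 < H
  /-- the transition kernels `P^h(· | x, a)` -/
  trans : ℕ → Kernel (X × A) X
  trans_markov : ∀ h, IsMarkovKernel (trans h)
  /-- the rewards `r^h(x, a, x')` -/
  reward : ℕ → X → A → X → ℝ
  reward_measurable : ∀ h, Measurable fun q : X × A × X => reward h q.1 q.2.1 q.2.2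
  reward_mem : ∀ h x a x', reward h x a x' ∈ Icc (0 : ℝ) 1
  /-- the law of the first state of an episode -/
  start : Measure X
  start_prob : IsProbabilityMeasure start

namespace EpisodicMDP

variable {X A : Type*} [MeasurableSpace X] [MeasurableSpace A] (M : EpisodicMDP X A)

/-- `M.RewardAtMost k h x c`: starting from state `x` at level `h`, the total reward of the next
`k` levels is almost surely at most `c`, whatever actions are taken (they may depend on the
past). -/
def RewardAtMost : ℕ → ℕ → X → ℝ → Prop
  | 0, _, _, c => 0 ≤ c
  | k + 1, h, x, c =>
      ∀ a, ∀ᵐ x' ∂(M.trans h (x, a)), RewardAtMost k (h + 1) x' (c - M.reward h x a x')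

/-- Sparse rewards: from every level and state on, the total reward is at most `1`. -/
def SparseReward : Prop :=
  ∀ h ∈ Finset.Icc 1 M.H, ∀ x, M.RewardAtMost (M.H + 1 - h) h x 1

/-- Deterministic (measurable) policies, one map `X → A` for each level. -/
abbrev Policy (X A : Type*) [MeasurableSpace X] [MeasurableSpace A] : Type _ :=
  {π : ℕ → X → A // ∀ h, Measurable (π h)}

/-- Expected total reward of the policy `π` over `k` levels, from state `x` at level `h`. -/
def policyReturn (π : ℕ → X → A) : ℕ → ℕ → X → ℝ
  | 0, _, _ => 0
  | k + 1, h, x =>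
      ∫ x', (M.reward h x (π h x) x' + policyReturn π k (h + 1) x') ∂(M.trans h (x, π h x))

/-- `V_π^h(x)`, for `1 ≤ h ≤ H + 1`. -/
def valueV (π : ℕ → X → A) (h : ℕ) (x : X) : ℝ := M.policyReturn π (M.H + 1 - h) h x

/-- The Bellman operator `(𝒯 V)(x, a) = 𝔼[r^h + V(x^{h+1}) | x, a]` at level `h`. -/
def bellman (h : ℕ) (V : X → ℝ) (z : X × A) : ℝ :=
  ∫ x', (M.reward h z.1 z.2 x' + V x') ∂(M.trans h z)

/-- The second-moment operator `(𝒯₂ V)(x, a) = 𝔼[(r^h + V(x^{h+1}))² | x, a]` at level `h`. -/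
def bellmanSq (h : ℕ) (V : X → ℝ) (z : X × A) : ℝ :=
  ∫ x', (M.reward h z.1 z.2 x' + V x') ^ 2 ∂(M.trans h z)

/-- `Q_π^h(x, a)`. -/
def valueQ (π : ℕ → X → A) (h : ℕ) (z : X × A) : ℝ := M.bellman h (M.valueV π (h + 1)) z

/-- The optimal value function `V_⋆^h = sup_π V_π^h`. -/
def optV (h : ℕ) (x : X) : ℝ := ⨆ π : Policy X A, M.valueV π.1 h x

/-- The optimal action-value function `Q_⋆^h = sup_π Q_π^h`. -/
def optQ (h : ℕ) (z : X × A) : ℝ := ⨆ π : Policy X A, M.valueQ π.1 h z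

/-- `ε`-completeness of the finite function classes `F h` (`1 ≤ h ≤ H`) for the Bellman operator
and for the second-moment operator. -/
structure Complete (F : ℕ → Finset (X × A → ℝ)) (L ε : ℝ) : Prop where
  measurable : ∀ h ∈ Finset.Icc 1 M.H, ∀ f ∈ F h, Measurable f
  range : ∀ h ∈ Finset.Icc 1 M.H, ∀ f ∈ F h, ∀ z, f z ∈ Icc 0 L
  first_moment : ∀ h ∈ Finset.Icc 1 M.H, ∀ V : X → ℝ, Measurable V → (∀ x, V x ∈ Icc (0 : ℝ) 2) →
    ∃ f ∈ F h, ∀ z, |f z - M.bellman h V z| ≤ ε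
  second_moment : ∀ h ∈ Finset.Icc 1 M.H, ∀ V : X → ℝ, Measurable V → (∀ x, V x ∈ Icc (0 : ℝ) 1) →
    ∃ f ∈ F h, ∀ z, |f z - M.bellmanSq h V z| ≤ ε
  optimal : ∀ h ∈ Finset.Icc 1 M.H, ∃ f ∈ F h, ∀ z, |f z - M.optQ h z| ≤ ε

/-- The size `𝒩 = max_h |F h|`. -/
def classSize (F : ℕ → Finset (X × A → ℝ)) : ℕ := (Finset.Icc 1 M.H).sup fun h => (F h).card

end EpisodicMDP

section Eluder

variable {Z : Type*}

/-- `D²_F(z; z_{[t-1]}, σ_{[t-1]})`. Sequences are indexed from `1`; only the first `t - 1` terms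
matter. -/
def wdistSq (F : Finset (Z → ℝ)) (lam : ℝ) (zs : ℕ → Z) (σ : ℕ → ℝ) (t : ℕ) (z : Z) : ℝ :=
  ⨆ q : F × F, (q.1.1 z - q.2.1 z) ^ 2 /
    (∑ s ∈ Finset.Ico 1 t, 1 / σ s ^ 2 * (q.1.1 (zs s) - q.2.1 (zs s)) ^ 2 + lam)

/-- `D_F(z; z_{[t-1]}, σ_{[t-1]})`. -/
def wdist (F : Finset (Z → ℝ)) (lam : ℝ) (zs : ℕ → Z) (σ : ℕ → ℝ) (t : ℕ) (z : Z) : ℝ :=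
  Real.sqrt (wdistSq F lam zs σ t z)

/-- The generalized Eluder dimension `dim_{α,T}(F)`, a supremum over `z_1, …, z_T` and over
weights `σ_1, …, σ_T ≥ α`. -/
def eluderDim (F : Finset (Z → ℝ)) (lam α : ℝ) (T : ℕ) : ℝ :=
  ⨆ q : {q : (ℕ → Z) × (ℕ → ℝ) // ∀ s, α ≤ q.2 s},
    ∑ i ∈ Finset.Icc 1 T, min 1 (1 / q.1.2 i ^ 2 * wdistSq F lam q.1.1 q.1.2 i (q.1.1 i))

/-- `f` minimizes the weighted square loss `∑_{s < t} (f(z_s) - y_s)² / σ_s²` over `F`. -/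
def IsLeastSquares (F : Finset (Z → ℝ)) (σ : ℕ → ℝ) (zs : ℕ → Z) (y : ℕ → ℝ) (t : ℕ)
    (f : Z → ℝ) : Prop :=
  f ∈ F ∧ ∀ g ∈ F, ∑ s ∈ Finset.Ico 1 t, 1 / σ s ^ 2 * (f (zs s) - y s) ^ 2 ≤
    ∑ s ∈ Finset.Ico 1 t, 1 / σ s ^ 2 * (g (zs s) - y s) ^ 2

end Eluder

/-- The parameters of the algorithm, apart from the threshold sequence `u`. -/
structure VOQLParams where
  /-- number of episodes -/
  T : ℕ
  /-- horizon -/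
  H : ℕ
  /-- range of the function classes -/
  L : ℝ
  /-- completeness error -/
  ε : ℝ
  /-- error of the bonus oracle -/
  εb : ℝ
  /-- smallest regression weight -/
  α : ℝ
  /-- regularization -/
  lam : ℝ
  /-- failure probability -/
  δ : ℝ
  /-- size of the function classes -/
  N : ℕ
  /-- size of the bonus class -/
  Nb : ℕ

namespace VOQLParams

variable (p : VOQLParams)

/-- `δ_{t,h}`, which depends neither on `t` nor on `h`. -/
def δth : ℝ := p.δ / ((p.T + 1) * (p.H + 1))

/-- `(2 log(4LT/α) + 2)(log(8L/α²) + 2)` -/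
def peel : ℝ :=
  (2 * Real.log (4 * p.L * p.T / p.α) + 2) * (Real.log (8 * p.L / p.α ^ 2) + 2)

/-- `υ(δ_{t,h})` -/
def υ : ℝ := Real.sqrt (Real.log ((p.N : ℝ) ^ 2 * p.peel / p.δth))

/-- `ι(δ_{t,h})` -/
def ι : ℝ := 3 * Real.sqrt (Real.log (p.N * p.Nb * p.peel / p.δth))

/-- `β_{t,1}^h` -/
def β₁ (t : ℕ) : ℝ :=
  Real.sqrt (6 * Real.sqrt p.lam + 156) *
      Real.sqrt (Real.log ((p.N : ℝ) ^ 2 * (p.T + 1) * (p.H + 1) * p.peel / p.δ)) +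
    Real.sqrt (8 * t * p.L / p.α ^ 2 * p.ε)

/-- `ι̇(δ_{t,h})` -/
def ιDot : ℝ :=
  Real.sqrt (2 * Real.log (p.N * p.Nb * (2 * Real.log (18 * p.L * p.T) + 2) *
    (Real.log (18 * p.L) + 2) / p.δth))

/-- `β_{t,2}^h` -/
def β₂ (t : ℕ) : ℝ := Real.sqrt (2 * (24 * p.L + 21) * p.ιDot ^ 2 + 20 * t * p.L * p.ε)

/-- `ι'(δ_{t,h})` -/
def ιPrime : ℝ :=
  Real.sqrt (2 * Real.log (p.N * p.Nb * (2 * Real.log (32 * p.L * p.T) + 2) *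
    (Real.log (32 * p.L) + 2) / p.δth))

/-- `β̄_t^h` -/
def βBar (t : ℕ) : ℝ := Real.sqrt (8 * (11 * p.L + 9) * p.ιPrime ^ 2 + 32 * t * p.L * p.ε)

end VOQLParams

/-- A sequence of observed state-action pairs, rewards and next states at some level. -/
structure Dataset (X A : Type*) where
  z : ℕ → X × A
  r : ℕ → ℝ
  next : ℕ → X

/-- A bonus oracle. `B h t σ D f β` is the bonus function that it returns at level `h` for the
weights `σ_1, …, σ_{t-1}`, the first `t - 1` entries of `D`, the regression solution `f` and the
confidence radius `β` (function classes, `λ` and `ε_b` being fixed). -/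
abbrev BonusOracle (X A : Type*) : Type _ :=
  ℕ → ℕ → (ℕ → ℝ) → Dataset X A → (X × A → ℝ) → ℝ → X × A → ℝ

/-- `D` and `D'` have the same first `t - 1` entries, and so have the weights `σ` and `σ'`. -/
def SamePrefix {X A : Type*} (t : ℕ) (σ σ' : ℕ → ℝ) (D D' : Dataset X A) : Prop :=
  ∀ s ∈ Finset.Ico 1 t, σ s = σ' s ∧ D.z s = D'.z s ∧ D.r s = D'.r s ∧ D.next s = D'.next s

/-- `B` is a consistent bonus oracle with outputs in the finite class `W` and with constant `C`,
for the confidence radii `β 1, β 2, …`. -/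
structure IsConsistentBonusOracle {X A : Type*} (B : BonusOracle X A)
    (F : ℕ → Finset (X × A → ℝ)) (W : Finset (X × A → ℝ)) (p : VOQLParams) (C : ℝ)
    (β : ℕ → ℝ) : Prop where
  causal : ∀ h ∈ Finset.Icc 1 p.H, ∀ t ∈ Finset.Icc 1 p.T, ∀ σ σ' D D', SamePrefix t σ σ' D D' →
    ∀ f, B h t σ D f (β t) = B h t σ' D' f (β t)
  mem : ∀ h ∈ Finset.Icc 1 p.H, ∀ t ∈ Finset.Icc 1 p.T, ∀ σ : ℕ → ℝ, (∀ s, p.α ≤ σ s) →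
    ∀ D, ∀ f ∈ F h, B h t σ D f (β t) ∈ W
  nonneg : ∀ h ∈ Finset.Icc 1 p.H, ∀ t ∈ Finset.Icc 1 p.T, ∀ σ : ℕ → ℝ, (∀ s, p.α ≤ σ s) →
    ∀ D, ∀ f ∈ F h, ∀ z, 0 ≤ B h t σ D f (β t) z
  lower : ∀ h ∈ Finset.Icc 1 p.H, ∀ t ∈ Finset.Icc 1 p.T, ∀ σ : ℕ → ℝ, (∀ s, p.α ≤ σ s) →
    ∀ D, ∀ f ∈ F h, ∀ z, ∀ g ∈ F h,
      ∑ s ∈ Finset.Ico 1 t, (g (D.z s) - f (D.z s)) ^ 2 / σ s ^ 2 ≤ β t ^ 2 →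
        |g z - f z| ≤ B h t σ D f (β t) z
  upper : ∀ h ∈ Finset.Icc 1 p.H, ∀ t ∈ Finset.Icc 1 p.T, ∀ σ : ℕ → ℝ, (∀ s, p.α ≤ σ s) →
    ∀ D, ∀ f ∈ F h, ∀ z, B h t σ D f (β t) z ≤
      C * (wdist (F h) p.lam D.z σ t z * Real.sqrt (β t ^ 2 + p.lam) + p.εb * β t)
  consistent : ∀ h ∈ Finset.Icc 1 p.H, ∀ t ∈ Finset.Icc 1 p.T, ∀ t' ∈ Finset.Icc 1 p.T, t < t' →
    ∀ σ σ' : ℕ → ℝ, (∀ s, p.α ≤ σ s) → (∀ s, p.α ≤ σ' s) →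
    ∀ D D', SamePrefix t σ σ' D D' → ∀ f f' : X × A → ℝ, ∀ V V' : X → ℝ,
      IsLeastSquares (F h) σ D.z (fun s => D.r s + V (D.next s)) t f →
      IsLeastSquares (F h) σ' D'.z (fun s => D'.r s + V' (D'.next s)) t' f' →
      ∀ z, B h t' σ' D' f' (β t') z ≤ B h t σ D f (β t) z

/-- Everything that is observed or computed while the algorithm runs, as functions of the episode
`t` and the level `h`. -/
structure Trace (X A : Type*) where
  /-- the states `x_t^h`, `1 ≤ h ≤ H + 1` -/
  x : ℕ → ℕ → X
  /-- the actions `a_t^h` -/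
  a : ℕ → ℕ → A
  /-- the regression solutions `f̂_{t,1}^h`, `f̂_{t,2}^h`, `f̂_{t,-2}^h` and `ĝ_t^h` -/
  fhat₁ : ℕ → ℕ → X × A → ℝ
  fhat₂ : ℕ → ℕ → X × A → ℝ
  fhatNeg₂ : ℕ → ℕ → X × A → ℝ
  ghat : ℕ → ℕ → X × A → ℝ
  /-- the bonuses `b_{t,1}^h` and `b_{t,2}^h` -/
  b₁ : ℕ → ℕ → X × A → ℝ
  b₂ : ℕ → ℕ → X × A → ℝ
  /-- the regression weights `σ̄_t^h` -/
  σbar : ℕ → ℕ → ℝ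

/-- `f(x) = max_a f(x, a)` -/
def maxAct {X A : Type*} (f : X × A → ℝ) (x : X) : ℝ := ⨆ a, f (x, a)

/-- `a` maximizes `f(x, ·)`. -/
def IsGreedy {X A : Type*} (f : X × A → ℝ) (x : X) (a : A) : Prop := ∀ a', f (x, a') ≤ f (x, a)

namespace Trace

variable {X A : Type*} (τ : Trace X A) (p : VOQLParams)

/-- `z_t^h = (x_t^h, a_t^h)` -/
def z (t h : ℕ) : X × A := (τ.x t h, τ.a t h)

/-- The optimistic function `f_{t,1}^h`. It vanishes at level `H + 1`; no data are available in
the first episode, where it is the trivial upper bound. -/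
def f₁ (t h : ℕ) (z : X × A) : ℝ :=
  if p.H < h then 0 else if t ≤ 1 then 1 else min (τ.fhat₁ t h z + τ.b₁ t h z + p.ε) 1

/-- The overly optimistic function `f_{t,2}^h`. -/
def f₂ (t h : ℕ) (z : X × A) : ℝ :=
  if p.H < h then 0 else if t ≤ 1 then 2 else
    min (τ.fhat₂ t h z + 2 * τ.b₁ t h z + τ.b₂ t h z + 3 * p.ε) 2

/-- The overly pessimistic function `f_{t,-2}^h`. -/
def fNeg₂ (t h : ℕ) (z : X × A) : ℝ :=
  if p.H < h then 0 else if t ≤ 1 then 0 else max (τ.fhatNeg₂ t h z - τ.b₂ t h z - p.ε) 0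

variable [MeasurableSpace X] [MeasurableSpace A]

/-- The data collected at level `h`. -/
def data (M : EpisodicMDP X A) (h : ℕ) : Dataset X A where
  z s := τ.z s h
  r s := M.reward h (τ.x s h) (τ.a s h) (τ.x s (h + 1))
  next s := τ.x s (h + 1)

/-- The variance estimate `(σ_t^h)²`. -/
def sigmaSq (M : EpisodicMDP X A) (F : ℕ → Finset (X × A → ℝ)) (t h : ℕ) : ℝ :=
  if t ≤ 1 then 4 else
    min 4 (τ.ghat t h (τ.z t h) - τ.fhatNeg₂ t h (τ.z t h) ^ 2 +
      wdist (F h) p.lam (τ.data M h).z (fun _ => 1) t (τ.z t h) *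
        (Real.sqrt (p.βBar t ^ 2 + p.lam) + 2 * p.L * Real.sqrt (p.β₂ t ^ 2 + p.lam)) +
      2 * (1 + p.L) * p.ε)

/-- The regression weight `σ̄_t^h`, in terms of the earlier weights. -/
def weight (M : EpisodicMDP X A) (F : ℕ → Finset (X × A → ℝ)) (t h : ℕ) : ℝ :=
  max (max (Real.sqrt (τ.sigmaSq p M F t h)) p.α)
    (max (Real.sqrt 2 * p.ι * Real.sqrt (τ.f₂ p t h (τ.z t h) - τ.fNeg₂ p t h (τ.z t h)))
      (2 * (Real.sqrt p.υ + p.ι) *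
        Real.sqrt (wdist (F h) p.lam (τ.data M h).z (fun s => τ.σbar s h) t (τ.z t h))))

end Trace

/-- `τ` is a possible outcome of a run of VOQL with the function classes `F`, the bonus oracle
`B`, the parameters `p` and the thresholds `u`; minimizers and maximizers are arbitrary. -/
structure IsVOQL {X A : Type*} [MeasurableSpace X] [MeasurableSpace A] (M : EpisodicMDP X A)
    (F : ℕ → Finset (X × A → ℝ)) (B : BonusOracle X A) (p : VOQLParams) (u : ℕ → ℝ)
    (τ : Trace X A) : Prop where
  fhat₁ : ∀ t ∈ Finset.Icc 2 p.T, ∀ h ∈ Finset.Icc 1 p.H,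
    IsLeastSquares (F h) (fun s => τ.σbar s h) (τ.data M h).z
      (fun s => (τ.data M h).r s + maxAct (τ.f₁ p t (h + 1)) ((τ.data M h).next s)) t
      (τ.fhat₁ t h)
  fhat₂ : ∀ t ∈ Finset.Icc 2 p.T, ∀ h ∈ Finset.Icc 1 p.H,
    IsLeastSquares (F h) (fun _ => 1) (τ.data M h).z
      (fun s => (τ.data M h).r s + maxAct (τ.f₂ p t (h + 1)) ((τ.data M h).next s)) t
      (τ.fhat₂ t h)
  fhatNeg₂ : ∀ t ∈ Finset.Icc 2 p.T, ∀ h ∈ Finset.Icc 1 p.H,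
    IsLeastSquares (F h) (fun _ => 1) (τ.data M h).z
      (fun s => (τ.data M h).r s + maxAct (τ.fNeg₂ p t (h + 1)) ((τ.data M h).next s)) t
      (τ.fhatNeg₂ t h)
  ghat : ∀ t ∈ Finset.Icc 2 p.T, ∀ h ∈ Finset.Icc 1 p.H,
    IsLeastSquares (F h) (fun _ => 1) (τ.data M h).z
      (fun s => ((τ.data M h).r s + maxAct (τ.f₁ p t (h + 1)) ((τ.data M h).next s)) ^ 2) t
      (τ.ghat t h)
  b₁ : ∀ t ∈ Finset.Icc 2 p.T, ∀ h ∈ Finset.Icc 1 p.H,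
    τ.b₁ t h = B h t (fun s => τ.σbar s h) (τ.data M h) (τ.fhat₁ t h) (p.β₁ t)
  b₂ : ∀ t ∈ Finset.Icc 2 p.T, ∀ h ∈ Finset.Icc 1 p.H,
    τ.b₂ t h = B h t (fun _ => 1) (τ.data M h) (τ.fhat₂ t h) (p.β₂ t)
  weights : ∀ t ∈ Finset.Icc 1 p.T, ∀ h ∈ Finset.Icc 1 p.H, τ.σbar t h = τ.weight p M F t h
  greedy₁ : ∀ t ∈ Finset.Icc 1 p.T, ∀ h ∈ Finset.Icc 1 p.H,
    (∀ h' ∈ Finset.Icc 1 h,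
      maxAct (τ.f₁ p t h') (τ.x t h') ≥ maxAct (τ.f₂ p t h') (τ.x t h') - u t) →
    IsGreedy (τ.f₁ p t h) (τ.x t h) (τ.a t h)
  greedy₂ : ∀ t ∈ Finset.Icc 1 p.T, ∀ h ∈ Finset.Icc 1 p.H,
    (¬ ∀ h' ∈ Finset.Icc 1 h,
      maxAct (τ.f₁ p t h') (τ.x t h') ≥ maxAct (τ.f₂ p t h') (τ.x t h') - u t) →
    IsGreedy (τ.f₂ p t h) (τ.x t h) (τ.a t h)

/-- A run of VOQL in the MDP `M`, on the probability space `(Ω, P)`. -/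
structure VOQLRun {X A : Type*} [MeasurableSpace X] [MeasurableSpace A] (M : EpisodicMDP X A)
    (F : ℕ → Finset (X × A → ℝ)) (B : BonusOracle X A) (p : VOQLParams) (u : ℕ → ℝ)
    {Ω : Type*} [mΩ : MeasurableSpace Ω] (P : Measure Ω) where
  trace : Ω → Trace X A
  /-- `hist t h` is the information available once the state `x_t^{h+1}` has been observed;
  thus `hist t H` is the information available at the end of episode `t`. -/
  hist : ℕ → ℕ → MeasurableSpace Ω
  hist_le : ∀ t h, hist t h ≤ mΩ
  hist_mono : ∀ t, ∀ h < M.H, hist t h ≤ hist t (h + 1)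
  hist_next : ∀ t, hist t M.H ≤ hist (t + 1) 0
  isVOQL : ∀ ω, IsVOQL M F B p u (trace ω)
  /-- the functions used in episode `t` are determined by the past episodes -/
  fhat₁_meas : ∀ t ∈ Finset.Icc 2 p.T, ∀ h ∈ Finset.Icc 1 p.H, ∀ g,
    MeasurableSet[hist (t - 1) M.H] {ω | (trace ω).fhat₁ t h = g}
  fhat₂_meas : ∀ t ∈ Finset.Icc 2 p.T, ∀ h ∈ Finset.Icc 1 p.H, ∀ g,
    MeasurableSet[hist (t - 1) M.H] {ω | (trace ω).fhat₂ t h = g}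
  fhatNeg₂_meas : ∀ t ∈ Finset.Icc 2 p.T, ∀ h ∈ Finset.Icc 1 p.H, ∀ g,
    MeasurableSet[hist (t - 1) M.H] {ω | (trace ω).fhatNeg₂ t h = g}
  ghat_meas : ∀ t ∈ Finset.Icc 2 p.T, ∀ h ∈ Finset.Icc 1 p.H, ∀ g,
    MeasurableSet[hist (t - 1) M.H] {ω | (trace ω).ghat t h = g}
  b₁_meas : ∀ t ∈ Finset.Icc 2 p.T, ∀ h ∈ Finset.Icc 1 p.H, ∀ g,
    MeasurableSet[hist (t - 1) M.H] {ω | (trace ω).b₁ t h = g}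
  b₂_meas : ∀ t ∈ Finset.Icc 2 p.T, ∀ h ∈ Finset.Icc 1 p.H, ∀ g,
    MeasurableSet[hist (t - 1) M.H] {ω | (trace ω).b₂ t h = g}
  x_meas : ∀ t ∈ Finset.Icc 1 p.T, ∀ h ≤ M.H, Measurable[hist t h] fun ω => (trace ω).x t (h + 1)
  a_meas : ∀ t ∈ Finset.Icc 1 p.T, ∀ h ∈ Finset.Icc 1 p.H,
    Measurable[hist t (h - 1)] fun ω => (trace ω).a t h
  /-- given the past episodes, `x_t^1` has the law `μ` -/
  law_start : ∀ t ∈ Finset.Icc 1 p.T, ∀ s : Set X, MeasurableSet s →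
    P[((fun ω => (trace ω).x t 1) ⁻¹' s).indicator fun _ => (1 : ℝ) | hist (t - 1) M.H]
      =ᵐ[P] fun _ => M.start.real s
  /-- given the past, `x_t^{h+1}` has the law `P^h(· | x_t^h, a_t^h)` -/
  law_step : ∀ t ∈ Finset.Icc 1 p.T, ∀ h ∈ Finset.Icc 1 p.H, ∀ s : Set X, MeasurableSet s →
    P[((fun ω => (trace ω).x t (h + 1)) ⁻¹' s).indicator fun _ => (1 : ℝ) | hist t (h - 1)]
      =ᵐ[P] fun ω => (M.trans h ((trace ω).z t h)).real s

namespace VOQLRun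

variable {X A : Type*} [MeasurableSpace X] [MeasurableSpace A] {M : EpisodicMDP X A}
  {F : ℕ → Finset (X × A → ℝ)} {B : BonusOracle X A} {p : VOQLParams} {u : ℕ → ℝ}
  {Ω : Type*} [mΩ : MeasurableSpace Ω] {P : Measure Ω} (R : VOQLRun M F B p u P)

/-- `V_t^1`, the expected total reward of episode `t` given `x_t^1` and the functions used. -/
def value (t : ℕ) : Ω → ℝ :=
  P[fun ω => ∑ h ∈ Finset.Icc 1 M.H, ((R.trace ω).data M h).r t | R.hist t 0]

/-- `Regret(T) = ∑_t 𝔼_{x^1 ∼ μ}[V_⋆^1(x^1) - V_t^1]`; the expectation over the first state of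
episode `t` is the conditional expectation given the earlier episodes. -/
def regret (ω : Ω) : ℝ :=
  ∑ t ∈ Finset.Icc 1 p.T,
    (P[fun ω' => M.optV 1 ((R.trace ω').x t 1) - R.value t ω' | R.hist (t - 1) M.H]) ω

end VOQLRun

section Main

variable {X A : Type*} [MeasurableSpace X] [MeasurableSpace A] (M : EpisodicMDP X A)
  (F : ℕ → Finset (X × A → ℝ)) (W : Finset (X × A → ℝ))

/-- The parameters with `α = √(1/(TH))` and `λ = 1`. -/
def stdParams (T : ℕ) (L ε εb δ : ℝ) : VOQLParams where
  T := T
  H := M.H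
  L := L
  ε := ε
  εb := εb
  α := Real.sqrt (1 / (T * M.H))
  lam := 1
  δ := δ
  N := M.classSize F
  Nb := W.card

end Main

namespace VOQLParams

/-- `d_α`, the average of the generalized Eluder dimensions of `F 1, …, F H`. -/
def avgDim {Z : Type*} (p : VOQLParams) (F : ℕ → Finset (Z → ℝ)) : ℝ :=
  1 / p.H * ∑ h ∈ Finset.Icc 1 p.H, eluderDim (F h) p.lam p.α p.T

variable (p : VOQLParams) (d : ℝ)

/-- The threshold `u_t` for the bound in expectation, without the constant. -/
def thresholdExp (t : ℕ) : ℝ :=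
  Real.sqrt (Real.log (p.N * p.T * p.H / (p.α * p.δ)) + p.T / p.α ^ 2 * p.ε) *
      (Real.log (p.N * p.Nb * p.T * p.H / (p.α * p.δ)) * (p.H : ℝ) ^ (5 / 2 : ℝ) * Real.sqrt d +
        Real.sqrt t * p.H * p.εb) / Real.sqrt t +
    (p.H : ℝ) ^ 2 * p.ε + p.H * p.δ

/-- The threshold `u_t` for the bound in probability, without the constant. -/
def thresholdProb (t : ℕ) : ℝ :=
  Real.sqrt (Real.log (p.N * p.T * p.H / (p.α * p.δ)) + p.T / p.α ^ 2 * p.ε) *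
      (Real.log (p.N * p.Nb * p.T * p.H / (p.α * p.δ)) * (p.H : ℝ) ^ (5 / 2 : ℝ) * Real.sqrt d +
        Real.sqrt t * (p.H : ℝ) ^ 2 * p.εb) / Real.sqrt t +
    (p.H : ℝ) ^ 2 * p.ε

/-- The threshold `u_t` for an accurate bonus oracle (`T H ε_b = O(1)`), without the constant. -/
def thresholdAcc (t : ℕ) : ℝ :=
  Real.sqrt (Real.log (p.N * p.T * p.H / p.δ) + (p.T : ℝ) ^ 2 * p.H * p.ε) *
      (Real.log (p.N * p.Nb * p.T * p.H / p.δ) * Real.sqrt ((p.H : ℝ) ^ 5 * d)) / Real.sqrt t +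
    (p.H : ℝ) ^ 2 * p.ε + p.H * p.δ

/-- The regret bound for an accurate bonus oracle, without the constant. -/
def boundAcc : ℝ :=
  Real.sqrt (Real.log (p.N * p.T * p.H / p.δ) + (p.T : ℝ) ^ 2 * p.H * p.ε) *
      Real.sqrt (p.T * p.H * d) +
    (Real.log (p.N * p.T * p.H / p.δ) + (p.T : ℝ) ^ 2 * p.H * p.ε) *
      (Real.log (p.N * p.Nb * p.T * p.H / p.δ) ^ 2 * (p.H : ℝ) ^ 5 * d)

/-- The regret bound for a general bonus oracle, without the constant. -/
def bound : ℝ :=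
  Real.sqrt (Real.log (p.N * p.T * p.H / p.δ) + (p.T : ℝ) ^ 2 * p.H * p.ε) *
      Real.sqrt (p.T * p.H * d) +
    (Real.log (p.N * p.T * p.H / p.δ) + (p.T : ℝ) ^ 2 * p.H * p.ε) *
      (Real.log (p.N * p.Nb * p.T * p.H / p.δ) ^ 2 * (p.H : ℝ) ^ 5 * d +
        (p.T : ℝ) ^ 2 * p.εb ^ 2)

end VOQLParams

end

set_option linter.unusedSectionVars false

/-! ### Bounded integrals, maxima over actions, dynamic programming -/

section

/-! All probability is confined to one event of probability at least `1 - δ` (`RunGood`), on which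
the regret bound is deterministic.

Regression. Every value function of the algorithm is a truncated maximum built from a member of `F`
and bonuses from `W`, hence lies in a finite class. A Bernstein bound with fixed parameter
(`VOQLRun.measure_not_noiseBound_le`) and a union bound (`VOQLRun.measure_not_regressionGood_le`)
control the noise of all regressions. For the unweighted ones this bounds the squared error at once
(`sum_sq_le_of_noiseBound`). In the weighted one the noise of `r + V` is split into that of `r + V⋆`
and that of `V - V⋆`. The function `V⋆` is fixed, so its union bound does not involve `𝒩_b`, which
keeps `𝒩_b` out of the leading radius; the second part pays for `𝒩_b`, but its variance is smaller
than the squared weight by the factor `2 ι²`. The admissible size of the coefficients depends on the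
error being estimated, which is resolved by peeling (`weighted_sum_sq_le_of_noiseBound`).

Monotonicity. The weight of episode `s` must dominate the variance of `f_{t,1} - V⋆` for every later
`t`. This is the role of `f_{s,2}`: bonuses decrease in time by consistency of the oracle, so
`f_{t,1} ≤ f_{s,2}` for `s ≤ t`, and the gap `f_{s,2} - f_{s,-2}`, which is part of the weight,
dominates that variance. Optimism, pessimism, monotonicity and the variance estimates need each
other and are proved together, by induction from the last level down (`IsVOQL.stepGood`,
`IsVOQL.levelGood`). The bonus of `f̂_{t,2}` serves `f̂_{t,-2}` as well, by consistency with a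
fictitious next episode (`IsVOQL.bonus₂_lower_neg`); therefore the last episode is left out of the
analysis, as is the first, where there are no data. Each costs at most `1`.

One episode. Telescoping along the path, each level costs a bonus `b_1`, each level of exploration a
bonus `b_2` in addition, while the switch to exploration gains `u_t`
(`IsVOQL.optV_sub_sum_reward_le`). The gap obeys a similar recursion, paying `u_t` for each level
where the action was greedy for `f_1` instead of `f_2` (`IsVOQL.gap_le`). Because rewards are
sparse, the variances along an episode have conditional mean at most `2`, independently of `H`
(`IsVOQL.sum_cvar_le`). Multiplicative concentration passes between conditional means and observed
sums at the price of a factor `2` and a logarithm (`VOQLRun.measure_not_runGood_le`).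

Summation. Cauchy–Schwarz and the Eluder dimension bound the sum of the `b_1` by `√Λ (s √(H d) + H
d)` up to constants and `ε_b`, where `s² = ∑ σ̄²` (`IsVOQL.sum_dist_le`). In turn `s²` is at most of
order `T` plus `ℓ` times the gaps plus lower-order terms, and the gaps are bounded by the bonuses
and thresholds. This quadratic inequality is solved for `s` in `sq_weight_le` and gives the main
term `√Λ √(T H d)`. If `n` episodes explore, their extra bonuses cost about `H √(ℓ d n)` while the
switches gain at least `n` times the last threshold; the arithmetic-geometric inequality eliminates
`n` (`regret_arithmetic`). All this presupposes `√Λ ℓ √(H⁵ d) ≤ √T`; otherwise `T`, a trivial bound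
for the regret, is already below the claimed one. -/

theorem integrable_of_mem_Icc {Ω : Type*} {m : MeasurableSpace Ω} {μ : Measure Ω} [IsFiniteMeasure μ]
    {f : Ω → ℝ} (hf : Measurable f) {a b : ℝ} (h : ∀ x, f x ∈ Icc a b) : Integrable f μ :=
  Integrable.of_bound hf.aestronglyMeasurable (max |a| |b|)
    (Filter.Eventually.of_forall fun x => by
      rw [Real.norm_eq_abs]; exact abs_le_max_abs_abs (h x).1 (h x).2)

theorem integral_mem_Icc {Ω : Type*} {m : MeasurableSpace Ω} {μ : Measure Ω} [IsProbabilityMeasure μ]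
    {f : Ω → ℝ} (hf : Measurable f) {a b : ℝ} (h : ∀ x, f x ∈ Icc a b) : ∫ x, f x ∂μ ∈ Icc a b := by
  have hi := integrable_of_mem_Icc (μ := μ) hf h
  constructor
  · have := integral_mono (integrable_const a) hi (fun x => (h x).1)
    simpa using this
  · have := integral_mono hi (integrable_const b) (fun x => (h x).2)
    simpa using this

section MaxAct

variable {X A : Type*}

theorem le_maxAct {f : X × A → ℝ} {c : ℝ} (hf : ∀ z, f z ≤ c) (x : X) (a : A) :
    f (x, a) ≤ maxAct f x :=
  le_ciSup (f := fun a => f (x, a)) ⟨c, by rintro _ ⟨a, rfl⟩; exact hf _⟩ a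

theorem maxAct_le [Nonempty A] {f : X × A → ℝ} {c : ℝ} (x : X) (hf : ∀ a, f (x, a) ≤ c) :
    maxAct f x ≤ c := ciSup_le hf

theorem maxAct_mem_Icc [Nonempty A] {f : X × A → ℝ} {a b : ℝ} (hf : ∀ z, f z ∈ Icc a b) (x : X) :
    maxAct f x ∈ Icc a b :=
  ⟨(hf _).1.trans (le_maxAct (fun z => (hf z).2) x (Classical.arbitrary A)),
    maxAct_le x fun a => (hf _).2⟩

theorem maxAct_mono [Nonempty A] {f g : X × A → ℝ} {c : ℝ} (hg : ∀ z, g z ≤ c)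
    (h : ∀ z, f z ≤ g z) (x : X) : maxAct f x ≤ maxAct g x :=
  maxAct_le x fun a => (h _).trans (le_maxAct hg x a)

theorem IsGreedy.maxAct_eq {f : X × A → ℝ} {x : X} {a : A} (h : IsGreedy f x a) :
    maxAct f x = f (x, a) :=
  have : Nonempty A := ⟨a⟩
  le_antisymm (maxAct_le x h) (le_ciSup (f := fun a => f (x, a)) ⟨_, by rintro _ ⟨b, rfl⟩; exact h b⟩ a)

theorem maxAct_const [Nonempty A] (c : ℝ) : maxAct (fun _ : X × A => c) = fun _ => c := by
  funext x; simp [maxAct]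

variable [MeasurableSpace X] [MeasurableSpace A]

theorem measurable_maxAct [Countable A] {f : X × A → ℝ} (hf : Measurable f) :
    Measurable (maxAct f) :=
  Measurable.iSup fun a => hf.comp (measurable_id.prodMk measurable_const)

end MaxAct

namespace EpisodicMDP

variable {X : Type u} {A : Type v} [MeasurableSpace X] [MeasurableSpace A] (M : EpisodicMDP X A)

instance (h : ℕ) : IsMarkovKernel (M.trans h) := M.trans_markov h

theorem measurable_reward (h : ℕ) :
    Measurable fun q : (X × A) × X => M.reward h q.1.1 q.1.2 q.2 :=
  (M.reward_measurable h).comp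
    ((measurable_fst.comp measurable_fst).prodMk
      ((measurable_snd.comp measurable_fst).prodMk measurable_snd))

/-- `𝔼[φ(z, x') | z]` at level `h`. -/
noncomputable def cmean (h : ℕ) (φ : (X × A) × X → ℝ) (z : X × A) : ℝ :=
  ∫ y, φ (z, y) ∂(M.trans h z)

/-- The conditional variance of `φ(z, x')` given `z` at level `h`. -/
noncomputable def cvar (h : ℕ) (φ : (X × A) × X → ℝ) (z : X × A) : ℝ :=
  ∫ y, (φ (z, y) - M.cmean h φ z) ^ 2 ∂(M.trans h z)

/-- `r^h + V(x^{h+1})` -/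
def target (h : ℕ) (V : X → ℝ) (q : (X × A) × X) : ℝ := M.reward h q.1.1 q.1.2 q.2 + V q.2

/-- `(r^h + V(x^{h+1}))²` -/
def targetSq (h : ℕ) (V : X → ℝ) (q : (X × A) × X) : ℝ := M.target h V q ^ 2

theorem cmean_target (h : ℕ) (V : X → ℝ) : M.cmean h (M.target h V) = M.bellman h V := rfl

theorem cmean_targetSq (h : ℕ) (V : X → ℝ) : M.cmean h (M.targetSq h V) = M.bellmanSq h V := rfl

theorem measurable_target (h : ℕ) {V : X → ℝ} (hV : Measurable V) : Measurable (M.target h V) :=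
  (M.measurable_reward h).add (hV.comp measurable_snd)

theorem target_mem {h : ℕ} {V : X → ℝ} {a b : ℝ} (hV : ∀ x, V x ∈ Icc a b) (q : (X × A) × X) :
    M.target h V q ∈ Icc a (1 + b) :=
  ⟨by have := (M.reward_mem h q.1.1 q.1.2 q.2).1; have := (hV q.2).1; unfold target; linarith,
   by have := (M.reward_mem h q.1.1 q.1.2 q.2).2; have := (hV q.2).2; unfold target; linarith⟩

variable {M} {h : ℕ} {φ ψ : (X × A) × X → ℝ} {a b : ℝ}

theorem integrable_section (hφ : Measurable φ) (hb : ∀ q, φ q ∈ Icc a b) (z : X × A) :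
    Integrable (fun y => φ (z, y)) (M.trans h z) :=
  integrable_of_mem_Icc (hφ.comp measurable_prodMk_left) fun _ => hb _

theorem measurable_cmean (hφ : Measurable φ) : Measurable (M.cmean h φ) :=
  (hφ.stronglyMeasurable.integral_kernel_prod_right' (κ := M.trans h)).measurable

theorem cmean_mem (hφ : Measurable φ) (hb : ∀ q, φ q ∈ Icc a b) (z : X × A) :
    M.cmean h φ z ∈ Icc a b :=
  integral_mem_Icc (hφ.comp measurable_prodMk_left) fun _ => hb _

theorem measurable_cvar (hφ : Measurable φ) : Measurable (M.cvar h φ) := by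
  have : Measurable fun q : (X × A) × X => (φ q - M.cmean h φ q.1) ^ 2 :=
    (hφ.sub ((measurable_cmean hφ).comp measurable_fst)).pow_const 2
  exact (this.stronglyMeasurable.integral_kernel_prod_right' (κ := M.trans h)).measurable

theorem cvar_nonneg (z : X × A) : 0 ≤ M.cvar h φ z := integral_nonneg fun _ => sq_nonneg _

theorem cvar_le (hφ : Measurable φ) (hb : ∀ q, φ q ∈ Icc a b) (z : X × A) :
    M.cvar h φ z ≤ ((b - a) / 2) ^ 2 := by
  have hm : Measurable fun y => φ (z, y) := hφ.comp measurable_prodMk_left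
  have := variance_le_sq_of_bounded (μ := M.trans h z) (X := fun y => φ (z, y)) (a := a) (b := b)
    (Filter.Eventually.of_forall fun y => hb _) hm.aemeasurable
  rwa [variance_eq_integral hm.aemeasurable] at this

theorem integrable_sq_section (hφ : Measurable φ) (hb : ∀ q, φ q ∈ Icc a b) (z : X × A) :
    Integrable (fun y => φ (z, y) ^ 2) (M.trans h z) := by
  refine integrable_of_mem_Icc (a := 0) (b := max |a| |b| ^ 2)
    ((hφ.comp measurable_prodMk_left).pow_const 2) fun y => ⟨sq_nonneg _, ?_⟩
  rw [← sq_abs]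
  exact pow_le_pow_left₀ (abs_nonneg _) (abs_le_max_abs_abs (hb _).1 (hb _).2) 2

theorem cvar_eq (hφ : Measurable φ) (hb : ∀ q, φ q ∈ Icc a b) (z : X × A) :
    M.cvar h φ z = M.cmean h (fun q => φ q ^ 2) z - M.cmean h φ z ^ 2 := by
  have h1 := integrable_section (M := M) (h := h) hφ hb z
  have h2 := integrable_sq_section (M := M) (h := h) hφ hb z
  have e1 := integral_sub h2 (h1.const_mul (2 * M.cmean h φ z))
  have e2 := integral_add (h2.sub (h1.const_mul (2 * M.cmean h φ z)))
    (integrable_const (M.cmean h φ z ^ 2))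
  simp only [Pi.sub_apply] at e2
  rw [e1, integral_const_mul] at e2
  simp only [integral_const, probReal_univ, smul_eq_mul, one_mul] at e2
  have : M.cvar h φ z = ∫ y, (φ (z, y) ^ 2 - 2 * M.cmean h φ z * φ (z, y) + M.cmean h φ z ^ 2)
      ∂(M.trans h z) := integral_congr_ae (Filter.Eventually.of_forall fun y => by simp only; ring)
  rw [this, e2]
  unfold cmean
  ring

theorem cmean_mono (hφ : Measurable φ) (hb : ∀ q, φ q ∈ Icc a b) {c d : ℝ} (hψ : Measurable ψ)
    (hc : ∀ q, ψ q ∈ Icc c d) {z : X × A} (hle : ∀ y, φ (z, y) ≤ ψ (z, y)) :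
    M.cmean h φ z ≤ M.cmean h ψ z :=
  integral_mono (integrable_section hφ hb z) (integrable_section hψ hc z) hle

theorem measurable_bellman {V : X → ℝ} (hV : Measurable V) : Measurable (M.bellman h V) :=
  measurable_cmean (M.measurable_target h hV)

theorem bellman_mem {V : X → ℝ} (hV : Measurable V) (hb : ∀ x, V x ∈ Icc a b) (z : X × A) :
    M.bellman h V z ∈ Icc a (1 + b) :=
  cmean_mem (M.measurable_target h hV) (M.target_mem hb) z

theorem bellman_mono {V V' : X → ℝ} {c d : ℝ} (hV : Measurable V) (hb : ∀ x, V x ∈ Icc a b)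
    (hV' : Measurable V') (hb' : ∀ x, V' x ∈ Icc c d) (hle : ∀ x, V x ≤ V' x) (z : X × A) :
    M.bellman h V z ≤ M.bellman h V' z :=
  cmean_mono (M.measurable_target h hV) (M.target_mem hb) (M.measurable_target h hV')
    (M.target_mem hb') fun y => by unfold target; linarith [hle y]

theorem cmean_sub_eq_bellman_sub {V V' : X → ℝ} {c d : ℝ} (hV : Measurable V)
    (hb : ∀ x, V x ∈ Icc a b) (hV' : Measurable V') (hb' : ∀ x, V' x ∈ Icc c d) (z : X × A) :
    M.cmean h (fun q => V q.2 - V' q.2) z = M.bellman h V z - M.bellman h V' z := by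
  have h1 := integrable_section (M := M) (h := h) (M.measurable_target h hV) (M.target_mem hb) z
  have h2 := integrable_section (M := M) (h := h) (M.measurable_target h hV') (M.target_mem hb') z
  refine Eq.trans ?_ (integral_sub h1 h2)
  exact integral_congr_ae (Filter.Eventually.of_forall fun y => by simp [target])

theorem bellman_add_const {V : X → ℝ} (hV : Measurable V) (hb : ∀ x, V x ∈ Icc a b) (c : ℝ)
    (z : X × A) : M.bellman h (fun x => V x + c) z = M.bellman h V z + c := by
  have := integral_add (integrable_section (M := M) (h := h) (M.measurable_target h hV)
    (M.target_mem hb) z) (integrable_const c)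
  simp only [integral_const, probReal_univ, smul_eq_mul, one_mul] at this
  refine Eq.trans ?_ this
  exact integral_congr_ae (Filter.Eventually.of_forall fun y => by simp only [target]; ring)

/-! ### Dynamic programming -/

variable (M) in
/-- The optimal expected reward of `k` steps, defined by dynamic programming. -/
noncomputable def dpV : ℕ → ℕ → X → ℝ
  | 0, _ => fun _ => 0
  | k + 1, h => maxAct (M.bellman h (dpV k (h + 1)))

variable [Countable A] [Nonempty A]

theorem dpV_spec (k : ℕ) : ∀ h, Measurable (M.dpV k h) ∧ ∀ x, M.dpV k h x ∈ Icc (0 : ℝ) k := by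
  induction k with
  | zero => exact fun h => ⟨measurable_const, fun x => by simp [dpV]⟩
  | succ k ih =>
    intro h
    have hm := (ih (h + 1)).1
    have hb := (ih (h + 1)).2
    refine ⟨measurable_maxAct (measurable_bellman hm), maxAct_mem_Icc fun z => ?_⟩
    have := bellman_mem (M := M) (h := h) hm hb z
    push_cast
    exact ⟨this.1, by linarith [this.2]⟩

theorem policyReturn_spec {π : ℕ → X → A} (hπ : ∀ h, Measurable (π h)) (k : ℕ) : ∀ h,
    Measurable (M.policyReturn π k h) ∧ (∀ x, M.policyReturn π k h x ∈ Icc (0 : ℝ) k) ∧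
      ∀ x, M.policyReturn π k h x ≤ M.dpV k h x := by
  induction k with
  | zero => exact fun h => ⟨measurable_const, fun x => by simp [policyReturn],
      fun x => by simp [policyReturn, dpV]⟩
  | succ k ih =>
    intro h
    obtain ⟨hm, hb, hle⟩ := ih (h + 1)
    have e : M.policyReturn π (k + 1) h = fun x =>
        M.bellman h (M.policyReturn π k (h + 1)) (x, π h x) := rfl
    have hd := dpV_spec (M := M) k (h + 1)
    rw [e]
    refine ⟨(measurable_bellman hm).comp (measurable_id.prodMk (hπ h)), fun x => ?_, fun x => ?_⟩
    · have := bellman_mem (M := M) (h := h) hm hb (x, π h x)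
      push_cast
      exact ⟨this.1, by linarith [this.2]⟩
    · exact (bellman_mono hm hb hd.1 hd.2 hle _).trans
        (le_maxAct (c := 1 + k) (fun z => (bellman_mem hd.1 hd.2 z).2) x _)

/-- As `A` is countable, take the first action in an enumeration that comes within `e` of the
maximum. The slack is needed since a supremum over infinitely many actions need not be attained. -/
theorem exists_measurable_selector [MeasurableSingletonClass A] {Q : X × A → ℝ} (hQ : Measurable Q)
    {c : ℝ} (hc : ∀ z, Q z ≤ c) {e : ℝ} (he : 0 < e) :
    ∃ s : X → A, Measurable s ∧ ∀ x, maxAct Q x - e ≤ Q (x, s x) := by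
  classical
  obtain ⟨f, hf⟩ := exists_surjective_nat A
  have hex : ∀ x, ∃ n, maxAct Q x - e ≤ Q (x, f n) := fun x => by
    obtain ⟨a, ha⟩ := exists_lt_of_lt_ciSup (show maxAct Q x - e < ⨆ a, Q (x, a) by
      change _ < maxAct Q x; linarith)
    obtain ⟨n, rfl⟩ := hf a
    exact ⟨n, ha.le⟩
  refine ⟨fun x => f (Nat.find (hex x)), (measurable_of_countable f).comp
    (measurable_find hex fun n => ?_), fun x => Nat.find_spec (hex x)⟩
  exact measurableSet_le ((measurable_maxAct hQ).sub_const _)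
    (hQ.comp (measurable_id.prodMk measurable_const))

variable (M) in
-- Use an `e`-optimal selector at each level. The Bellman operator is monotone and commutes with
-- adding constants, so the losses add up. The level `M.H + 1 - k` is the one from which `k` levels
-- remain.
theorem exists_policy_near_dpV [MeasurableSingletonClass A] {e : ℝ} (he : 0 < e) :
    ∃ π : Policy X A, ∀ k ≤ M.H, ∀ x,
      M.dpV k (M.H + 1 - k) x - k * e ≤ M.policyReturn π.1 k (M.H + 1 - k) x := by
  have hs : ∀ h, ∃ s : X → A, Measurable s ∧ ∀ x,
      M.dpV (M.H + 1 - h - 1 + 1) h x - e ≤ M.bellman h (M.dpV (M.H + 1 - h - 1) (h + 1)) (x, s x) :=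
    fun h => exists_measurable_selector
      (measurable_bellman (dpV_spec _ _).1) (fun z => (bellman_mem (dpV_spec _ _).1 (dpV_spec _ _).2 z).2) he
  choose s hsm hs using hs
  refine ⟨⟨s, hsm⟩, fun k => ?_⟩
  induction k with
  | zero => simp [dpV, policyReturn]
  | succ k ih =>
    intro hk x
    have ih := ih (by omega)
    obtain ⟨h, hh⟩ : ∃ h, h = M.H + 1 - (k + 1) := ⟨_, rfl⟩
    have e1 : M.H + 1 - k = h + 1 := by omega
    have e2 : M.H + 1 - h - 1 = k := by omega
    rw [← hh]
    rw [e1] at ih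
    have h1 := hs h x
    rw [e2] at h1
    have hp := policyReturn_spec (M := M) hsm k (h + 1)
    have hd := dpV_spec (M := M) k (h + 1)
    have h2 : M.bellman h (fun x => M.dpV k (h + 1) x + -(k * e)) (x, s h x) ≤
        M.bellman h (M.policyReturn s k (h + 1)) (x, s h x) :=
      bellman_mono (a := 0 + -(k * e)) (b := k + -(k * e)) (hd.1.add_const _)
        (fun x => ⟨add_le_add_left (hd.2 x).1 _, add_le_add_left (hd.2 x).2 _⟩) hp.1 hp.2.1
        (fun x => by have := ih x; linarith) _
    rw [bellman_add_const hd.1 hd.2] at h2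
    change _ ≤ M.bellman h (M.policyReturn s k (h + 1)) (x, s h x)
    push_cast
    linarith

/-- An almost sure bound on the remaining reward survives each integration. Rewards in `[0, 1]`
alone would only give the number of levels. -/
theorem rewardAtMost_dpV_le (k : ℕ) : ∀ h x c, M.RewardAtMost k h x c → M.dpV k h x ≤ c := by
  induction k with
  | zero => exact fun h x c hc => hc
  | succ k ih =>
    intro h x c hc
    refine maxAct_le x fun a => ?_
    have hd := dpV_spec (M := M) k (h + 1)
    have := integral_mono_ae (μ := M.trans h (x, a)) (integrable_section (M := M) (h := h)
      (M.measurable_target h hd.1) (M.target_mem hd.2) (x, a)) (integrable_const c)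
      ((hc a).mono fun y hy => by
        have := ih _ _ _ hy
        simp only [target]
        linarith)
    rw [integral_const, probReal_univ, one_smul] at this
    exact this

variable [MeasurableSingletonClass A]

variable (M) in
-- Measurability of `optV`, its bound by `1` and its Bellman equation are all read off from the
-- recursion.
theorem optV_eq_dpV {h : ℕ} (hh : 1 ≤ h) (x : X) : M.optV h x = M.dpV (M.H + 1 - h) h x := by
  have : Nonempty (Policy X A) := ⟨⟨fun _ _ => Classical.arbitrary A, fun _ => measurable_const⟩⟩
  refine le_antisymm (ciSup_le fun π => (policyReturn_spec π.2 _ _).2.2 x)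
    (le_of_forall_pos_sub_le fun e he => ?_)
  have hb : BddAbove (range fun π : Policy X A => M.valueV π.1 h x) :=
    ⟨(M.H + 1 - h : ℕ), by rintro _ ⟨π, rfl⟩; exact ((policyReturn_spec π.2 _ _).2.1 x).2⟩
  -- The slack `e` is spread over the levels, so that the whole loss is at most `e`.
  obtain ⟨π, hπ⟩ := M.exists_policy_near_dpV (e := e / (M.H + 1)) (by positivity)
  refine le_trans ?_ (le_ciSup hb π)
  rcases le_or_gt h (M.H + 1) with h1 | h1
  · have := hπ (M.H + 1 - h) (by omega) x
    have e1 : M.H + 1 - (M.H + 1 - h) = h := by omega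
    rw [e1] at this
    refine le_trans ?_ this
    have h2 : ((M.H + 1 - h : ℕ) : ℝ) ≤ M.H + 1 := by exact_mod_cast Nat.sub_le _ _
    have h3 : ((M.H + 1 - h : ℕ) : ℝ) * (e / (M.H + 1)) ≤ e := by
      rw [mul_div_assoc', div_le_iff₀ (by positivity)]; nlinarith
    linarith
  · have : M.H + 1 - h = 0 := by omega
    simp [valueV, this, dpV, policyReturn, he.le]

variable (M) in
theorem optV_eq_dpV' {h : ℕ} (hh : 1 ≤ h) : M.optV h = M.dpV (M.H + 1 - h) h :=
  funext fun x => M.optV_eq_dpV hh x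

theorem measurable_optV (hh : 1 ≤ h) : Measurable (M.optV h) := by
  rw [M.optV_eq_dpV' hh]; exact (dpV_spec _ _).1

theorem optV_mem (hs : M.SparseReward) (hh : 1 ≤ h) (hH : h ≤ M.H + 1) (x : X) :
    M.optV h x ∈ Icc (0 : ℝ) 1 := by
  rw [M.optV_eq_dpV hh]
  refine ⟨((dpV_spec _ _).2 x).1, ?_⟩
  rcases hH.eq_or_lt with rfl | h1
  · simp [dpV]
  · exact rewardAtMost_dpV_le _ _ _ _ (hs h (Finset.mem_Icc.2 ⟨hh, by omega⟩) x)

theorem optV_last (x : X) : M.optV (M.H + 1) x = 0 := by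
  rw [M.optV_eq_dpV (by omega)]; simp [dpV]

variable (M) in
theorem optQ_eq (h : ℕ) : M.optQ h = M.bellman h (M.optV (h + 1)) := by
  funext z
  have : Nonempty (Policy X A) := ⟨⟨fun _ _ => Classical.arbitrary A, fun _ => measurable_const⟩⟩
  have hd := dpV_spec (M := M) (M.H + 1 - (h + 1)) (h + 1)
  rw [M.optV_eq_dpV' (by omega)]
  have hp := fun π : Policy X A => policyReturn_spec (M := M) π.2 (M.H + 1 - (h + 1)) (h + 1)
  refine le_antisymm (ciSup_le fun π => bellman_mono (hp π).1 (hp π).2.1 hd.1 hd.2 (hp π).2.2 z)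
    (le_of_forall_pos_sub_le fun e he => ?_)
  have hb : BddAbove (range fun π : Policy X A => M.valueQ π.1 h z) :=
    ⟨_, by rintro _ ⟨π, rfl⟩; exact (bellman_mem (hp π).1 (hp π).2.1 z).2⟩
  obtain ⟨π, hπ⟩ := M.exists_policy_near_dpV (e := e / (M.H + 1)) (by positivity)
  refine le_trans ?_ (le_ciSup hb π)
  have key : ∀ x, M.dpV (M.H + 1 - (h + 1)) (h + 1) x + -e ≤ M.valueV π.1 (h + 1) x := by
    intro x
    rcases le_or_gt (h + 1) (M.H + 1) with h1 | h1
    · have := hπ (M.H + 1 - (h + 1)) (by omega) x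
      have e1 : M.H + 1 - (M.H + 1 - (h + 1)) = h + 1 := by omega
      rw [e1] at this
      refine le_trans ?_ this
      have h2 : ((M.H + 1 - (h + 1) : ℕ) : ℝ) ≤ M.H + 1 := by exact_mod_cast Nat.sub_le _ _
      have h3 : ((M.H + 1 - (h + 1) : ℕ) : ℝ) * (e / (M.H + 1)) ≤ e := by
        rw [mul_div_assoc', div_le_iff₀ (by positivity)]; nlinarith
      linarith
    · have : M.H + 1 - (h + 1) = 0 := by omega
      simp [valueV, this, dpV, policyReturn, he.le]
  have h2 : M.bellman h (fun x => M.dpV (M.H + 1 - (h + 1)) (h + 1) x + -e) z ≤ M.valueQ π.1 h z :=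
    bellman_mono (hd.1.add_const _)
      (fun x => ⟨add_le_add_left (hd.2 x).1 _, add_le_add_left (hd.2 x).2 _⟩) (hp π).1 (hp π).2.1 key z
  rw [bellman_add_const hd.1 hd.2] at h2
  linarith

variable (M) in
theorem optV_eq_maxAct (hh : h ∈ Finset.Icc 1 M.H) : M.optV h = maxAct (M.optQ h) := by
  rw [Finset.mem_Icc] at hh
  rw [optQ_eq, M.optV_eq_dpV' hh.1, M.optV_eq_dpV' (by omega),
    show M.H + 1 - h = (M.H + 1 - (h + 1)) + 1 by omega]
  rfl

/-- The Bellman operator alone would give the bound `2`; the bound `1` comes from `Q⋆ ≤ V⋆` at the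
same level. -/
theorem optQ_mem (hs : M.SparseReward) (hh : h ∈ Finset.Icc 1 M.H) (z : X × A) :
    M.optQ h z ∈ Icc (0 : ℝ) 1 := by
  have hh' := Finset.mem_Icc.1 hh
  have hm := measurable_optV (M := M) (h := h + 1) (by omega)
  have hb := optV_mem hs (h := h + 1) (by omega) (by omega)
  have h0 := M.optQ_eq h ▸ bellman_mem (M := M) (h := h) hm hb
  refine ⟨(h0 z).1, ?_⟩
  have h1 := (optV_mem hs (h := h) hh'.1 (by omega) z.1).2
  rw [M.optV_eq_maxAct hh] at h1
  exact (le_maxAct (fun z => (h0 z).2) z.1 z.2).trans h1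

theorem optQ_le_optV (hs : M.SparseReward) (hh : h ∈ Finset.Icc 1 M.H) (z : X × A) :
    M.optQ h z ≤ M.optV h z.1 := by
  rw [M.optV_eq_maxAct hh]
  exact le_maxAct (fun z => (optQ_mem hs hh z).2) z.1 z.2

end EpisodicMDP

end

/-! ### Transitions given the past, and exponential tail bounds -/

section

section Law

/-- By hypothesis the joint law of `(Y, x)` and the composition of the law of `Y` with `η` agree on
rectangles, hence coincide; the rest is Fubini. -/
theorem integral_eq_of_rect {Ω Ω' X : Type*} {mΩ : MeasurableSpace Ω} {mΩ' : MeasurableSpace Ω'}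
    {mX : MeasurableSpace X} {P : Measure Ω} [IsProbabilityMeasure P] {Y : Ω → Ω'} (hY : Measurable Y)
    {x : Ω → X} (hx : Measurable x) (η : Kernel Ω' X) [IsMarkovKernel η]
    (law : ∀ A, MeasurableSet A → ∀ S, MeasurableSet S →
      P (Y ⁻¹' A ∩ x ⁻¹' S) = ∫⁻ ω in Y ⁻¹' A, η (Y ω) S ∂P)
    {Ψ : Ω' × X → ℝ} (hΨ : Measurable Ψ) {a b : ℝ} (hb : ∀ q, Ψ q ∈ Icc a b) :
    ∫ ω, Ψ (Y ω, x ω) ∂P = ∫ ω, ∫ y, Ψ (Y ω, y) ∂(η (Y ω)) ∂P := by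
  have hp : IsProbabilityMeasure (P.map Y) := Measure.isProbabilityMeasure_map hY.aemeasurable
  have key : P.map (fun ω => (Y ω, x ω)) = (P.map Y) ⊗ₘ η := by
    have : IsFiniteMeasure (P.map fun ω => (Y ω, x ω)) := inferInstance
    refine Measure.ext_prod fun {A S} hA hS => ?_
    rw [Measure.compProd_apply_prod hA hS, Measure.map_apply (hY.prodMk hx) (hA.prod hS),
      setLIntegral_map hA (η.measurable_coe hS) hY, ← law A hA S hS]
    rfl
  rw [← integral_map (φ := fun ω => (Y ω, x ω)) (hY.prodMk hx).aemeasurable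
    hΨ.aestronglyMeasurable, key, Measure.integral_compProd (integrable_of_mem_Icc hΨ hb),
    integral_map hY.aemeasurable
      (hΨ.stronglyMeasurable.integral_kernel_prod_right' (κ := η)).aestronglyMeasurable]

/-- Given `m`, the random element `x` has the law `η z`. -/
structure StepLaw {Ω Z X : Type*} (m : MeasurableSpace Ω) {mΩ : MeasurableSpace Ω}
    [MeasurableSpace Z] [MeasurableSpace X] (P : Measure Ω) (η : Kernel Z X) (z : Ω → Z) (x : Ω → X) : Prop where
  le : m ≤ mΩ
  meas_z : Measurable[m] z
  meas_x : Measurable x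
  law : ∀ S, MeasurableSet S →
    P[(x ⁻¹' S).indicator (fun _ => (1 : ℝ)) | m] =ᵐ[P] fun ω => (η (z ω)).real S

variable {Ω Z X : Type*} {m mΩ : MeasurableSpace Ω} [MeasurableSpace Z] [mX : MeasurableSpace X]
  {P : Measure Ω} [IsProbabilityMeasure P] {η : Kernel Z X} [IsMarkovKernel η]
  {z : Ω → Z} {x : Ω → X}

/-- Here `Y` is the identity into `Ω` with the smaller σ-algebra `m`. Thus a conditional law given
set by set integrates functions of the whole past and the next state. -/
theorem StepLaw.integral_eq (hl : StepLaw m P η z x) {Ψ : Ω × X → ℝ}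
    (hΨ : Measurable[m.prod mX] Ψ) {a b : ℝ} (hb : ∀ q, Ψ q ∈ Icc a b) :
    ∫ ω, Ψ (ω, x ω) ∂P = ∫ ω, ∫ y, Ψ (ω, y) ∂(η (z ω)) ∂P := by
  have hz : Measurable[m] z := hl.meas_z
  have hη : @IsMarkovKernel Ω X m mX (@Kernel.comap _ _ _ _ _ m η z hz) :=
    @Kernel.IsMarkovKernel.comap _ _ _ _ _ m z η _ hz
  refine @integral_eq_of_rect Ω Ω X mΩ m mX P _ id (measurable_id'' hl.le) x hl.meas_x
    (@Kernel.comap _ _ _ _ _ m η z hz) hη (fun A hA S hS => ?_) Ψ hΨ a b hb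
  have hmS : Measurable fun ω => (η (z ω)) S :=
    (η.measurable_coe hS).comp (hz.mono hl.le le_rfl)
  have h1 := setIntegral_condExp hl.le (μ := P) (s := A)
    (f := (x ⁻¹' S).indicator fun _ => (1 : ℝ))
    ((integrable_const _).indicator (hl.meas_x hS)) hA
  rw [setIntegral_congr_ae (g := fun ω => (η (z ω)).real S) (hl.le A hA)
    ((hl.law S hS).mono fun ω h _ => h), integral_indicator (hl.meas_x hS)] at h1
  simp only [integral_const, smul_eq_mul, mul_one, Measure.restrict_restrict (hl.meas_x hS),
    measureReal_def, Measure.restrict_apply_univ] at h1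
  rw [integral_toReal hmS.aemeasurable
    (Filter.Eventually.of_forall fun ω => measure_lt_top _ _)] at h1
  rw [ENNReal.toReal_eq_toReal_iff' _ (measure_ne_top _ _), inter_comm] at h1
  · exact h1.symm
  · refine ne_of_lt (lt_of_le_of_lt (lintegral_mono (g := fun _ => 1) fun ω => prob_le_one) ?_)
    simp

theorem StepLaw.measurable_comp (_ : StepLaw m P η z x) {m' : MeasurableSpace Ω} (hm : m ≤ m')
    (hx : Measurable[m'] x) {Ψ : Ω × X → ℝ} (hΨ : Measurable[m.prod mX] Ψ) :
    Measurable[m'] fun ω => Ψ (ω, x ω) :=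
  hΨ.comp ((measurable_id'' hm).prodMk hx)

theorem StepLaw.measurable_integral (hl : StepLaw m P η z x) {Ψ : Ω × X → ℝ}
    (hΨ : Measurable[m.prod mX] Ψ) : Measurable[m] fun ω => ∫ y, Ψ (ω, y) ∂(η (z ω)) := by
  have hη : @IsMarkovKernel Ω X m mX (@Kernel.comap _ _ _ _ _ m η z hl.meas_z) :=
    @Kernel.IsMarkovKernel.comap _ _ _ _ _ m z η _ hl.meas_z
  exact (hΨ.stronglyMeasurable.integral_kernel_prod_right'
    (κ := @Kernel.comap _ _ _ _ _ m η z hl.meas_z)).measurable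

theorem StepLaw.condExp_eq (hl : StepLaw m P η z x) {Ψ : Ω × X → ℝ}
    (hΨ : Measurable[m.prod mX] Ψ) {a b : ℝ} (hb : ∀ q, Ψ q ∈ Icc a b) :
    P[fun ω => Ψ (ω, x ω) | m] =ᵐ[P] fun ω => ∫ y, Ψ (ω, y) ∂(η (z ω)) := by
  have hmI := hl.measurable_integral hΨ
  have hΨω : ∀ ω, Measurable fun y => Ψ (ω, y) := fun ω =>
    hΨ.comp (measurable_const.prodMk measurable_id)
  have hbI : ∀ ω, ∫ y, Ψ (ω, y) ∂(η (z ω)) ∈ Icc a b := fun ω =>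
    integral_mem_Icc (hΨω ω) fun y => hb _
  have hint : Integrable (fun ω => ∫ y, Ψ (ω, y) ∂(η (z ω))) P :=
    integrable_of_mem_Icc (hmI.mono hl.le le_rfl) hbI
  refine (ae_eq_condExp_of_forall_setIntegral_eq hl.le
    (integrable_of_mem_Icc (hl.measurable_comp hl.le hl.meas_x hΨ) fun ω => hb _)
    (fun s _ _ => hint.integrableOn) (fun s hs _ => ?_)
    hmI.stronglyMeasurable.aestronglyMeasurable).symm
  have hs1 : Measurable[m.prod mX] fun q : Ω × X => s.indicator (fun _ => (1 : ℝ)) q.1 :=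
    (measurable_const.indicator hs).comp measurable_fst
  -- Multiplying `Ψ` by the indicator of a set in `m` keeps it jointly measurable; the identity for
  -- the product is the defining property of the conditional expectation.
  have h1 := hl.integral_eq (Ψ := fun q => s.indicator (fun _ => (1 : ℝ)) q.1 * Ψ q)
    (a := -(max |a| |b|)) (b := max |a| |b|)
    (hs1.mul hΨ) fun q => abs_le.1 (by
      rw [abs_mul]
      refine (mul_le_mul (b := 1) ?_ (abs_le_max_abs_abs (hb q).1 (hb q).2) (abs_nonneg _)
        zero_le_one).trans (one_mul _).le
      by_cases h : q.1 ∈ s <;> simp [h])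
  simp only [integral_const_mul] at h1
  have e : ∀ f : Ω → ℝ, (fun ω => s.indicator (fun _ => (1 : ℝ)) ω * f ω) = s.indicator f := by
    intro f; funext ω; by_cases h : ω ∈ s <;> simp [h]
  rw [e, e, integral_indicator (hl.le s hs), integral_indicator (hl.le s hs)] at h1
  exact h1.symm

/-- The coarser `m'` is there because the noise of a transition is averaged given the earlier
episodes only. -/
theorem StepLaw.condExp_centered (hl : StepLaw m P η z x) {Ψ : Ω × X → ℝ}
    (hΨ : Measurable[m.prod mX] Ψ) {a b : ℝ} (hb : ∀ q, Ψ q ∈ Icc a b) {m' : MeasurableSpace Ω}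
    (hm' : m' ≤ m) :
    P[fun ω => Ψ (ω, x ω) - ∫ y, Ψ (ω, y) ∂(η (z ω)) | m'] =ᵐ[P] 0 := by
  have hmI := hl.measurable_integral hΨ
  have hΨω : ∀ ω, Measurable fun y => Ψ (ω, y) := fun ω =>
    hΨ.comp (measurable_const.prodMk measurable_id)
  have hbI : ∀ ω, ∫ y, Ψ (ω, y) ∂(η (z ω)) ∈ Icc a b := fun ω =>
    integral_mem_Icc (hΨω ω) fun y => hb _
  have hint : Integrable (fun ω => ∫ y, Ψ (ω, y) ∂(η (z ω))) P :=
    integrable_of_mem_Icc (hmI.mono hl.le le_rfl) hbI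
  have hint' : Integrable (fun ω => Ψ (ω, x ω)) P :=
    integrable_of_mem_Icc (hl.measurable_comp hl.le hl.meas_x hΨ) fun ω => hb _
  have h1 : P[fun ω => Ψ (ω, x ω) - ∫ y, Ψ (ω, y) ∂(η (z ω)) | m] =ᵐ[P] 0 := by
    refine (condExp_sub hint' hint m).trans ?_
    rw [condExp_of_stronglyMeasurable hl.le hmI.stronglyMeasurable hint]
    filter_upwards [hl.condExp_eq hΨ hb] with ω h
    simp [h]
  refine (condExp_condExp_of_le hm' hl.le).symm.trans ((condExp_congr_ae h1).trans ?_)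
  simp

end Law

section Tail

variable {Ω : Type*} {mΩ : MeasurableSpace Ω} {P : Measure Ω} [IsProbabilityMeasure P]

/-- Condition on `m t` for the last index: the earlier factors are known, and the last one has
conditional mean at most `1`. Only `had` relates the different `m s`, which need not form a
filtration. -/
theorem integral_exp_sum_le_one {a t : ℕ} {m : ℕ → MeasurableSpace Ω} {U : ℕ → Ω → ℝ} {K : ℝ}
    (hm : ∀ s ∈ Finset.Ico a t, m s ≤ mΩ)
    (hU : ∀ s ∈ Finset.Ico a t, Measurable (U s))
    (hb : ∀ s ∈ Finset.Ico a t, ∀ ω, |U s ω| ≤ K)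
    (had : ∀ s ∈ Finset.Ico a t, ∀ s' ∈ Finset.Ico a t, s < s' → Measurable[m s'] (U s))
    (hc : ∀ s ∈ Finset.Ico a t, P[fun ω => Real.exp (U s ω) | m s] ≤ᵐ[P] fun _ => 1) :
    ∫ ω, Real.exp (∑ s ∈ Finset.Ico a t, U s ω) ∂P ≤ 1 := by
  induction t with
  | zero => simp
  | succ t ih =>
    rcases lt_or_ge t a with hta | hta
    · rw [Finset.Ico_eq_empty (by omega)]; simp
    have hsub : ∀ s ∈ Finset.Ico a t, s ∈ Finset.Ico a (t + 1) := fun s hs => by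
      rw [Finset.mem_Ico] at hs ⊢; omega
    have ht : t ∈ Finset.Ico a (t + 1) := by rw [Finset.mem_Ico]; omega
    have ih := ih (fun s hs => hm s (hsub s hs)) (fun s hs => hU s (hsub s hs))
      (fun s hs => hb s (hsub s hs)) (fun s hs s' hs' => had s (hsub s hs) s' (hsub s' hs'))
      (fun s hs => hc s (hsub s hs))
    refine le_trans ?_ ih
    set S : Ω → ℝ := fun ω => ∑ s ∈ Finset.Ico a t, U s ω with hS
    have hSb : ∀ ω, |S ω| ≤ (Finset.Ico a t).card * K := fun ω =>
      (Finset.abs_sum_le_sum_abs _ _).trans ((Finset.sum_le_card_nsmul _ _ K fun s hs =>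
        hb s (hsub s hs) ω).trans (by simp))
    have hSm : Measurable[m t] fun ω => Real.exp (S ω) :=
      Real.measurable_exp.comp (Finset.measurable_sum _ fun s hs =>
        had s (hsub s hs) t ht (Finset.mem_Ico.1 hs).2)
    have hS1 : ∀ ω, Real.exp (S ω) ∈ Icc 0 (Real.exp ((Finset.Ico a t).card * K)) := fun ω =>
      ⟨(Real.exp_pos _).le, Real.exp_le_exp.2 ((le_abs_self _).trans (hSb ω))⟩
    have hiS : Integrable (fun ω => Real.exp (S ω)) P :=
      integrable_of_mem_Icc (hSm.mono (hm t ht) le_rfl) hS1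
    have hU1 : ∀ ω, Real.exp (U t ω) ∈ Icc 0 (Real.exp K) := fun ω =>
      ⟨(Real.exp_pos _).le, Real.exp_le_exp.2 ((le_abs_self _).trans (hb t ht ω))⟩
    have hiU : Integrable (fun ω => Real.exp (U t ω)) P :=
      integrable_of_mem_Icc (Real.measurable_exp.comp (hU t ht)) hU1
    have hprod : Integrable ((fun ω => Real.exp (S ω)) * fun ω => Real.exp (U t ω)) P :=
      integrable_of_mem_Icc (a := 0) (b := Real.exp ((Finset.Ico a t).card * K) * Real.exp K)
        ((hSm.mono (hm t ht) le_rfl).mul (Real.measurable_exp.comp (hU t ht))) fun ω =>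
        ⟨mul_nonneg (hS1 ω).1 (hU1 ω).1, mul_le_mul (hS1 ω).2 (hU1 ω).2 (hU1 ω).1 (Real.exp_pos _).le⟩
    have h1 := condExp_mul_of_stronglyMeasurable_left hSm.stronglyMeasurable hprod hiU
    calc ∫ ω, Real.exp (∑ s ∈ Finset.Ico a (t + 1), U s ω) ∂P
        = ∫ ω, ((fun ω => Real.exp (S ω)) * fun ω => Real.exp (U t ω)) ω ∂P := by
          refine integral_congr_ae (Filter.Eventually.of_forall fun ω => ?_)
          simp only [Finset.sum_Ico_succ_top hta, Real.exp_add, Pi.mul_apply, hS]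
      _ = ∫ ω, (P[(fun ω => Real.exp (S ω)) * fun ω => Real.exp (U t ω) | m t]) ω ∂P :=
          (integral_condExp (hm t ht)).symm
      _ ≤ ∫ ω, Real.exp (S ω) ∂P := by
          refine integral_mono_ae integrable_condExp hiS ?_
          filter_upwards [h1, hc t ht] with ω h1 h2
          rw [h1]
          simp only [Pi.mul_apply]
          exact mul_le_of_le_one_right (Real.exp_pos _).le h2

theorem measure_sum_gt_le_exp {a t : ℕ} {m : ℕ → MeasurableSpace Ω} {U : ℕ → Ω → ℝ} {K : ℝ}
    (hm : ∀ s ∈ Finset.Ico a t, m s ≤ mΩ)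
    (hU : ∀ s ∈ Finset.Ico a t, Measurable (U s))
    (hb : ∀ s ∈ Finset.Ico a t, ∀ ω, |U s ω| ≤ K)
    (had : ∀ s ∈ Finset.Ico a t, ∀ s' ∈ Finset.Ico a t, s < s' → Measurable[m s'] (U s))
    (hc : ∀ s ∈ Finset.Ico a t, P[fun ω => Real.exp (U s ω) | m s] ≤ᵐ[P] fun _ => 1) (l : ℝ) :
    P.real {ω | l < ∑ s ∈ Finset.Ico a t, U s ω} ≤ Real.exp (-l) := by
  have h1 := integral_exp_sum_le_one hm hU hb had hc
  have hmeas : Measurable fun ω => ∑ s ∈ Finset.Ico a t, U s ω := Finset.measurable_sum _ hU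
  have hint : Integrable (fun ω => Real.exp (∑ s ∈ Finset.Ico a t, U s ω)) P :=
    integrable_of_mem_Icc (a := 0) (b := Real.exp ((Finset.Ico a t).card * K))
      (Real.measurable_exp.comp hmeas) fun ω => ⟨(Real.exp_pos _).le, Real.exp_le_exp.2 <|
        (le_abs_self _).trans <| (Finset.abs_sum_le_sum_abs _ _).trans <|
          (Finset.sum_le_card_nsmul _ _ K fun s hs => hb s hs ω).trans (by simp)⟩
  have h2 := mul_meas_ge_le_integral_of_nonneg
    (Filter.Eventually.of_forall fun ω => (Real.exp_pos (∑ s ∈ Finset.Ico a t, U s ω)).le)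
    hint (Real.exp l)
  rw [Real.exp_neg, ← one_div, le_div_iff₀ (Real.exp_pos _), mul_comm]
  refine (mul_le_mul_of_nonneg_left (measureReal_mono fun ω hω => ?_) (Real.exp_pos _).le).trans
    (h2.trans h1)
  exact Real.exp_le_exp.2 (le_of_lt hω)

/-- Multiplicative concentration of a sum of `[0, R]`-valued variables around the sum of their
conditional expectations; `exp (q x) ≤ 1 + r x` on `[0, 1]`. -/
theorem measure_condExp_sum_gt_le_exp {a t : ℕ} {m : ℕ → MeasurableSpace Ω} {Y : ℕ → Ω → ℝ} {R q r : ℝ}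
    (hR : 0 < R) (hqr : ∀ x ∈ Icc (0 : ℝ) 1, Real.exp (q * x) ≤ 1 + r * x)
    (hm : ∀ s, m s ≤ mΩ)
    (hmono : ∀ s ∈ Finset.Ico a t, ∀ s' ∈ Finset.Ico a t, s < s' → m s ≤ m s')
    (hY : ∀ s ∈ Finset.Ico a t, Measurable (Y s))
    (hb : ∀ s ∈ Finset.Ico a t, ∀ ω, Y s ω ∈ Icc 0 R)
    (had : ∀ s ∈ Finset.Ico a t, ∀ s' ∈ Finset.Ico a t, s < s' → Measurable[m s'] (Y s)) (l : ℝ) :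
    P.real {ω | R * l < ∑ s ∈ Finset.Ico a t, (q * Y s ω - r * (P[Y s | m s]) ω)} ≤ Real.exp (-l) := by
  -- The conditional expectation is clipped to `[0, R]`, where it lies almost surely anyway, so that
  -- the exponents are bounded everywhere.
  set E : ℕ → Ω → ℝ := fun s ω => max 0 (min R ((P[Y s | m s]) ω)) with hE
  have hEb : ∀ s ω, E s ω ∈ Icc 0 R := fun s ω => ⟨le_max_left _ _, max_le hR.le (min_le_left _ _)⟩
  have hEm : ∀ s, Measurable[m s] (E s) := fun s =>
    measurable_const.max (measurable_const.min stronglyMeasurable_condExp.measurable)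
  have hYi : ∀ s ∈ Finset.Ico a t, Integrable (Y s) P := fun s hs =>
    integrable_of_mem_Icc (hY s hs) (hb s hs)
  have hEe : ∀ s ∈ Finset.Ico a t, E s =ᵐ[P] P[Y s | m s] := fun s hs => by
    have h1 : P[fun _ => (0 : ℝ) | m s] ≤ᵐ[P] P[Y s | m s] :=
      condExp_mono (integrable_const _) (hYi s hs) (Filter.Eventually.of_forall fun ω => (hb s hs ω).1)
    have h2 : P[Y s | m s] ≤ᵐ[P] P[fun _ => R | m s] :=
      condExp_mono (hYi s hs) (integrable_const _) (Filter.Eventually.of_forall fun ω => (hb s hs ω).2)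
    rw [condExp_const (hm s)] at h1 h2
    filter_upwards [h1, h2] with ω h1 h2
    simp [hE, h1, h2]
  have hae : ∀ᵐ ω ∂P, ∀ s ∈ Finset.Ico a t, E s ω = (P[Y s | m s]) ω :=
    (Finset.eventually_all _).2 fun s hs => hEe s hs
  have hmain := measure_sum_gt_le_exp (P := P) (a := a) (t := t) (m := m)
    (U := fun s ω => (q * Y s ω - r * E s ω) / R) (K := |q| + |r|) (fun s _ => hm s)
    (fun s hs => (((hY s hs).const_mul q).sub (((hEm s).mono (hm s) le_rfl).const_mul r)).div_const R)
    (fun s hs ω => by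
      rw [abs_div, abs_of_pos hR, div_le_iff₀ hR]
      refine (abs_sub _ _).trans ?_
      rw [abs_mul, abs_mul, add_mul, abs_of_nonneg (hb s hs ω).1, abs_of_nonneg (hEb s ω).1]
      exact add_le_add (mul_le_mul_of_nonneg_left (hb s hs ω).2 (abs_nonneg _))
        (mul_le_mul_of_nonneg_left (hEb s ω).2 (abs_nonneg _)))
    (fun s hs s' hs' hlt => by
      have h1 := had s hs s' hs' hlt
      have h2 := (hEm s).mono (hmono s hs s' hs' hlt) le_rfl
      exact ((h1.const_mul q).sub (h2.const_mul r)).div_const R)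
    (fun s hs => ?_) l
  · rw [show P.real {ω | R * l < ∑ s ∈ Finset.Ico a t, (q * Y s ω - r * (P[Y s | m s]) ω)} =
      P.real {ω | l < ∑ s ∈ Finset.Ico a t, (q * Y s ω - r * E s ω) / R} from ?_]
    · exact hmain
    refine measureReal_congr ?_
    filter_upwards [hae] with ω hω
    refine propext ?_
    change R * l < _ ↔ l < _
    rw [← Finset.sum_div, lt_div_iff₀ hR, mul_comm R l]
    rw [Finset.sum_congr rfl fun s hs => by rw [← hω s hs]]
  · have hi1 : Integrable (fun ω => 1 + r * (Y s ω / R)) P :=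
      (integrable_const _).add (((hYi s hs).div_const R).const_mul r)
    have hg : Measurable[m s] fun ω => Real.exp (-(r * (E s ω / R))) :=
      Real.measurable_exp.comp (((hEm s).div_const R).const_mul r).neg
    have hmY := hY s hs
    have hgb : ∀ ω, |Real.exp (-(r * (E s ω / R)))| ≤ Real.exp |r| := fun ω => by
      rw [abs_of_pos (Real.exp_pos _)]
      refine Real.exp_le_exp.2 ((neg_le_abs _).trans ?_)
      rw [abs_mul, abs_of_nonneg (div_nonneg (hEb s ω).1 hR.le)]
      exact mul_le_of_le_one_right (abs_nonneg _) ((div_le_one hR).2 (hEb s ω).2)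
    have hi2 : Integrable ((fun ω => Real.exp (-(r * (E s ω / R)))) *
        fun ω => 1 + r * (Y s ω / R)) P :=
      hi1.bdd_mul (c := Real.exp |r|) (hg.mono (hm s) le_rfl).aestronglyMeasurable
        (Filter.Eventually.of_forall hgb)
    have hi3 : Integrable (fun ω => Real.exp ((q * Y s ω - r * E s ω) / R)) P := by
      refine integrable_of_mem_Icc (a := 0) (b := Real.exp (|q| + |r|))
        (Real.measurable_exp.comp ((((hmY).const_mul q).sub
          (((hEm s).mono (hm s) le_rfl).const_mul r)).div_const R)) fun ω =>
          ⟨(Real.exp_pos _).le, Real.exp_le_exp.2 ?_⟩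
      rw [div_le_iff₀ hR, add_mul]
      have h1 := mul_le_mul (le_abs_self q) (hb s hs ω).2 (hb s hs ω).1 (abs_nonneg q)
      have h2 := mul_le_mul (neg_le_abs r) (hEb s ω).2 (hEb s ω).1 (abs_nonneg r)
      linarith
    have hle : P[fun ω => Real.exp ((q * Y s ω - r * E s ω) / R) | m s] ≤ᵐ[P]
        P[(fun ω => Real.exp (-(r * (E s ω / R)))) * fun ω => 1 + r * (Y s ω / R) | m s] := by
      refine condExp_mono hi3 hi2 (Filter.Eventually.of_forall fun ω => ?_)
      simp only [Pi.mul_apply]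
      rw [show (q * Y s ω - r * E s ω) / R = -(r * (E s ω / R)) + q * (Y s ω / R) by ring,
        Real.exp_add]
      exact mul_le_mul_of_nonneg_left (hqr _ ⟨div_nonneg (hb s hs ω).1 hR.le,
        (div_le_one hR).2 (hb s hs ω).2⟩) (Real.exp_pos _).le
    have hpull := condExp_mul_of_stronglyMeasurable_left hg.stronglyMeasurable hi2 hi1
    have hlin : P[fun ω => 1 + r * (Y s ω / R) | m s] =ᵐ[P]
        fun ω => 1 + r * ((P[Y s | m s]) ω / R) := by
      have e : (fun ω => 1 + r * (Y s ω / R)) = (fun _ => (1 : ℝ)) + (r / R) • Y s := by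
        funext ω; simp only [Pi.add_apply, Pi.smul_apply, smul_eq_mul]; ring
      rw [e]
      refine (condExp_add (integrable_const _) ((hYi s hs).smul _) (m s)).trans ?_
      rw [condExp_const (hm s)]
      filter_upwards [condExp_smul (μ := P) (r / R) (Y s) (m s)] with ω h
      simp only [Pi.add_apply, h, Pi.smul_apply, smul_eq_mul]; ring
    filter_upwards [hle, hpull, hlin, hEe s hs] with ω h1 h2 h3 h4
    refine h1.trans ?_
    rw [h2, Pi.mul_apply, h3, ← h4]
    have := Real.add_one_le_exp (r * (E s ω / R))
    calc Real.exp (-(r * (E s ω / R))) * (1 + r * (E s ω / R))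
        ≤ Real.exp (-(r * (E s ω / R))) * Real.exp (r * (E s ω / R)) :=
          mul_le_mul_of_nonneg_left (by linarith) (Real.exp_pos _).le
      _ = 1 := by rw [← Real.exp_add]; simp

/-- The chord of `exp(-x)` over `[0, 1]`. Through it `∑ 𝔼[Y]` is bounded by `2 ∑ Y` and a logarithm.
-/
theorem exp_neg_le_one_sub_half {x : ℝ} (hx : x ∈ Icc (0 : ℝ) 1) :
    Real.exp (-1 * x) ≤ 1 + -(1 / 2) * x := by
  have hc := convexOn_exp.2 (mem_univ (0 : ℝ)) (mem_univ (-1 : ℝ)) (sub_nonneg.2 hx.2) hx.1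
    (sub_add_cancel 1 x)
  have h1 : Real.exp (-1) ≤ 1 / 2 := by
    rw [Real.exp_neg, ← one_div]
    exact one_div_le_one_div_of_le (by norm_num) (by linarith [Real.add_one_le_exp (1 : ℝ)])
  simp only [smul_eq_mul, mul_zero, zero_add, Real.exp_zero, mul_one] at hc
  rw [mul_comm x] at hc
  nlinarith [hx.1]

/-- From `exp x ≤ 1 + x + x²`. Through it `∑ Y` is bounded by `2 ∑ 𝔼[Y]` and a logarithm. -/
theorem exp_le_one_add_two_mul {x : ℝ} (hx : x ∈ Icc (0 : ℝ) 1) :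
    Real.exp (1 * x) ≤ 1 + 2 * x := by
  have h := abs_le.1 (Real.abs_exp_sub_one_sub_id_le (x := x) (by rw [abs_of_nonneg hx.1]; exact hx.2))
  have := hx.1; have := hx.2
  rw [one_mul]
  nlinarith

end Tail

end

/-! ### Weighted distances and least squares -/

section

section Wdist

variable {Z : Type*} {F : Finset (Z → ℝ)} {lam : ℝ} {zs : ℕ → Z} {σ : ℕ → ℝ} {t : ℕ} {z : Z}

theorem wdistSq_term_nonneg (hlam : 0 < lam) (q : F × F) :
    0 ≤ (q.1.1 z - q.2.1 z) ^ 2 /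
      (∑ s ∈ Finset.Ico 1 t, 1 / σ s ^ 2 * (q.1.1 (zs s) - q.2.1 (zs s)) ^ 2 + lam) :=
  div_nonneg (sq_nonneg _) (add_nonneg (Finset.sum_nonneg fun _ _ => by positivity) hlam.le)

theorem wdistSq_nonneg (hlam : 0 < lam) : 0 ≤ wdistSq F lam zs σ t z :=
  Real.iSup_nonneg fun q => wdistSq_term_nonneg hlam q

theorem wdist_nonneg : 0 ≤ wdist F lam zs σ t z := Real.sqrt_nonneg _

theorem wdist_sq (hlam : 0 < lam) : wdist F lam zs σ t z ^ 2 = wdistSq F lam zs σ t z :=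
  Real.sq_sqrt (wdistSq_nonneg hlam)

/-- The form in which the distance is used: a cumulative error on the data becomes an error at `z`.
-/
theorem abs_sub_le_wdist (hlam : 0 < lam) {f g : Z → ℝ} (hf : f ∈ F) (hg : g ∈ F) :
    |f z - g z| ≤ wdist F lam zs σ t z *
      √(∑ s ∈ Finset.Ico 1 t, 1 / σ s ^ 2 * (f (zs s) - g (zs s)) ^ 2 + lam) := by
  have h0 : 0 < ∑ s ∈ Finset.Ico 1 t, 1 / σ s ^ 2 * (f (zs s) - g (zs s)) ^ 2 + lam :=
    add_pos_of_nonneg_of_pos (Finset.sum_nonneg fun _ _ => by positivity) hlam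
  rw [wdist, ← Real.sqrt_mul (wdistSq_nonneg hlam), ← Real.sqrt_sq_eq_abs]
  refine Real.sqrt_le_sqrt ?_
  rw [← div_le_iff₀ h0]
  exact le_ciSup (f := fun q : F × F => (q.1.1 z - q.2.1 z) ^ 2 /
      (∑ s ∈ Finset.Ico 1 t, 1 / σ s ^ 2 * (q.1.1 (zs s) - q.2.1 (zs s)) ^ 2 + lam))
    (finite_range _).bddAbove (⟨f, hf⟩, ⟨g, hg⟩)

theorem wdist_congr {zs' : ℕ → Z} {σ' : ℕ → ℝ} (h : ∀ s ∈ Finset.Ico 1 t, zs s = zs' s ∧ σ s = σ' s) :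
    wdist F lam zs σ t z = wdist F lam zs' σ' t z := by
  unfold wdist wdistSq
  congr 2
  funext q
  rw [Finset.sum_congr rfl fun s hs => by rw [(h s hs).1, (h s hs).2]]

theorem wdist_le {L : ℝ} (hL : 0 ≤ L) (hF : ∀ f ∈ F, ∀ z, f z ∈ Icc 0 L) :
    wdist F 1 zs σ t z ≤ L := by
  refine Real.sqrt_le_iff.2 ⟨hL, Real.iSup_le (fun q => ?_) (sq_nonneg _)⟩
  refine div_le_of_le_mul₀ (add_nonneg (Finset.sum_nonneg fun _ _ => by positivity) zero_le_one)
    (sq_nonneg _) ?_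
  have h1 := hF _ q.1.2 z
  have h2 := hF _ q.2.2 z
  have h3 : (q.1.1 z - q.2.1 z) ^ 2 ≤ L ^ 2 :=
    sq_le_sq' (by linarith [h1.1, h2.2]) (by linarith [h1.2, h2.1])
  refine h3.trans (le_mul_of_one_le_right (sq_nonneg _) ?_)
  linarith [Finset.sum_nonneg (s := Finset.Ico 1 t)
    (f := fun s => 1 / σ s ^ 2 * (q.1.1 (zs s) - q.2.1 (zs s)) ^ 2) fun _ _ => by positivity]

theorem sum_le_eluderDim {α : ℝ} {T : ℕ} (hσ : ∀ s ∈ Finset.Icc 1 T, α ≤ σ s) :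
    ∑ i ∈ Finset.Icc 1 T, min 1 (1 / σ i ^ 2 * wdistSq F lam zs σ i (zs i)) ≤ eluderDim F lam α T := by
  have hb : BddAbove (range fun q : {q : (ℕ → Z) × (ℕ → ℝ) // ∀ s, α ≤ q.2 s} =>
      ∑ i ∈ Finset.Icc 1 T, min 1 (1 / q.1.2 i ^ 2 * wdistSq F lam q.1.1 q.1.2 i (q.1.1 i))) := by
    refine ⟨T, ?_⟩
    rintro _ ⟨q, rfl⟩
    exact (Finset.sum_le_card_nsmul _ _ 1 fun i _ => min_le_left _ _).trans (by simp)
  -- Weights outside `{1, …, T}` are unconstrained; the maximum with `α` makes the sequence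
  -- admissible and changes no term of the sum.
  refine le_of_eq_of_le ?_ (le_ciSup hb ⟨(zs, fun s => max (σ s) α), fun s => le_max_right _ _⟩)
  refine Finset.sum_congr rfl fun i hi => ?_
  have hs : ∀ s ∈ Finset.Icc 1 T, max (σ s) α = σ s := fun s hs => max_eq_left (hσ s hs)
  simp only [hs i hi]
  congr 2
  unfold wdistSq
  congr 1
  funext q
  rw [Finset.sum_congr rfl fun s h => by
    rw [← hs s (by rw [Finset.mem_Icc] at hi ⊢; rw [Finset.mem_Ico] at h; omega)]]

theorem measurable_wdist {Ω : Type*} {m : MeasurableSpace Ω} [MeasurableSpace Z]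
    (hF : ∀ f ∈ F, Measurable f) {zs : Ω → ℕ → Z} {σ : Ω → ℕ → ℝ} {z : Ω → Z}
    (hzs : ∀ s ∈ Finset.Ico 1 t, Measurable fun ω => zs ω s)
    (hσ : ∀ s ∈ Finset.Ico 1 t, Measurable fun ω => σ ω s) (hz : Measurable z) :
    Measurable fun ω => wdist F lam (zs ω) (σ ω) t (z ω) := by
  refine Measurable.sqrt (Measurable.iSup fun q => ?_)
  have h1 := hF _ q.1.2
  have h2 := hF _ q.2.2
  refine (((h1.comp hz).sub (h2.comp hz)).pow_const 2).div
    (Measurable.add (Finset.measurable_sum _ fun s hs => ?_) measurable_const)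
  exact (((hσ s hs).pow_const 2).const_div 1).mul
    (((h1.comp (hzs s hs)).sub (h2.comp (hzs s hs))).pow_const 2)

end Wdist

section LeastSquares

variable {Z : Type*} {F : Finset (Z → ℝ)} {zs : ℕ → Z} {σ y : ℕ → ℝ} {t : ℕ} {f g : Z → ℝ}

/-- Compare the losses of `f` and of its competitor `g`. The squares of `g - y` cancel, and the
cross term with `y - g` splits into the noise `y - mean` and the approximation error `mean - g`. -/
theorem IsLeastSquares.sum_sq_sub_le (hf : IsLeastSquares F σ zs y t f) (hg : g ∈ F) {mean : Z → ℝ}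
    {ε : ℝ} (hm : ∀ z, |g z - mean z| ≤ ε) :
    ∑ s ∈ Finset.Ico 1 t, 1 / σ s ^ 2 * (f (zs s) - g (zs s)) ^ 2 ≤
      2 * ∑ s ∈ Finset.Ico 1 t, 1 / σ s ^ 2 * (f (zs s) - g (zs s)) * (y s - mean (zs s)) +
      2 * ε * ∑ s ∈ Finset.Ico 1 t, 1 / σ s ^ 2 * |f (zs s) - g (zs s)| := by
  have h := hf.2 g hg
  rw [Finset.mul_sum, Finset.mul_sum, ← Finset.sum_add_distrib]
  rw [← sub_nonneg, ← Finset.sum_sub_distrib] at h ⊢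
  refine h.trans (Finset.sum_le_sum fun s _ => ?_)
  have hw : 0 ≤ 1 / σ s ^ 2 := by positivity
  have h1 : -(f (zs s) - g (zs s)) * (g (zs s) - mean (zs s)) ≤ |f (zs s) - g (zs s)| * ε := by
    refine (le_abs_self _).trans ?_
    rw [abs_mul, abs_neg]
    exact mul_le_mul_of_nonneg_left (hm _) (abs_nonneg _)
  nlinarith [mul_le_mul_of_nonneg_left h1 hw]

theorem IsLeastSquares.congr {σ' y' : ℕ → ℝ} {zs' : ℕ → Z} (hf : IsLeastSquares F σ zs y t f)
    (h : ∀ s ∈ Finset.Ico 1 t, σ s = σ' s ∧ zs s = zs' s ∧ y s = y' s) :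
    IsLeastSquares F σ' zs' y' t f := by
  have e : ∀ g : Z → ℝ, ∑ s ∈ Finset.Ico 1 t, 1 / σ' s ^ 2 * (g (zs' s) - y' s) ^ 2 =
      ∑ s ∈ Finset.Ico 1 t, 1 / σ s ^ 2 * (g (zs s) - y s) ^ 2 := fun g =>
    Finset.sum_congr rfl fun s hs => by rw [(h s hs).1, (h s hs).2.1, (h s hs).2.2]
  refine ⟨hf.1, fun g hg => ?_⟩
  rw [e, e]
  exact hf.2 g hg

end LeastSquares

namespace EpisodicMDP

variable {X : Type u} {A : Type v} [MeasurableSpace X] [MeasurableSpace A] (M : EpisodicMDP X A)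

/-- The tail bound for the noise of `φ(z_s, x_s')`, `s < t`, with coefficients `c`. -/
def NoiseBound (h t : ℕ) (φ : (X × A) × X → ℝ) (D : Dataset X A) (c : ℕ → ℝ) (θ l : ℝ) : Prop :=
  ∑ s ∈ Finset.Ico 1 t, c s * (φ (D.z s, D.next s) - M.cmean h φ (D.z s)) ≤
    θ * ∑ s ∈ Finset.Ico 1 t, c s ^ 2 * M.cvar h φ (D.z s) + l / θ

variable {M} {F : Finset (X × A → ℝ)} {h t : ℕ} {φ : (X × A) × X → ℝ} {D : Dataset X A}

/-- The error of unweighted regression. -/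
theorem sum_sq_le_of_noiseBound {f g : X × A → ℝ} {R L ε l : ℝ}
    (hf : IsLeastSquares F (fun _ => 1) D.z (fun s => φ (D.z s, D.next s)) t f) (hg : g ∈ F)
    (hF : ∀ f ∈ F, ∀ z, f z ∈ Icc 0 L) (hε : 0 ≤ ε) (hm : ∀ z, |g z - M.cmean h φ z| ≤ ε)
    (hφ : Measurable φ) (hR : 0 < R) (hb : ∀ q, φ q ∈ Icc 0 R) (hL : 1 ≤ L)
    (hn : M.NoiseBound h t φ D (fun s => f (D.z s) - g (D.z s)) (1 / (R ^ 2 * L)) l) :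
    ∑ s ∈ Finset.Ico 1 t, (f (D.z s) - g (D.z s)) ^ 2 ≤ 4 * R ^ 2 * L * l + 4 * t * L * ε := by
  have h1 := hf.sum_sq_sub_le hg hm
  simp only [one_pow, div_one, one_mul] at h1
  unfold NoiseBound at hn
  set S := ∑ s ∈ Finset.Ico 1 t, (f (D.z s) - g (D.z s)) ^ 2 with hS
  have hS0 : 0 ≤ S := Finset.sum_nonneg fun _ _ => sq_nonneg _
  -- The variance is at most `(R / 2) ^ 2`; with `θ = 1 / (R ^ 2 * L)` the quadratic part of the
  -- noise bound is at most `S / 4`, and twice that is absorbed on the left.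
  have h2 : ∑ s ∈ Finset.Ico 1 t, (f (D.z s) - g (D.z s)) ^ 2 * M.cvar h φ (D.z s) ≤
      S * (R / 2) ^ 2 := by
    rw [hS, Finset.sum_mul]
    refine Finset.sum_le_sum fun s _ => mul_le_mul_of_nonneg_left ?_ (sq_nonneg _)
    simpa using cvar_le (M := M) (h := h) hφ hb (D.z s)
  have h3 : ∑ s ∈ Finset.Ico 1 t, |f (D.z s) - g (D.z s)| ≤ t * L := by
    refine (Finset.sum_le_card_nsmul _ _ L fun s _ => ?_).trans ?_
    · have h1 := hF _ hf.1 (D.z s)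
      have h2 := hF _ hg (D.z s)
      exact abs_le.2 ⟨by linarith [h1.1, h2.2], by linarith [h1.2, h2.1]⟩
    · rw [nsmul_eq_mul, Nat.card_Ico]
      exact mul_le_mul_of_nonneg_right (by exact_mod_cast Nat.sub_le _ _) (by linarith)
  have h4 : 1 / (R ^ 2 * L) * (S * (R / 2) ^ 2) ≤ S / 4 := by
    rw [show 1 / (R ^ 2 * L) * (S * (R / 2) ^ 2) = S / 4 / L by field_simp; norm_num]
    exact div_le_self (by positivity) hL
  have h5 := mul_le_mul_of_nonneg_left h2 (show 0 ≤ 1 / (R ^ 2 * L) by positivity)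
  have h6 : l / (1 / (R ^ 2 * L)) = R ^ 2 * L * l := by rw [div_div_eq_mul_div, div_one, mul_comm]
  rw [h6] at hn
  have h7 := mul_le_mul_of_nonneg_left h3 hε
  nlinarith

end EpisodicMDP

end

/-! ### Parameters, and weighted regression by peeling -/

section

/-- The admissible parameters: `λ = 1`, `α = √(1/(TH))` and classes that are not degenerate. -/
structure VOQLParams.Admissible (p : VOQLParams) : Prop where
  T_pos : 0 < p.T
  H_pos : 0 < p.H
  one_le_L : 1 ≤ p.L
  eps_nonneg : 0 ≤ p.ε
  epsb_nonneg : 0 ≤ p.εb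
  α_eq : p.α = √(1 / (p.T * p.H))
  lam_eq : p.lam = 1
  δ_pos : 0 < p.δ
  δ_le : p.δ ≤ 1 / 11
  two_le_N : 2 ≤ p.N
  one_le_Nb : 1 ≤ p.Nb

theorem two_le_log_of_eight_le {x : ℝ} (hx : 8 ≤ x) : 2 ≤ Real.log x := by
  rw [Real.le_log_iff_exp_le (by linarith)]
  have h1 := Real.exp_one_lt_d9
  have : Real.exp 2 = Real.exp 1 * Real.exp 1 := by rw [← Real.exp_add]; norm_num
  have h0 := Real.exp_pos 1
  nlinarith

namespace VOQLParams.Admissible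

variable {p : VOQLParams} (hp : p.Admissible)
include hp

theorem one_le_T : (1 : ℝ) ≤ p.T := by exact_mod_cast hp.T_pos
theorem one_le_H : (1 : ℝ) ≤ p.H := by exact_mod_cast hp.H_pos
theorem two_le_N' : (2 : ℝ) ≤ p.N := by exact_mod_cast hp.two_le_N
theorem one_le_Nb' : (1 : ℝ) ≤ p.Nb := by exact_mod_cast hp.one_le_Nb

theorem one_le_TH : (1 : ℝ) ≤ p.T * p.H := by
  have := hp.one_le_T; have := hp.one_le_H; nlinarith

theorem α_pos : 0 < p.α := by
  rw [hp.α_eq]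
  have := hp.one_le_TH
  positivity

theorem α_sq : p.α ^ 2 = 1 / (p.T * p.H) := by
  rw [hp.α_eq, Real.sq_sqrt]
  have := hp.one_le_TH
  positivity

theorem α_le_one : p.α ≤ 1 := by
  rw [hp.α_eq, Real.sqrt_le_iff, one_pow]
  exact ⟨zero_le_one, (div_le_one (by linarith [hp.one_le_TH])).2 hp.one_le_TH⟩

theorem δth_pos : 0 < p.δth := by
  have := hp.δ_pos
  unfold δth
  positivity

theorem δth_mul_le : p.T * p.H * p.δth ≤ p.δ := by
  have := hp.δ_pos
  unfold δth
  rw [mul_div_assoc', div_le_iff₀ (by positivity)]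
  have : (p.T : ℝ) * p.H ≤ (p.T + 1) * (p.H + 1) := by
    have := hp.one_le_T; have := hp.one_le_H; nlinarith
  nlinarith

theorem δth_le : p.δth ≤ 1 / 44 := by
  have h1 := hp.δ_le
  have := hp.one_le_T; have := hp.one_le_H
  unfold δth
  rw [div_le_iff₀ (by positivity)]
  have : (4 : ℝ) ≤ (p.T + 1) * (p.H + 1) := by nlinarith
  nlinarith

theorem peel_eq : p.peel =
    (Real.log (16 * p.L ^ 2 * p.T ^ 3 * p.H) + 2) * (Real.log (8 * p.L * p.T * p.H) + 2) := by
  have h1 := hp.α_pos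
  have h2 := hp.α_sq
  have hT := hp.one_le_T
  have hH := hp.one_le_H
  have hL := hp.one_le_L
  unfold peel
  congr 2
  · rw [show (2 : ℝ) * Real.log (4 * p.L * p.T / p.α) = (2 : ℕ) * Real.log (4 * p.L * p.T / p.α) by
      norm_num, ← Real.log_pow]
    congr 2
    rw [div_pow, h2]
    field_simp
    ring
  · rw [h2]
    congr 2
    field_simp

theorem log_aux : 2 ≤ Real.log (16 * p.L ^ 2 * p.T ^ 3 * p.H) ∧
    2 ≤ Real.log (8 * p.L * p.T * p.H) := by
  have hT := hp.one_le_T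
  have hH := hp.one_le_H
  have hL := hp.one_le_L
  have h2 : (1 : ℝ) ≤ p.L ^ 2 := one_le_pow₀ hL
  have h3 : (1 : ℝ) ≤ p.T ^ 3 := one_le_pow₀ hT
  have e1 : (1 : ℝ) ≤ p.L ^ 2 * p.T ^ 3 * p.H :=
    one_le_mul_of_one_le_of_one_le (one_le_mul_of_one_le_of_one_le h2 h3) hH
  have e2 : (1 : ℝ) ≤ p.L * p.T * p.H :=
    one_le_mul_of_one_le_of_one_le (one_le_mul_of_one_le_of_one_le hL hT) hH
  constructor <;> refine two_le_log_of_eight_le ?_ <;> nlinarith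

theorem peel_ge : 4 * (Real.log (16 * p.L ^ 2 * p.T ^ 3 * p.H) + 2) ≤ p.peel := by
  obtain ⟨h1, h2⟩ := hp.log_aux
  rw [hp.peel_eq]
  nlinarith

theorem peel_ge_sixteen : 16 ≤ p.peel := by
  have := hp.peel_ge
  have := hp.log_aux.1
  linarith

/-- A term whose logarithm occurs in `υ` and `ι` is large. -/
theorem le_ratio {c n : ℝ} (hc : 4 ≤ c) (hn : 1 ≤ n) : 8 ≤ n * c / p.δth := by
  rw [le_div_iff₀ hp.δth_pos]
  have := hp.δth_le
  nlinarith [hp.δth_pos]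

theorem upsilon_sq : p.υ ^ 2 = Real.log ((p.N : ℝ) ^ 2 * p.peel / p.δth) := by
  refine Real.sq_sqrt (Real.log_nonneg ?_)
  have := hp.le_ratio (c := p.peel) (n := (p.N : ℝ) ^ 2) (by linarith [hp.peel_ge_sixteen])
    (one_le_pow₀ (by linarith [hp.two_le_N']))
  linarith

theorem one_le_NNb : (1 : ℝ) ≤ p.N * p.Nb :=
  one_le_mul_of_one_le_of_one_le (by linarith [hp.two_le_N']) hp.one_le_Nb'

theorem iota_sq : p.ι ^ 2 = 9 * Real.log (p.N * p.Nb * p.peel / p.δth) := by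
  unfold ι
  rw [mul_pow, Real.sq_sqrt (Real.log_nonneg _)]
  · norm_num
  have := hp.le_ratio (c := p.peel) (by linarith [hp.peel_ge_sixteen]) hp.one_le_NNb
  linarith

theorem one_le_upsilon_sq : 1 ≤ p.υ ^ 2 := by
  rw [hp.upsilon_sq]
  have := hp.le_ratio (c := p.peel) (n := (p.N : ℝ) ^ 2) (by linarith [hp.peel_ge_sixteen])
    (one_le_pow₀ (by linarith [hp.two_le_N']))
  linarith [two_le_log_of_eight_le this]

/-- `𝒩² P₀/δ'` is at most the square of `𝒩 𝒩_b P₀/δ'`, and `ι²` carries the factor `9`. In the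
peeling argument `ι² κ` can then pay for `υ² κ`. -/
theorem upsilon_sq_le : 9 / 2 * p.υ ^ 2 ≤ p.ι ^ 2 := by
  rw [hp.upsilon_sq, hp.iota_sq]
  have h1 := hp.le_ratio (c := p.peel) (by linarith [hp.peel_ge_sixteen]) hp.one_le_NNb
  have h2 := hp.le_ratio (c := p.peel) (n := (p.N : ℝ) ^ 2) (by linarith [hp.peel_ge_sixteen])
    (one_le_pow₀ (by linarith [hp.two_le_N']))
  have h3 : Real.log ((p.N : ℝ) ^ 2 * p.peel / p.δth) ≤
      2 * Real.log (p.N * p.Nb * p.peel / p.δth) := by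
    rw [show (2 : ℝ) * Real.log (p.N * p.Nb * p.peel / p.δth) =
      (2 : ℕ) * Real.log (p.N * p.Nb * p.peel / p.δth) by norm_num, ← Real.log_pow]
    refine Real.log_le_log (by linarith) ?_
    have h4 : (1 : ℝ) ≤ p.peel / p.δth := by
      have := hp.le_ratio (c := p.peel) (by linarith [hp.peel_ge_sixteen]) le_rfl
      rw [one_mul] at this; linarith
    have h5 : (1 : ℝ) ≤ p.Nb ^ 2 := one_le_pow₀ hp.one_le_Nb'
    calc (p.N : ℝ) ^ 2 * p.peel / p.δth = (p.N : ℝ) ^ 2 * 1 * (p.peel / p.δth * 1) := by ring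
      _ ≤ (p.N : ℝ) ^ 2 * p.Nb ^ 2 * (p.peel / p.δth * (p.peel / p.δth)) := by gcongr
      _ = _ := by ring
  linarith

theorem one_le_iota_sq : 1 ≤ p.ι ^ 2 := by
  have := hp.upsilon_sq_le; have := hp.one_le_upsilon_sq; linarith

theorem log_term_ge {c : ℝ} (hc : 18 ≤ c) :
    4 ≤ (2 * Real.log (c * p.L * p.T) + 2) * (Real.log (c * p.L) + 2) := by
  have hT := hp.one_le_T
  have hL := hp.one_le_L
  have h1 : 8 ≤ c * p.L := by nlinarith
  have h2 : 8 ≤ c * p.L * p.T := by nlinarith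
  have := two_le_log_of_eight_le h1
  have := two_le_log_of_eight_le h2
  nlinarith

theorem iotaDot_sq : p.ιDot ^ 2 = 2 * Real.log (p.N * p.Nb * ((2 * Real.log (18 * p.L * p.T) + 2) *
    (Real.log (18 * p.L) + 2)) / p.δth) := by
  have h := two_le_log_of_eight_le (hp.le_ratio (hp.log_term_ge (c := 18) le_rfl) hp.one_le_NNb)
  unfold ιDot
  rw [mul_assoc (p.N * p.Nb : ℝ), Real.sq_sqrt]
  linarith

theorem iotaPrime_sq : p.ιPrime ^ 2 = 2 * Real.log (p.N * p.Nb *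
    ((2 * Real.log (32 * p.L * p.T) + 2) * (Real.log (32 * p.L) + 2)) / p.δth) := by
  have h := two_le_log_of_eight_le (hp.le_ratio (hp.log_term_ge (c := 32) (by norm_num)) hp.one_le_NNb)
  unfold ιPrime
  rw [mul_assoc (p.N * p.Nb : ℝ), Real.sq_sqrt]
  linarith

theorem one_le_iotaDot_sq : 1 ≤ p.ιDot ^ 2 := by
  rw [hp.iotaDot_sq]
  linarith [two_le_log_of_eight_le (hp.le_ratio (hp.log_term_ge (c := 18) le_rfl) hp.one_le_NNb)]

theorem one_le_iotaPrime_sq : 1 ≤ p.ιPrime ^ 2 := by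
  rw [hp.iotaPrime_sq]
  linarith [two_le_log_of_eight_le
    (hp.le_ratio (hp.log_term_ge (c := 32) (by norm_num)) hp.one_le_NNb)]

theorem beta₁_eq (t : ℕ) : p.β₁ t = √162 * p.υ + √(8 * t * p.L / p.α ^ 2 * p.ε) := by
  unfold β₁ υ δth
  rw [hp.lam_eq, Real.sqrt_one]
  rw [show (6 * 1 + 156 : ℝ) = 162 by norm_num]
  congr 3
  field_simp

theorem epsTerm_nonneg (t : ℕ) : 0 ≤ 8 * t * p.L / p.α ^ 2 * p.ε := by
  have := hp.eps_nonneg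
  have := hp.one_le_L
  positivity

theorem beta₁_sq_ge (t : ℕ) : 162 * p.υ ^ 2 + 8 * t * p.L / p.α ^ 2 * p.ε ≤ p.β₁ t ^ 2 := by
  have h1 : 0 ≤ p.υ := Real.sqrt_nonneg _
  have h2 := Real.sq_sqrt (hp.epsTerm_nonneg t)
  have h3 := Real.sq_sqrt (show (0 : ℝ) ≤ 162 by norm_num)
  have h4 := Real.sqrt_nonneg (8 * t * p.L / p.α ^ 2 * p.ε)
  have h5 := Real.sqrt_nonneg (162 : ℝ)
  rw [hp.beta₁_eq]
  nlinarith [mul_nonneg (mul_nonneg h5 h1) h4]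

theorem beta₁_sq_le (t : ℕ) :
    p.β₁ t ^ 2 ≤ 2 * (162 * p.υ ^ 2 + 8 * t * p.L / p.α ^ 2 * p.ε) := by
  have h2 := Real.sq_sqrt (hp.epsTerm_nonneg t)
  have h3 := Real.sq_sqrt (show (0 : ℝ) ≤ 162 by norm_num)
  rw [hp.beta₁_eq]
  nlinarith [sq_nonneg (√162 * p.υ - √(8 * t * p.L / p.α ^ 2 * p.ε))]

theorem beta₂_sq (t : ℕ) :
    p.β₂ t ^ 2 = 2 * (24 * p.L + 21) * p.ιDot ^ 2 + 20 * t * p.L * p.ε := by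
  have := hp.eps_nonneg
  have := hp.one_le_L
  exact Real.sq_sqrt (by positivity)

theorem betaBar_sq (t : ℕ) :
    p.βBar t ^ 2 = 8 * (11 * p.L + 9) * p.ιPrime ^ 2 + 32 * t * p.L * p.ε := by
  have := hp.eps_nonneg
  have := hp.one_le_L
  exact Real.sq_sqrt (by positivity)

end VOQLParams.Admissible

/-- `c` if `|c| ≤ κ`, otherwise `0`. -/
noncomputable def truncAbs (κ c : ℝ) : ℝ := if |c| ≤ κ then c else 0

theorem abs_truncAbs_le {κ : ℝ} (hκ : 0 ≤ κ) (c : ℝ) : |truncAbs κ c| ≤ κ := by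
  unfold truncAbs; split_ifs with h
  · exact h
  · simpa using hκ

theorem measurable_truncAbs (κ : ℝ) : Measurable (truncAbs κ) :=
  Measurable.ite (measurableSet_le (measurable_id.norm) measurable_const) measurable_id measurable_const

/-- The truncation level of the `k`-th peel. -/
noncomputable def VOQLParams.peelLevel (p : VOQLParams) (k : ℕ) : ℝ := √(4 ^ k + 1) / (4 * p.ι ^ 2)

/-- The number of peels. -/
noncomputable def VOQLParams.numPeels (p : VOQLParams) : ℕ :=
  ⌈Real.log (p.L ^ 2 * p.T ^ 2 * p.H)⌉₊ + 1

/-- Take the least `k` with `S ≤ 4 ^ k`. It is positive because `S > 1`, and its predecessor fails.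
-/
theorem exists_peel {S B : ℝ} {K : ℕ} (hS : 1 < S) (hSB : S ≤ B) (hK : B ≤ 4 ^ K) :
    ∃ k ∈ Finset.range (K + 1), S ≤ 4 ^ k ∧ (4 : ℝ) ^ k ≤ 4 * S := by
  classical
  have hex : ∃ k : ℕ, S ≤ 4 ^ k := ⟨K, hSB.trans hK⟩
  refine ⟨Nat.find hex, ?_, Nat.find_spec hex, ?_⟩
  · rw [Finset.mem_range]
    exact Nat.lt_succ_of_le (Nat.find_min' hex (hSB.trans hK))
  · have h0 : Nat.find hex ≠ 0 := fun h => by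
      have := Nat.find_spec hex
      rw [h, pow_zero] at this
      linarith
    obtain ⟨j, hj⟩ := Nat.exists_eq_succ_of_ne_zero h0
    have := Nat.find_min hex (m := j) (by omega)
    rw [hj, pow_succ]
    linarith

namespace EpisodicMDP

variable {X : Type u} {A : Type v} [MeasurableSpace X] [MeasurableSpace A] {M : EpisodicMDP X A}
  {F : Finset (X × A → ℝ)} {h t : ℕ} {D : Dataset X A} {p : VOQLParams}

/-- The left side is the a priori bound on the weighted error, so the peels exhaust all cases; the
logarithm becomes a power of `4` since `e < 4`. -/
theorem four_pow_numPeels (hp : p.Admissible) :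
    p.L ^ 2 * p.T ^ 2 * p.H ≤ 4 ^ (p.numPeels - 1) := by
  have h0 : 0 < p.L ^ 2 * p.T ^ 2 * p.H := by
    have := hp.one_le_L; have := hp.one_le_T; have := hp.one_le_H
    positivity
  unfold VOQLParams.numPeels
  rw [Nat.add_sub_cancel]
  calc p.L ^ 2 * p.T ^ 2 * p.H = Real.exp (Real.log (p.L ^ 2 * p.T ^ 2 * p.H)) := (Real.exp_log h0).symm
    _ ≤ Real.exp (⌈Real.log (p.L ^ 2 * p.T ^ 2 * p.H)⌉₊) := Real.exp_le_exp.2 (Nat.le_ceil _)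
    _ = Real.exp 1 ^ ⌈Real.log (p.L ^ 2 * p.T ^ 2 * p.H)⌉₊ := by rw [← Real.exp_nat_mul, mul_one]
    _ ≤ 4 ^ ⌈Real.log (p.L ^ 2 * p.T ^ 2 * p.H)⌉₊ :=
      pow_le_pow_left₀ (Real.exp_pos _).le (by linarith [Real.exp_one_lt_d9]) _

/-- The error of weighted regression. -/
theorem weighted_sum_sq_le_of_noiseBound (hp : p.Admissible) {f g : X × A → ℝ} {V Vs : X → ℝ}
    {σ : ℕ → ℝ} (htT : t ≤ p.T)
    (hf : IsLeastSquares F σ D.z (fun s => M.target h V (D.z s, D.next s)) t f) (hg : g ∈ F)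
    (hF : ∀ f ∈ F, ∀ z, f z ∈ Icc 0 p.L) (hm : ∀ z, |g z - M.bellman h V z| ≤ p.ε)
    (hV : Measurable V) (hVb : ∀ x, V x ∈ Icc (0 : ℝ) 1)
    (hVs : Measurable Vs) (hVsb : ∀ x, Vs x ∈ Icc (0 : ℝ) 1)
    (hα : ∀ s ∈ Finset.Ico 1 t, p.α ≤ σ s)
    (hD : ∀ s ∈ Finset.Ico 1 t, 4 * p.ι ^ 2 * wdist F 1 D.z σ s (D.z s) ≤ σ s ^ 2)
    (hvar : ∀ s ∈ Finset.Ico 1 t, M.cvar h (M.target h Vs) (D.z s) ≤ σ s ^ 2)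
    (hvar' : ∀ s ∈ Finset.Ico 1 t,
      2 * p.ι ^ 2 * M.cvar h (fun q => V q.2 - Vs q.2) (D.z s) ≤ σ s ^ 2)
    (hη : ∀ k ∈ Finset.range p.numPeels, M.NoiseBound h t (M.target h Vs) D
      (fun s => truncAbs (p.peelLevel k) (1 / σ s ^ 2 * (f (D.z s) - g (D.z s))))
      (1 / (12 + 2 * p.peelLevel k)) (p.υ ^ 2))
    (hζ : ∀ k ∈ Finset.range p.numPeels, M.NoiseBound h t (fun q => V q.2 - Vs q.2) D
      (fun s => truncAbs (p.peelLevel k) (1 / σ s ^ 2 * (f (D.z s) - g (D.z s))))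
      (1 / (8 / p.ι ^ 2 + 2 * p.peelLevel k)) (p.ι ^ 2 / 3)) :
    ∑ s ∈ Finset.Ico 1 t, (f (D.z s) - g (D.z s)) ^ 2 / σ s ^ 2 ≤ p.β₁ t ^ 2 := by
  have hα0 := hp.α_pos
  have hL := hp.one_le_L
  have hι := hp.one_le_iota_sq
  have hι0 : p.ι ≠ 0 := fun h => by rw [h] at hι; norm_num at hι
  have hυ := hp.one_le_upsilon_sq
  have hιυ := hp.upsilon_sq_le
  have hε := hp.eps_nonneg
  have e0 : ∀ s, (f (D.z s) - g (D.z s)) ^ 2 / σ s ^ 2 = 1 / σ s ^ 2 * (f (D.z s) - g (D.z s)) ^ 2 :=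
    fun s => by ring
  simp only [e0]
  set S := ∑ s ∈ Finset.Ico 1 t, 1 / σ s ^ 2 * (f (D.z s) - g (D.z s)) ^ 2 with hS
  -- If the error `S` exceeds the squared radius, then `S > 162 υ² + E`; this is what gets
  -- contradicted.
  by_contra hlt
  rw [not_le] at hlt
  set E := 8 * t * p.L / p.α ^ 2 * p.ε with hE
  have hE0 : 0 ≤ E := hp.epsTerm_nonneg t
  have hSE : 162 * p.υ ^ 2 + E < S := (hp.beta₁_sq_ge t).trans_lt hlt
  have hσ0 : ∀ s ∈ Finset.Ico 1 t, 0 < σ s := fun s hs => hα0.trans_le (hα s hs)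
  have hw : ∀ s ∈ Finset.Ico 1 t, 1 / σ s ^ 2 ≤ 1 / p.α ^ 2 := fun s hs =>
    one_div_le_one_div_of_le (by positivity) (pow_le_pow_left₀ hα0.le (hα s hs) 2)
  have hab : ∀ z, |f z - g z| ≤ p.L := fun z => by
    have h1 := hF _ hf.1 z
    have h2 := hF _ hg z
    exact abs_le.2 ⟨by linarith [h1.1, h2.2], by linarith [h1.2, h2.1]⟩
  have htT' : (t : ℝ) ≤ p.T := by exact_mod_cast htT
  have hcard : ((Finset.Ico 1 t).card : ℝ) ≤ t := by
    rw [Nat.card_Ico]; exact_mod_cast Nat.sub_le _ _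
  have hSB : S ≤ p.L ^ 2 * p.T ^ 2 * p.H := by
    calc S ≤ (Finset.Ico 1 t).card • (1 / p.α ^ 2 * p.L ^ 2) :=
          Finset.sum_le_card_nsmul _ _ _ fun s hs =>
            mul_le_mul (hw s hs) (sq_le_sq' (abs_le.1 (hab _)).1 (abs_le.1 (hab _)).2) (sq_nonneg _)
              (by positivity)
      _ ≤ p.T * (1 / p.α ^ 2 * p.L ^ 2) := by
          rw [nsmul_eq_mul]
          exact mul_le_mul_of_nonneg_right (hcard.trans htT') (by positivity)
      _ = p.L ^ 2 * p.T ^ 2 * p.H := by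
          rw [hp.α_sq]
          have := hp.one_le_TH
          field_simp
  -- Since `S` depends on the data, the noise bounds are assumed for all peels, and the one whose
  -- scale matches `S` is used.
  obtain ⟨k, hk, hSk, hkS⟩ := exists_peel (by linarith) hSB (four_pow_numPeels hp)
  have hk : k ∈ Finset.range p.numPeels := hk
  set κ := p.peelLevel k with hκ
  have hκ0 : 0 ≤ κ := by unfold VOQLParams.peelLevel at hκ; rw [hκ]; positivity
  have hκι : 4 * p.ι ^ 2 * κ = √(4 ^ k + 1) := by
    rw [hκ, VOQLParams.peelLevel, mul_div_cancel₀]; positivity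
  -- The constant `162` of the radius enters here: `4 S + 1 ≤ S² / 36` once `S ≥ 162`.
  have hsq : √(4 ^ k + 1) ≤ S / 6 := by
    refine Real.sqrt_le_iff.2 ⟨by linarith, ?_⟩
    have h162 : 162 ≤ S := by linarith
    nlinarith
  -- On these data the truncation is inactive: `|f - g| ≤ D √(4 ^ k + 1) = D · 4 ι² κ`, and `σ² ≥ 4
  -- ι² D`. It only serves to bound the coefficients on all other outcomes.
  have htr : ∀ s ∈ Finset.Ico 1 t, truncAbs κ (1 / σ s ^ 2 * (f (D.z s) - g (D.z s))) =
      1 / σ s ^ 2 * (f (D.z s) - g (D.z s)) := fun s hs => by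
    refine if_pos ?_
    have h1 := abs_sub_le_wdist (lam := 1) (zs := D.z) (σ := σ) (t := s) (z := D.z s)
      one_pos hf.1 hg
    have h2 : √(∑ s ∈ Finset.Ico 1 s, 1 / σ s ^ 2 * (f (D.z s) - g (D.z s)) ^ 2 + 1) ≤
        √(4 ^ k + 1) := by
      refine Real.sqrt_le_sqrt (add_le_add_left (le_trans ?_ hSk) _)
      refine Finset.sum_le_sum_of_subset_of_nonneg (Finset.Ico_subset_Ico_right
        (Finset.mem_Ico.1 hs).2.le) fun _ _ _ => by positivity
    have h3 : |f (D.z s) - g (D.z s)| ≤ wdist F 1 D.z σ s (D.z s) * √(4 ^ k + 1) :=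
      h1.trans (mul_le_mul_of_nonneg_left h2 wdist_nonneg)
    have hσs := hσ0 s hs
    rw [abs_mul, abs_of_nonneg (by positivity : (0 : ℝ) ≤ 1 / σ s ^ 2), one_div,
      inv_mul_le_iff₀ (by positivity)]
    refine h3.trans ?_
    rw [← hκι]
    calc wdist F 1 D.z σ s (D.z s) * (4 * p.ι ^ 2 * κ)
        = (4 * p.ι ^ 2 * wdist F 1 D.z σ s (D.z s)) * κ := by ring
      _ ≤ σ s ^ 2 * κ := mul_le_mul_of_nonneg_right (hD s hs) hκ0
  have hη := hη k hk
  have hζ := hζ k hk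
  unfold NoiseBound at hη hζ
  have htr' : ∀ n : ℕ → ℝ, ∑ s ∈ Finset.Ico 1 t, 1 / σ s ^ 2 * (f (D.z s) - g (D.z s)) * n s =
      ∑ s ∈ Finset.Ico 1 t, truncAbs κ (1 / σ s ^ 2 * (f (D.z s) - g (D.z s))) * n s := fun n =>
    Finset.sum_congr rfl fun s hs => by rw [htr s hs]
  have eη : ∑ s ∈ Finset.Ico 1 t, truncAbs κ (1 / σ s ^ 2 * (f (D.z s) - g (D.z s))) ^ 2 *
      M.cvar h (M.target h Vs) (D.z s) ≤ S := by
    refine Finset.sum_le_sum fun s hs => ?_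
    rw [htr s hs]
    have hσs := hσ0 s hs
    calc (1 / σ s ^ 2 * (f (D.z s) - g (D.z s))) ^ 2 * M.cvar h (M.target h Vs) (D.z s)
        ≤ (1 / σ s ^ 2 * (f (D.z s) - g (D.z s))) ^ 2 * σ s ^ 2 :=
          mul_le_mul_of_nonneg_left (hvar s hs) (sq_nonneg _)
      _ = _ := by field_simp
  have eζ : ∑ s ∈ Finset.Ico 1 t, truncAbs κ (1 / σ s ^ 2 * (f (D.z s) - g (D.z s))) ^ 2 *
      M.cvar h (fun q => V q.2 - Vs q.2) (D.z s) ≤ S / (2 * p.ι ^ 2) := by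
    rw [hS, Finset.sum_div]
    refine Finset.sum_le_sum fun s hs => ?_
    rw [htr s hs]
    have hσs := hσ0 s hs
    have hv : M.cvar h (fun q => V q.2 - Vs q.2) (D.z s) ≤ σ s ^ 2 / (2 * p.ι ^ 2) := by
      rw [le_div_iff₀ (by positivity), mul_comm]
      exact hvar' s hs
    calc (1 / σ s ^ 2 * (f (D.z s) - g (D.z s))) ^ 2 * M.cvar h (fun q => V q.2 - Vs q.2) (D.z s)
        ≤ (1 / σ s ^ 2 * (f (D.z s) - g (D.z s))) ^ 2 * (σ s ^ 2 / (2 * p.ι ^ 2)) :=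
          mul_le_mul_of_nonneg_left hv (sq_nonneg _)
      _ = _ := by field_simp
  have hls := hf.sum_sq_sub_le hg hm
  -- The noise of `r + V` is that of `r + Vs`, with `Vs` a fixed function, plus that of `V - Vs`,
  -- which has small variance.
  have hsplit : ∑ s ∈ Finset.Ico 1 t, 1 / σ s ^ 2 * (f (D.z s) - g (D.z s)) *
      (M.target h V (D.z s, D.next s) - M.bellman h V (D.z s)) =
      ∑ s ∈ Finset.Ico 1 t, 1 / σ s ^ 2 * (f (D.z s) - g (D.z s)) *
        (M.target h Vs (D.z s, D.next s) - M.cmean h (M.target h Vs) (D.z s)) +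
      ∑ s ∈ Finset.Ico 1 t, 1 / σ s ^ 2 * (f (D.z s) - g (D.z s)) *
        (V (D.z s, D.next s).2 - Vs (D.z s, D.next s).2 -
          M.cmean h (fun q => V q.2 - Vs q.2) (D.z s)) := by
    rw [← Finset.sum_add_distrib]
    refine Finset.sum_congr rfl fun s _ => ?_
    rw [cmean_sub_eq_bellman_sub hV hVb hVs hVsb, cmean_target]
    unfold target
    ring
  rw [hsplit] at hls
  have hεt : 2 * p.ε * ∑ s ∈ Finset.Ico 1 t, 1 / σ s ^ 2 * |f (D.z s) - g (D.z s)| ≤ E / 4 := by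
    have : ∑ s ∈ Finset.Ico 1 t, 1 / σ s ^ 2 * |f (D.z s) - g (D.z s)| ≤ t * (1 / p.α ^ 2 * p.L) := by
      refine (Finset.sum_le_card_nsmul _ _ (1 / p.α ^ 2 * p.L) fun s hs =>
        mul_le_mul (hw s hs) (hab _) (abs_nonneg _) (by positivity)).trans ?_
      rw [nsmul_eq_mul]
      exact mul_le_mul_of_nonneg_right hcard (by positivity)
    calc _ ≤ 2 * p.ε * (t * (1 / p.α ^ 2 * p.L)) := mul_le_mul_of_nonneg_left this (by positivity)
      _ = E / 4 := by rw [hE]; ring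
  set Nη := ∑ s ∈ Finset.Ico 1 t, 1 / σ s ^ 2 * (f (D.z s) - g (D.z s)) *
        (M.target h Vs (D.z s, D.next s) - M.cmean h (M.target h Vs) (D.z s))
  set Nζ := ∑ s ∈ Finset.Ico 1 t, 1 / σ s ^ 2 * (f (D.z s) - g (D.z s)) *
        (V (D.z s, D.next s).2 - Vs (D.z s, D.next s).2 -
          M.cmean h (fun q => V q.2 - Vs q.2) (D.z s))
  have hS0 : 0 < S := by linarith
  have bη : Nη ≤ S / 12 + (12 * p.υ ^ 2 + √(4 ^ k + 1) / 9) := by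
    refine (htr' _).trans_le (hη.trans (add_le_add ?_ ?_))
    · refine (mul_le_mul_of_nonneg_left eη (by positivity)).trans ?_
      rw [one_div_mul_eq_div]
      exact div_le_div_of_nonneg_left hS0.le (by norm_num) (by linarith)
    · rw [div_div_eq_mul_div, div_one]
      have : 9 * (p.υ ^ 2 * (2 * κ)) ≤ √(4 ^ k + 1) := by
        rw [← hκι]
        have := mul_le_mul_of_nonneg_right hιυ hκ0
        linarith
      linarith
  have bζ : Nζ ≤ S / 16 + (8 / 3 + √(4 ^ k + 1) / 6) := by
    refine (htr' _).trans_le (hζ.trans (add_le_add ?_ ?_))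
    · refine (mul_le_mul_of_nonneg_left eζ (by positivity)).trans ?_
      have : 1 / (8 / p.ι ^ 2 + 2 * κ) ≤ p.ι ^ 2 / 8 := by
        rw [div_le_div_iff₀ (by positivity) (by norm_num)]
        have : p.ι ^ 2 * (8 / p.ι ^ 2 + 2 * κ) = 8 + 2 * κ * p.ι ^ 2 := by field_simp
        rw [this]
        have : 0 ≤ 2 * κ * p.ι ^ 2 := by positivity
        linarith
      refine (mul_le_mul_of_nonneg_right this (by positivity)).trans (le_of_eq ?_)
      field_simp
      norm_num
    · rw [div_div_eq_mul_div, div_one, ← hκι, mul_add,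
        show p.ι ^ 2 / 3 * (8 / p.ι ^ 2) = 8 / 3 by field_simp]
      linarith
  -- The multiples of `S` on the right add up to less than `S / 2`, and the other terms are too
  -- small for `S > 162 υ² + E`.
  linarith

end EpisodicMDP

end

/-! ### The setup, the finite value classes, and the bonuses of a run -/

section

/-- The standing assumptions on the MDP, the function classes and the bonus oracle. -/
structure VOQLSetup {X : Type u} {A : Type v} [MeasurableSpace X] [MeasurableSpace A]
    (M : EpisodicMDP X A) (F : ℕ → Finset (X × A → ℝ)) (W : Finset (X × A → ℝ))
    (B : BonusOracle X A) (p : VOQLParams) (C : ℝ) : Prop where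
  adm : p.Admissible
  H_eq : p.H = M.H
  N_eq : p.N = M.classSize F
  Nb_eq : p.Nb = W.card
  sparse : M.SparseReward
  complete : M.Complete F p.L p.ε
  W_meas : ∀ w ∈ W, Measurable w
  C_pos : 0 < C
  oracle₁ : IsConsistentBonusOracle B F W p C p.β₁
  oracle₂ : IsConsistentBonusOracle B F W p C p.β₂

open Classical in
/-- An element of `F` that is `ε`-close to `m`, if there is one. -/
noncomputable def approxIn {Z : Type*} (F : Finset (Z → ℝ)) (ε : ℝ) (m : Z → ℝ) : Z → ℝ :=
  if h : ∃ f ∈ F, ∀ z, |f z - m z| ≤ ε then h.choose else 0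

theorem approxIn_spec {Z : Type*} {F : Finset (Z → ℝ)} {ε : ℝ} {m : Z → ℝ}
    (h : ∃ f ∈ F, ∀ z, |f z - m z| ≤ ε) :
    approxIn F ε m ∈ F ∧ ∀ z, |approxIn F ε m z - m z| ≤ ε := by
  unfold approxIn
  rw [dif_pos h]
  exact h.choose_spec

section ValueClass

variable {X : Type u} {A : Type v} (F : ℕ → Finset (X × A → ℝ)) (W : Finset (X × A → ℝ))
  (p : VOQLParams)

open Classical in
/-- The possible values of `f_{t,1}^h(x)`. -/
noncomputable def valueClass₁ (h : ℕ) : Finset (X → ℝ) :=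
  if p.H < h then {fun _ => 0} else
    (F h ×ˢ W).image fun q => maxAct fun z => max 0 (min (q.1 z + q.2 z + p.ε) 1)

open Classical in
/-- The possible values of `f_{t,2}^h(x)`. -/
noncomputable def valueClass₂ (h : ℕ) : Finset (X → ℝ) :=
  if p.H < h then {fun _ => 0} else
    (F h ×ˢ (W ×ˢ W)).image fun q => maxAct fun z =>
      max 0 (min (q.1 z + 2 * q.2.1 z + q.2.2 z + 3 * p.ε) 2)

open Classical in
/-- The possible values of `f_{t,-2}^h(x)`, if they are at most `2`. -/
noncomputable def valueClassNeg (h : ℕ) : Finset (X → ℝ) :=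
  if p.H < h then {fun _ => 0} else
    (F h ×ˢ W).image fun q => maxAct fun z => min 2 (max (q.1 z - q.2 z - p.ε) 0)

end ValueClass

namespace Trace

variable {X : Type u} {A : Type v} (τ : Trace X A) (p : VOQLParams)

/-- `f_{t,1}^h(x)` -/
noncomputable def v₁ (t h : ℕ) : X → ℝ := maxAct (τ.f₁ p t h)

/-- `f_{t,2}^h(x)` -/
noncomputable def v₂ (t h : ℕ) : X → ℝ := maxAct (τ.f₂ p t h)

/-- `f_{t,-2}^h(x)` -/
noncomputable def vNeg₂ (t h : ℕ) : X → ℝ := maxAct (τ.fNeg₂ p t h)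

end Trace

variable {X : Type u} {A : Type v} [MeasurableSpace X] [MeasurableSpace A]

/-- The noise bounds on which the analysis of the regression problems rests. -/
structure RegressionGood (M : EpisodicMDP X A) (F : ℕ → Finset (X × A → ℝ))
    (W : Finset (X × A → ℝ)) (p : VOQLParams) (τ : Trace X A) : Prop where
  unweighted : ∀ h ∈ Finset.Icc 1 p.H, ∀ t ∈ Finset.Ico 2 p.T, ∀ V,
    V ∈ valueClass₂ F W p (h + 1) ∨ V ∈ valueClassNeg F W p (h + 1) → ∀ f ∈ F h,
    M.NoiseBound h t (M.target h V) (τ.data M h)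
      (fun s => f (τ.z s h) - approxIn (F h) p.ε (M.bellman h V) (τ.z s h))
      (1 / (3 ^ 2 * p.L)) (p.ιDot ^ 2)
  square : ∀ h ∈ Finset.Icc 1 p.H, ∀ t ∈ Finset.Ico 2 p.T, ∀ V ∈ valueClass₁ F W p (h + 1),
    ∀ f ∈ F h, M.NoiseBound h t (M.targetSq h V) (τ.data M h)
      (fun s => f (τ.z s h) - approxIn (F h) p.ε (M.bellmanSq h V) (τ.z s h))
      (1 / (4 ^ 2 * p.L)) (p.ιPrime ^ 2)
  optimal : ∀ h ∈ Finset.Icc 1 p.H, ∀ t ∈ Finset.Ico 2 p.T, ∀ f ∈ F h, ∀ g ∈ F h,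
    ∀ k ∈ Finset.range p.numPeels, M.NoiseBound h t (M.target h (M.optV (h + 1))) (τ.data M h)
      (fun s => truncAbs (p.peelLevel k) (1 / τ.σbar s h ^ 2 * (f (τ.z s h) - g (τ.z s h))))
      (1 / (12 + 2 * p.peelLevel k)) (p.υ ^ 2)
  diff : ∀ h ∈ Finset.Icc 1 p.H, ∀ t ∈ Finset.Ico 2 p.T, ∀ V ∈ valueClass₁ F W p (h + 1),
    ∀ f ∈ F h, ∀ g ∈ F h, ∀ k ∈ Finset.range p.numPeels,
    M.NoiseBound h t (fun q => V q.2 - M.optV (h + 1) q.2) (τ.data M h)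
      (fun s => truncAbs (p.peelLevel k) (1 / τ.σbar s h ^ 2 * (f (τ.z s h) - g (τ.z s h))))
      (1 / (8 / p.ι ^ 2 + 2 * p.peelLevel k)) (p.ι ^ 2 / 3)

variable [Countable A] [Nonempty A] [MeasurableSingletonClass A]
  {M : EpisodicMDP X A} {F : ℕ → Finset (X × A → ℝ)} {W : Finset (X × A → ℝ)}
  {B : BonusOracle X A} {p : VOQLParams} {C : ℝ} {u : ℕ → ℝ} {τ : Trace X A}

namespace VOQLSetup

variable (S : VOQLSetup M F W B p C)
include S

theorem F_mem {h : ℕ} (hh : h ∈ Finset.Icc 1 p.H) {f : X × A → ℝ} (hf : f ∈ F h) (z : X × A) :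
    f z ∈ Icc 0 p.L := S.complete.range h (S.H_eq ▸ hh) f hf z

theorem F_meas {h : ℕ} (hh : h ∈ Finset.Icc 1 p.H) {f : X × A → ℝ} (hf : f ∈ F h) :
    Measurable f := S.complete.measurable h (S.H_eq ▸ hh) f hf

theorem optV_mem {h : ℕ} (hh : h ∈ Finset.Icc 1 (p.H + 1)) (x : X) :
    M.optV h x ∈ Icc (0 : ℝ) 1 := by
  rw [Finset.mem_Icc, S.H_eq] at hh
  exact EpisodicMDP.optV_mem S.sparse hh.1 hh.2 x

theorem optQ_mem {h : ℕ} (hh : h ∈ Finset.Icc 1 p.H) (z : X × A) : M.optQ h z ∈ Icc (0 : ℝ) 1 :=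
  EpisodicMDP.optQ_mem S.sparse (S.H_eq ▸ hh) z

theorem optQ_le_optV {h : ℕ} (hh : h ∈ Finset.Icc 1 p.H) (z : X × A) : M.optQ h z ≤ M.optV h z.1 :=
  EpisodicMDP.optQ_le_optV S.sparse (S.H_eq ▸ hh) z

theorem optV_eq_maxAct {h : ℕ} (hh : h ∈ Finset.Icc 1 p.H) : M.optV h = maxAct (M.optQ h) :=
  M.optV_eq_maxAct (S.H_eq ▸ hh)

theorem optV_last (x : X) : M.optV (p.H + 1) x = 0 := by
  rw [S.H_eq]; exact EpisodicMDP.optV_last x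

end VOQLSetup

theorem measurable_optV_succ (h : ℕ) : Measurable (M.optV (h + 1)) :=
  EpisodicMDP.measurable_optV (by omega)

namespace IsVOQL

variable (S : VOQLSetup M F W B p C) (hv : IsVOQL M F B p u τ)
include hv

theorem alpha_le {t h : ℕ} (ht : t ∈ Finset.Icc 1 p.T) (hh : h ∈ Finset.Icc 1 p.H) :
    p.α ≤ τ.σbar t h := by
  rw [hv.weights t ht h hh]
  exact (le_max_right _ _).trans (le_max_left _ _)

include S

/-- The oracle wants weights at least `α` at all indices, but those of a run are controlled in
episodes `1` to `T` only. By causality they may be replaced by their maximum with `α`. -/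
theorem bonus₁_eq {t h : ℕ} (ht : t ∈ Finset.Icc 2 p.T) (hh : h ∈ Finset.Icc 1 p.H) :
    τ.b₁ t h = B h t (fun s => max (τ.σbar s h) p.α) (τ.data M h) (τ.fhat₁ t h) (p.β₁ t) := by
  rw [hv.b₁ t ht h hh]
  rw [Finset.mem_Icc] at ht
  refine S.oracle₁.causal h hh t (Finset.mem_Icc.2 (by omega)) _ _ _ _ (fun s hs => ⟨?_, rfl, rfl, rfl⟩) _
  rw [Finset.mem_Ico] at hs
  exact (max_eq_left (hv.alpha_le (Finset.mem_Icc.2 (by omega)) hh)).symm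

theorem max_weight_eq {t h s : ℕ} (ht : t ∈ Finset.Icc 2 p.T) (hh : h ∈ Finset.Icc 1 p.H)
    (hs : s ∈ Finset.Ico 1 t) : max (τ.σbar s h) p.α = τ.σbar s h := by
  rw [Finset.mem_Icc] at ht
  rw [Finset.mem_Ico] at hs
  exact max_eq_left (hv.alpha_le (Finset.mem_Icc.2 (by omega)) hh)

theorem bonus₁_mem {t h : ℕ} (ht : t ∈ Finset.Icc 2 p.T) (hh : h ∈ Finset.Icc 1 p.H) :
    τ.b₁ t h ∈ W := by
  rw [hv.bonus₁_eq S ht hh]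
  rw [Finset.mem_Icc] at ht
  exact S.oracle₁.mem h hh t (Finset.mem_Icc.2 (by omega)) _ (fun s => le_max_right _ _) _ _
    (hv.fhat₁ t (Finset.mem_Icc.2 ht) h hh).1

theorem bonus₁_nonneg {t h : ℕ} (ht : t ∈ Finset.Icc 2 p.T) (hh : h ∈ Finset.Icc 1 p.H) (z : X × A) :
    0 ≤ τ.b₁ t h z := by
  rw [hv.bonus₁_eq S ht hh]
  rw [Finset.mem_Icc] at ht
  exact S.oracle₁.nonneg h hh t (Finset.mem_Icc.2 (by omega)) _ (fun s => le_max_right _ _) _ _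
    (hv.fhat₁ t (Finset.mem_Icc.2 ht) h hh).1 z

theorem bonus₁_lower {t h : ℕ} (ht : t ∈ Finset.Icc 2 p.T) (hh : h ∈ Finset.Icc 1 p.H)
    {g : X × A → ℝ} (hg : g ∈ F h)
    (hle : ∑ s ∈ Finset.Ico 1 t, (τ.fhat₁ t h (τ.z s h) - g (τ.z s h)) ^ 2 / τ.σbar s h ^ 2 ≤ p.β₁ t ^ 2)
    (z : X × A) : |τ.fhat₁ t h z - g z| ≤ τ.b₁ t h z := by
  rw [hv.bonus₁_eq S ht hh, abs_sub_comm]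
  have ht' := Finset.mem_Icc.1 ht
  refine S.oracle₁.lower h hh t (Finset.mem_Icc.2 (by omega)) _ (fun s => le_max_right _ _) _ _
    (hv.fhat₁ t ht h hh).1 z g hg (le_of_eq_of_le ?_ hle)
  refine Finset.sum_congr rfl fun s hs => ?_
  simp only [hv.max_weight_eq S ht hh hs]
  congr 1
  exact sub_sq_comm _ _

theorem bonus₁_upper {t h : ℕ} (ht : t ∈ Finset.Icc 2 p.T) (hh : h ∈ Finset.Icc 1 p.H) (z : X × A) :
    τ.b₁ t h z ≤ C * (wdist (F h) 1 (τ.data M h).z (fun s => τ.σbar s h) t z * √(p.β₁ t ^ 2 + 1) +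
      p.εb * p.β₁ t) := by
  rw [hv.bonus₁_eq S ht hh]
  have ht' := Finset.mem_Icc.1 ht
  have := S.oracle₁.upper h hh t (Finset.mem_Icc.2 (by omega)) (fun s => max (τ.σbar s h) p.α)
    (fun s => le_max_right _ _) (τ.data M h) _ (hv.fhat₁ t ht h hh).1 z
  rwa [S.adm.lam_eq, wdist_congr (zs' := (τ.data M h).z) (σ' := fun s => τ.σbar s h)
    fun s hs => ⟨rfl, hv.max_weight_eq S ht hh hs⟩] at this

/-- Consistency of the oracle. It is the reason why `f_{t,1}` stays below every earlier `f_{s,2}`.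
-/
theorem bonus₁_anti {s t h : ℕ} (hs : 2 ≤ s) (hst : s ≤ t) (ht : t ≤ p.T) (hh : h ∈ Finset.Icc 1 p.H)
    (z : X × A) : τ.b₁ t h z ≤ τ.b₁ s h z := by
  rcases hst.eq_or_lt with rfl | hlt
  · rfl
  have hs' : s ∈ Finset.Icc 2 p.T := Finset.mem_Icc.2 (by omega)
  have ht' : t ∈ Finset.Icc 2 p.T := Finset.mem_Icc.2 (by omega)
  rw [hv.bonus₁_eq S ht' hh, hv.bonus₁_eq S hs' hh]
  exact S.oracle₁.consistent h hh s (Finset.mem_Icc.2 (by omega)) t (Finset.mem_Icc.2 (by omega)) hlt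
    _ _ (fun s => le_max_right _ _) (fun s => le_max_right _ _) _ _ (fun _ _ => ⟨rfl, rfl, rfl, rfl⟩)
    _ _ (maxAct (τ.f₁ p s (h + 1))) (maxAct (τ.f₁ p t (h + 1)))
    ((hv.fhat₁ s hs' h hh).congr fun r hr => ⟨(hv.max_weight_eq S hs' hh hr).symm, rfl, rfl⟩)
    ((hv.fhat₁ t ht' h hh).congr fun r hr => ⟨(hv.max_weight_eq S ht' hh hr).symm, rfl, rfl⟩) z

theorem bonus₂_mem {t h : ℕ} (ht : t ∈ Finset.Icc 2 p.T) (hh : h ∈ Finset.Icc 1 p.H) :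
    τ.b₂ t h ∈ W := by
  rw [hv.b₂ t ht h hh]
  have ht' := Finset.mem_Icc.1 ht
  exact S.oracle₂.mem h hh t (Finset.mem_Icc.2 (by omega)) _ (fun s => S.adm.α_le_one) _ _
    (hv.fhat₂ t ht h hh).1

theorem bonus₂_nonneg {t h : ℕ} (ht : t ∈ Finset.Icc 2 p.T) (hh : h ∈ Finset.Icc 1 p.H) (z : X × A) :
    0 ≤ τ.b₂ t h z := by
  rw [hv.b₂ t ht h hh]
  have ht' := Finset.mem_Icc.1 ht
  exact S.oracle₂.nonneg h hh t (Finset.mem_Icc.2 (by omega)) _ (fun s => S.adm.α_le_one) _ _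
    (hv.fhat₂ t ht h hh).1 z

theorem bonus₂_upper {t h : ℕ} (ht : t ∈ Finset.Icc 2 p.T) (hh : h ∈ Finset.Icc 1 p.H) (z : X × A) :
    τ.b₂ t h z ≤ C * (wdist (F h) 1 (τ.data M h).z (fun _ => 1) t z * √(p.β₂ t ^ 2 + 1) +
      p.εb * p.β₂ t) := by
  rw [hv.b₂ t ht h hh]
  have ht' := Finset.mem_Icc.1 ht
  have := S.oracle₂.upper h hh t (Finset.mem_Icc.2 (by omega)) _ (fun s => S.adm.α_le_one)
    (τ.data M h) _ (hv.fhat₂ t ht h hh).1 z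
  rwa [S.adm.lam_eq] at this

theorem bonus₂_lower {t h : ℕ} (ht : t ∈ Finset.Icc 2 p.T) (hh : h ∈ Finset.Icc 1 p.H)
    {g : X × A → ℝ} (hg : g ∈ F h)
    (hle : ∑ s ∈ Finset.Ico 1 t, (τ.fhat₂ t h (τ.z s h) - g (τ.z s h)) ^ 2 ≤ p.β₂ t ^ 2)
    (z : X × A) : |τ.fhat₂ t h z - g z| ≤ τ.b₂ t h z := by
  rw [hv.b₂ t ht h hh, abs_sub_comm]
  have ht' := Finset.mem_Icc.1 ht
  refine S.oracle₂.lower h hh t (Finset.mem_Icc.2 (by omega)) _ (fun s => S.adm.α_le_one) _ _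
    (hv.fhat₂ t ht h hh).1 z g hg (le_of_eq_of_le ?_ hle)
  refine Finset.sum_congr rfl fun s hs => ?_
  rw [one_pow, div_one]
  exact sub_sq_comm _ _

/-- By consistency the bonus for `f̂_{t,2}` is also a bonus for `f̂_{t,-2}`: extend the data by a
point of negligible weight at which `f̂_{t,-2}` has no loss. -/
theorem bonus₂_lower_neg {t h : ℕ} (ht : t ∈ Finset.Ico 2 p.T) (hh : h ∈ Finset.Icc 1 p.H)
    {g : X × A → ℝ} (hg : g ∈ F h)
    (hle : ∑ s ∈ Finset.Ico 1 t, (τ.fhatNeg₂ t h (τ.z s h) - g (τ.z s h)) ^ 2 + 1 ≤ p.β₂ t ^ 2)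
    (z : X × A) : |τ.fhatNeg₂ t h z - g z| ≤ τ.b₂ t h z := by
  have ht0 := Finset.mem_Ico.1 ht
  have ht' : t ∈ Finset.Icc 2 p.T := Finset.mem_Icc.2 (by omega)
  have hL := S.adm.one_le_L
  set f := τ.fhatNeg₂ t h with hf
  have hfl := hv.fhatNeg₂ t ht' h hh
  rw [← hf] at hfl
  set V := maxAct (τ.fNeg₂ p t (h + 1))
  set D := τ.data M h with hD
  -- The reward of the added point is defined so that its target equals the value of `f`; a
  -- `Dataset` need not come from the MDP.
  let D' : Dataset X A := ⟨D.z, fun s => if s = t then f (D.z s) - V (D.next s) else D.r s, D.next⟩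
  -- With weight `L`, the range of the class, the point adds at most `1` to the squared error of a
  -- competitor; this is the `+ 1` in the hypothesis.
  let σ' : ℕ → ℝ := fun s => if s = t then p.L else 1
  have hσ' : ∀ s, p.α ≤ σ' s := fun s => by
    have := S.adm.α_le_one
    simp only [σ']
    split_ifs <;> linarith
  have hpre : SamePrefix t (fun _ => 1) σ' D D' := fun s hs => by
    have : s ≠ t := by rw [Finset.mem_Ico] at hs; omega
    simp [σ', D', this]
  have hls' : IsLeastSquares (F h) σ' D'.z (fun s => D'.r s + V (D'.next s)) (t + 1) f := by
    have e : ∀ g : X × A → ℝ, ∑ s ∈ Finset.Ico 1 t, 1 / σ' s ^ 2 *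
        (g (D'.z s) - (D'.r s + V (D'.next s))) ^ 2 = ∑ s ∈ Finset.Ico 1 t, 1 / (1 : ℝ) ^ 2 *
        (g (D.z s) - (D.r s + V (D.next s))) ^ 2 := fun g =>
      Finset.sum_congr rfl fun s hs => by
        have : s ≠ t := by rw [Finset.mem_Ico] at hs; omega
        simp [σ', D', this]
    refine ⟨hfl.1, fun g hg => ?_⟩
    rw [Finset.sum_Ico_succ_top (by omega), Finset.sum_Ico_succ_top (by omega), e, e]
    refine add_le_add (hfl.2 g hg) (le_trans (le_of_eq ?_) (show (0 : ℝ) ≤ _ by positivity))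
    simp [D']
  -- Episode `t + 1` must exist for the oracle, so `t < T`. Hence the range `Ico 2 p.T` in all that
  -- follows.
  have h1 := S.oracle₂.consistent h hh t (Finset.mem_Icc.2 (by omega)) (t + 1)
    (Finset.mem_Icc.2 (by omega)) (by omega) _ σ' (fun s => S.adm.α_le_one) hσ' D D' hpre
    _ f (maxAct (τ.f₂ p t (h + 1))) V (hv.fhat₂ t ht' h hh) hls' z
  rw [← hv.b₂ t ht' h hh] at h1
  refine le_trans ?_ h1
  rw [abs_sub_comm]
  refine S.oracle₂.lower h hh (t + 1) (Finset.mem_Icc.2 (by omega)) σ' hσ' D' f hfl.1 z g hg ?_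
  have hmono : p.β₂ t ^ 2 ≤ p.β₂ (t + 1) ^ 2 := by
    rw [S.adm.beta₂_sq, S.adm.beta₂_sq]
    have := S.adm.eps_nonneg
    push_cast
    have : 0 ≤ p.L * p.ε := by positivity
    linarith
  refine le_trans ?_ (hle.trans hmono)
  rw [Finset.sum_Ico_succ_top (by omega)]
  refine add_le_add (le_of_eq (Finset.sum_congr rfl fun s hs => ?_)) ?_
  · have : s ≠ t := by rw [Finset.mem_Ico] at hs; omega
    simp only [σ', this, if_false, one_pow, div_one]
    exact sub_sq_comm _ _
  · simp only [σ', if_true]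
    rw [div_le_one (by positivity)]
    have h1 := S.F_mem hh hfl.1 (D'.z t)
    have h2 := S.F_mem hh hg (D'.z t)
    exact sq_le_sq' (by linarith [h1.2, h2.1]) (by linarith [h1.1, h2.2])

theorem f₁_mem {t h : ℕ} (ht : t ∈ Finset.Icc 1 p.T) (hh : h ∈ Finset.Icc 1 (p.H + 1)) (z : X × A) :
    τ.f₁ p t h z ∈ Icc (0 : ℝ) 1 := by
  unfold Trace.f₁
  rw [Finset.mem_Icc] at ht hh
  split_ifs with h1 h2
  · simp
  · simp
  · have hh' : h ∈ Finset.Icc 1 p.H := Finset.mem_Icc.2 (by omega)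
    have ht' : t ∈ Finset.Icc 2 p.T := Finset.mem_Icc.2 (by omega)
    have h3 := (S.F_mem hh' (hv.fhat₁ t ht' h hh').1 z).1
    have h4 := hv.bonus₁_nonneg S ht' hh' z
    have h5 := S.adm.eps_nonneg
    exact ⟨le_min (by linarith) zero_le_one, min_le_right _ _⟩

theorem f₂_mem {t h : ℕ} (ht : t ∈ Finset.Icc 1 p.T) (hh : h ∈ Finset.Icc 1 (p.H + 1)) (z : X × A) :
    τ.f₂ p t h z ∈ Icc (0 : ℝ) 2 := by
  unfold Trace.f₂
  rw [Finset.mem_Icc] at ht hh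
  split_ifs with h1 h2
  · simp
  · simp
  · have hh' : h ∈ Finset.Icc 1 p.H := Finset.mem_Icc.2 (by omega)
    have ht' : t ∈ Finset.Icc 2 p.T := Finset.mem_Icc.2 (by omega)
    have h3 := (S.F_mem hh' (hv.fhat₂ t ht' h hh').1 z).1
    have h4 := hv.bonus₁_nonneg S ht' hh' z
    have h6 := hv.bonus₂_nonneg S ht' hh' z
    have h5 := S.adm.eps_nonneg
    exact ⟨le_min (by linarith) zero_le_two, min_le_right _ _⟩

theorem fNeg₂_mem {t h : ℕ} (ht : t ∈ Finset.Icc 1 p.T) (hh : h ∈ Finset.Icc 1 (p.H + 1)) (z : X × A) :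
    τ.fNeg₂ p t h z ∈ Icc (0 : ℝ) p.L := by
  have hL := S.adm.one_le_L
  unfold Trace.fNeg₂
  rw [Finset.mem_Icc] at ht hh
  split_ifs with h1 h2
  · exact ⟨le_rfl, by linarith⟩
  · exact ⟨le_rfl, by linarith⟩
  · have hh' : h ∈ Finset.Icc 1 p.H := Finset.mem_Icc.2 (by omega)
    have ht' : t ∈ Finset.Icc 2 p.T := Finset.mem_Icc.2 (by omega)
    have h3 := (S.F_mem hh' (hv.fhatNeg₂ t ht' h hh').1 z).2
    have h6 := hv.bonus₂_nonneg S ht' hh' z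
    have h5 := S.adm.eps_nonneg
    exact ⟨le_max_right _ _, max_le (by linarith) (by linarith)⟩

theorem measurable_f₁ {t h : ℕ} (ht : t ∈ Finset.Icc 1 p.T) (hh : h ∈ Finset.Icc 1 (p.H + 1)) :
    Measurable (τ.f₁ p t h) := by
  unfold Trace.f₁
  rw [Finset.mem_Icc] at ht hh
  split_ifs with h1 h2
  · exact measurable_const
  · exact measurable_const
  · have hh' : h ∈ Finset.Icc 1 p.H := Finset.mem_Icc.2 (by omega)
    have ht' : t ∈ Finset.Icc 2 p.T := Finset.mem_Icc.2 (by omega)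
    exact (((S.F_meas hh' (hv.fhat₁ t ht' h hh').1).add (S.W_meas _ (hv.bonus₁_mem S ht' hh'))).add_const
      _).min measurable_const

theorem measurable_f₂ {t h : ℕ} (ht : t ∈ Finset.Icc 1 p.T) (hh : h ∈ Finset.Icc 1 (p.H + 1)) :
    Measurable (τ.f₂ p t h) := by
  unfold Trace.f₂
  rw [Finset.mem_Icc] at ht hh
  split_ifs with h1 h2
  · exact measurable_const
  · exact measurable_const
  · have hh' : h ∈ Finset.Icc 1 p.H := Finset.mem_Icc.2 (by omega)
    have ht' : t ∈ Finset.Icc 2 p.T := Finset.mem_Icc.2 (by omega)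
    exact ((((S.F_meas hh' (hv.fhat₂ t ht' h hh').1).add
      ((S.W_meas _ (hv.bonus₁_mem S ht' hh')).const_mul 2)).add
      (S.W_meas _ (hv.bonus₂_mem S ht' hh'))).add_const _).min measurable_const

theorem measurable_fNeg₂ {t h : ℕ} (ht : t ∈ Finset.Icc 1 p.T) (hh : h ∈ Finset.Icc 1 (p.H + 1)) :
    Measurable (τ.fNeg₂ p t h) := by
  unfold Trace.fNeg₂
  rw [Finset.mem_Icc] at ht hh
  split_ifs with h1 h2
  · exact measurable_const
  · exact measurable_const
  · have hh' : h ∈ Finset.Icc 1 p.H := Finset.mem_Icc.2 (by omega)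
    have ht' : t ∈ Finset.Icc 2 p.T := Finset.mem_Icc.2 (by omega)
    exact (((S.F_meas hh' (hv.fhatNeg₂ t ht' h hh').1).sub
      (S.W_meas _ (hv.bonus₂_mem S ht' hh'))).sub_const _).max measurable_const

theorem v₁_mem {t h : ℕ} (ht : t ∈ Finset.Icc 1 p.T) (hh : h ∈ Finset.Icc 1 (p.H + 1)) (x : X) :
    τ.v₁ p t h x ∈ Icc (0 : ℝ) 1 := maxAct_mem_Icc (hv.f₁_mem S ht hh) x

theorem v₂_mem {t h : ℕ} (ht : t ∈ Finset.Icc 1 p.T) (hh : h ∈ Finset.Icc 1 (p.H + 1)) (x : X) :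
    τ.v₂ p t h x ∈ Icc (0 : ℝ) 2 := maxAct_mem_Icc (hv.f₂_mem S ht hh) x

theorem vNeg₂_mem {t h : ℕ} (ht : t ∈ Finset.Icc 1 p.T) (hh : h ∈ Finset.Icc 1 (p.H + 1)) (x : X) :
    τ.vNeg₂ p t h x ∈ Icc (0 : ℝ) p.L := maxAct_mem_Icc (hv.fNeg₂_mem S ht hh) x

theorem measurable_v₁ {t h : ℕ} (ht : t ∈ Finset.Icc 1 p.T) (hh : h ∈ Finset.Icc 1 (p.H + 1)) :
    Measurable (τ.v₁ p t h) := measurable_maxAct (hv.measurable_f₁ S ht hh)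

theorem measurable_v₂ {t h : ℕ} (ht : t ∈ Finset.Icc 1 p.T) (hh : h ∈ Finset.Icc 1 (p.H + 1)) :
    Measurable (τ.v₂ p t h) := measurable_maxAct (hv.measurable_f₂ S ht hh)

theorem measurable_vNeg₂ {t h : ℕ} (ht : t ∈ Finset.Icc 1 p.T) (hh : h ∈ Finset.Icc 1 (p.H + 1)) :
    Measurable (τ.vNeg₂ p t h) := measurable_maxAct (hv.measurable_fNeg₂ S ht hh)

/-- The outer `max 0` in the class is inactive here. It is there because elements of `W` may be
negative, while every member of the class has to take values in `[0, 1]`. -/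
theorem v₁_mem_class {t h : ℕ} (ht : t ∈ Finset.Icc 2 p.T) (hh : h ∈ Finset.Icc 1 p.H) :
    τ.v₁ p t (h + 1) ∈ valueClass₁ F W p (h + 1) := by
  have hh1 := Finset.mem_Icc.1 hh
  have ht1 := Finset.mem_Icc.1 ht
  have hb := hv.f₁_mem S (t := t) (h := h + 1) (Finset.mem_Icc.2 (by omega)) (Finset.mem_Icc.2 (by omega))
  unfold valueClass₁ Trace.v₁
  split_ifs with h1
  · rw [Finset.mem_singleton]
    have : τ.f₁ p t (h + 1) = fun _ => 0 := by funext z; simp [Trace.f₁, h1]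
    rw [this, maxAct_const]
  · have hh' : h + 1 ∈ Finset.Icc 1 p.H := Finset.mem_Icc.2 (by omega)
    classical
    rw [Finset.mem_image]
    refine ⟨(τ.fhat₁ t (h + 1), τ.b₁ t (h + 1)),
      Finset.mem_product.2 ⟨(hv.fhat₁ t ht _ hh').1, hv.bonus₁_mem S ht hh'⟩, ?_⟩
    congr 1
    funext z
    have hz := hb z
    have e : τ.f₁ p t (h + 1) z = min (τ.fhat₁ t (h + 1) z + τ.b₁ t (h + 1) z + p.ε) 1 := by
      unfold Trace.f₁; rw [if_neg h1, if_neg (by omega)]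
    rw [e] at hz ⊢
    exact max_eq_right hz.1

theorem v₂_mem_class {t h : ℕ} (ht : t ∈ Finset.Icc 2 p.T) (hh : h ∈ Finset.Icc 1 p.H) :
    τ.v₂ p t (h + 1) ∈ valueClass₂ F W p (h + 1) := by
  have hh1 := Finset.mem_Icc.1 hh
  have ht1 := Finset.mem_Icc.1 ht
  have hb := hv.f₂_mem S (t := t) (h := h + 1) (Finset.mem_Icc.2 (by omega)) (Finset.mem_Icc.2 (by omega))
  unfold valueClass₂ Trace.v₂
  split_ifs with h1
  · rw [Finset.mem_singleton]
    have : τ.f₂ p t (h + 1) = fun _ => 0 := by funext z; simp [Trace.f₂, h1]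
    rw [this, maxAct_const]
  · have hh' : h + 1 ∈ Finset.Icc 1 p.H := Finset.mem_Icc.2 (by omega)
    classical
    rw [Finset.mem_image]
    refine ⟨(τ.fhat₂ t (h + 1), τ.b₁ t (h + 1), τ.b₂ t (h + 1)),
      Finset.mem_product.2 ⟨(hv.fhat₂ t ht _ hh').1, Finset.mem_product.2
        ⟨hv.bonus₁_mem S ht hh', hv.bonus₂_mem S ht hh'⟩⟩, ?_⟩
    congr 1
    funext z
    have hz := hb z
    have e : τ.f₂ p t (h + 1) z = min (τ.fhat₂ t (h + 1) z + 2 * τ.b₁ t (h + 1) z +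
        τ.b₂ t (h + 1) z + 3 * p.ε) 2 := by
      unfold Trace.f₂; rw [if_neg h1, if_neg (by omega)]
    rw [e] at hz ⊢
    exact max_eq_right hz.1

/-- A priori the values only lie below `L`. The bound `2`, which makes the cap in the class
inactive, comes from pessimism at level `h + 1`. -/
theorem vNeg₂_mem_class {t h : ℕ} (ht : t ∈ Finset.Icc 2 p.T) (hh : h ∈ Finset.Icc 1 p.H)
    (hle : ∀ x, τ.vNeg₂ p t (h + 1) x ≤ 2) :
    τ.vNeg₂ p t (h + 1) ∈ valueClassNeg F W p (h + 1) := by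
  have hh1 := Finset.mem_Icc.1 hh
  have ht1 := Finset.mem_Icc.1 ht
  have hb := hv.fNeg₂_mem S (t := t) (h := h + 1) (Finset.mem_Icc.2 (by omega))
    (Finset.mem_Icc.2 (by omega))
  unfold valueClassNeg
  split_ifs with h1
  · rw [Finset.mem_singleton]
    have : τ.fNeg₂ p t (h + 1) = fun _ => 0 := by funext z; simp [Trace.fNeg₂, h1]
    rw [Trace.vNeg₂, this, maxAct_const]
  · have hh' : h + 1 ∈ Finset.Icc 1 p.H := Finset.mem_Icc.2 (by omega)
    classical
    rw [Finset.mem_image]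
    refine ⟨(τ.fhatNeg₂ t (h + 1), τ.b₂ t (h + 1)),
      Finset.mem_product.2 ⟨(hv.fhatNeg₂ t ht _ hh').1, hv.bonus₂_mem S ht hh'⟩, ?_⟩
    unfold Trace.vNeg₂
    congr 1
    funext z
    have hz := (le_maxAct (fun z => (hb z).2) z.1 z.2).trans (hle z.1)
    have e : τ.fNeg₂ p t (h + 1) z = max (τ.fhatNeg₂ t (h + 1) z - τ.b₂ t (h + 1) z - p.ε) 0 := by
      unfold Trace.fNeg₂; rw [if_neg h1, if_neg (by omega)]
    rw [e] at hz ⊢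
    exact min_eq_right hz

end IsVOQL

end

/-! ### Optimism, monotonicity and variance estimates -/

section

variable {X : Type u} {A : Type v} [MeasurableSpace X] [MeasurableSpace A]

/-- Optimism, monotonicity and the Bellman inequalities of the functions used in episode `t`. -/
structure StepGood (M : EpisodicMDP X A) (p : VOQLParams) (τ : Trace X A) (t h : ℕ) : Prop where
  optQ_le_f₁ : ∀ z, M.optQ h z ≤ τ.f₁ p t h z
  f₁_le : ∀ z, τ.f₁ p t h z ≤ M.bellman h (τ.v₁ p t (h + 1)) z + (2 * τ.b₁ t h z + 2 * p.ε)
  f₁_le_f₂ : ∀ z, τ.f₁ p t h z ≤ τ.f₂ p t h z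
  f₂_le : ∀ z, τ.f₂ p t h z ≤ M.bellman h (τ.v₂ p t (h + 1)) z +
    ((2 * τ.b₁ t h z + 2 * p.ε) + (2 * τ.b₂ t h z + 2 * p.ε))
  fNeg₂_le : ∀ z, τ.fNeg₂ p t h z ≤ M.bellman h (τ.vNeg₂ p t (h + 1)) z
  fNeg₂_le_optQ : ∀ z, τ.fNeg₂ p t h z ≤ M.optQ h z
  le_fNeg₂ : ∀ z, M.bellman h (τ.vNeg₂ p t (h + 1)) z - (2 * τ.b₂ t h z + 2 * p.ε) ≤ τ.fNeg₂ p t h z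
  bellman_vNeg₂_le : ∀ z, M.bellman h (τ.vNeg₂ p t (h + 1)) z ≤ M.optQ h z

/-- Optimism and monotonicity of the values at level `h`. -/
def LevelGood (M : EpisodicMDP X A) (p : VOQLParams) (τ : Trace X A) (h : ℕ) : Prop :=
  ∀ t ∈ Finset.Ico 1 p.T, (∀ x, M.optV h x ≤ τ.v₁ p t h x) ∧
    (∀ s ∈ Finset.Icc 1 t, ∀ x, τ.v₁ p t h x ≤ τ.v₂ p s h x) ∧ ∀ x, τ.vNeg₂ p t h x ≤ M.optV h x

variable [Countable A] [Nonempty A] [MeasurableSingletonClass A]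
  {M : EpisodicMDP X A} {F : ℕ → Finset (X × A → ℝ)} {W : Finset (X × A → ℝ)}
  {B : BonusOracle X A} {p : VOQLParams} {C : ℝ} {u : ℕ → ℝ} {τ : Trace X A}

theorem abs_sub_le_wdist_of_sum_le {F : Finset (X × A → ℝ)} {zs : ℕ → X × A} {t : ℕ} {f g m : X × A → ℝ}
    {β ε : ℝ} (hf : f ∈ F) (hg : g ∈ F) (hm : ∀ z, |g z - m z| ≤ ε)
    (hle : ∑ s ∈ Finset.Ico 1 t, (f (zs s) - g (zs s)) ^ 2 ≤ β ^ 2) (z : X × A) :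
    |f z - m z| ≤ wdist F 1 zs (fun _ => 1) t z * √(β ^ 2 + 1) + ε := by
  have h1 := abs_sub_le_wdist (lam := 1) (zs := zs) (σ := fun _ => 1) (t := t) (z := z) one_pos hf hg
  simp only [one_pow, div_one, one_mul] at h1
  have h2 := mul_le_mul_of_nonneg_left (Real.sqrt_le_sqrt (add_le_add_left hle 1))
    (wdist_nonneg (F := F) (lam := 1) (zs := zs) (σ := fun _ => 1) (t := t) (z := z))
  have h3 := abs_sub_le (f z) (g z) (m z)
  linarith [hm z]

namespace IsVOQL

variable (S : VOQLSetup M F W B p C) (hv : IsVOQL M F B p u τ)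
include hv

theorem sigma_facts {t h : ℕ} (ht : t ∈ Finset.Icc 1 p.T) (hh : h ∈ Finset.Icc 1 p.H) :
    √(τ.sigmaSq p M F t h) ≤ τ.σbar t h ∧
    √2 * p.ι * √(τ.f₂ p t h (τ.z t h) - τ.fNeg₂ p t h (τ.z t h)) ≤ τ.σbar t h ∧
    2 * (√p.υ + p.ι) * √(wdist (F h) p.lam (τ.data M h).z (fun s => τ.σbar s h) t (τ.z t h)) ≤
      τ.σbar t h := by
  rw [hv.weights t ht h hh]
  exact ⟨(le_max_left _ _).trans (le_max_left _ _), (le_max_left _ _).trans (le_max_right _ _),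
    (le_max_right _ _).trans (le_max_right _ _)⟩

include S

theorem sigmaSq_le_sq {t h : ℕ} (ht : t ∈ Finset.Icc 1 p.T) (hh : h ∈ Finset.Icc 1 p.H) :
    τ.sigmaSq p M F t h ≤ τ.σbar t h ^ 2 := by
  have h1 := (hv.sigma_facts ht hh).1
  have h2 := S.adm.α_pos.trans_le (hv.alpha_le ht hh)
  exact (Real.sqrt_le_left h2.le).1 h1

theorem gap_le_sq {t h : ℕ} (ht : t ∈ Finset.Icc 1 p.T) (hh : h ∈ Finset.Icc 1 p.H) :
    2 * p.ι ^ 2 * (τ.f₂ p t h (τ.z t h) - τ.fNeg₂ p t h (τ.z t h)) ≤ τ.σbar t h ^ 2 := by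
  have h1 := (hv.sigma_facts ht hh).2.1
  have h2 := S.adm.α_pos.trans_le (hv.alpha_le ht hh)
  have h0 : 0 ≤ p.ι := by unfold VOQLParams.ι; positivity
  set G := τ.f₂ p t h (τ.z t h) - τ.fNeg₂ p t h (τ.z t h)
  rcases le_total G 0 with hG | hG
  · nlinarith [sq_nonneg p.ι, sq_nonneg (τ.σbar t h)]
  · have h3 := pow_le_pow_left₀ (by positivity) h1 2
    rwa [mul_pow, mul_pow, Real.sq_sqrt hG, Real.sq_sqrt zero_le_two] at h3

/-- The part `ι` of the factor `√υ + ι` already makes the truncation of the peeling argument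
inactive. -/
theorem wdist_le_sq {t h : ℕ} (ht : t ∈ Finset.Icc 1 p.T) (hh : h ∈ Finset.Icc 1 p.H) :
    4 * p.ι ^ 2 * wdist (F h) 1 (τ.data M h).z (fun s => τ.σbar s h) t (τ.z t h) ≤
      τ.σbar t h ^ 2 := by
  have h1 := (hv.sigma_facts ht hh).2.2
  rw [S.adm.lam_eq] at h1
  have h0 : 0 ≤ p.ι := by unfold VOQLParams.ι; positivity
  have h3 := pow_le_pow_left₀ (by positivity) h1 2
  rw [mul_pow, mul_pow, Real.sq_sqrt wdist_nonneg] at h3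
  refine le_trans (mul_le_mul_of_nonneg_right ?_ wdist_nonneg) h3
  nlinarith [Real.sqrt_nonneg p.υ, mul_nonneg (Real.sqrt_nonneg p.υ) h0, sq_nonneg (√p.υ)]

/-- The weights are not much larger than they have to be. -/
theorem sq_le {t h : ℕ} (ht : t ∈ Finset.Icc 1 p.T) (hh : h ∈ Finset.Icc 1 p.H) :
    τ.σbar t h ^ 2 ≤ max 0 (τ.sigmaSq p M F t h) + p.α ^ 2 +
      2 * p.ι ^ 2 * max 0 (τ.f₂ p t h (τ.z t h) - τ.fNeg₂ p t h (τ.z t h)) +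
      4 * (√p.υ + p.ι) ^ 2 *
        wdist (F h) 1 (τ.data M h).z (fun s => τ.σbar s h) t (τ.z t h) := by
  have h0 : 0 ≤ p.ι := by unfold VOQLParams.ι; positivity
  have hα := S.adm.α_pos
  rw [hv.weights t ht h hh]
  unfold Trace.weight
  rw [S.adm.lam_eq]
  set G := τ.f₂ p t h (τ.z t h) - τ.fNeg₂ p t h (τ.z t h)
  set D := wdist (F h) 1 (τ.data M h).z (fun s => τ.σbar s h) t (τ.z t h)
  have hD : 0 ≤ D := wdist_nonneg
  have e1 : √(τ.sigmaSq p M F t h) ^ 2 ≤ max 0 (τ.sigmaSq p M F t h) := by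
    rcases le_total 0 (τ.sigmaSq p M F t h) with h1 | h1
    · rw [Real.sq_sqrt h1]; exact le_max_right _ _
    · rw [Real.sqrt_eq_zero_of_nonpos h1]; simp
  have e2 : √G ^ 2 ≤ max 0 G := by
    rcases le_total 0 G with h1 | h1
    · rw [Real.sq_sqrt h1]; exact le_max_right _ _
    · rw [Real.sqrt_eq_zero_of_nonpos h1]; simp
  have e3 : 0 ≤ max 0 (τ.sigmaSq p M F t h) := le_max_left _ _
  have e4 : 0 ≤ 2 * p.ι ^ 2 * max 0 G := mul_nonneg (by positivity) (le_max_left _ _)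
  have e5 : 0 ≤ 4 * (√p.υ + p.ι) ^ 2 * D := by positivity
  have e6 : 0 ≤ p.α ^ 2 := by positivity
  have key : ∀ x ∈ ({√(τ.sigmaSq p M F t h), p.α, √2 * p.ι * √G, 2 * (√p.υ + p.ι) * √D} : Set ℝ),
      x ^ 2 ≤ max 0 (τ.sigmaSq p M F t h) + p.α ^ 2 + 2 * p.ι ^ 2 * max 0 G +
        4 * (√p.υ + p.ι) ^ 2 * D := by
    rintro x (rfl | rfl | rfl | rfl)
    · linarith
    · linarith
    · rw [mul_pow, mul_pow, Real.sq_sqrt zero_le_two]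
      have := mul_le_mul_of_nonneg_left e2 (show 0 ≤ 2 * p.ι ^ 2 by positivity)
      linarith
    · rw [mul_pow, mul_pow, Real.sq_sqrt hD]
      linarith
  apply key
  simp only [mem_insert_iff, mem_singleton_iff]
  rcases max_choice (max √(τ.sigmaSq p M F t h) p.α) (max (√2 * p.ι * √G) (2 * (√p.υ + p.ι) * √D))
    with hc | hc <;> rw [hc]
  · rcases max_choice √(τ.sigmaSq p M F t h) p.α with hd | hd <;> rw [hd] <;> simp
  · rcases max_choice (√2 * p.ι * √G) (2 * (√p.υ + p.ι) * √D) with hd | hd <;> rw [hd] <;> simp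

variable (hg : RegressionGood M F W p τ) {t h : ℕ}
include hg

/-- The next-level values belong to a finite class covered by the noise bounds. The resulting
squared error `36 L ι̇² + 4 t L ε` is below `β_{t,2}²`, and the oracle makes it pointwise. -/
theorem abs_fhat₂_sub_le (ht : t ∈ Finset.Ico 2 p.T) (hh : h ∈ Finset.Icc 1 p.H) (z : X × A) :
    |τ.fhat₂ t h z - M.bellman h (τ.v₂ p t (h + 1)) z| ≤ τ.b₂ t h z + p.ε := by
  have ht0 := Finset.mem_Ico.1 ht
  have hh0 := Finset.mem_Icc.1 hh
  have ht' : t ∈ Finset.Icc 2 p.T := Finset.mem_Icc.2 (by omega)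
  have ht1 : t ∈ Finset.Icc 1 p.T := Finset.mem_Icc.2 (by omega)
  have hh' : h + 1 ∈ Finset.Icc 1 (p.H + 1) := Finset.mem_Icc.2 (by omega)
  have hm := hv.measurable_v₂ S ht1 hh'
  have hb := hv.v₂_mem S ht1 hh'
  have hap := approxIn_spec (S.complete.first_moment h (S.H_eq ▸ hh) _ hm hb)
  have h1 := EpisodicMDP.sum_sq_le_of_noiseBound (φ := M.target h (τ.v₂ p t (h + 1)))
    (hv.fhat₂ t ht' h hh) hap.1
    (fun f hf => S.F_mem hh hf) S.adm.eps_nonneg hap.2 (M.measurable_target h hm) (R := 3) (by norm_num)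
    (fun q => by
      have := M.target_mem (h := h) hb q
      exact ⟨this.1, this.2.trans (by norm_num)⟩) S.adm.one_le_L
    (hg.unweighted h hh t ht _ (Or.inl (hv.v₂_mem_class S ht' hh)) _ (hv.fhat₂ t ht' h hh).1)
  have h2 := hv.bonus₂_lower S ht' hh hap.1 (h1.trans (by
    rw [S.adm.beta₂_sq]
    have := S.adm.one_le_iotaDot_sq
    have := S.adm.one_le_L
    have : 0 ≤ t * p.L * p.ε := by have := S.adm.eps_nonneg; positivity
    nlinarith)) z
  have h3 := abs_sub_le (τ.fhat₂ t h z) (approxIn (F h) p.ε (M.bellman h (τ.v₂ p t (h + 1))) z)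
    (M.bellman h (τ.v₂ p t (h + 1)) z)
  linarith [hap.2 z]

/-- The first bound borrows the bonus of `f̂_{t,2}` and needs room for an extra `1` in the radius.
The second avoids the oracle; it matches the variance estimate, which contains the distance itself.
-/
theorem abs_fhatNeg₂_sub_le (ht : t ∈ Finset.Ico 2 p.T) (hh : h ∈ Finset.Icc 1 p.H)
    (hle : ∀ x, τ.vNeg₂ p t (h + 1) x ≤ 2) (z : X × A) :
    |τ.fhatNeg₂ t h z - M.bellman h (τ.vNeg₂ p t (h + 1)) z| ≤ τ.b₂ t h z + p.ε ∧
    |τ.fhatNeg₂ t h z - M.bellman h (τ.vNeg₂ p t (h + 1)) z| ≤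
      wdist (F h) 1 (τ.data M h).z (fun _ => 1) t z * √(p.β₂ t ^ 2 + 1) + p.ε := by
  have ht0 := Finset.mem_Ico.1 ht
  have hh0 := Finset.mem_Icc.1 hh
  have ht' : t ∈ Finset.Icc 2 p.T := Finset.mem_Icc.2 (by omega)
  have ht1 : t ∈ Finset.Icc 1 p.T := Finset.mem_Icc.2 (by omega)
  have hh' : h + 1 ∈ Finset.Icc 1 (p.H + 1) := Finset.mem_Icc.2 (by omega)
  have hm := hv.measurable_vNeg₂ S ht1 hh'
  have hb : ∀ x, τ.vNeg₂ p t (h + 1) x ∈ Icc (0 : ℝ) 2 := fun x =>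
    ⟨(hv.vNeg₂_mem S ht1 hh' x).1, hle x⟩
  have hap := approxIn_spec (S.complete.first_moment h (S.H_eq ▸ hh) _ hm hb)
  have h1 := EpisodicMDP.sum_sq_le_of_noiseBound (φ := M.target h (τ.vNeg₂ p t (h + 1)))
    (hv.fhatNeg₂ t ht' h hh) hap.1
    (fun f hf => S.F_mem hh hf) S.adm.eps_nonneg hap.2 (M.measurable_target h hm) (R := 3) (by norm_num)
    (fun q => by
      have := M.target_mem (h := h) hb q
      exact ⟨this.1, this.2.trans (by norm_num)⟩) S.adm.one_le_L
    (hg.unweighted h hh t ht _ (Or.inr (hv.vNeg₂_mem_class S ht' hh hle)) _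
      (hv.fhatNeg₂ t ht' h hh).1)
  have hle2 : 4 * 3 ^ 2 * p.L * p.ιDot ^ 2 + 4 * t * p.L * p.ε + 1 ≤ p.β₂ t ^ 2 := by
    rw [S.adm.beta₂_sq]
    have := S.adm.one_le_iotaDot_sq
    have := S.adm.one_le_L
    have : 0 ≤ t * p.L * p.ε := by have := S.adm.eps_nonneg; positivity
    nlinarith
  constructor
  · have h2 := hv.bonus₂_lower_neg S ht hh hap.1 ((add_le_add_left h1 1).trans hle2) z
    have h3 := abs_sub_le (τ.fhatNeg₂ t h z) (approxIn (F h) p.ε (M.bellman h (τ.vNeg₂ p t (h + 1))) z)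
      (M.bellman h (τ.vNeg₂ p t (h + 1)) z)
    linarith [hap.2 z]
  · exact abs_sub_le_wdist_of_sum_le (hv.fhatNeg₂ t ht' h hh).1 hap.1 hap.2 (by linarith) z

/-- No bonus is computed for `ĝ`, so its error is expressed by the distance. The targets lie in `[0,
4]`, whence `R = 4`. -/
theorem abs_ghat_sub_le (ht : t ∈ Finset.Ico 2 p.T) (hh : h ∈ Finset.Icc 1 p.H) (z : X × A) :
    |τ.ghat t h z - M.bellmanSq h (τ.v₁ p t (h + 1)) z| ≤
      wdist (F h) 1 (τ.data M h).z (fun _ => 1) t z * √(p.βBar t ^ 2 + 1) + p.ε := by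
  have ht0 := Finset.mem_Ico.1 ht
  have hh0 := Finset.mem_Icc.1 hh
  have ht' : t ∈ Finset.Icc 2 p.T := Finset.mem_Icc.2 (by omega)
  have ht1 : t ∈ Finset.Icc 1 p.T := Finset.mem_Icc.2 (by omega)
  have hh' : h + 1 ∈ Finset.Icc 1 (p.H + 1) := Finset.mem_Icc.2 (by omega)
  have hm := hv.measurable_v₁ S ht1 hh'
  have hb := hv.v₁_mem S ht1 hh'
  have hap := approxIn_spec (S.complete.second_moment h (S.H_eq ▸ hh) _ hm hb)
  have h1 := EpisodicMDP.sum_sq_le_of_noiseBound (φ := M.targetSq h (τ.v₁ p t (h + 1)))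
    (hv.ghat t ht' h hh) hap.1
    (fun f hf => S.F_mem hh hf) S.adm.eps_nonneg hap.2 ((M.measurable_target h hm).pow_const 2)
    (R := 4) (by norm_num)
    (fun q => by
      have := M.target_mem (h := h) hb q
      exact ⟨sq_nonneg _, by unfold EpisodicMDP.targetSq; nlinarith [this.1, this.2]⟩) S.adm.one_le_L
    (hg.square h hh t ht _ (hv.v₁_mem_class S ht' hh) _ (hv.ghat t ht' h hh).1)
  refine abs_sub_le_wdist_of_sum_le (hv.ghat t ht' h hh).1 hap.1 hap.2 (h1.trans ?_) z
  rw [S.adm.betaBar_sq]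
  have := S.adm.one_le_iotaPrime_sq
  have := S.adm.one_le_L
  have : 0 ≤ t * p.L * p.ε := by have := S.adm.eps_nonneg; positivity
  nlinarith

/-- The estimates of step `h` with the exploration functions `f_{t,2}` and `f_{t,-2}`. -/
theorem f₂_facts (hl : LevelGood M p τ (h + 1)) (ht : t ∈ Finset.Ico 1 p.T)
    (hh : h ∈ Finset.Icc 1 p.H) (z : X × A) :
    min (M.bellman h (τ.v₂ p t (h + 1)) z) 2 ≤ τ.f₂ p t h z ∧ τ.fNeg₂ p t h z ≤ M.optQ h z := by
  have ht0 := Finset.mem_Ico.1 ht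
  have hh0 := Finset.mem_Icc.1 hh
  have ht1 : t ∈ Finset.Icc 1 p.T := Finset.mem_Icc.2 (by omega)
  have hh' : h + 1 ∈ Finset.Icc 1 (p.H + 1) := Finset.mem_Icc.2 (by omega)
  rcases ht0.1.eq_or_lt with rfl | h2
  · refine ⟨?_, ?_⟩
    · unfold Trace.f₂; rw [if_neg (by omega), if_pos le_rfl]; exact min_le_right _ _
    · unfold Trace.fNeg₂; rw [if_neg (by omega), if_pos le_rfl]; exact (S.optQ_mem hh z).1
  · have ht2 : t ∈ Finset.Ico 2 p.T := Finset.mem_Ico.2 (by omega)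
    have ht2' : t ∈ Finset.Icc 2 p.T := Finset.mem_Icc.2 (by omega)
    have hε := S.adm.eps_nonneg
    have hb₁ := hv.bonus₁_nonneg S ht2' hh z
    constructor
    · have h1 := abs_le.1 (hv.abs_fhat₂_sub_le S hg ht2 hh z)
      unfold Trace.f₂
      rw [if_neg (by omega), if_neg (by omega)]
      exact min_le_min_right _ (by linarith [h1.1])
    · have hle := (hl t ht).2.2
      have hVs := S.optV_mem hh'
      have h1 := abs_le.1 (hv.abs_fhatNeg₂_sub_le S hg ht2 hh
        (fun x => by linarith [hle x, (hVs x).2]) z).1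
      have h3 : M.bellman h (τ.vNeg₂ p t (h + 1)) z ≤ M.optQ h z := by
        rw [M.optQ_eq]
        exact EpisodicMDP.bellman_mono (hv.measurable_vNeg₂ S ht1 hh') (hv.vNeg₂_mem S ht1 hh')
          (measurable_optV_succ h) hVs hle z
      unfold Trace.fNeg₂
      rw [if_neg (by omega), if_neg (by omega)]
      exact max_le (by linarith [h1.2]) (S.optQ_mem hh z).1

/-- The gap `f_{s,2} - f_{s,-2}` controls the distance of the later values from `V_⋆`. -/
theorem bellman_sub_optQ_le (hl : LevelGood M p τ (h + 1)) {s : ℕ} (hs : s ∈ Finset.Ico 1 p.T)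
    (hh : h ∈ Finset.Icc 1 p.H) {V : X → ℝ} (hV : Measurable V) (hVb : ∀ x, V x ∈ Icc (0 : ℝ) 1)
    (hle : ∀ x, V x ≤ τ.v₂ p s (h + 1) x) (z : X × A) :
    M.bellman h V z - M.optQ h z ≤ τ.f₂ p s h z - τ.fNeg₂ p s h z := by
  have hs0 := Finset.mem_Ico.1 hs
  have hh0 := Finset.mem_Icc.1 hh
  have hs1 : s ∈ Finset.Icc 1 p.T := Finset.mem_Icc.2 (by omega)
  have hh' : h + 1 ∈ Finset.Icc 1 (p.H + 1) := Finset.mem_Icc.2 (by omega)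
  obtain ⟨h1, h2⟩ := hv.f₂_facts S hg hl hs hh z
  have h3 : M.bellman h V z ≤ M.bellman h (τ.v₂ p s (h + 1)) z :=
    EpisodicMDP.bellman_mono hV hVb (hv.measurable_v₂ S hs1 hh') (hv.v₂_mem S hs1 hh') hle z
  have h4 := (EpisodicMDP.bellman_mem (M := M) (h := h) hV hVb z).2
  have := le_min h3 (by linarith : M.bellman h V z ≤ 2)
  linarith

/-- `V - V⋆` takes values in `[0, 1]`, so its variance is at most its mean, which the gap of episode
`s` controls. It is applied to the value of a later episode, for which `hle` is monotonicity. -/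
theorem cvar_diff_le (hl : LevelGood M p τ (h + 1)) {s : ℕ} (hs : s ∈ Finset.Ico 1 p.T)
    (hh : h ∈ Finset.Icc 1 p.H) {V : X → ℝ} (hV : Measurable V) (hVb : ∀ x, V x ∈ Icc (0 : ℝ) 1)
    (hle : ∀ x, V x ≤ τ.v₂ p s (h + 1) x) (hge : ∀ x, M.optV (h + 1) x ≤ V x) (z : X × A) :
    M.cvar h (fun q => V q.2 - M.optV (h + 1) q.2) z ≤ τ.f₂ p s h z - τ.fNeg₂ p s h z := by
  have hh0 := Finset.mem_Icc.1 hh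
  have hh' : h + 1 ∈ Finset.Icc 1 (p.H + 1) := Finset.mem_Icc.2 (by omega)
  refine le_trans ?_ (hv.bellman_sub_optQ_le S hg hl hs hh hV hVb hle z)
  have hVs := S.optV_mem hh'
  have hVsm := measurable_optV_succ (M := M) h
  rw [M.optQ_eq, ← EpisodicMDP.cmean_sub_eq_bellman_sub hV hVb hVsm hVs]
  have hm : Measurable fun q : (X × A) × X => V q.2 - M.optV (h + 1) q.2 :=
    (hV.comp measurable_snd).sub (hVsm.comp measurable_snd)
  have hb : ∀ q : (X × A) × X, V q.2 - M.optV (h + 1) q.2 ∈ Icc (0 : ℝ) 1 := fun q =>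
    ⟨sub_nonneg.2 (hge _), by linarith [(hVb q.2).2, (hVs q.2).1]⟩
  rw [EpisodicMDP.cvar_eq hm hb]
  have h1 : M.cmean h (fun q => (V q.2 - M.optV (h + 1) q.2) ^ 2) z ≤
      M.cmean h (fun q => V q.2 - M.optV (h + 1) q.2) z :=
    EpisodicMDP.cmean_mono (hm.pow_const 2) (a := 0) (b := 1)
      (fun q => ⟨sq_nonneg _, pow_le_one₀ (hb q).1 (hb q).2⟩) hm hb
      fun y => by have := hb (z, y); nlinarith [this.1, this.2]
  linarith [sq_nonneg (M.cmean h (fun q => V q.2 - M.optV (h + 1) q.2) z)]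

/-- The difference between the variance estimate and the variance of `r + V_⋆`. -/
theorem sigmaSq_bounds (hl : LevelGood M p τ (h + 1)) (ht : t ∈ Finset.Ico 2 p.T)
    (hh : h ∈ Finset.Icc 1 p.H) :
    M.cvar h (M.target h (M.optV (h + 1))) (τ.z t h) ≤ τ.sigmaSq p M F t h ∧
    τ.sigmaSq p M F t h ≤ M.cvar h (M.target h (M.optV (h + 1))) (τ.z t h) +
      6 * (τ.f₂ p t h (τ.z t h) - τ.fNeg₂ p t h (τ.z t h)) +
      wdist (F h) 1 (τ.data M h).z (fun _ => 1) t (τ.z t h) *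
        (2 * √(p.βBar t ^ 2 + 1) + (2 + 2 * p.L) * √(p.β₂ t ^ 2 + 1)) + (5 + 2 * p.L) * p.ε := by
  have ht0 := Finset.mem_Ico.1 ht
  have hh0 := Finset.mem_Icc.1 hh
  have hL := S.adm.one_le_L
  have hε := S.adm.eps_nonneg
  have ht' : t ∈ Finset.Ico 1 p.T := Finset.mem_Ico.2 (by omega)
  have ht2 : t ∈ Finset.Icc 2 p.T := Finset.mem_Icc.2 (by omega)
  have ht1 : t ∈ Finset.Icc 1 p.T := Finset.mem_Icc.2 (by omega)
  have hh' : h + 1 ∈ Finset.Icc 1 (p.H + 1) := Finset.mem_Icc.2 (by omega)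
  have hVs := S.optV_mem hh'
  have hVsm := measurable_optV_succ (M := M) h
  obtain ⟨l1, l2, l3⟩ := hl t ht'
  set z := τ.z t h with hz
  have g1 := abs_le.1 (hv.abs_ghat_sub_le S hg ht hh z)
  have g2 := abs_le.1 (hv.abs_fhatNeg₂_sub_le S hg ht hh
    (fun x => by linarith [l3 x, (hVs x).2]) z).2
  have hgap := hv.bellman_sub_optQ_le S hg hl ht' hh (hv.measurable_v₁ S ht1 hh')
    (hv.v₁_mem S ht1 hh') (l2 t (Finset.mem_Icc.2 (by omega))) z
  have hneg := (hv.f₂_facts S hg hl ht' hh z).2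
  have hbn : M.bellman h (τ.vNeg₂ p t (h + 1)) z ≤ M.optQ h z := by
    rw [M.optQ_eq]
    exact EpisodicMDP.bellman_mono (hv.measurable_vNeg₂ S ht1 hh') (hv.vNeg₂_mem S ht1 hh') hVsm hVs l3 z
  have hQ := S.optQ_mem hh z
  have hfn : τ.fNeg₂ p t h z ≤ M.bellman h (τ.vNeg₂ p t (h + 1)) z := by
    have h1 := abs_le.1 (hv.abs_fhatNeg₂_sub_le S hg ht hh
      (fun x => by linarith [l3 x, (hVs x).2]) z).1
    unfold Trace.fNeg₂
    rw [if_neg (by omega), if_neg (by omega)]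
    exact max_le (by linarith [h1.2]) (EpisodicMDP.bellman_mem (hv.measurable_vNeg₂ S ht1 hh')
      (hv.vNeg₂_mem S ht1 hh') z).1
  have hf2 : M.optQ h z ≤ τ.f₂ p t h z := by
    have h1 : M.optQ h z ≤ M.bellman h (τ.v₂ p t (h + 1)) z := by
      rw [M.optQ_eq]
      exact EpisodicMDP.bellman_mono hVsm hVs (hv.measurable_v₂ S ht1 hh') (hv.v₂_mem S ht1 hh')
        (fun x => (l1 x).trans (l2 t (Finset.mem_Icc.2 (by omega)) x)) z
    exact (le_min h1 (by linarith [hQ.2])).trans (hv.f₂_facts S hg hl ht' hh z).1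
  have hcv := EpisodicMDP.cvar_eq (M := M) (h := h) (M.measurable_target h hVsm) (M.target_mem hVs) z
  rw [EpisodicMDP.cmean_target, ← M.optQ_eq] at hcv
  have hvb := EpisodicMDP.cvar_le (M := M) (h := h) (M.measurable_target h hVsm) (M.target_mem hVs) z
  have hsqm : ∀ {V : X → ℝ}, Measurable V → (∀ x, V x ∈ Icc (0 : ℝ) 1) →
      Measurable (M.targetSq h V) ∧ ∀ q, M.targetSq h V q ∈ Icc (0 : ℝ) 4 := fun hV hVb =>
    ⟨(M.measurable_target h hV).pow_const 2, fun q => ⟨sq_nonneg _, by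
      have := M.target_mem (h := h) hVb q
      unfold EpisodicMDP.targetSq
      nlinarith [this.1, this.2]⟩⟩
  have s1 := hsqm hVsm hVs
  have s2 := hsqm (hv.measurable_v₁ S ht1 hh') (hv.v₁_mem S ht1 hh')
  have m1 : M.cmean h (M.targetSq h (M.optV (h + 1))) z ≤ M.bellmanSq h (τ.v₁ p t (h + 1)) z := by
    rw [← M.cmean_targetSq]
    refine EpisodicMDP.cmean_mono s1.1 s1.2 s2.1 s2.2 fun y => ?_
    have := (M.target_mem (h := h) hVs (z, y)).1
    exact pow_le_pow_left₀ this (by unfold EpisodicMDP.target; linarith [l1 y]) 2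
  -- Both targets lie in `[0, 2]`, so their squares differ by at most `4` times their difference.
  have m2 : M.bellmanSq h (τ.v₁ p t (h + 1)) z ≤ M.cmean h (M.targetSq h (M.optV (h + 1))) z +
      4 * (M.bellman h (τ.v₁ p t (h + 1)) z - M.optQ h z) := by
    rw [M.optQ_eq, ← M.cmean_targetSq]
    have i1 := EpisodicMDP.integrable_section (M := M) (h := h) s1.1 s1.2 z
    have i3 := EpisodicMDP.integrable_section (M := M) (h := h)
      (M.measurable_target h (hv.measurable_v₁ S ht1 hh')) (M.target_mem (hv.v₁_mem S ht1 hh')) z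
    have i4 := EpisodicMDP.integrable_section (M := M) (h := h)
      (M.measurable_target h hVsm) (M.target_mem hVs) z
    have e : M.cmean h (M.targetSq h (M.optV (h + 1))) z +
      4 * (M.bellman h (τ.v₁ p t (h + 1)) z - M.bellman h (M.optV (h + 1)) z) =
      ∫ y, (M.targetSq h (M.optV (h + 1)) (z, y) + 4 * (M.target h (τ.v₁ p t (h + 1)) (z, y) -
        M.target h (M.optV (h + 1)) (z, y))) ∂(M.trans h z) := by
      have e1 := integral_add i1 ((i3.sub i4).const_mul 4)
      have e2 := integral_sub i3 i4
      simp only [Pi.sub_apply] at e1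
      rw [e1, integral_const_mul, e2]
      rfl
    rw [e]
    refine integral_mono (EpisodicMDP.integrable_section s2.1 s2.2 z)
      (i1.add ((i3.sub i4).const_mul 4)) fun y => ?_
    have a1 := M.target_mem (h := h) hVs (z, y)
    have a2 := M.target_mem (h := h) (hv.v₁_mem S ht1 hh') (z, y)
    have a3 : M.target h (M.optV (h + 1)) (z, y) ≤ M.target h (τ.v₁ p t (h + 1)) (z, y) := by
      unfold EpisodicMDP.target; linarith [l1 y]
    simp only [EpisodicMDP.targetSq]
    nlinarith [a1.1, a1.2, a2.1, a2.2]
  have hms : M.cmean h (fun q => M.target h (M.optV (h + 1)) q ^ 2) z =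
      M.cmean h (M.targetSq h (M.optV (h + 1))) z := rfl
  rw [hms] at hcv
  set D := wdist (F h) 1 (τ.data M h).z (fun _ => 1) t z with hD
  have hD0 : 0 ≤ D := wdist_nonneg
  set β' := √(p.βBar t ^ 2 + 1)
  set β₂ := √(p.β₂ t ^ 2 + 1)
  have hβ2 : 0 ≤ D * β₂ := mul_nonneg hD0 (Real.sqrt_nonneg _)
  have hβ' : 0 ≤ D * β' := mul_nonneg hD0 (Real.sqrt_nonneg _)
  have hfh := S.F_mem hh (hv.fhatNeg₂ t ht2 h hh).1 z
  have eσ : τ.sigmaSq p M F t h = min 4 (τ.ghat t h z - τ.fhatNeg₂ t h z ^ 2 +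
      D * (β' + 2 * p.L * β₂) + 2 * (1 + p.L) * p.ε) := by
    unfold Trace.sigmaSq
    rw [if_neg (by omega), S.adm.lam_eq]
  set q := M.optQ h z
  set f := τ.fhatNeg₂ t h z
  constructor
  · rw [eσ]
    -- The cap `4` is harmless: a variable in `[0, 2]` has variance at most `1`.
    refine le_min (by norm_num at hvb; linarith) ?_
    have hfq : f ≤ q + (D * β₂ + p.ε) := by linarith [g2.2]
    -- `f̂_{t,-2}` may be as large as `L`; this explains the factor `2 L` in the variance estimate.
    have hsq : f ^ 2 ≤ q ^ 2 + 2 * p.L * (D * β₂ + p.ε) := by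
      rcases le_total f q with h1 | h1
      · have : 0 ≤ 2 * p.L * (D * β₂ + p.ε) := by positivity
        nlinarith [hfh.1]
      · have h2 : f ^ 2 - q ^ 2 = (f - q) * (f + q) := by ring
        have h3 : (f - q) * (f + q) ≤ (D * β₂ + p.ε) * (2 * p.L) :=
          mul_le_mul (by linarith) (by linarith [hfh.2, hQ.2]) (by linarith [hfh.1, hQ.1]) (by linarith)
        linarith
    linarith [g1.1]
  · rw [eσ]
    refine (min_le_right _ _).trans ?_
    have hgap0 : 0 ≤ τ.f₂ p t h z - τ.fNeg₂ p t h z := by linarith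
    have hfq : q - f ≤ (τ.f₂ p t h z - τ.fNeg₂ p t h z) + D * β₂ + p.ε := by
      linarith [g2.1]
    -- Here `0 ≤ q ≤ 1` suffices and `L` does not enter. With the factor `4` from the second moments
    -- this makes `6` times the gap.
    have hsq : q ^ 2 - f ^ 2 ≤ 2 * ((τ.f₂ p t h z - τ.fNeg₂ p t h z) + D * β₂ + p.ε) := by
      have h1 : q ^ 2 - f ^ 2 ≤ 2 * q * (q - f) := by nlinarith [sq_nonneg (q - f)]
      have h2 : 2 * q * (q - f) ≤ 2 * q * ((τ.f₂ p t h z - τ.fNeg₂ p t h z) + D * β₂ + p.ε) :=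
        mul_le_mul_of_nonneg_left hfq (by linarith [hQ.1])
      nlinarith [hQ.2]
    linarith [g1.2]

theorem cvar_optV_le_sq (hl : LevelGood M p τ (h + 1)) (ht : t ∈ Finset.Ico 1 p.T)
    (hh : h ∈ Finset.Icc 1 p.H) :
    M.cvar h (M.target h (M.optV (h + 1))) (τ.z t h) ≤ τ.σbar t h ^ 2 := by
  have ht0 := Finset.mem_Ico.1 ht
  have hh0 := Finset.mem_Icc.1 hh
  refine le_trans ?_ (hv.sigmaSq_le_sq S (Finset.mem_Icc.2 (by omega)) hh)
  rcases ht0.1.eq_or_lt with rfl | h2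
  · have hVs := S.optV_mem (h := h + 1) (Finset.mem_Icc.2 (by omega))
    have := EpisodicMDP.cvar_le (M := M) (h := h)
      (M.measurable_target h (measurable_optV_succ (M := M) h)) (M.target_mem hVs) (τ.z 1 h)
    unfold Trace.sigmaSq
    rw [if_pos le_rfl]
    norm_num at this
    linarith
  · exact (hv.sigmaSq_bounds S hg hl (Finset.mem_Ico.2 (by omega)) hh).1

/-- The weights meet the demands of the peeling argument at every earlier `s`: they dominate the
variance of `r + V⋆` by the variance estimate, and that of `f_{t,1} - V⋆` because `f_{t,1} ≤
f_{s,2}`. -/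
theorem abs_fhat₁_sub_le (hl : LevelGood M p τ (h + 1)) (ht : t ∈ Finset.Ico 2 p.T)
    (hh : h ∈ Finset.Icc 1 p.H) (z : X × A) :
    |τ.fhat₁ t h z - M.bellman h (τ.v₁ p t (h + 1)) z| ≤ τ.b₁ t h z + p.ε := by
  have ht0 := Finset.mem_Ico.1 ht
  have hh0 := Finset.mem_Icc.1 hh
  have ht' : t ∈ Finset.Icc 2 p.T := Finset.mem_Icc.2 (by omega)
  have ht1 : t ∈ Finset.Icc 1 p.T := Finset.mem_Icc.2 (by omega)
  have hh' : h + 1 ∈ Finset.Icc 1 (p.H + 1) := Finset.mem_Icc.2 (by omega)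
  have hm := hv.measurable_v₁ S ht1 hh'
  have hb := hv.v₁_mem S ht1 hh'
  obtain ⟨l1, l2, -⟩ := hl t (Finset.mem_Ico.2 (by omega))
  have hap := approxIn_spec (S.complete.first_moment h (S.H_eq ▸ hh) _ hm
    fun x => ⟨(hb x).1, (hb x).2.trans one_le_two⟩)
  have hs : ∀ s ∈ Finset.Ico 1 t, s ∈ Finset.Ico 1 p.T ∧ s ∈ Finset.Icc 1 p.T ∧ s ∈ Finset.Icc 1 t :=
    fun s hs => by simp only [Finset.mem_Ico, Finset.mem_Icc] at hs ⊢; omega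
  have h1 := EpisodicMDP.weighted_sum_sq_le_of_noiseBound S.adm (by omega)
    (hv.fhat₁ t ht' h hh) hap.1 (fun f hf => S.F_mem hh hf) hap.2 hm hb
    (measurable_optV_succ (M := M) h) (S.optV_mem hh')
    (fun s h => hv.alpha_le (hs s h).2.1 hh) (fun s h => hv.wdist_le_sq S (hs s h).2.1 hh)
    (fun s h => hv.cvar_optV_le_sq S hg hl (hs s h).1 hh)
    (fun s h => le_trans (mul_le_mul_of_nonneg_left
      (hv.cvar_diff_le S hg hl (hs s h).1 hh hm hb (l2 s (hs s h).2.2) l1 _)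
        (by positivity)) (hv.gap_le_sq S (hs s h).2.1 hh))
    (fun k hk => hg.optimal h hh t ht _ (hv.fhat₁ t ht' h hh).1 _ hap.1 k hk)
    (fun k hk => hg.diff h hh t ht _ (hv.v₁_mem_class S ht' hh) _ (hv.fhat₁ t ht' h hh).1 _ hap.1 k hk)
  have h2 := hv.bonus₁_lower S ht' hh hap.1 h1 z
  have h3 := abs_sub_le (τ.fhat₁ t h z) (approxIn (F h) p.ε (M.bellman h (τ.v₁ p t (h + 1))) z)
    (M.bellman h (τ.v₁ p t (h + 1)) z)
  linarith [hap.2 z]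

/-- Everything follows from the three regression bounds and the relations between the values at
level `h + 1`. -/
theorem stepGood (hl : LevelGood M p τ (h + 1)) (ht : t ∈ Finset.Ico 2 p.T)
    (hh : h ∈ Finset.Icc 1 p.H) :
    StepGood M p τ t h ∧ ∀ s ∈ Finset.Icc 1 t, ∀ z, τ.f₁ p t h z ≤ τ.f₂ p s h z := by
  have ht0 := Finset.mem_Ico.1 ht
  have hh0 := Finset.mem_Icc.1 hh
  have hε := S.adm.eps_nonneg
  have ht' : t ∈ Finset.Icc 2 p.T := Finset.mem_Icc.2 (by omega)
  have ht1 : t ∈ Finset.Icc 1 p.T := Finset.mem_Icc.2 (by omega)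
  have ht1' : t ∈ Finset.Ico 1 p.T := Finset.mem_Ico.2 (by omega)
  have hh' : h + 1 ∈ Finset.Icc 1 (p.H + 1) := Finset.mem_Icc.2 (by omega)
  have hm₁ := hv.measurable_v₁ S ht1 hh'
  have hb₁ := hv.v₁_mem S ht1 hh'
  have hVs := S.optV_mem hh'
  have hVsm := measurable_optV_succ (M := M) h
  obtain ⟨l1, l2, l3⟩ := hl t ht1'
  have r1 := fun z => abs_le.1 (hv.abs_fhat₁_sub_le S hg hl ht hh z)
  have r2 := fun z => abs_le.1 (hv.abs_fhat₂_sub_le S hg ht hh z)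
  have r3 := fun z => abs_le.1 (hv.abs_fhatNeg₂_sub_le S hg ht hh
    (fun x => by linarith [l3 x, (hVs x).2]) z).1
  have e1 : ∀ z, τ.f₁ p t h z = min (τ.fhat₁ t h z + τ.b₁ t h z + p.ε) 1 := fun z => by
    unfold Trace.f₁; rw [if_neg (by omega), if_neg (by omega)]
  have e2 : ∀ s, 2 ≤ s → ∀ z, τ.f₂ p s h z =
      min (τ.fhat₂ s h z + 2 * τ.b₁ s h z + τ.b₂ s h z + 3 * p.ε) 2 := fun s hs z => by
    unfold Trace.f₂; rw [if_neg (by omega), if_neg (by omega)]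
  have e3 : ∀ z, τ.fNeg₂ p t h z = max (τ.fhatNeg₂ t h z - τ.b₂ t h z - p.ε) 0 := fun z => by
    unfold Trace.fNeg₂; rw [if_neg (by omega), if_neg (by omega)]
  -- The definition of `f_{s,2}` is made for this: `2 b_{s,1}` covers the two copies of `b_{t,1}`
  -- (from the definition of `f_{t,1}` and from its regression error), and `3 ε` covers their two
  -- `ε` and the one in the regression for `f_{s,2}`.
  have hmono : ∀ s ∈ Finset.Icc 1 t, ∀ z, τ.f₁ p t h z ≤ τ.f₂ p s h z := fun s hs z => by
    have hs0 := Finset.mem_Icc.1 hs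
    rcases hs0.1.eq_or_lt with rfl | h2
    · have : τ.f₂ p 1 h z = 2 := by unfold Trace.f₂; rw [if_neg (by omega), if_pos le_rfl]
      rw [this, e1]
      exact (min_le_right _ _).trans one_le_two
    · have hs2 : s ∈ Finset.Ico 2 p.T := Finset.mem_Ico.2 (by omega)
      have hs1 : s ∈ Finset.Icc 1 p.T := Finset.mem_Icc.2 (by omega)
      rw [e1, e2 s h2]
      have h3 := abs_le.1 (hv.abs_fhat₂_sub_le S hg hs2 hh z)
      have h4 := hv.bonus₁_anti S h2 hs0.2 (by omega) hh z
      have h5 : M.bellman h (τ.v₁ p t (h + 1)) z ≤ M.bellman h (τ.v₂ p s (h + 1)) z :=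
        EpisodicMDP.bellman_mono hm₁ hb₁ (hv.measurable_v₂ S hs1 hh') (hv.v₂_mem S hs1 hh') (l2 s hs) z
      exact min_le_min (by linarith [(r1 z).2, h3.1]) one_le_two
  have hbn : ∀ z, M.bellman h (τ.vNeg₂ p t (h + 1)) z ≤ M.optQ h z := fun z => by
    rw [M.optQ_eq]
    exact EpisodicMDP.bellman_mono (hv.measurable_vNeg₂ S ht1 hh') (hv.vNeg₂_mem S ht1 hh') hVsm hVs l3 z
  refine ⟨⟨fun z => ?_, fun z => ?_, fun z => hmono t (Finset.mem_Icc.2 (by omega)) z, fun z => ?_,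
    fun z => ?_, fun z => (hv.f₂_facts S hg hl ht1' hh z).2, fun z => ?_, hbn⟩, hmono⟩
  · have h1 : M.optQ h z ≤ M.bellman h (τ.v₁ p t (h + 1)) z := by
      rw [M.optQ_eq]
      exact EpisodicMDP.bellman_mono hVsm hVs hm₁ hb₁ l1 z
    rw [e1]
    exact le_min (by linarith [(r1 z).1]) (S.optQ_mem hh z).2
  · rw [e1]
    exact (min_le_left _ _).trans (by linarith [(r1 z).2])
  · rw [e2 t ht0.1]
    exact (min_le_left _ _).trans (by linarith [(r2 z).2])
  · rw [e3]
    exact max_le (by linarith [(r3 z).2]) (EpisodicMDP.bellman_mem (hv.measurable_vNeg₂ S ht1 hh')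
      (hv.vNeg₂_mem S ht1 hh') z).1
  · rw [e3]
    exact le_trans (by linarith [(r3 z).1]) (le_max_left _ _)

/-- Induction from level `H + 1`, where all functions vanish. The three relations go together
because the analysis of the weights at level `h` uses all of them at level `h + 1`. -/
theorem levelGood {h : ℕ} (hh : h ∈ Finset.Icc 1 (p.H + 1)) : LevelGood M p τ h := by
  obtain ⟨k, hk⟩ : ∃ k, k = p.H + 1 - h := ⟨_, rfl⟩
  induction k generalizing h with
  | zero =>
    rw [Finset.mem_Icc] at hh
    obtain rfl : h = p.H + 1 := by omega
    intro t _
    have e : τ.f₁ p t (p.H + 1) = fun _ => 0 := by funext z; simp [Trace.f₁]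
    have e' : ∀ s, τ.f₂ p s (p.H + 1) = fun _ => 0 := fun s => by funext z; simp [Trace.f₂]
    have e'' : τ.fNeg₂ p t (p.H + 1) = fun _ => 0 := by funext z; simp [Trace.fNeg₂]
    simp only [Trace.v₁, Trace.v₂, Trace.vNeg₂, e, e', e'', maxAct_const, S.optV_last, le_refl,
      implies_true, and_self]
  | succ k ih =>
    rw [Finset.mem_Icc] at hh
    have hl := ih (h := h + 1) (Finset.mem_Icc.2 (by omega)) (by omega)
    have hh' : h ∈ Finset.Icc 1 p.H := Finset.mem_Icc.2 (by omega)
    have hh2 : h ∈ Finset.Icc 1 (p.H + 1) := Finset.mem_Icc.2 (by omega)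
    intro t ht
    have ht0 := Finset.mem_Ico.1 ht
    have ht1 : t ∈ Finset.Icc 1 p.T := Finset.mem_Icc.2 (by omega)
    have hs1 : ∀ s ∈ Finset.Icc 1 t, s ∈ Finset.Icc 1 p.T := fun s hs => by
      rw [Finset.mem_Icc] at hs ⊢; omega
    suffices H : (∀ z, M.optQ h z ≤ τ.f₁ p t h z) ∧
        (∀ s ∈ Finset.Icc 1 t, ∀ z, τ.f₁ p t h z ≤ τ.f₂ p s h z) ∧
        ∀ z, τ.fNeg₂ p t h z ≤ M.optQ h z by
      rw [S.optV_eq_maxAct hh']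
      exact ⟨fun x => maxAct_mono (fun z => (hv.f₁_mem S ht1 hh2 z).2) H.1 x,
        fun s hs x => maxAct_mono (fun z => (hv.f₂_mem S (hs1 s hs) hh2 z).2) (H.2.1 s hs) x,
        fun x => maxAct_mono (fun z => (S.optQ_mem hh' z).2) H.2.2 x⟩
    refine ⟨?_, ?_, fun z => (hv.f₂_facts S hg hl ht hh' z).2⟩
    · rcases ht0.1.eq_or_lt with rfl | h2
      · intro z
        unfold Trace.f₁; rw [if_neg (by omega), if_pos le_rfl]; exact (S.optQ_mem hh' z).2
      · exact (hv.stepGood S hg hl (Finset.mem_Ico.2 (by omega)) hh').1.optQ_le_f₁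
    · rcases ht0.1.eq_or_lt with rfl | h2
      · intro s hs z
        have : s = 1 := by rw [Finset.mem_Icc] at hs; omega
        subst this
        unfold Trace.f₁ Trace.f₂
        rw [if_neg (by omega), if_pos le_rfl, if_neg (by omega), if_pos le_rfl]
        exact one_le_two
      · exact (hv.stepGood S hg hl (Finset.mem_Ico.2 (by omega)) hh').2

theorem stepGood_of_regressionGood (ht : t ∈ Finset.Ico 2 p.T) (hh : h ∈ Finset.Icc 1 p.H) :
    StepGood M p τ t h := by
  have hh0 := Finset.mem_Icc.1 hh
  exact (hv.stepGood S hg (hv.levelGood S hg (Finset.mem_Icc.2 (by omega))) ht hh).1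

end IsVOQL

end

/-! ### Measurability of the functions and weights of a run -/

section

section FiniteValued

/-- `g` takes finitely many values, and the sets on which it is constant are in `m`. -/
structure FiniteValued {Ω E : Type*} (m : MeasurableSpace Ω) (g : Ω → E) : Prop where
  finite : (range g).Finite
  meas : ∀ e, MeasurableSet[m] {ω | g ω = e}

variable {Ω E E' : Type*} {m m' : MeasurableSpace Ω} {g : Ω → E} {g' : Ω → E'}

theorem FiniteValued.measurableSet_setOf (hg : FiniteValued m g) (q : E → Prop) :
    MeasurableSet[m] {ω | q (g ω)} := by
  have : {ω | q (g ω)} = ⋃ e ∈ {e ∈ range g | q e}, {ω | g ω = e} := by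
    ext ω
    simp
  rw [this]
  exact (hg.finite.subset fun _ he => he.1).measurableSet_biUnion fun e _ => hg.meas e

theorem FiniteValued.comp (hg : FiniteValued m g) (φ : E → E') :
    FiniteValued m fun ω => φ (g ω) :=
  ⟨(hg.finite.image φ).subset (by rintro _ ⟨ω, rfl⟩; exact ⟨_, ⟨ω, rfl⟩, rfl⟩),
    fun e => hg.measurableSet_setOf fun x => φ x = e⟩

theorem FiniteValued.pair (hg : FiniteValued m g) (hg' : FiniteValued m g') :
    FiniteValued m fun ω => (g ω, g' ω) := by
  refine ⟨(hg.finite.prod hg'.finite).subset (by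
    rintro _ ⟨ω, rfl⟩; exact ⟨⟨ω, rfl⟩, ⟨ω, rfl⟩⟩), fun e => ?_⟩
  have : {ω | (g ω, g' ω) = e} = {ω | g ω = e.1} ∩ {ω | g' ω = e.2} := by
    ext ω; simp [Prod.ext_iff]
  rw [this]
  exact (hg.meas _).inter (hg'.meas _)

theorem FiniteValued.mono (hg : FiniteValued m g) (h : m ≤ m') : FiniteValued m' g :=
  ⟨hg.finite, fun e => h _ (hg.meas e)⟩

theorem FiniteValued.const (e : E) : FiniteValued m fun _ => e :=
  ⟨(finite_singleton e).subset (by rintro _ ⟨ω, rfl⟩; rfl), fun _ => MeasurableSet.const _⟩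

theorem FiniteValued.ite {q : Ω → Prop} [DecidablePred q] (hq : MeasurableSet[m] {ω | q ω})
    {g₁ g₂ : Ω → E} (h₁ : FiniteValued m g₁) (h₂ : FiniteValued m g₂) :
    FiniteValued m fun ω => if q ω then g₁ ω else g₂ ω := by
  refine ⟨(h₁.finite.union h₂.finite).subset ?_, fun e => ?_⟩
  · rintro _ ⟨ω, rfl⟩
    dsimp only
    split_ifs
    · exact Or.inl ⟨ω, rfl⟩
    · exact Or.inr ⟨ω, rfl⟩
  · have : {ω | (if q ω then g₁ ω else g₂ ω) = e} =
        ({ω | q ω} ∩ {ω | g₁ ω = e}) ∪ ({ω | q ω}ᶜ ∩ {ω | g₂ ω = e}) := by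
      ext ω
      by_cases h : q ω <;> simp [h]
    rw [this]
    exact (hq.inter (h₁.meas e)).union (hq.compl.inter (h₂.meas e))

/-- Splitting according to the finitely many values of `g` gives joint measurability without a
σ-algebra on a space of functions. -/
theorem FiniteValued.measurable_uncurry {Y : Type*} [mY : MeasurableSpace Y] {g : Ω → Y → ℝ}
    (hg : FiniteValued m g) (hm : ∀ ω, Measurable (g ω)) :
    Measurable[m.prod mY] fun q : Ω × Y => g q.1 q.2 := by
  intro S hS
  have : (fun q : Ω × Y => g q.1 q.2) ⁻¹' S = ⋃ e ∈ range g, {ω | g ω = e} ×ˢ (e ⁻¹' S) := by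
    ext ⟨ω, y⟩
    simp only [mem_preimage, mem_iUnion, mem_prod, mem_ofPred_eq, mem_range, exists_prop]
    constructor
    · exact fun h => ⟨g ω, ⟨ω, rfl⟩, rfl, h⟩
    · rintro ⟨e, -, rfl, h⟩; exact h
  rw [this]
  refine hg.finite.measurableSet_biUnion fun e he => ?_
  obtain ⟨ω, rfl⟩ := he
  exact (hg.meas _).prod (hm ω hS)

theorem FiniteValued.measurable_eval {Y : Type*} [mY : MeasurableSpace Y] {g : Ω → Y → ℝ}
    (hg : FiniteValued m g) (hm : ∀ ω, Measurable (g ω)) {y : Ω → Y} (hy : Measurable[m] y) :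
    Measurable[m] fun ω => g ω (y ω) :=
  (hg.measurable_uncurry hm).comp (measurable_id.prodMk hy)

end FiniteValued

variable {X : Type u} {A : Type v} [mX : MeasurableSpace X] [mA : MeasurableSpace A]
  [Countable A] [Nonempty A] [MeasurableSingletonClass A]
  {M : EpisodicMDP X A} {F : ℕ → Finset (X × A → ℝ)} {W : Finset (X × A → ℝ)}
  {B : BonusOracle X A} {p : VOQLParams} {C : ℝ} {u : ℕ → ℝ}
  {Ω : Type w} {mΩ : MeasurableSpace Ω} {P : Measure Ω}

namespace VOQLRun

variable (R : VOQLRun M F B p u P)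

theorem hist_le_hist_of_le {t h h' : ℕ} (hh : h ≤ h') (hh' : h' ≤ M.H) :
    R.hist t h ≤ R.hist t h' := by
  induction h', hh using Nat.le_induction with
  | base => exact le_rfl
  | succ k _ ih => exact (ih (by omega)).trans (R.hist_mono t k (by omega))

theorem hist_le_hist_of_lt {t t' h h' : ℕ} (ht : t < t') (hh : h ≤ M.H) (hh' : h' ≤ M.H) :
    R.hist t h ≤ R.hist t' h' := by
  induction t', ht using Nat.le_induction generalizing h' with
  | base =>
    exact (R.hist_le_hist_of_le hh le_rfl).trans
      ((R.hist_next t).trans (R.hist_le_hist_of_le (Nat.zero_le _) hh'))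
  | succ k _ ih =>
    exact (ih (h' := M.H) le_rfl).trans
      ((R.hist_next k).trans (R.hist_le_hist_of_le (Nat.zero_le _) hh'))

theorem hist_pred_le {t h : ℕ} (ht : 1 ≤ t) (hh : h ≤ M.H) :
    R.hist (t - 1) M.H ≤ R.hist t h :=
  R.hist_le_hist_of_lt (by omega) le_rfl hh

variable {t h : ℕ}

theorem measurable_x (ht : t ∈ Finset.Icc 1 p.T) (hh : h ∈ Finset.Icc 1 (M.H + 1)) :
    Measurable[R.hist t (h - 1)] fun ω => (R.trace ω).x t h := by
  rw [Finset.mem_Icc] at hh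
  have := R.x_meas t ht (h - 1) (by omega)
  rwa [Nat.sub_add_cancel hh.1] at this

variable (S : VOQLSetup M F W B p C)
include S

theorem measurable_z (ht : t ∈ Finset.Icc 1 p.T) (hh : h ∈ Finset.Icc 1 p.H) :
    Measurable[R.hist t (h - 1)] fun ω => (R.trace ω).z t h := by
  have hh0 := Finset.mem_Icc.1 hh
  rw [S.H_eq] at hh0
  exact (R.measurable_x ht (Finset.mem_Icc.2 (by omega))).prodMk (R.a_meas t ht h hh)

theorem stepLaw (ht : t ∈ Finset.Icc 1 p.T) (hh : h ∈ Finset.Icc 1 p.H) :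
    StepLaw (R.hist t (h - 1)) P (M.trans h) (fun ω => (R.trace ω).z t h)
      (fun ω => (R.trace ω).x t (h + 1)) := by
  have hh0 := Finset.mem_Icc.1 hh
  rw [S.H_eq] at hh0
  exact ⟨R.hist_le _ _, R.measurable_z S ht hh, (R.x_meas t ht h hh0.2).mono (R.hist_le _ _) le_rfl,
    R.law_step t ht h hh⟩

theorem finiteValued_fhat₁ (ht : t ∈ Finset.Icc 2 p.T) (hh : h ∈ Finset.Icc 1 p.H) :
    FiniteValued (R.hist (t - 1) M.H) fun ω => (R.trace ω).fhat₁ t h :=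
  ⟨(F h).finite_toSet.subset (by rintro _ ⟨ω, rfl⟩; exact ((R.isVOQL ω).fhat₁ t ht h hh).1),
    R.fhat₁_meas t ht h hh⟩

theorem finiteValued_fhat₂ (ht : t ∈ Finset.Icc 2 p.T) (hh : h ∈ Finset.Icc 1 p.H) :
    FiniteValued (R.hist (t - 1) M.H) fun ω => (R.trace ω).fhat₂ t h :=
  ⟨(F h).finite_toSet.subset (by rintro _ ⟨ω, rfl⟩; exact ((R.isVOQL ω).fhat₂ t ht h hh).1),
    R.fhat₂_meas t ht h hh⟩

theorem finiteValued_fhatNeg₂ (ht : t ∈ Finset.Icc 2 p.T) (hh : h ∈ Finset.Icc 1 p.H) :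
    FiniteValued (R.hist (t - 1) M.H) fun ω => (R.trace ω).fhatNeg₂ t h :=
  ⟨(F h).finite_toSet.subset (by rintro _ ⟨ω, rfl⟩; exact ((R.isVOQL ω).fhatNeg₂ t ht h hh).1),
    R.fhatNeg₂_meas t ht h hh⟩

theorem finiteValued_ghat (ht : t ∈ Finset.Icc 2 p.T) (hh : h ∈ Finset.Icc 1 p.H) :
    FiniteValued (R.hist (t - 1) M.H) fun ω => (R.trace ω).ghat t h :=
  ⟨(F h).finite_toSet.subset (by rintro _ ⟨ω, rfl⟩; exact ((R.isVOQL ω).ghat t ht h hh).1),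
    R.ghat_meas t ht h hh⟩

theorem finiteValued_b₁ (ht : t ∈ Finset.Icc 2 p.T) (hh : h ∈ Finset.Icc 1 p.H) :
    FiniteValued (R.hist (t - 1) M.H) fun ω => (R.trace ω).b₁ t h :=
  ⟨W.finite_toSet.subset (by rintro _ ⟨ω, rfl⟩; exact (R.isVOQL ω).bonus₁_mem S ht hh),
    R.b₁_meas t ht h hh⟩

theorem finiteValued_b₂ (ht : t ∈ Finset.Icc 2 p.T) (hh : h ∈ Finset.Icc 1 p.H) :
    FiniteValued (R.hist (t - 1) M.H) fun ω => (R.trace ω).b₂ t h :=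
  ⟨W.finite_toSet.subset (by rintro _ ⟨ω, rfl⟩; exact (R.isVOQL ω).bonus₂_mem S ht hh),
    R.b₂_meas t ht h hh⟩

theorem finiteValued_f₁ (ht : t ∈ Finset.Icc 1 p.T) (hh : h ∈ Finset.Icc 1 (p.H + 1)) :
    FiniteValued (R.hist (t - 1) M.H) fun ω => (R.trace ω).f₁ p t h := by
  rw [Finset.mem_Icc] at ht hh
  unfold Trace.f₁
  by_cases h1 : p.H < h
  · simp only [if_pos h1]; exact FiniteValued.const _
  · by_cases h2 : t ≤ 1
    · simp only [if_neg h1, if_pos h2]; exact FiniteValued.const _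
    · simp only [if_neg h1, if_neg h2]
      have hh' : h ∈ Finset.Icc 1 p.H := Finset.mem_Icc.2 (by omega)
      have ht' : t ∈ Finset.Icc 2 p.T := Finset.mem_Icc.2 (by omega)
      exact ((R.finiteValued_fhat₁ S ht' hh').pair (R.finiteValued_b₁ S ht' hh')).comp
        fun q z => min (q.1 z + q.2 z + p.ε) 1

theorem finiteValued_f₂ (ht : t ∈ Finset.Icc 1 p.T) (hh : h ∈ Finset.Icc 1 (p.H + 1)) :
    FiniteValued (R.hist (t - 1) M.H) fun ω => (R.trace ω).f₂ p t h := by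
  rw [Finset.mem_Icc] at ht hh
  unfold Trace.f₂
  by_cases h1 : p.H < h
  · simp only [if_pos h1]; exact FiniteValued.const _
  · by_cases h2 : t ≤ 1
    · simp only [if_neg h1, if_pos h2]; exact FiniteValued.const _
    · simp only [if_neg h1, if_neg h2]
      have hh' : h ∈ Finset.Icc 1 p.H := Finset.mem_Icc.2 (by omega)
      have ht' : t ∈ Finset.Icc 2 p.T := Finset.mem_Icc.2 (by omega)
      exact (((R.finiteValued_fhat₂ S ht' hh').pair (R.finiteValued_b₁ S ht' hh')).pair
        (R.finiteValued_b₂ S ht' hh')).comp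
          fun q z => min (q.1.1 z + 2 * q.1.2 z + q.2 z + 3 * p.ε) 2

theorem finiteValued_fNeg₂ (ht : t ∈ Finset.Icc 1 p.T) (hh : h ∈ Finset.Icc 1 (p.H + 1)) :
    FiniteValued (R.hist (t - 1) M.H) fun ω => (R.trace ω).fNeg₂ p t h := by
  rw [Finset.mem_Icc] at ht hh
  unfold Trace.fNeg₂
  by_cases h1 : p.H < h
  · simp only [if_pos h1]; exact FiniteValued.const _
  · by_cases h2 : t ≤ 1
    · simp only [if_neg h1, if_pos h2]; exact FiniteValued.const _
    · simp only [if_neg h1, if_neg h2]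
      have hh' : h ∈ Finset.Icc 1 p.H := Finset.mem_Icc.2 (by omega)
      have ht' : t ∈ Finset.Icc 2 p.T := Finset.mem_Icc.2 (by omega)
      exact ((R.finiteValued_fhatNeg₂ S ht' hh').pair (R.finiteValued_b₂ S ht' hh')).comp
        fun q z => max (q.1 z - q.2 z - p.ε) 0

theorem finiteValued_v₁ (ht : t ∈ Finset.Icc 1 p.T) (hh : h ∈ Finset.Icc 1 (p.H + 1)) :
    FiniteValued (R.hist (t - 1) M.H) fun ω => (R.trace ω).v₁ p t h :=
  (R.finiteValued_f₁ S ht hh).comp maxAct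

theorem finiteValued_v₂ (ht : t ∈ Finset.Icc 1 p.T) (hh : h ∈ Finset.Icc 1 (p.H + 1)) :
    FiniteValued (R.hist (t - 1) M.H) fun ω => (R.trace ω).v₂ p t h :=
  (R.finiteValued_f₂ S ht hh).comp maxAct

theorem finiteValued_vNeg₂ (ht : t ∈ Finset.Icc 1 p.T) (hh : h ∈ Finset.Icc 1 (p.H + 1)) :
    FiniteValued (R.hist (t - 1) M.H) fun ω => (R.trace ω).vNeg₂ p t h :=
  (R.finiteValued_fNeg₂ S ht hh).comp maxAct

/-- The relations involve only functions with finitely many values, determined by the earlier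
episodes, so the quantifier over all `z` does no harm. Conditional expectations given the past may
thus be restricted to this event. -/
theorem measurableSet_stepGood (ht : t ∈ Finset.Icc 2 p.T) (hh : h ∈ Finset.Icc 1 p.H) :
    MeasurableSet[R.hist (t - 1) M.H] {ω | StepGood M p (R.trace ω) t h} := by
  have ht0 := Finset.mem_Icc.1 ht
  have hh0 := Finset.mem_Icc.1 hh
  have ht1 : t ∈ Finset.Icc 1 p.T := Finset.mem_Icc.2 (by omega)
  have hh1 : h ∈ Finset.Icc 1 (p.H + 1) := Finset.mem_Icc.2 (by omega)
  have hh' : h + 1 ∈ Finset.Icc 1 (p.H + 1) := Finset.mem_Icc.2 (by omega)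
  have hfin := (((R.finiteValued_f₁ S ht1 hh1).pair (R.finiteValued_f₂ S ht1 hh1)).pair
    ((R.finiteValued_fNeg₂ S ht1 hh1).pair (R.finiteValued_b₁ S ht hh))).pair
    (((R.finiteValued_b₂ S ht hh).pair (R.finiteValued_v₁ S ht1 hh')).pair
    ((R.finiteValued_v₂ S ht1 hh').pair (R.finiteValued_vNeg₂ S ht1 hh')))
  convert hfin.measurableSet_setOf fun q => (∀ z, M.optQ h z ≤ q.1.1.1 z) ∧
    (∀ z, q.1.1.1 z ≤ M.bellman h q.2.1.2 z + (2 * q.1.2.2 z + 2 * p.ε)) ∧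
    (∀ z, q.1.1.1 z ≤ q.1.1.2 z) ∧
    (∀ z, q.1.1.2 z ≤ M.bellman h q.2.2.1 z +
      ((2 * q.1.2.2 z + 2 * p.ε) + (2 * q.2.1.1 z + 2 * p.ε))) ∧
    (∀ z, q.1.2.1 z ≤ M.bellman h q.2.2.2 z) ∧ (∀ z, q.1.2.1 z ≤ M.optQ h z) ∧
    (∀ z, M.bellman h q.2.2.2 z - (2 * q.2.1.1 z + 2 * p.ε) ≤ q.1.2.1 z) ∧
    ∀ z, M.bellman h q.2.2.2 z ≤ M.optQ h z using 1
  ext ω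
  exact ⟨fun ⟨a, b, c, d, e, f, g, i⟩ => ⟨a, b, c, d, e, f, g, i⟩,
    fun ⟨a, b, c, d, e, f, g, i⟩ => ⟨a, b, c, d, e, f, g, i⟩⟩

theorem measurable_f_eval {f : X × A → ℝ} (hf : f ∈ F h) (ht : t ∈ Finset.Icc 1 p.T)
    (hh : h ∈ Finset.Icc 1 p.H) : Measurable[R.hist t (h - 1)] fun ω => f ((R.trace ω).z t h) :=
  (S.F_meas hh hf).comp (R.measurable_z S ht hh)

theorem measurable_f₂_eval (ht : t ∈ Finset.Icc 1 p.T) (hh : h ∈ Finset.Icc 1 p.H) :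
    Measurable[R.hist t (h - 1)] fun ω => (R.trace ω).f₂ p t h ((R.trace ω).z t h) := by
  have ht0 := Finset.mem_Icc.1 ht
  have hh0 := Finset.mem_Icc.1 hh
  have hh1 : h ∈ Finset.Icc 1 (p.H + 1) := Finset.mem_Icc.2 (by omega)
  have hH := S.H_eq
  exact ((R.finiteValued_f₂ S ht hh1).mono (R.hist_pred_le (h := h - 1) ht0.1 (by omega))).measurable_eval
    (fun ω => (R.isVOQL ω).measurable_f₂ S ht hh1) (R.measurable_z S ht hh)

theorem measurable_fNeg₂_eval (ht : t ∈ Finset.Icc 1 p.T) (hh : h ∈ Finset.Icc 1 p.H) :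
    Measurable[R.hist t (h - 1)] fun ω => (R.trace ω).fNeg₂ p t h ((R.trace ω).z t h) := by
  have ht0 := Finset.mem_Icc.1 ht
  have hh0 := Finset.mem_Icc.1 hh
  have hh1 : h ∈ Finset.Icc 1 (p.H + 1) := Finset.mem_Icc.2 (by omega)
  have hH := S.H_eq
  exact ((R.finiteValued_fNeg₂ S ht hh1).mono
    (R.hist_pred_le (h := h - 1) ht0.1 (by omega))).measurable_eval
    (fun ω => (R.isVOQL ω).measurable_fNeg₂ S ht hh1) (R.measurable_z S ht hh)

/-- A weight contains a distance formed with all earlier weights, hence the strong induction. -/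
theorem measurable_σbar (ht : t ∈ Finset.Icc 1 p.T) (hh : h ∈ Finset.Icc 1 p.H) :
    Measurable[R.hist t (h - 1)] fun ω => (R.trace ω).σbar t h := by
  have hh0 := Finset.mem_Icc.1 hh
  have hH := S.H_eq
  induction t using Nat.strong_induction_on with
  | _ t ih =>
    have ht0 := Finset.mem_Icc.1 ht
    have hlt : ∀ s ∈ Finset.Ico 1 t, s ∈ Finset.Icc 1 p.T ∧ R.hist s (h - 1) ≤ R.hist t (h - 1) :=
      fun s hs => by
        rw [Finset.mem_Ico] at hs
        exact ⟨Finset.mem_Icc.2 (by omega),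
          R.hist_le_hist_of_lt hs.2 (by omega) (by omega)⟩
    have hzs : ∀ s ∈ Finset.Ico 1 t,
        Measurable[R.hist t (h - 1)] fun ω => ((R.trace ω).data M h).z s := fun s hs =>
      (R.measurable_z S (hlt s hs).1 hh).mono (hlt s hs).2 le_rfl
    have hσ : ∀ s ∈ Finset.Ico 1 t, Measurable[R.hist t (h - 1)] fun ω => (R.trace ω).σbar s h :=
      fun s hs => (ih s (Finset.mem_Ico.1 hs).2 (hlt s hs).1).mono (hlt s hs).2 le_rfl
    have hz := R.measurable_z S ht hh
    have hF : ∀ f ∈ F h, Measurable f := fun f hf => S.F_meas hh hf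
    have hw : (fun ω => (R.trace ω).σbar t h) = fun ω => (R.trace ω).weight p M F t h :=
      funext fun ω => (R.isVOQL ω).weights t ht h hh
    rw [hw]
    unfold Trace.weight
    have hsig : Measurable[R.hist t (h - 1)] fun ω => (R.trace ω).sigmaSq p M F t h := by
      unfold Trace.sigmaSq
      by_cases h1 : t ≤ 1
      · simp only [if_pos h1]; exact measurable_const
      · simp only [if_neg h1]
        have ht2 : t ∈ Finset.Icc 2 p.T := Finset.mem_Icc.2 (by omega)
        have hle := R.hist_pred_le (h := h - 1) ht0.1 (by omega)
        have m1 := ((R.finiteValued_ghat S ht2 hh).mono hle).measurable_eval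
          (fun ω => S.F_meas hh ((R.isVOQL ω).ghat t ht2 h hh).1) hz
        have m2 := ((R.finiteValued_fhatNeg₂ S ht2 hh).mono hle).measurable_eval
          (fun ω => S.F_meas hh ((R.isVOQL ω).fhatNeg₂ t ht2 h hh).1) hz
        have m3 := measurable_wdist (F := F h) (lam := p.lam) (t := t) (m := R.hist t (h - 1)) hF hzs
          (σ := fun _ _ => 1) (fun s _ => measurable_const) hz
        exact measurable_const.min (((m1.sub (m2.pow_const 2)).add (m3.mul_const _)).add_const _)
    have m4 := measurable_wdist (F := F h) (lam := p.lam) (t := t) (m := R.hist t (h - 1)) hF hzs hσ hz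
    have m5 := (R.measurable_f₂_eval S ht hh).sub (R.measurable_fNeg₂_eval S ht hh)
    exact (hsig.sqrt.max measurable_const).max
      ((m5.sqrt.const_mul _).max (m4.sqrt.const_mul _))

end VOQLRun

end

/-! ### The noise bounds and their union bound -/

section

theorem measureReal_exists_le {Ω ι : Type*} {m : MeasurableSpace Ω} {P : Measure Ω} [IsProbabilityMeasure P]
    (s : Finset ι) {q : ι → Ω → Prop} {c : ℝ} (h : ∀ i ∈ s, P.real {ω | q i ω} ≤ c) :
    P.real {ω | ∃ i ∈ s, q i ω} ≤ s.card * c := by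
  have e : {ω | ∃ i ∈ s, q i ω} = ⋃ i ∈ s, {ω | q i ω} := by ext; simp
  rw [e]
  refine (measureReal_biUnion_finset_le s _).trans ?_
  rw [← nsmul_eq_mul]
  exact Finset.sum_le_card_nsmul s _ c h

section ValueClass

variable {X : Type u} {A : Type v} [mX : MeasurableSpace X] [mA : MeasurableSpace A]
  [Countable A] [Nonempty A] [MeasurableSingletonClass A]
  {M : EpisodicMDP X A} {F : ℕ → Finset (X × A → ℝ)} {W : Finset (X × A → ℝ)}
  {B : BonusOracle X A} {p : VOQLParams} {C : ℝ} (S : VOQLSetup M F W B p C) {h : ℕ} {V : X → ℝ}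

include S

theorem VOQLSetup.card_le (hh : h ∈ Finset.Icc 1 p.H) : (F h).card ≤ p.N := by
  rw [S.N_eq]
  rw [S.H_eq] at hh
  exact Finset.le_sup (f := fun h => (F h).card) hh

theorem valueClass₁_spec (hh : h ∈ Finset.Icc 1 (p.H + 1)) (hV : V ∈ valueClass₁ F W p h) :
    Measurable V ∧ ∀ x, V x ∈ Icc (0 : ℝ) 1 := by
  classical
  rw [Finset.mem_Icc] at hh
  unfold valueClass₁ at hV
  split_ifs at hV with h1
  · rw [Finset.mem_singleton] at hV; subst hV
    exact ⟨measurable_const, fun _ => ⟨le_rfl, zero_le_one⟩⟩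
  · obtain ⟨q, hq, rfl⟩ := Finset.mem_image.1 hV
    rw [Finset.mem_product] at hq
    have m1 := S.F_meas (Finset.mem_Icc.2 (by omega)) hq.1
    have m2 := S.W_meas _ hq.2
    exact ⟨measurable_maxAct (measurable_const.max (((m1.add m2).add_const _).min measurable_const)),
      maxAct_mem_Icc fun z => ⟨le_max_left _ _, max_le zero_le_one (min_le_right _ _)⟩⟩

theorem valueClass₂_spec (hh : h ∈ Finset.Icc 1 (p.H + 1)) (hV : V ∈ valueClass₂ F W p h) :
    Measurable V ∧ ∀ x, V x ∈ Icc (0 : ℝ) 2 := by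
  classical
  rw [Finset.mem_Icc] at hh
  unfold valueClass₂ at hV
  split_ifs at hV with h1
  · rw [Finset.mem_singleton] at hV; subst hV
    exact ⟨measurable_const, fun _ => ⟨le_rfl, zero_le_two⟩⟩
  · obtain ⟨q, hq, rfl⟩ := Finset.mem_image.1 hV
    rw [Finset.mem_product, Finset.mem_product] at hq
    have m1 := S.F_meas (Finset.mem_Icc.2 (by omega)) hq.1
    have m2 := S.W_meas _ hq.2.1
    have m3 := S.W_meas _ hq.2.2
    exact ⟨measurable_maxAct (measurable_const.max
      ((((m1.add (m2.const_mul 2)).add m3).add_const _).min measurable_const)),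
      maxAct_mem_Icc fun z => ⟨le_max_left _ _, max_le zero_le_two (min_le_right _ _)⟩⟩

theorem valueClassNeg_spec (hh : h ∈ Finset.Icc 1 (p.H + 1)) (hV : V ∈ valueClassNeg F W p h) :
    Measurable V ∧ ∀ x, V x ∈ Icc (0 : ℝ) 2 := by
  classical
  rw [Finset.mem_Icc] at hh
  unfold valueClassNeg at hV
  split_ifs at hV with h1
  · rw [Finset.mem_singleton] at hV; subst hV
    exact ⟨measurable_const, fun _ => ⟨le_rfl, zero_le_two⟩⟩
  · obtain ⟨q, hq, rfl⟩ := Finset.mem_image.1 hV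
    rw [Finset.mem_product] at hq
    have m1 := S.F_meas (Finset.mem_Icc.2 (by omega)) hq.1
    have m2 := S.W_meas _ hq.2
    exact ⟨measurable_maxAct (measurable_const.min (((m1.sub m2).sub_const _).max measurable_const)),
      maxAct_mem_Icc fun z => ⟨le_min zero_le_two (le_max_right _ _), min_le_left _ _⟩⟩

theorem card_valueClass₁_le (hh : h ∈ Finset.Icc 1 (p.H + 1)) :
    (valueClass₁ F W p h).card ≤ p.N * p.Nb := by
  classical
  rw [Finset.mem_Icc] at hh
  have h1 := S.adm.two_le_N
  have h2 := S.adm.one_le_Nb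
  unfold valueClass₁
  split_ifs with h3
  · rw [Finset.card_singleton]; nlinarith
  · refine Finset.card_image_le.trans ?_
    rw [Finset.card_product, S.Nb_eq]
    exact Nat.mul_le_mul_right _ (S.card_le (Finset.mem_Icc.2 (by omega)))

theorem card_valueClass₂_le (hh : h ∈ Finset.Icc 1 (p.H + 1)) :
    (valueClass₂ F W p h).card ≤ p.N * p.Nb ^ 2 := by
  classical
  rw [Finset.mem_Icc] at hh
  have h1 := S.adm.two_le_N
  have h2 := S.adm.one_le_Nb
  unfold valueClass₂
  split_ifs with h3
  · exact Nat.mul_pos (by omega) (pow_pos (by omega) 2)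
  · refine Finset.card_image_le.trans ?_
    rw [Finset.card_product, Finset.card_product, S.Nb_eq, ← pow_two]
    exact Nat.mul_le_mul_right _ (S.card_le (Finset.mem_Icc.2 (by omega)))

theorem card_valueClassNeg_le (hh : h ∈ Finset.Icc 1 (p.H + 1)) :
    (valueClassNeg F W p h).card ≤ p.N * p.Nb ^ 2 := by
  classical
  rw [Finset.mem_Icc] at hh
  have h1 := S.adm.two_le_N
  have h2 := S.adm.one_le_Nb
  unfold valueClassNeg
  split_ifs with h3
  · exact Nat.mul_pos (by omega) (pow_pos (by omega) 2)
  · refine Finset.card_image_le.trans ?_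
    rw [Finset.card_product, ← S.Nb_eq]
    exact Nat.mul_le_mul (S.card_le (Finset.mem_Icc.2 (by omega))) (Nat.le_self_pow two_ne_zero _)

end ValueClass

namespace VOQLParams.Admissible

variable {p : VOQLParams} (hp : p.Admissible)
include hp

theorem numPeels_le : (p.numPeels : ℝ) ≤ p.peel / 4 := by
  have h0 := hp.peel_ge
  have hT := hp.one_le_T
  have hH := hp.one_le_H
  have hL := hp.one_le_L
  have h1 : (1 : ℝ) ≤ p.L ^ 2 * p.T ^ 2 * p.H := one_le_mul_of_one_le_of_one_le
    (one_le_mul_of_one_le_of_one_le (one_le_pow₀ hL) (one_le_pow₀ hT)) hH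
  have h2 := Nat.ceil_lt_add_one (Real.log_nonneg h1)
  have h3 : Real.log (p.L ^ 2 * p.T ^ 2 * p.H) ≤ Real.log (16 * p.L ^ 2 * p.T ^ 3 * p.H) := by
    refine Real.log_le_log (by linarith) ?_
    rw [show 16 * p.L ^ 2 * p.T ^ 3 * p.H = (16 * p.T) * (p.L ^ 2 * p.T ^ 2 * p.H) by ring]
    exact le_mul_of_one_le_left (by linarith) (by linarith)
  unfold VOQLParams.numPeels
  push_cast
  linarith

/-- `ι̇²` and `ι'²` are twice a logarithm: the square beats the `(𝒩 𝒩_b) ^ 2` pairs of functions and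
leaves a factor `δ'` to spare. -/
theorem exp_neg_two_log_le {n c : ℝ} (hn : 1 ≤ n) (hc : 4 ≤ c) :
    n ^ 2 * Real.exp (-(2 * Real.log (n * c / p.δth))) ≤ p.δth / 704 := by
  have hδ := hp.δth_pos
  have h8 := hp.le_ratio hc hn
  have e : Real.exp (-(2 * Real.log (n * c / p.δth))) = (p.δth / (n * c)) ^ 2 := by
    rw [show -(2 * Real.log (n * c / p.δth)) = (2 : ℕ) * Real.log (p.δth / (n * c)) by
      rw [← inv_div (n * c), Real.log_inv]; push_cast; ring, Real.exp_nat_mul, Real.exp_log (by positivity)]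
  rw [e, div_pow, mul_pow, ← mul_div_assoc, mul_div_mul_left _ _ (by positivity)]
  rw [div_le_div_iff₀ (by positivity) (by norm_num)]
  have h1 := hp.δth_le
  have h2 : p.δth * 704 ≤ c ^ 2 := by nlinarith
  nlinarith

end VOQLParams.Admissible

variable {X : Type u} {A : Type v} [mX : MeasurableSpace X] [mA : MeasurableSpace A]
  [Countable A] [Nonempty A] [MeasurableSingletonClass A]
  {M : EpisodicMDP X A} {F : ℕ → Finset (X × A → ℝ)} {W : Finset (X × A → ℝ)}
  {B : BonusOracle X A} {p : VOQLParams} {C : ℝ} {u : ℕ → ℝ}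
  {Ω : Type w} {mΩ : MeasurableSpace Ω} {P : Measure Ω} [IsProbabilityMeasure P]

namespace VOQLRun

variable (R : VOQLRun M F B p u P) (S : VOQLSetup M F W B p C) {t h : ℕ}
include S

/-- Bernstein's inequality with fixed parameter `θ`. As `θ κ (b - a) ≤ 1`, the exponents are at most
`1` in absolute value, and the compensator `θ² c² Var` brings the conditional mean of each
exponential down to `1`. With the predictable variance in the bound, no estimate of it is needed
here. -/
theorem measure_not_noiseBound_le (ht : t ≤ p.T) (hh : h ∈ Finset.Icc 1 p.H)
    {φ : (X × A) × X → ℝ} {a b : ℝ} (hφ : Measurable φ) (hb : ∀ q, φ q ∈ Icc a b) {c : Ω → ℕ → ℝ}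
    {κ θ : ℝ} (l : ℝ) (hcm : ∀ s ∈ Finset.Ico 1 t, Measurable[R.hist s (h - 1)] fun ω => c ω s)
    (hc : ∀ s ∈ Finset.Ico 1 t, ∀ ω, |c ω s| ≤ κ) (hκ : 0 ≤ κ) (hθ : 0 < θ) (hab : a ≤ b)
    (hθκ : θ * κ * (b - a) ≤ 1) :
    P.real {ω | ¬ M.NoiseBound h t φ ((R.trace ω).data M h) (c ω) θ l} ≤ Real.exp (-l) := by
  have hh0 := Finset.mem_Icc.1 hh
  have hH := S.H_eq
  have hs1 : ∀ s ∈ Finset.Ico 1 t, s ∈ Finset.Icc 1 p.T := fun s hs => by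
    rw [Finset.mem_Ico] at hs; exact Finset.mem_Icc.2 (by omega)
  set Ψ : ℕ → Ω × X → ℝ := fun s q =>
    θ * c q.1 s * (φ ((R.trace q.1).z s h, q.2) - M.cmean h φ ((R.trace q.1).z s h)) -
      θ ^ 2 * c q.1 s ^ 2 * M.cvar h φ ((R.trace q.1).z s h) with hΨ
  have hmean := fun z => EpisodicMDP.cmean_mem (M := M) (h := h) hφ hb z
  have hy : ∀ s ∈ Finset.Ico 1 t, ∀ ω x,
      |θ * c ω s * (φ ((R.trace ω).z s h, x) - M.cmean h φ ((R.trace ω).z s h))| ≤ 1 :=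
    fun s hs ω x => by
      rw [abs_mul, abs_mul, abs_of_pos hθ]
      refine le_trans (mul_le_mul (mul_le_mul_of_nonneg_left (hc s hs ω) hθ.le) ?_ (abs_nonneg _)
        (by positivity)) hθκ
      rw [abs_le]
      have h1 := hb ((R.trace ω).z s h, x)
      have h2 := hmean ((R.trace ω).z s h)
      constructor <;> linarith [h1.1, h1.2, h2.1, h2.2]
  have hv : ∀ s ∈ Finset.Ico 1 t, ∀ ω,
      θ ^ 2 * c ω s ^ 2 * M.cvar h φ ((R.trace ω).z s h) ∈ Icc (0 : ℝ) 1 := fun s hs ω => by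
    have h1 := EpisodicMDP.cvar_le (M := M) (h := h) hφ hb ((R.trace ω).z s h)
    have h0 := EpisodicMDP.cvar_nonneg (M := M) (h := h) (φ := φ) ((R.trace ω).z s h)
    refine ⟨by positivity, ?_⟩
    have h2 : c ω s ^ 2 ≤ κ ^ 2 := sq_le_sq' (by linarith [(abs_le.1 (hc s hs ω)).1])
      (abs_le.1 (hc s hs ω)).2
    calc θ ^ 2 * c ω s ^ 2 * M.cvar h φ ((R.trace ω).z s h)
        ≤ θ ^ 2 * κ ^ 2 * ((b - a) / 2) ^ 2 := by gcongr
      _ = (θ * κ * (b - a)) ^ 2 / 4 := by ring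
      _ ≤ 1 := by
        have : 0 ≤ θ * κ * (b - a) := mul_nonneg (by positivity) (by linarith)
        nlinarith
  have hΨm : ∀ s ∈ Finset.Ico 1 t, Measurable[(R.hist s (h - 1)).prod mX] (Ψ s) := fun s hs => by
    have hz : Measurable[(R.hist s (h - 1)).prod mX] fun q : Ω × X => (R.trace q.1).z s h :=
      (R.measurable_z S (hs1 s hs) hh).comp (@measurable_fst Ω X (R.hist s (h - 1)) mX)
    have hc' : Measurable[(R.hist s (h - 1)).prod mX] fun q : Ω × X => c q.1 s :=
      (hcm s hs).comp (@measurable_fst Ω X (R.hist s (h - 1)) mX)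
    exact ((hc'.const_mul θ).mul ((hφ.comp (hz.prodMk
      (@measurable_snd Ω X (R.hist s (h - 1)) mX))).sub
      ((EpisodicMDP.measurable_cmean hφ).comp hz))).sub
      (((hc'.pow_const 2).const_mul _).mul ((EpisodicMDP.measurable_cvar hφ).comp hz))
  have hΨb : ∀ s ∈ Finset.Ico 1 t, ∀ q, Ψ s q ∈ Icc (-2 : ℝ) 2 := fun s hs q => by
    have h1 := abs_le.1 (hy s hs q.1 q.2)
    have h2 := hv s hs q.1
    simp only [hΨ]
    constructor <;> linarith [h1.1, h1.2, h2.1, h2.2]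
  have hmain := measure_sum_gt_le_exp (P := P) (a := 1) (t := t) (m := fun s => R.hist s (h - 1))
    (U := fun s ω => Ψ s (ω, (R.trace ω).x s (h + 1))) (K := 2) (fun s _ => R.hist_le _ _)
    (fun s hs => ?_) (fun s hs ω => abs_le.2 (hΨb s hs _)) (fun s hs s' hs' hlt => ?_)
    (fun s hs => ?_) l
  · refine (measureReal_mono fun ω hω => ?_).trans hmain
    simp only [mem_ofPred_eq, EpisodicMDP.NoiseBound, not_le] at hω ⊢
    have hl := mul_lt_mul_of_pos_left hω hθ
    rw [mul_add, mul_div_cancel₀ _ hθ.ne'] at hl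
    have e : ∑ s ∈ Finset.Ico 1 t, Ψ s (ω, (R.trace ω).x s (h + 1)) =
        θ * ∑ s ∈ Finset.Ico 1 t, c ω s * (φ (((R.trace ω).data M h).z s,
          ((R.trace ω).data M h).next s) - M.cmean h φ (((R.trace ω).data M h).z s)) -
        θ * (θ * ∑ s ∈ Finset.Ico 1 t, c ω s ^ 2 * M.cvar h φ (((R.trace ω).data M h).z s)) := by
      rw [← mul_assoc, Finset.mul_sum, Finset.mul_sum, ← Finset.sum_sub_distrib]
      refine Finset.sum_congr rfl fun s _ => ?_
      simp only [hΨ, Trace.data]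
      ring
    rw [e]
    linarith
  · exact (R.stepLaw S (hs1 s hs) hh).measurable_comp (R.hist_le _ _)
      ((R.x_meas s (hs1 s hs) h (by omega)).mono (R.hist_le _ _) le_rfl) (hΨm s hs)
  · exact (R.stepLaw S (hs1 s hs) hh).measurable_comp
      (R.hist_le_hist_of_lt hlt (by omega) (by omega))
      ((R.x_meas s (hs1 s hs) h (by omega)).mono (R.hist_le_hist_of_lt hlt (by omega) (by omega)) le_rfl)
      (hΨm s hs)
  · have hl := R.stepLaw S (hs1 s hs) hh
    have h1 := hl.condExp_eq (Ψ := fun q => Real.exp (Ψ s q)) (a := 0) (b := Real.exp 2)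
      (Real.measurable_exp.comp (hΨm s hs)) fun q =>
        ⟨(Real.exp_pos _).le, Real.exp_le_exp.2 (hΨb s hs q).2⟩
    refine h1.le.trans (Filter.Eventually.of_forall fun ω => ?_)
    set z := (R.trace ω).z s h with hz
    set v := θ ^ 2 * c ω s ^ 2 * M.cvar h φ z with hvdef
    have hint := EpisodicMDP.integrable_section (M := M) (h := h) hφ hb z
    have hsub : Integrable (fun y => φ (z, y) - M.cmean h φ z) (M.trans h z) :=
      hint.sub (integrable_const _)
    have hsq : Integrable (fun y => (φ (z, y) - M.cmean h φ z) ^ 2) (M.trans h z) := by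
      refine integrable_of_mem_Icc (a := 0) (b := (b - a) ^ 2)
        (((hφ.comp measurable_prodMk_left).sub_const _).pow_const 2) fun y => ⟨sq_nonneg _, ?_⟩
      have h2 := hb (z, y)
      have h3 := hmean z
      exact sq_le_sq' (by linarith [h2.1, h3.2]) (by linarith [h2.2, h3.1])
    -- `exp y ≤ 1 + y + y²` for `|y| ≤ 1`. The linear term integrates to zero, the quadratic one to
    -- `v`, and `1 + v ≤ exp v`.
    have hle : ∀ y, Real.exp (Ψ s (ω, y)) ≤ Real.exp (-v) *
        (1 + θ * c ω s * (φ (z, y) - M.cmean h φ z) +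
          θ ^ 2 * c ω s ^ 2 * (φ (z, y) - M.cmean h φ z) ^ 2) := fun y => by
      have h2 := (abs_le.1 (Real.abs_exp_sub_one_sub_id_le (hy s hs ω y))).2
      have e : Ψ s (ω, y) = -v + θ * c ω s * (φ (z, y) - M.cmean h φ z) := by
        simp only [hΨ, hvdef]; ring
      rw [e, Real.exp_add]
      refine mul_le_mul_of_nonneg_left ?_ (Real.exp_pos _).le
      rw [← hz] at h2
      nlinarith
    have hi1 : Integrable (fun y => θ * c ω s * (φ (z, y) - M.cmean h φ z)) (M.trans h z) :=
      hsub.const_mul _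
    have hi2 : Integrable (fun y => θ ^ 2 * c ω s ^ 2 * (φ (z, y) - M.cmean h φ z) ^ 2) (M.trans h z) :=
      hsq.const_mul _
    have hmexp : Measurable fun y => Real.exp (Ψ s (ω, y)) := by
      simp only [hΨ]
      exact Real.measurable_exp.comp ((((hφ.comp measurable_prodMk_left).sub_const _).const_mul _).sub_const _)
    have hexp : Integrable (fun y => Real.exp (Ψ s (ω, y))) (M.trans h z) :=
      integrable_of_mem_Icc (a := 0) (b := Real.exp 2) hmexp fun y =>
        ⟨(Real.exp_pos _).le, Real.exp_le_exp.2 (hΨb s hs _).2⟩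
    have h3 := integral_mono hexp ((((integrable_const (1 : ℝ)).add hi1).add hi2).const_mul
      (Real.exp (-v))) hle
    refine h3.trans ?_
    rw [integral_const_mul]
    have e1 := integral_add ((integrable_const (1 : ℝ)).add hi1) hi2
    have e2 := integral_add (integrable_const (1 : ℝ)) hi1
    have e3 := integral_sub hint (integrable_const (M.cmean h φ z))
    simp only [Pi.add_apply] at e1 ⊢
    rw [e1, e2, integral_const_mul, integral_const_mul, e3]
    simp only [integral_const, probReal_univ, one_smul]
    have e4 : ∫ y, φ (z, y) ∂(M.trans h z) = M.cmean h φ z := rfl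
    have e5 : ∫ y, (φ (z, y) - M.cmean h φ z) ^ 2 ∂(M.trans h z) = M.cvar h φ z := rfl
    rw [e4, e5, sub_self, mul_zero, add_zero, ← hvdef]
    calc Real.exp (-v) * (1 + v) ≤ Real.exp (-v) * Real.exp v :=
          mul_le_mul_of_nonneg_left (by linarith [Real.add_one_le_exp v]) (Real.exp_pos _).le
      _ = 1 := by rw [← Real.exp_add]; simp

open Classical in
-- Four union bounds for each pair of a level and an episode, each costing a fixed fraction of `δ'`;
-- there are at most `T H` pairs, and `T H δ' ≤ δ`. The one for `V⋆` runs over `F` and the peels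
-- only, so `υ` is free of `𝒩_b`.
theorem measure_not_regressionGood_le :
    P.real {ω | ¬ RegressionGood M F W p (R.trace ω)} ≤ p.δ / 2 := by
  have hp := S.adm
  have hL := hp.one_le_L
  have hN := hp.two_le_N'
  have hNb := hp.one_le_Nb'
  have hδ := hp.δth_pos
  have hpk := hp.peel_ge_sixteen
  have hnp := hp.numPeels_le
  have hι := hp.one_le_iota_sq
  have hκ : ∀ k, 0 ≤ p.peelLevel k := fun k => by unfold VOQLParams.peelLevel; positivity
  have hlev : ∀ i ∈ Finset.Icc 1 p.H ×ˢ Finset.Ico 2 p.T, i.1 ∈ Finset.Icc 1 p.H ∧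
      i.1 + 1 ∈ Finset.Icc 1 (p.H + 1) ∧ i.2 ≤ p.T ∧
      ∀ s ∈ Finset.Ico 1 i.2, s ∈ Finset.Icc 1 p.T := fun i hi => by
    simp only [Finset.mem_product, Finset.mem_Icc, Finset.mem_Ico] at hi ⊢
    exact ⟨hi.1, by omega, by omega, fun s hs => by omega⟩
  have hap₁ : ∀ h ∈ Finset.Icc 1 p.H, ∀ V : X → ℝ, Measurable V → (∀ x, V x ∈ Icc (0 : ℝ) 2) →
      approxIn (F h) p.ε (M.bellman h V) ∈ F h := fun h hh V hV hVb =>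
    (approxIn_spec (S.complete.first_moment h (S.H_eq ▸ hh) V hV hVb)).1
  have hap₂ : ∀ h ∈ Finset.Icc 1 p.H, ∀ V : X → ℝ, Measurable V → (∀ x, V x ∈ Icc (0 : ℝ) 1) →
      approxIn (F h) p.ε (M.bellmanSq h V) ∈ F h := fun h hh V hV hVb =>
    (approxIn_spec (S.complete.second_moment h (S.H_eq ▸ hh) V hV hVb)).1
  have hfg : ∀ {h : ℕ}, h ∈ Finset.Icc 1 p.H → ∀ {f g : X × A → ℝ}, f ∈ F h → g ∈ F h → ∀ z,
      |f z - g z| ≤ p.L := fun hh f g hf hg z => by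
    have h1 := S.F_mem hh hf z
    have h2 := S.F_mem hh hg z
    exact abs_le.2 ⟨by linarith [h1.1, h2.2], by linarith [h1.2, h2.1]⟩
  have hwm : ∀ {s h : ℕ}, s ∈ Finset.Icc 1 p.T → h ∈ Finset.Icc 1 p.H → ∀ {f g : X × A → ℝ},
      f ∈ F h → g ∈ F h → ∀ κ, Measurable[R.hist s (h - 1)] fun ω => truncAbs κ
        (1 / (R.trace ω).σbar s h ^ 2 * (f ((R.trace ω).z s h) - g ((R.trace ω).z s h))) :=
    fun hs hh f g hf hg κ => (measurable_truncAbs κ).comp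
      ((measurable_const.div ((R.measurable_σbar S hs hh).pow_const 2)).mul
        ((R.measurable_f_eval S hf hs hh).sub (R.measurable_f_eval S hg hs hh)))
  -- the union bound over functions, for each level and episode
  have b1 : ∀ i ∈ Finset.Icc 1 p.H ×ˢ Finset.Ico 2 p.T, P.real {ω |
      ∃ q ∈ (valueClass₂ F W p (i.1 + 1) ∪ valueClassNeg F W p (i.1 + 1)) ×ˢ F i.1,
      ¬ M.NoiseBound i.1 i.2 (M.target i.1 q.1) ((R.trace ω).data M i.1)
      (fun s => q.2 ((R.trace ω).z s i.1) - approxIn (F i.1) p.ε (M.bellman i.1 q.1) ((R.trace ω).z s i.1))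
      (1 / (3 ^ 2 * p.L)) (p.ιDot ^ 2)} ≤ 1 / 352 * p.δth := fun i hi => by
    obtain ⟨hh, hh', ht, hs⟩ := hlev i hi
    refine (measureReal_exists_le _ (c := Real.exp (-p.ιDot ^ 2)) fun q hq => ?_).trans ?_
    · rw [Finset.mem_product, Finset.mem_union] at hq
      obtain ⟨hVm, hVb⟩ := hq.1.elim (valueClass₂_spec S hh') (valueClassNeg_spec S hh')
      have ha := hap₁ i.1 hh q.1 hVm hVb
      refine R.measure_not_noiseBound_le S ht hh (M.measurable_target _ hVm) (M.target_mem hVb)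
        (κ := p.L) _ (fun s h => (R.measurable_f_eval S hq.2 (hs s h) hh).sub
          (R.measurable_f_eval S ha (hs s h) hh)) (fun s _ ω => hfg hh hq.2 ha _) (by linarith)
        (by positivity) (by norm_num) ?_
      rw [div_mul_eq_mul_div, div_mul_eq_mul_div, div_le_one (by positivity)]
      linarith
    · have hcard : (((valueClass₂ F W p (i.1 + 1) ∪ valueClassNeg F W p (i.1 + 1)) ×ˢ F i.1).card : ℝ) ≤
          2 * (p.N * p.Nb) ^ 2 := by
        have : ((valueClass₂ F W p (i.1 + 1) ∪ valueClassNeg F W p (i.1 + 1)) ×ˢ F i.1).card ≤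
            (p.N * p.Nb ^ 2 + p.N * p.Nb ^ 2) * p.N := by
          rw [Finset.card_product]
          exact Nat.mul_le_mul ((Finset.card_union_le _ _).trans (add_le_add
            (card_valueClass₂_le S hh') (card_valueClassNeg_le S hh'))) (S.card_le hh)
        calc _ ≤ (((p.N * p.Nb ^ 2 + p.N * p.Nb ^ 2) * p.N : ℕ) : ℝ) := by exact_mod_cast this
          _ = _ := by push_cast; ring
      have := hp.exp_neg_two_log_le hp.one_le_NNb (hp.log_term_ge (c := 18) le_rfl)
      rw [← hp.iotaDot_sq] at this
      have h2 := mul_le_mul_of_nonneg_right hcard (Real.exp_pos (-p.ιDot ^ 2)).le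
      linarith
  have b2 : ∀ i ∈ Finset.Icc 1 p.H ×ˢ Finset.Ico 2 p.T, P.real {ω |
      ∃ q ∈ valueClass₁ F W p (i.1 + 1) ×ˢ F i.1,
      ¬ M.NoiseBound i.1 i.2 (M.targetSq i.1 q.1) ((R.trace ω).data M i.1)
      (fun s => q.2 ((R.trace ω).z s i.1) -
        approxIn (F i.1) p.ε (M.bellmanSq i.1 q.1) ((R.trace ω).z s i.1))
      (1 / (4 ^ 2 * p.L)) (p.ιPrime ^ 2)} ≤ 1 / 704 * p.δth := fun i hi => by
    obtain ⟨hh, hh', ht, hs⟩ := hlev i hi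
    refine (measureReal_exists_le _ (c := Real.exp (-p.ιPrime ^ 2)) fun q hq => ?_).trans ?_
    · rw [Finset.mem_product] at hq
      obtain ⟨hVm, hVb⟩ := valueClass₁_spec S hh' hq.1
      have ha := hap₂ i.1 hh q.1 hVm hVb
      refine R.measure_not_noiseBound_le S ht hh (a := 0) (b := 4)
        ((M.measurable_target _ hVm).pow_const 2) (fun y => ⟨sq_nonneg _, ?_⟩)
        (κ := p.L) _ (fun s h => (R.measurable_f_eval S hq.2 (hs s h) hh).sub
          (R.measurable_f_eval S ha (hs s h) hh)) (fun s _ ω => hfg hh hq.2 ha _) (by linarith)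
        (by positivity) (by norm_num) ?_
      · have := M.target_mem (h := i.1) hVb y
        nlinarith [this.1, this.2]
      · rw [div_mul_eq_mul_div, div_mul_eq_mul_div, div_le_one (by positivity)]
        linarith
    · have hcard : ((valueClass₁ F W p (i.1 + 1) ×ˢ F i.1).card : ℝ) ≤ (p.N * p.Nb) ^ 2 := by
        have : (valueClass₁ F W p (i.1 + 1) ×ˢ F i.1).card ≤ p.N * p.Nb * p.N := by
          rw [Finset.card_product]
          exact Nat.mul_le_mul (card_valueClass₁_le S hh') (S.card_le hh)
        calc _ ≤ ((p.N * p.Nb * p.N : ℕ) : ℝ) := by exact_mod_cast this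
          _ ≤ (p.N * p.Nb) * (p.N * p.Nb) := by
            push_cast
            exact mul_le_mul_of_nonneg_left (le_mul_of_one_le_right (by linarith) hNb) (by positivity)
          _ = _ := by ring
      have := hp.exp_neg_two_log_le hp.one_le_NNb (hp.log_term_ge (c := 32) (by norm_num))
      rw [← hp.iotaPrime_sq] at this
      have h2 := mul_le_mul_of_nonneg_right hcard (Real.exp_pos (-p.ιPrime ^ 2)).le
      linarith
  have b3 : ∀ i ∈ Finset.Icc 1 p.H ×ˢ Finset.Ico 2 p.T, P.real {ω |
      ∃ q ∈ (F i.1 ×ˢ F i.1) ×ˢ Finset.range p.numPeels,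
      ¬ M.NoiseBound i.1 i.2 (M.target i.1 (M.optV (i.1 + 1))) ((R.trace ω).data M i.1)
      (fun s => truncAbs (p.peelLevel q.2) (1 / (R.trace ω).σbar s i.1 ^ 2 *
        (q.1.1 ((R.trace ω).z s i.1) - q.1.2 ((R.trace ω).z s i.1))))
      (1 / (12 + 2 * p.peelLevel q.2)) (p.υ ^ 2)} ≤ 1 / 4 * p.δth := fun i hi => by
    obtain ⟨hh, hh', ht, hs⟩ := hlev i hi
    refine (measureReal_exists_le _ (c := Real.exp (-p.υ ^ 2)) fun q hq => ?_).trans ?_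
    · rw [Finset.mem_product, Finset.mem_product] at hq
      have := hκ q.2
      refine R.measure_not_noiseBound_le S ht hh (M.measurable_target _ (measurable_optV_succ _))
        (M.target_mem (S.optV_mem hh')) (κ := p.peelLevel q.2) _
        (fun s h => hwm (hs s h) hh hq.1.1 hq.1.2 _) (fun s _ ω => abs_truncAbs_le this _) this
        (by positivity) (by norm_num) ?_
      rw [div_mul_eq_mul_div, div_mul_eq_mul_div, div_le_one (by positivity)]
      linarith
    · have hcard : (((F i.1 ×ˢ F i.1) ×ˢ Finset.range p.numPeels).card : ℝ) ≤
          (p.N : ℝ) ^ 2 * (p.peel / 4) := by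
        have : ((F i.1).card : ℝ) ≤ p.N := by exact_mod_cast S.card_le hh
        rw [Finset.card_product, Finset.card_product, Finset.card_range]
        push_cast
        rw [pow_two]
        gcongr
      -- `υ` is calibrated to this: `exp(-υ²)` times `𝒩²` pairs and `P₀ / 4` peels is `δ' / 4`.
      have e : Real.exp (-p.υ ^ 2) = p.δth / ((p.N : ℝ) ^ 2 * p.peel) := by
        rw [hp.upsilon_sq, ← Real.log_inv, Real.exp_log (by positivity), inv_div]
      refine (mul_le_mul_of_nonneg_right hcard (Real.exp_pos _).le).trans ?_
      rw [e]
      refine le_of_eq ?_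
      field_simp
  have b4 : ∀ i ∈ Finset.Icc 1 p.H ×ˢ Finset.Ico 2 p.T, P.real {ω |
      ∃ q ∈ (valueClass₁ F W p (i.1 + 1) ×ˢ (F i.1 ×ˢ F i.1)) ×ˢ Finset.range p.numPeels,
      ¬ M.NoiseBound i.1 i.2 (fun y => q.1.1 y.2 - M.optV (i.1 + 1) y.2) ((R.trace ω).data M i.1)
      (fun s => truncAbs (p.peelLevel q.2) (1 / (R.trace ω).σbar s i.1 ^ 2 *
        (q.1.2.1 ((R.trace ω).z s i.1) - q.1.2.2 ((R.trace ω).z s i.1))))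
      (1 / (8 / p.ι ^ 2 + 2 * p.peelLevel q.2)) (p.ι ^ 2 / 3)} ≤ 1 / 64 * p.δth := fun i hi => by
    obtain ⟨hh, hh', ht, hs⟩ := hlev i hi
    refine (measureReal_exists_le _ (c := Real.exp (-(p.ι ^ 2 / 3))) fun q hq => ?_).trans ?_
    · rw [Finset.mem_product, Finset.mem_product, Finset.mem_product] at hq
      obtain ⟨hVm, hVb⟩ := valueClass₁_spec S hh' hq.1.1
      have := hκ q.2
      have hVs := S.optV_mem hh'
      refine R.measure_not_noiseBound_le S ht hh (a := -1) (b := 1) ((hVm.comp measurable_snd).sub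
        ((measurable_optV_succ _).comp measurable_snd)) (fun y => ?_) (κ := p.peelLevel q.2) _
        (fun s h => hwm (hs s h) hh hq.1.2.1 hq.1.2.2 _) (fun s _ ω => abs_truncAbs_le this _) this
        (by positivity) (by norm_num) ?_
      · have h1 := hVb y.2
        have h2 := hVs y.2
        change q.1.1 y.2 - M.optV (i.1 + 1) y.2 ∈ Icc (-1 : ℝ) 1
        constructor <;> linarith [h1.1, h1.2, h2.1, h2.2]
      · rw [div_mul_eq_mul_div, div_mul_eq_mul_div, div_le_one (by positivity)]
        have : 0 ≤ 8 / p.ι ^ 2 := by positivity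
        linarith
    · have hcard : (((valueClass₁ F W p (i.1 + 1) ×ˢ (F i.1 ×ˢ F i.1)) ×ˢ
          Finset.range p.numPeels).card : ℝ) ≤ (p.N * p.Nb * (p.N * p.N)) * (p.peel / 4) := by
        have h1 : ((F i.1).card : ℝ) ≤ p.N := by exact_mod_cast S.card_le hh
        have h2 : ((valueClass₁ F W p (i.1 + 1)).card : ℝ) ≤ p.N * p.Nb := by
          exact_mod_cast card_valueClass₁_le S hh'
        rw [Finset.card_product, Finset.card_product, Finset.card_product, Finset.card_range]
        push_cast
        gcongr
      -- The factor `3` in `ι` makes `ι² / 3` three logarithms; the cube absorbs three factors from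
      -- `F`, one from `W` and the peels.
      have e : Real.exp (-(p.ι ^ 2 / 3)) = (p.δth / (p.N * p.Nb * p.peel)) ^ 3 := by
        rw [hp.iota_sq, show -(9 * Real.log (p.N * p.Nb * p.peel / p.δth) / 3) =
          (3 : ℕ) * Real.log (p.δth / (p.N * p.Nb * p.peel)) by
            rw [← inv_div (p.N * p.Nb * p.peel : ℝ), Real.log_inv]; push_cast; ring,
          Real.exp_nat_mul, Real.exp_log (by positivity)]
      refine (mul_le_mul_of_nonneg_right hcard (Real.exp_pos _).le).trans ?_
      have e2 : (p.N * p.Nb * (p.N * p.N)) * (p.peel / 4) * (p.δth / (p.N * p.Nb * p.peel)) ^ 3 =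
          1 / 64 * p.δth * ((4 * p.δth / (p.Nb * p.peel)) ^ 2) := by
        field_simp
        norm_num
      rw [e, e2]
      refine mul_le_of_le_one_right (by positivity) (pow_le_one₀ (by positivity) ?_)
      rw [div_le_one (by positivity)]
      have := hp.δth_le
      nlinarith
  have c1 := measureReal_exists_le _ b1
  have c2 := measureReal_exists_le _ b2
  have c3 := measureReal_exists_le _ b3
  have c4 := measureReal_exists_le _ b4
  have hcard : ((Finset.Icc 1 p.H ×ˢ Finset.Ico 2 p.T).card : ℝ) ≤ p.T * p.H := by
    rw [Finset.card_product, Nat.card_Icc, Nat.card_Ico]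
    have : (p.H + 1 - 1) * (p.T - 2) ≤ p.T * p.H := by
      rw [mul_comm]; exact Nat.mul_le_mul (by omega) (by omega)
    exact_mod_cast this
  have hδ' := hp.δth_mul_le
  have hcδ : ((Finset.Icc 1 p.H ×ˢ Finset.Ico 2 p.T).card : ℝ) * p.δth ≤ p.δ :=
    (mul_le_mul_of_nonneg_right hcard hδ.le).trans hδ'
  refine (measureReal_mono (s₂ := (_ ∪ _) ∪ (_ ∪ _)) ?_ (measure_ne_top _ _)).trans
    ((measureReal_union_le _ _).trans (add_le_add ((measureReal_union_le _ _).trans (add_le_add c1 c2))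
      ((measureReal_union_le _ _).trans (add_le_add c3 c4)))) |>.trans ?_
  · intro ω hω
    by_contra hcon
    simp only [mem_union, mem_ofPred_eq, not_or, not_exists, not_and, not_not] at hcon
    obtain ⟨⟨d1, d2⟩, d3, d4⟩ := hcon
    refine hω ⟨fun h hh t ht V hV f hf => ?_, fun h hh t ht V hV f hf => ?_,
      fun h hh t ht f hf g hg k hk => ?_, fun h hh t ht V hV f hf g hg k hk => ?_⟩
    · exact d1 (h, t) (Finset.mem_product.2 ⟨hh, ht⟩) (V, f)
        (Finset.mem_product.2 ⟨Finset.mem_union.2 hV, hf⟩)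
    · exact d2 (h, t) (Finset.mem_product.2 ⟨hh, ht⟩) (V, f) (Finset.mem_product.2 ⟨hV, hf⟩)
    · exact d3 (h, t) (Finset.mem_product.2 ⟨hh, ht⟩) ((f, g), k)
        (Finset.mem_product.2 ⟨Finset.mem_product.2 ⟨hf, hg⟩, hk⟩)
    · exact d4 (h, t) (Finset.mem_product.2 ⟨hh, ht⟩) ((V, f, g), k)
        (Finset.mem_product.2 ⟨Finset.mem_product.2 ⟨hV, Finset.mem_product.2 ⟨hf, hg⟩⟩, hk⟩)
  · have := hp.δ_pos
    linarith

end VOQLRun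

end

/-! ### Telescoping along one episode -/

section

theorem le_sum_Ico_add_of_le_add {Ψ s : ℕ → ℝ} {a n : ℕ} (han : a ≤ n)
    (h : ∀ k ∈ Finset.Ico a n, Ψ k ≤ s k + Ψ (k + 1)) : Ψ a ≤ ∑ k ∈ Finset.Ico a n, s k + Ψ n := by
  induction n, han using Nat.le_induction with
  | base => simp
  | succ n hn ih =>
    rw [Finset.sum_Ico_succ_top hn]
    have h1 := ih fun k hk => h k (by rw [Finset.mem_Ico] at hk ⊢; omega)
    have h2 := h n (by rw [Finset.mem_Ico]; omega)
    linarith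

namespace Trace

variable {X : Type u} {A : Type v} (τ : Trace X A) (p : VOQLParams) (u : ℕ → ℝ)

/-- The one-step error of `f_{t,1}^h`. -/
noncomputable def err₁ (t h : ℕ) (z : X × A) : ℝ := min (2 * τ.b₁ t h z + 2 * p.ε) 2

/-- The one-step error of `f_{t,-2}^h`. -/
noncomputable def err₂ (t h : ℕ) (z : X × A) : ℝ := min (2 * τ.b₂ t h z + 2 * p.ε) 2

/-- Up to level `h`, episode `t` follows `f_{t,1}`. -/
def Exploits (t h : ℕ) : Prop :=
  ∀ h' ∈ Finset.Icc 1 h, τ.v₁ p t h' (τ.x t h') ≥ τ.v₂ p t h' (τ.x t h') - u t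

open Classical in
/-- `1` if episode `t` follows `f_{t,2}` at level `h`, and `0` otherwise. -/
noncomputable def explore (t h : ℕ) : ℝ := if τ.Exploits p u t h then 0 else 1

open Classical in
/-- The value at level `h + 1` of the function that episode `t` follows at level `h`. -/
noncomputable def vNext (t h : ℕ) : X → ℝ :=
  if τ.Exploits p u t h then τ.v₁ p t (h + 1) else τ.v₂ p t (h + 1)

/-- The gap `f_{t,2}^h - f_{t,-2}^h` at the observed state-action pair. -/
noncomputable def gap (t h : ℕ) : ℝ := τ.f₂ p t h (τ.z t h) - τ.fNeg₂ p t h (τ.z t h)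

variable [MeasurableSpace X] [MeasurableSpace A] (M : EpisodicMDP X A)

/-- The noise of the regression target for `V`. -/
noncomputable def noise (t h : ℕ) (V : X → ℝ) : ℝ :=
  M.target h V (τ.z t h, τ.x t (h + 1)) - M.bellman h V (τ.z t h)

/-- The noise of the squared regression target for `V`. -/
noncomputable def noiseSq (t h : ℕ) (V : X → ℝ) : ℝ :=
  M.targetSq h V (τ.z t h, τ.x t (h + 1)) - M.bellmanSq h V (τ.z t h)

end Trace

variable {X : Type u} {A : Type v} [MeasurableSpace X] [MeasurableSpace A]
  [Countable A] [Nonempty A] [MeasurableSingletonClass A]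
  {M : EpisodicMDP X A} {F : ℕ → Finset (X × A → ℝ)} {W : Finset (X × A → ℝ)}
  {B : BonusOracle X A} {p : VOQLParams} {C : ℝ} {u : ℕ → ℝ} {τ : Trace X A}

theorem Trace.explore_mem (τ : Trace X A) (t h : ℕ) : τ.explore p u t h ∈ Icc (0 : ℝ) 1 := by
  unfold Trace.explore; split_ifs <;> simp

namespace IsVOQL

variable (S : VOQLSetup M F W B p C) (hv : IsVOQL M F B p u τ)

section
include S hv

theorem err₁_mem {t h : ℕ} (ht : t ∈ Finset.Icc 2 p.T) (hh : h ∈ Finset.Icc 1 p.H) (z : X × A) :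
    τ.err₁ p t h z ∈ Icc (0 : ℝ) 2 := by
  have h1 := hv.bonus₁_nonneg S ht hh z
  have h2 := S.adm.eps_nonneg
  exact ⟨le_min (by linarith) zero_le_two, min_le_right _ _⟩

theorem err₂_mem {t h : ℕ} (ht : t ∈ Finset.Icc 2 p.T) (hh : h ∈ Finset.Icc 1 p.H) (z : X × A) :
    τ.err₂ p t h z ∈ Icc (0 : ℝ) 2 := by
  have h1 := hv.bonus₂_nonneg S ht hh z
  have h2 := S.adm.eps_nonneg
  exact ⟨le_min (by linarith) zero_le_two, min_le_right _ _⟩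

theorem vNext_mem {t h : ℕ} (ht : t ∈ Finset.Icc 1 p.T) (hh : h ∈ Finset.Icc 1 p.H) (x : X) :
    τ.vNext p u t h x ∈ Icc (0 : ℝ) 2 := by
  have hh' : h + 1 ∈ Finset.Icc 1 (p.H + 1) := by rw [Finset.mem_Icc] at hh ⊢; omega
  unfold Trace.vNext
  split_ifs
  · have := hv.v₁_mem S ht hh' x
    exact ⟨this.1, this.2.trans one_le_two⟩
  · exact hv.v₂_mem S ht hh' x

theorem measurable_vNext {t h : ℕ} (ht : t ∈ Finset.Icc 1 p.T) (hh : h ∈ Finset.Icc 1 p.H) :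
    Measurable (τ.vNext p u t h) := by
  have hh' : h + 1 ∈ Finset.Icc 1 (p.H + 1) := by rw [Finset.mem_Icc] at hh ⊢; omega
  unfold Trace.vNext
  split_ifs
  · exact hv.measurable_v₁ S ht hh'
  · exact hv.measurable_v₂ S ht hh'

variable {t : ℕ} (ht : t ∈ Finset.Icc 2 p.T)
include ht

section StepBounds

variable {h : ℕ} (hh : h ∈ Finset.Icc 1 p.H) (hst : StepGood M p τ t h)
include hh hst

/-- `f_{t,1}` exceeds the Bellman image by at most `1`, so the error may be clipped at `2`.
Concentration needs bounded errors. -/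
theorem f₁_le_err (z : X × A) :
    τ.f₁ p t h z ≤ M.bellman h (τ.v₁ p t (h + 1)) z + τ.err₁ p t h z := by
  have ht0 := Finset.mem_Icc.1 ht
  have hh0 := Finset.mem_Icc.1 hh
  have ht1 : t ∈ Finset.Icc 1 p.T := Finset.mem_Icc.2 (by omega)
  have hh1 : h ∈ Finset.Icc 1 (p.H + 1) := Finset.mem_Icc.2 (by omega)
  have hh' : h + 1 ∈ Finset.Icc 1 (p.H + 1) := Finset.mem_Icc.2 (by omega)
  have h1 := (hv.f₁_mem S ht1 hh1 z).2
  have h2 := (EpisodicMDP.bellman_mem (M := M) (h := h) (hv.measurable_v₁ S ht1 hh')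
    (hv.v₁_mem S ht1 hh') z).1
  have h3 := hst.f₁_le z
  have := le_min (show τ.f₁ p t h z - M.bellman h (τ.v₁ p t (h + 1)) z ≤ 2 * τ.b₁ t h z + 2 * p.ε by
    linarith) (show _ ≤ (2 : ℝ) by linarith)
  unfold Trace.err₁
  linarith

theorem f₂_le_err (z : X × A) : τ.f₂ p t h z ≤
    M.bellman h (τ.v₂ p t (h + 1)) z + (τ.err₁ p t h z + τ.err₂ p t h z) := by
  have ht0 := Finset.mem_Icc.1 ht
  have hh0 := Finset.mem_Icc.1 hh
  have ht1 : t ∈ Finset.Icc 1 p.T := Finset.mem_Icc.2 (by omega)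
  have hh1 : h ∈ Finset.Icc 1 (p.H + 1) := Finset.mem_Icc.2 (by omega)
  have hh' : h + 1 ∈ Finset.Icc 1 (p.H + 1) := Finset.mem_Icc.2 (by omega)
  have h1 := (hv.f₂_mem S ht1 hh1 z).2
  have h2 := (EpisodicMDP.bellman_mem (M := M) (h := h) (hv.measurable_v₂ S ht1 hh')
    (hv.v₂_mem S ht1 hh') z).1
  have h3 := hst.f₂_le z
  have b1 := hv.bonus₁_nonneg S ht hh z
  have b2 := hv.bonus₂_nonneg S ht hh z
  have b3 := S.adm.eps_nonneg
  unfold Trace.err₁ Trace.err₂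
  rcases min_cases (2 * τ.b₁ t h z + 2 * p.ε) 2 with ⟨e1, h4⟩ | ⟨e1, h4⟩ <;>
  rcases min_cases (2 * τ.b₂ t h z + 2 * p.ε) 2 with ⟨e2, h5⟩ | ⟨e2, h5⟩ <;>
  rw [e1, e2] <;> linarith

theorem le_fNeg₂_err (z : X × A) :
    M.bellman h (τ.vNeg₂ p t (h + 1)) z - τ.err₂ p t h z ≤ τ.fNeg₂ p t h z := by
  have ht0 := Finset.mem_Icc.1 ht
  have hh0 := Finset.mem_Icc.1 hh
  have ht1 : t ∈ Finset.Icc 1 p.T := Finset.mem_Icc.2 (by omega)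
  have hh1 : h ∈ Finset.Icc 1 (p.H + 1) := Finset.mem_Icc.2 (by omega)
  have h1 := (hv.fNeg₂_mem S ht1 hh1 z).1
  have h2 := hst.bellman_vNeg₂_le z
  have h3 := hst.le_fNeg₂ z
  have h4 := (S.optQ_mem hh z).2
  have := le_min (show M.bellman h (τ.vNeg₂ p t (h + 1)) z - τ.fNeg₂ p t h z ≤
    2 * τ.b₂ t h z + 2 * p.ε by linarith) (show _ ≤ (2 : ℝ) by linarith)
  unfold Trace.err₂
  linarith

theorem gap_nonneg : 0 ≤ τ.gap p t h := by
  have h1 := hst.optQ_le_f₁ (τ.z t h)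
  have h2 := hst.f₁_le_f₂ (τ.z t h)
  have h3 := hst.fNeg₂_le_optQ (τ.z t h)
  unfold Trace.gap
  linarith

theorem gap_le_two : τ.gap p t h ≤ 2 := by
  have ht0 := Finset.mem_Icc.1 ht
  have hh0 := Finset.mem_Icc.1 hh
  have ht1 : t ∈ Finset.Icc 1 p.T := Finset.mem_Icc.2 (by omega)
  have hh1 : h ∈ Finset.Icc 1 (p.H + 1) := Finset.mem_Icc.2 (by omega)
  have h1 := (hv.f₂_mem S ht1 hh1 (τ.z t h)).2
  have h2 := (hv.fNeg₂_mem S ht1 hh1 (τ.z t h)).1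
  unfold Trace.gap
  linarith

end StepBounds

variable (hu : 0 ≤ u t) (hst : ∀ h ∈ Finset.Icc 1 p.H, StepGood M p τ t h)
include hu hst

/-- The regret of an episode along its path. -/
theorem optV_sub_sum_reward_le : M.optV 1 (τ.x t 1) - ∑ h ∈ Finset.Icc 1 p.H, (τ.data M h).r t ≤
    ∑ h ∈ Finset.Icc 1 p.H, τ.err₁ p t h (τ.z t h) +
    ∑ h ∈ Finset.Icc 1 p.H, τ.explore p u t h * τ.err₂ p t h (τ.z t h) -
    min (u t) 2 * τ.explore p u t p.H - ∑ h ∈ Finset.Icc 1 p.H, τ.noise M t h (τ.vNext p u t h) := by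
  classical
  have ht0 := Finset.mem_Icc.1 ht
  have ht1 : t ∈ Finset.Icc 1 p.T := Finset.mem_Icc.2 (by omega)
  have hHpos := S.adm.H_pos
  -- The value of the function that is followed, lowered by `u t` during exploration. A switch
  -- happens when `v₁ < v₂ - u t`, so it only increases this potential.
  set Ψ : ℕ → ℝ := fun h => if τ.Exploits p u t h then τ.v₁ p t h (τ.x t h) else
    τ.v₂ p t h (τ.x t h) - u t with hΨ
  have hstep : ∀ h ∈ Finset.Ico 1 (p.H + 1), Ψ h ≤ ((τ.data M h).r t + τ.err₁ p t h (τ.z t h) +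
      τ.explore p u t h * τ.err₂ p t h (τ.z t h) - τ.noise M t h (τ.vNext p u t h)) + Ψ (h + 1) := by
    intro h hh
    have hh0 := Finset.mem_Ico.1 hh
    have hh1 : h ∈ Finset.Icc 1 p.H := Finset.mem_Icc.2 (by omega)
    have er : (τ.data M h).r t = M.reward h (τ.z t h).1 (τ.z t h).2 (τ.x t (h + 1)) := rfl
    by_cases hok : τ.Exploits p u t h
    · have e1 : Ψ h = τ.f₁ p t h (τ.z t h) := by
        simp only [hΨ, if_pos hok]
        exact (hv.greedy₁ t ht1 h hh1 hok).maxAct_eq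
      have e2 : τ.explore p u t h = 0 := by unfold Trace.explore; rw [if_pos hok]
      have e3 : τ.vNext p u t h = τ.v₁ p t (h + 1) := by unfold Trace.vNext; rw [if_pos hok]
      have h1 := hv.f₁_le_err S ht hh1 (hst h hh1) (τ.z t h)
      have h2 : τ.v₁ p t (h + 1) (τ.x t (h + 1)) ≤ Ψ (h + 1) := by
        simp only [hΨ]
        split_ifs with hok'
        · exact le_rfl
        · by_contra hcon
          push Not at hcon
          refine hok' fun h' hh' => ?_
          rw [Finset.mem_Icc] at hh'
          rcases hh'.2.eq_or_lt with rfl | hlt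
          · exact hcon.le
          · exact hok h' (Finset.mem_Icc.2 (by omega))
      rw [e1, e2, e3]
      unfold Trace.noise EpisodicMDP.target
      simp only
      linarith
    · have e1 : Ψ h = τ.f₂ p t h (τ.z t h) - u t := by
        simp only [hΨ, if_neg hok]
        congr 1
        exact (hv.greedy₂ t ht1 h hh1 hok).maxAct_eq
      have e2 : τ.explore p u t h = 1 := by unfold Trace.explore; rw [if_neg hok]
      have e3 : τ.vNext p u t h = τ.v₂ p t (h + 1) := by unfold Trace.vNext; rw [if_neg hok]
      have h1 := hv.f₂_le_err S ht hh1 (hst h hh1) (τ.z t h)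
      have hok' : ¬ τ.Exploits p u t (h + 1) := fun hcon => hok fun h' hh' => hcon h' (by
        rw [Finset.mem_Icc] at hh' ⊢; omega)
      have e4 : Ψ (h + 1) = τ.v₂ p t (h + 1) (τ.x t (h + 1)) - u t := by
        simp only [hΨ, if_neg hok']
      rw [e1, e2, e3, e4]
      unfold Trace.noise EpisodicMDP.target
      simp only
      linarith
  have h1 := le_sum_Ico_add_of_le_add (by omega) hstep
  have e0 : Finset.Ico 1 (p.H + 1) = Finset.Icc 1 p.H := by
    ext; simp only [Finset.mem_Ico, Finset.mem_Icc]; omega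
  rw [e0, Finset.sum_sub_distrib, Finset.sum_add_distrib, Finset.sum_add_distrib] at h1
  have ev1 : τ.v₁ p t (p.H + 1) (τ.x t (p.H + 1)) = 0 := by
    have e : τ.f₁ p t (p.H + 1) = fun _ => 0 := by funext z; simp [Trace.f₁]
    rw [Trace.v₁, e, maxAct_const]
  have ev2 : τ.v₂ p t (p.H + 1) (τ.x t (p.H + 1)) = 0 := by
    have e : τ.f₂ p t (p.H + 1) = fun _ => 0 := by funext z; simp [Trace.f₂]
    rw [Trace.v₂, e, maxAct_const]
  -- At level `H + 1` the values vanish and `u t ≥ 0`, so no switch occurs there. What is left is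
  -- the gain of an exploring episode, capped at `2` to keep it bounded.
  have hend : Ψ (p.H + 1) ≤ -(min (u t) 2 * τ.explore p u t p.H) := by
    by_cases hok : τ.Exploits p u t p.H
    · have hok' : τ.Exploits p u t (p.H + 1) := fun h' hh' => by
        rw [Finset.mem_Icc] at hh'
        rcases hh'.2.eq_or_lt with rfl | hlt
        · rw [ev1, ev2]; linarith
        · exact hok h' (Finset.mem_Icc.2 (by omega))
      simp only [hΨ, if_pos hok', Trace.explore, if_pos hok, ev1]
      simp
    · have hok' : ¬ τ.Exploits p u t (p.H + 1) := fun hcon => hok fun h' hh' => hcon h' (by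
        rw [Finset.mem_Icc] at hh' ⊢; omega)
      simp only [hΨ, if_neg hok', Trace.explore, if_neg hok, ev2]
      linarith [min_le_left (u t) 2]
  have hH1 : 1 ∈ Finset.Icc 1 p.H := Finset.mem_Icc.2 (by omega)
  have hstart : M.optV 1 (τ.x t 1) ≤ Ψ 1 := by
    have h2 : M.optV 1 (τ.x t 1) ≤ τ.v₁ p t 1 (τ.x t 1) := by
      rw [S.optV_eq_maxAct hH1]
      exact maxAct_mono (fun z => (hv.f₁_mem S ht1 (Finset.mem_Icc.2 (by omega)) z).2)
        (hst 1 hH1).optQ_le_f₁ _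
    simp only [hΨ]
    split_ifs with hok
    · exact h2
    · by_contra hcon
      refine hok fun h' hh' => ?_
      obtain rfl : h' = 1 := by rw [Finset.mem_Icc] at hh'; omega
      linarith
  linarith

/-- The gap between the optimistic and the pessimistic values along a path. -/
theorem gap_le {h : ℕ} (hh : h ∈ Finset.Icc 1 p.H) :
    τ.gap p t h ≤ ∑ k ∈ Finset.Icc 1 p.H, (τ.err₁ p t k (τ.z t k) + 2 * τ.err₂ p t k (τ.z t k)) +
      p.H * min (u t) 2 + ∑ k ∈ Finset.Ico h (p.H + 1),
        (τ.noise M t k (τ.vNeg₂ p t (k + 1)) - τ.noise M t k (τ.v₂ p t (k + 1))) := by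
  have ht0 := Finset.mem_Icc.1 ht
  have hh0 := Finset.mem_Icc.1 hh
  have ht1 : t ∈ Finset.Icc 1 p.T := Finset.mem_Icc.2 (by omega)
  have hu' : 0 ≤ min (u t) 2 := le_min hu zero_le_two
  have hstep : ∀ k ∈ Finset.Ico h (p.H + 1), τ.gap p t k ≤
      ((τ.err₁ p t k (τ.z t k) + 2 * τ.err₂ p t k (τ.z t k)) + min (u t) 2 +
        (τ.noise M t k (τ.vNeg₂ p t (k + 1)) - τ.noise M t k (τ.v₂ p t (k + 1)))) +
      τ.gap p t (k + 1) := by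
    intro k hk
    rw [Finset.mem_Ico] at hk
    have hk1 : k ∈ Finset.Icc 1 p.H := Finset.mem_Icc.2 (by omega)
    have hk' : k + 1 ∈ Finset.Icc 1 (p.H + 1) := Finset.mem_Icc.2 (by omega)
    have h1 := hv.f₂_le_err S ht hk1 (hst k hk1) (τ.z t k)
    have h2 := hv.le_fNeg₂_err S ht hk1 (hst k hk1) (τ.z t k)
    have h3 : τ.fNeg₂ p t (k + 1) (τ.z t (k + 1)) ≤ τ.vNeg₂ p t (k + 1) (τ.x t (k + 1)) :=
      le_maxAct (fun z => (hv.fNeg₂_mem S ht1 hk' z).2) _ _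
    -- During exploitation the action maximizes `f₁` instead of `f₂`; still `v₂ ≤ v₁ + u t` by the
    -- switching rule and `f₁ ≤ f₂`, so the gap moves on at the price `min (u t) 2`.
    have h4 : τ.v₂ p t (k + 1) (τ.x t (k + 1)) ≤
        τ.f₂ p t (k + 1) (τ.z t (k + 1)) + min (u t) 2 := by
      by_cases hkH : k = p.H
      · have e : τ.f₂ p t (k + 1) = fun _ => 0 := by funext z; simp [Trace.f₂, hkH]
        rw [Trace.v₂, e, maxAct_const]
        linarith
      have hk2 : k + 1 ∈ Finset.Icc 1 p.H := Finset.mem_Icc.2 (by omega)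
      by_cases hok : τ.Exploits p u t (k + 1)
      · have e1 : τ.v₁ p t (k + 1) (τ.x t (k + 1)) = τ.f₁ p t (k + 1) (τ.z t (k + 1)) :=
          (hv.greedy₁ t ht1 _ hk2 hok).maxAct_eq
        have e2 := hok (k + 1) (Finset.mem_Icc.2 (by omega))
        have e3 := (hst _ hk2).f₁_le_f₂ (τ.z t (k + 1))
        have e4 := (hv.v₂_mem S ht1 hk' (τ.x t (k + 1))).2
        have e5 := (hv.f₂_mem S ht1 hk' (τ.z t (k + 1))).1
        have := le_min (show τ.v₂ p t (k + 1) (τ.x t (k + 1)) - τ.f₂ p t (k + 1) (τ.z t (k + 1)) ≤ u t by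
          linarith) (show _ ≤ (2 : ℝ) by linarith)
        linarith
      · have e1 : τ.v₂ p t (k + 1) (τ.x t (k + 1)) = τ.f₂ p t (k + 1) (τ.z t (k + 1)) :=
          (hv.greedy₂ t ht1 _ hk2 hok).maxAct_eq
        linarith
    unfold Trace.gap Trace.noise EpisodicMDP.target
    simp only
    linarith
  have h1 := le_sum_Ico_add_of_le_add (by omega) hstep
  have hend : τ.gap p t (p.H + 1) = 0 := by simp [Trace.gap, Trace.f₂, Trace.fNeg₂]
  rw [Finset.sum_add_distrib, Finset.sum_add_distrib, Finset.sum_const, Nat.card_Ico, hend] at h1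
  have h2 : ∑ k ∈ Finset.Ico h (p.H + 1), (τ.err₁ p t k (τ.z t k) + 2 * τ.err₂ p t k (τ.z t k)) ≤
      ∑ k ∈ Finset.Icc 1 p.H, (τ.err₁ p t k (τ.z t k) + 2 * τ.err₂ p t k (τ.z t k)) := by
    refine Finset.sum_le_sum_of_subset_of_nonneg (fun k hk => ?_) fun k hk _ => ?_
    · rw [Finset.mem_Ico] at hk; exact Finset.mem_Icc.2 (by omega)
    · have := (hv.err₁_mem S ht hk (τ.z t k)).1
      have := (hv.err₂_mem S ht hk (τ.z t k)).1
      positivity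
  have h3 : (p.H + 1 - h) • min (u t) 2 ≤ p.H * min (u t) 2 := by
    rw [nsmul_eq_mul]
    refine mul_le_mul_of_nonneg_right ?_ hu'
    exact_mod_cast (by omega : p.H + 1 - h ≤ p.H)
  linarith

end

include S

/-- The variances along a path. -/
theorem sum_cvar_le (τ : Trace X A) (t : ℕ) :
    ∑ h ∈ Finset.Icc 1 p.H, M.cvar h (M.target h (M.optV (h + 1))) (τ.z t h) ≤
      2 + ∑ h ∈ Finset.Icc 1 p.H, (3 * τ.noise M t h (M.optV (h + 1)) -
        τ.noiseSq M t h (M.optV (h + 1))) := by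
  have hHpos := S.adm.H_pos
  -- Apart from the noise, a step of `3 V - V²` leaves the variance and `r (3 - r - 2 V') + (V - Q)
  -- (3 - V - Q)`, which is nonnegative as all values lie in `[0, 1]`. This is a law of total
  -- variance; sparsity makes it independent of `H`.
  set Ψ : ℕ → ℝ := fun h => 3 * M.optV h (τ.x t h) - M.optV h (τ.x t h) ^ 2 with hΨ
  have hstep : ∀ h ∈ Finset.Ico 1 (p.H + 1), -Ψ h ≤
      ((3 * τ.noise M t h (M.optV (h + 1)) - τ.noiseSq M t h (M.optV (h + 1))) -
        M.cvar h (M.target h (M.optV (h + 1))) (τ.z t h)) + -Ψ (h + 1) := by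
    intro h hh
    rw [Finset.mem_Ico] at hh
    have hh1 : h ∈ Finset.Icc 1 p.H := Finset.mem_Icc.2 (by omega)
    have hh' : h + 1 ∈ Finset.Icc 1 (p.H + 1) := Finset.mem_Icc.2 (by omega)
    have hV := S.optV_mem hh'
    have hm := measurable_optV_succ (M := M) h
    have hc := EpisodicMDP.cvar_eq (M := M) (h := h) (M.measurable_target h hm) (M.target_mem hV)
      (τ.z t h)
    have e1 : M.cmean h (fun q => M.target h (M.optV (h + 1)) q ^ 2) (τ.z t h) =
      M.bellmanSq h (M.optV (h + 1)) (τ.z t h) := rfl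
    rw [e1, M.cmean_target, ← M.optQ_eq] at hc
    have hQ := S.optQ_mem hh1 (τ.z t h)
    have hQV := S.optQ_le_optV hh1 (τ.z t h)
    have hV0 := S.optV_mem (h := h) (Finset.mem_Icc.2 (by omega)) (τ.x t h)
    have hV1 := hV (τ.x t (h + 1))
    have hr := M.reward_mem h (τ.z t h).1 (τ.z t h).2 (τ.x t (h + 1))
    rw [hc]
    unfold Trace.noise Trace.noiseSq EpisodicMDP.targetSq EpisodicMDP.target
    rw [← M.optQ_eq]
    simp only [hΨ]
    change M.optQ h (τ.z t h) ≤ M.optV h (τ.x t h) at hQV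
    set r := M.reward h (τ.z t h).1 (τ.z t h).2 (τ.x t (h + 1))
    set V := M.optV h (τ.x t h)
    set V' := M.optV (h + 1) (τ.x t (h + 1))
    set Q := M.optQ h (τ.z t h)
    have h1 : r * (3 - r - 2 * V') ≥ 0 := mul_nonneg hr.1 (by linarith [hr.2, hV1.2])
    have h2 : (V - Q) * (3 - V - Q) ≥ 0 := mul_nonneg (by linarith) (by linarith [hV0.2, hQ.2])
    nlinarith
  have h1 := le_sum_Ico_add_of_le_add (Ψ := fun h => -Ψ h) (by omega) hstep
  have e0 : Finset.Ico 1 (p.H + 1) = Finset.Icc 1 p.H := by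
    ext; simp only [Finset.mem_Ico, Finset.mem_Icc]; omega
  rw [e0, Finset.sum_sub_distrib] at h1
  have hend : Ψ (p.H + 1) = 0 := by simp [hΨ, S.optV_last]
  have hV0 := S.optV_mem (h := 1) (Finset.mem_Icc.2 (by omega)) (τ.x t 1)
  have hs : Ψ 1 ≤ 2 := by
    simp only [hΨ]
    nlinarith [hV0.1, hV0.2]
  simp only [hend] at h1
  linarith

end IsVOQL

end

/-! ### Conditional expectations of the sums over an episode -/

section

section CondCentered

variable {Ω : Type*} {m mΩ : MeasurableSpace Ω} {P : Measure Ω} [IsProbabilityMeasure P]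

/-- `N` is integrable and has conditional expectation `0` given `m`. -/
structure CondCentered (m : MeasurableSpace Ω) {mΩ : MeasurableSpace Ω} (P : Measure Ω)
    (N : Ω → ℝ) : Prop where
  integrable : Integrable N P
  condExp : P[N | m] =ᵐ[P] 0

theorem CondCentered.sub {N N' : Ω → ℝ} (h : CondCentered m P N) (h' : CondCentered m P N') :
    CondCentered m P (N - N') :=
  ⟨h.integrable.sub h'.integrable, by
    filter_upwards [condExp_sub h.integrable h'.integrable m, h.condExp, h'.condExp] with ω h1 h2 h3
    rw [h1, Pi.sub_apply, h2, h3]; simp⟩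

theorem CondCentered.const_mul {N : Ω → ℝ} (h : CondCentered m P N) (c : ℝ) :
    CondCentered m P fun ω => c * N ω :=
  ⟨h.integrable.const_mul c, by
    filter_upwards [condExp_smul (μ := P) c N m, h.condExp] with ω h1 h2
    change (P[c • N | m]) ω = _
    rw [h1, Pi.smul_apply, h2]; simp⟩

theorem CondCentered.sum {ι : Type*} {s : Finset ι} {N : ι → Ω → ℝ}
    (h : ∀ i ∈ s, CondCentered m P (N i)) : CondCentered m P fun ω => ∑ i ∈ s, N i ω := by
  have e : (fun ω => ∑ i ∈ s, N i ω) = ∑ i ∈ s, N i := by funext ω; simp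
  rw [e]
  refine ⟨integrable_finsetSum' _ fun i hi => (h i hi).integrable, ?_⟩
  have h1 : ∀ᵐ ω ∂P, ∀ i ∈ s, (P[N i | m]) ω = 0 :=
    (Finset.eventually_all _).2 fun i hi => (h i hi).condExp
  filter_upwards [condExp_finsetSum (fun i hi => (h i hi).integrable) m, h1] with ω h2 h3
  rw [h2, Finset.sum_apply, Finset.sum_eq_zero h3]; rfl

/-- Conditional expectations of an inequality that holds up to centered noise on a set in `m`. -/
theorem condExp_le_of_le_add (hm : m ≤ mΩ) {G : Set Ω} (hG : MeasurableSet[m] G) {f g N : Ω → ℝ}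
    (hf : Integrable f P) (hg : Integrable g P) (hN : CondCentered m P N)
    (hle : ∀ ω ∈ G, f ω ≤ g ω + N ω) : ∀ᵐ ω ∂P, ω ∈ G → (P[f | m]) ω ≤ (P[g | m]) ω := by
  have h1 : P[G.indicator f | m] ≤ᵐ[P] P[G.indicator (g + N) | m] :=
    condExp_mono (hf.indicator (hm _ hG)) ((hg.add hN.integrable).indicator (hm _ hG))
      (Filter.Eventually.of_forall fun ω => by
        by_cases hω : ω ∈ G
        · simpa [hω] using hle ω hω
        · simp [hω])
  filter_upwards [h1, condExp_indicator hf hG, condExp_indicator (hg.add hN.integrable) hG,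
    condExp_add hg hN.integrable m, hN.condExp] with ω h1 h2 h3 h4 h5 hω
  rw [h2, h3, indicator_of_mem hω, indicator_of_mem hω, h4, Pi.add_apply, h5] at h1
  simpa using h1

theorem integrable_of_measurable_mem (hm : m ≤ mΩ) {f : Ω → ℝ} (hf : Measurable[m] f) {a b : ℝ}
    (hb : ∀ ω, f ω ∈ Icc a b) : Integrable f P :=
  integrable_of_mem_Icc (hf.mono hm le_rfl) hb

end CondCentered

theorem sum_mem_Icc_of_mem {H : ℕ} {c : ℝ} {f : ℕ → ℝ} (h : ∀ k ∈ Finset.Icc 1 H, f k ∈ Icc 0 c) :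
    ∑ k ∈ Finset.Icc 1 H, f k ∈ Icc 0 (c * H) := by
  refine ⟨Finset.sum_nonneg fun k hk => (h k hk).1, ?_⟩
  have := Finset.sum_le_card_nsmul (Finset.Icc 1 H) f c fun k hk => (h k hk).2
  simpa [mul_comm] using this

variable {X : Type u} {A : Type v} [mX : MeasurableSpace X] [mA : MeasurableSpace A]
  [Countable A] [Nonempty A] [MeasurableSingletonClass A]
  {M : EpisodicMDP X A} {F : ℕ → Finset (X × A → ℝ)} {W : Finset (X × A → ℝ)}
  {B : BonusOracle X A} {p : VOQLParams} {C : ℝ} {u : ℕ → ℝ}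
  {Ω : Type w} {mΩ : MeasurableSpace Ω} {P : Measure Ω} [IsProbabilityMeasure P]

namespace Trace

variable (τ : Trace X A) (p : VOQLParams) (u : ℕ → ℝ) (M : EpisodicMDP X A) (t : ℕ)

/-- The sum of the errors `err₁` in episode `t`. -/
noncomputable def sumErr₁ : ℝ := ∑ h ∈ Finset.Icc 1 p.H, τ.err₁ p t h (τ.z t h)

/-- The sum of the errors `err₂` in episode `t`. -/
noncomputable def sumErr₂ : ℝ := ∑ h ∈ Finset.Icc 1 p.H, τ.err₂ p t h (τ.z t h)

/-- The sum of the errors `err₂` in episode `t` over the levels of exploration. -/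
noncomputable def sumExploreErr : ℝ :=
  ∑ h ∈ Finset.Icc 1 p.H, τ.explore p u t h * τ.err₂ p t h (τ.z t h)

/-- The threshold of episode `t`, if the episode ends with exploration. -/
noncomputable def switchGain : ℝ := min (u t) 2 * τ.explore p u t p.H

/-- The sum of the gaps in episode `t`, clipped to `[0, 2]`. -/
noncomputable def sumGap : ℝ := ∑ h ∈ Finset.Icc 1 p.H, max 0 (min (τ.gap p t h) 2)

/-- The sum of the variances of the optimal values in episode `t`. -/
noncomputable def sumVar : ℝ :=
  ∑ h ∈ Finset.Icc 1 p.H, M.cvar h (M.target h (M.optV (h + 1))) (τ.z t h)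

/-- The regret in episode `t` along the path. -/
noncomputable def pathRegret : ℝ :=
  M.optV 1 (τ.x t 1) - ∑ h ∈ Finset.Icc 1 M.H, (τ.data M h).r t

end Trace

namespace VOQLRun

variable (R : VOQLRun M F B p u P) (S : VOQLSetup M F W B p C) {t h : ℕ}
include S

/-- `V` may depend on the past up to the action of level `h`, as the function being followed does;
by the tower property the noise is still centered given the earlier episodes. -/
theorem condCentered_noise (ht : t ∈ Finset.Icc 1 p.T) (hh : h ∈ Finset.Icc 1 p.H)
    {V : Ω → X → ℝ} (hV : FiniteValued (R.hist t (h - 1)) V) (hm : ∀ ω, Measurable (V ω)) {a b : ℝ}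
    (hb : ∀ ω x, V ω x ∈ Icc a b) :
    CondCentered (R.hist (t - 1) M.H) P fun ω => (R.trace ω).noise M t h (V ω) := by
  have ht0 := Finset.mem_Icc.1 ht
  have hh0 := Finset.mem_Icc.1 hh
  have hH := S.H_eq
  have hl := R.stepLaw S ht hh
  set Ψ : Ω × X → ℝ := fun q => M.reward h ((R.trace q.1).z t h).1 ((R.trace q.1).z t h).2 q.2 +
    V q.1 q.2 with hΨ
  have hz : Measurable[(R.hist t (h - 1)).prod mX] fun q : Ω × X => (R.trace q.1).z t h :=
    (R.measurable_z S ht hh).comp (@measurable_fst Ω X (R.hist t (h - 1)) mX)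
  have hΨm : Measurable[(R.hist t (h - 1)).prod mX] Ψ :=
    ((EpisodicMDP.measurable_reward M h).comp
      (hz.prodMk (@measurable_snd Ω X (R.hist t (h - 1)) mX))).add (hV.measurable_uncurry hm)
  have hΨb : ∀ q, Ψ q ∈ Icc a (1 + b) := fun q => M.target_mem (h := h) (hb q.1) ((R.trace q.1).z t h, q.2)
  refine ⟨?_, hl.condExp_centered hΨm hΨb (R.hist_pred_le ht0.1 (by omega))⟩
  have m1 : Measurable fun ω => Ψ (ω, (R.trace ω).x t (h + 1)) :=
    hl.measurable_comp hl.le hl.meas_x hΨm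
  have m2 := (hl.measurable_integral hΨm).mono hl.le le_rfl
  exact (integrable_of_mem_Icc m1 fun ω => hΨb _).sub (integrable_of_mem_Icc m2 fun ω =>
    EpisodicMDP.bellman_mem (M := M) (h := h) (hm ω) (hb ω) ((R.trace ω).z t h))

theorem condCentered_noiseSq (ht : t ∈ Finset.Icc 1 p.T) (hh : h ∈ Finset.Icc 1 p.H)
    {V : X → ℝ} (hm : Measurable V) (hb : ∀ x, V x ∈ Icc (0 : ℝ) 1) :
    CondCentered (R.hist (t - 1) M.H) P fun ω => (R.trace ω).noiseSq M t h V := by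
  have ht0 := Finset.mem_Icc.1 ht
  have hh0 := Finset.mem_Icc.1 hh
  have hH := S.H_eq
  have hl := R.stepLaw S ht hh
  set Ψ : Ω × X → ℝ := fun q => M.targetSq h V ((R.trace q.1).z t h, q.2) with hΨ
  have hz : Measurable[(R.hist t (h - 1)).prod mX] fun q : Ω × X => (R.trace q.1).z t h :=
    (R.measurable_z S ht hh).comp (@measurable_fst Ω X (R.hist t (h - 1)) mX)
  have hΨm : Measurable[(R.hist t (h - 1)).prod mX] Ψ :=
    ((M.measurable_target h hm).pow_const 2).comp
      (hz.prodMk (@measurable_snd Ω X (R.hist t (h - 1)) mX))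
  have hb' : ∀ q, M.targetSq h V q ∈ Icc (0 : ℝ) 4 := fun q => by
    have := M.target_mem (h := h) hb q
    exact ⟨sq_nonneg _, by unfold EpisodicMDP.targetSq; nlinarith [this.1, this.2]⟩
  have hΨb : ∀ q, Ψ q ∈ Icc (0 : ℝ) 4 := fun q => hb' _
  refine ⟨?_, hl.condExp_centered hΨm hΨb (R.hist_pred_le ht0.1 (by omega))⟩
  have m1 : Measurable fun ω => Ψ (ω, (R.trace ω).x t (h + 1)) :=
    hl.measurable_comp hl.le hl.meas_x hΨm
  have m2 := (hl.measurable_integral hΨm).mono hl.le le_rfl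
  exact (integrable_of_mem_Icc m1 fun ω => hΨb _).sub (integrable_of_mem_Icc m2 fun ω =>
    EpisodicMDP.cmean_mem (M := M) (h := h) ((M.measurable_target h hm).pow_const 2) hb'
      ((R.trace ω).z t h))

theorem measurableSet_exploits (ht : t ∈ Finset.Icc 1 p.T) (hh : h ∈ Finset.Icc 1 p.H) :
    MeasurableSet[R.hist t (h - 1)] {ω | (R.trace ω).Exploits p u t h} := by
  have ht0 := Finset.mem_Icc.1 ht
  have hh0 := Finset.mem_Icc.1 hh
  have hH := S.H_eq
  have e : {ω | (R.trace ω).Exploits p u t h} = ⋂ h' ∈ Finset.Icc 1 h,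
      {ω | (R.trace ω).v₂ p t h' ((R.trace ω).x t h') - u t ≤ (R.trace ω).v₁ p t h' ((R.trace ω).x t h')} := by
    ext ω; simp [Trace.Exploits]
  rw [e]
  refine Finset.measurableSet_biInter _ fun h' hh' => ?_
  rw [Finset.mem_Icc] at hh'
  have h1 : h' ∈ Finset.Icc 1 (p.H + 1) := Finset.mem_Icc.2 (by omega)
  have hx : Measurable[R.hist t (h - 1)] fun ω => (R.trace ω).x t h' :=
    (R.measurable_x ht (Finset.mem_Icc.2 (by omega))).mono
      (R.hist_le_hist_of_le (by omega) (by omega)) le_rfl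
  have hle := R.hist_pred_le (h := h - 1) ht0.1 (by omega)
  have m1 := ((R.finiteValued_v₁ S ht h1).mono hle).measurable_eval
    (fun ω => (R.isVOQL ω).measurable_v₁ S ht h1) hx
  have m2 := ((R.finiteValued_v₂ S ht h1).mono hle).measurable_eval
    (fun ω => (R.isVOQL ω).measurable_v₂ S ht h1) hx
  exact measurableSet_le (m2.sub_const _) m1

theorem finiteValued_vNext (ht : t ∈ Finset.Icc 1 p.T) (hh : h ∈ Finset.Icc 1 p.H) :
    FiniteValued (R.hist t (h - 1)) fun ω => (R.trace ω).vNext p u t h := by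
  have ht0 := Finset.mem_Icc.1 ht
  have hh0 := Finset.mem_Icc.1 hh
  have hH := S.H_eq
  have hle := R.hist_pred_le (h := h - 1) ht0.1 (by omega)
  have h1 : h + 1 ∈ Finset.Icc 1 (p.H + 1) := Finset.mem_Icc.2 (by omega)
  classical
  exact FiniteValued.ite (R.measurableSet_exploits S ht hh) ((R.finiteValued_v₁ S ht h1).mono hle)
    ((R.finiteValued_v₂ S ht h1).mono hle)

theorem measurable_explore (ht : t ∈ Finset.Icc 1 p.T) (hh : h ∈ Finset.Icc 1 p.H) :
    Measurable[R.hist t (h - 1)] fun ω => (R.trace ω).explore p u t h := by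
  classical
  exact Measurable.ite (R.measurableSet_exploits S ht hh) measurable_const measurable_const

theorem measurable_err₁ (ht : t ∈ Finset.Icc 2 p.T) (hh : h ∈ Finset.Icc 1 p.H) :
    Measurable[R.hist t (h - 1)] fun ω => (R.trace ω).err₁ p t h ((R.trace ω).z t h) := by
  have ht0 := Finset.mem_Icc.1 ht
  have hh0 := Finset.mem_Icc.1 hh
  have hH := S.H_eq
  have ht1 : t ∈ Finset.Icc 1 p.T := Finset.mem_Icc.2 (by omega)
  have := ((R.finiteValued_b₁ S ht hh).mono
    (R.hist_pred_le (h := h - 1) (by omega) (by omega))).measurable_eval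
    (fun ω => S.W_meas _ ((R.isVOQL ω).bonus₁_mem S ht hh)) (R.measurable_z S ht1 hh)
  exact ((this.const_mul 2).add_const _).min measurable_const

theorem measurable_err₂ (ht : t ∈ Finset.Icc 2 p.T) (hh : h ∈ Finset.Icc 1 p.H) :
    Measurable[R.hist t (h - 1)] fun ω => (R.trace ω).err₂ p t h ((R.trace ω).z t h) := by
  have ht0 := Finset.mem_Icc.1 ht
  have hh0 := Finset.mem_Icc.1 hh
  have hH := S.H_eq
  have ht1 : t ∈ Finset.Icc 1 p.T := Finset.mem_Icc.2 (by omega)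
  have := ((R.finiteValued_b₂ S ht hh).mono
    (R.hist_pred_le (h := h - 1) (by omega) (by omega))).measurable_eval
    (fun ω => S.W_meas _ ((R.isVOQL ω).bonus₂_mem S ht hh)) (R.measurable_z S ht1 hh)
  exact ((this.const_mul 2).add_const _).min measurable_const

theorem hist_pred_le_last (hh : h ∈ Finset.Icc 1 p.H) : R.hist t (h - 1) ≤ R.hist t M.H := by
  have hh0 := Finset.mem_Icc.1 hh
  have hH := S.H_eq
  exact R.hist_le_hist_of_le (by omega) le_rfl

section EpisodeSums

variable (ht : t ∈ Finset.Icc 2 p.T)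
include ht

theorem measurable_sumErr₁ : Measurable[R.hist t M.H] fun ω => (R.trace ω).sumErr₁ p t :=
  Finset.measurable_sum _ fun _ hh => (R.measurable_err₁ S ht hh).mono (R.hist_pred_le_last S hh) le_rfl

theorem measurable_sumErr₂ : Measurable[R.hist t M.H] fun ω => (R.trace ω).sumErr₂ p t :=
  Finset.measurable_sum _ fun _ hh => (R.measurable_err₂ S ht hh).mono (R.hist_pred_le_last S hh) le_rfl

theorem measurable_sumExploreErr :
    Measurable[R.hist t M.H] fun ω => (R.trace ω).sumExploreErr p u t :=
  Finset.measurable_sum _ fun _ hh => ((R.measurable_explore S (by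
    rw [Finset.mem_Icc] at ht ⊢; omega) hh).mul (R.measurable_err₂ S ht hh)).mono
      (R.hist_pred_le_last S hh) le_rfl

theorem measurable_switchGain : Measurable[R.hist t M.H] fun ω => (R.trace ω).switchGain p u t := by
  have hH := S.adm.H_pos
  have hh : p.H ∈ Finset.Icc 1 p.H := Finset.mem_Icc.2 (by omega)
  exact ((R.measurable_explore S (by rw [Finset.mem_Icc] at ht ⊢; omega) hh).const_mul _).mono
    (R.hist_pred_le_last S hh) le_rfl

theorem measurable_sumGap : Measurable[R.hist t M.H] fun ω => (R.trace ω).sumGap p t := by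
  have ht1 : t ∈ Finset.Icc 1 p.T := by rw [Finset.mem_Icc] at ht ⊢; omega
  exact Finset.measurable_sum _ fun _ hh => (measurable_const.max (((R.measurable_f₂_eval S ht1 hh).sub
    (R.measurable_fNeg₂_eval S ht1 hh)).min measurable_const)).mono (R.hist_pred_le_last S hh) le_rfl

theorem measurable_sumVar : Measurable[R.hist t M.H] fun ω => (R.trace ω).sumVar p M t := by
  have ht1 : t ∈ Finset.Icc 1 p.T := by rw [Finset.mem_Icc] at ht ⊢; omega
  exact Finset.measurable_sum _ fun h hh => ((EpisodicMDP.measurable_cvar (M.measurable_target h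
    (measurable_optV_succ h))).comp (R.measurable_z S ht1 hh)).mono (R.hist_pred_le_last S hh) le_rfl

theorem sumErr₁_mem (ω : Ω) : (R.trace ω).sumErr₁ p t ∈ Icc (0 : ℝ) (2 * p.H) :=
  sum_mem_Icc_of_mem fun _ hh => (R.isVOQL ω).err₁_mem S ht hh _

theorem sumErr₂_mem (ω : Ω) : (R.trace ω).sumErr₂ p t ∈ Icc (0 : ℝ) (2 * p.H) :=
  sum_mem_Icc_of_mem fun _ hh => (R.isVOQL ω).err₂_mem S ht hh _

theorem sumExploreErr_mem (ω : Ω) : (R.trace ω).sumExploreErr p u t ∈ Icc (0 : ℝ) (2 * p.H) :=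
  sum_mem_Icc_of_mem fun h hh => by
    have h1 := (R.isVOQL ω).err₂_mem S ht hh ((R.trace ω).z t h)
    have h2 := (R.trace ω).explore_mem (p := p) (u := u) t h
    exact ⟨mul_nonneg h2.1 h1.1, by nlinarith [h1.1, h1.2, h2.1, h2.2]⟩

omit S ht in
theorem switchGain_mem (hu : 0 ≤ u t) (ω : Ω) : (R.trace ω).switchGain p u t ∈ Icc (0 : ℝ) 2 := by
  have h2 := (R.trace ω).explore_mem (p := p) (u := u) t p.H
  have h3 : 0 ≤ min (u t) 2 := le_min hu zero_le_two
  have h4 := min_le_right (u t) 2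
  exact ⟨mul_nonneg h3 h2.1, by unfold Trace.switchGain; nlinarith [h2.1, h2.2]⟩

omit S ht in
theorem sumGap_mem (ω : Ω) : (R.trace ω).sumGap p t ∈ Icc (0 : ℝ) (2 * p.H) :=
  sum_mem_Icc_of_mem fun _ _ => ⟨le_max_left _ _, max_le zero_le_two (min_le_right _ _)⟩

omit ht in
theorem sumVar_mem (ω : Ω) : (R.trace ω).sumVar p M t ∈ Icc (0 : ℝ) (1 * p.H) :=
  sum_mem_Icc_of_mem fun h hh => by
    have hh0 := Finset.mem_Icc.1 hh
    refine ⟨EpisodicMDP.cvar_nonneg _, ?_⟩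
    have := EpisodicMDP.cvar_le (M := M) (h := h) (M.measurable_target h (measurable_optV_succ h))
      (M.target_mem (S.optV_mem (Finset.mem_Icc.2 (by omega)))) ((R.trace ω).z t h)
    norm_num at this
    exact this

end EpisodeSums

theorem measurable_pathRegret (ht : t ∈ Finset.Icc 1 p.T) :
    Measurable[R.hist t M.H] fun ω => (R.trace ω).pathRegret M t := by
  have hH := S.H_eq
  have hHp := S.adm.H_pos
  refine Measurable.sub ?_ (Finset.measurable_sum _ fun h hh => ?_)
  · exact ((EpisodicMDP.measurable_optV le_rfl).comp (R.measurable_x ht (Finset.mem_Icc.2 (by omega)))).mono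
      (R.hist_le_hist_of_le (by omega) le_rfl) le_rfl
  · have hh' := hh
    rw [← hH] at hh'
    have hh0 := Finset.mem_Icc.1 hh
    exact (EpisodicMDP.measurable_reward M h).comp
      (((R.measurable_z S ht hh').mono (R.hist_pred_le_last S hh') le_rfl).prodMk
      ((R.x_meas t ht h hh0.2).mono (R.hist_le_hist_of_le hh0.2 le_rfl) le_rfl))

theorem pathRegret_mem (ω : Ω) : (R.trace ω).pathRegret M t ∈ Icc (-(p.H : ℝ)) 1 := by
  have hH := S.H_eq
  have hHp := S.adm.H_pos
  have h1 := S.optV_mem (h := 1) (Finset.mem_Icc.2 (by omega)) ((R.trace ω).x t 1)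
  have h2 : ∑ h ∈ Finset.Icc 1 M.H, ((R.trace ω).data M h).r t ∈ Icc 0 (1 * (M.H : ℝ)) :=
    sum_mem_Icc_of_mem fun h _ => M.reward_mem h _ _ _
  rw [← hH] at h2
  unfold Trace.pathRegret
  rw [← hH]
  constructor <;> linarith [h1.1, h1.2, h2.1, h2.2]

theorem integrable_pathRegret (ht : t ∈ Finset.Icc 1 p.T) :
    Integrable (fun ω => (R.trace ω).pathRegret M t) P :=
  integrable_of_measurable_mem (R.hist_le _ _) (R.measurable_pathRegret S ht) (R.pathRegret_mem S)

/-- The regret is the sum of the conditional expectations of the regrets along the paths. -/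
theorem regret_ae_eq : R.regret =ᵐ[P] fun ω =>
    ∑ t ∈ Finset.Icc 1 p.T, (P[fun ω => (R.trace ω).pathRegret M t | R.hist (t - 1) M.H]) ω := by
  have hH := S.H_eq
  have hHp := S.adm.H_pos
  have key : ∀ᵐ ω ∂P, ∀ t ∈ Finset.Icc 1 p.T,
      (P[fun ω' => M.optV 1 ((R.trace ω').x t 1) - R.value t ω' | R.hist (t - 1) M.H]) ω =
      (P[fun ω => (R.trace ω).pathRegret M t | R.hist (t - 1) M.H]) ω := by
    refine (Finset.eventually_all _).2 fun t ht => ?_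
    have ht0 := Finset.mem_Icc.1 ht
    have i1 : Integrable (fun ω => M.optV 1 ((R.trace ω).x t 1)) P :=
      integrable_of_measurable_mem (R.hist_le t 0)
        ((EpisodicMDP.measurable_optV le_rfl).comp (R.measurable_x ht (h := 1) (Finset.mem_Icc.2 (by omega))))
        fun ω => S.optV_mem (h := 1) (Finset.mem_Icc.2 (by omega)) _
    have i2 : Integrable (fun ω => ∑ h ∈ Finset.Icc 1 M.H, ((R.trace ω).data M h).r t) P := by
      have := i1.sub (R.integrable_pathRegret S ht)
      convert this using 1
      funext ω
      simp [Trace.pathRegret]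
    have h1 := condExp_sub (m := R.hist (t - 1) M.H) (μ := P) i1
      (integrable_condExp (m := R.hist t 0)
        (f := fun ω => ∑ h ∈ Finset.Icc 1 M.H, ((R.trace ω).data M h).r t))
    have h2 := condExp_sub (μ := P) i1 i2 (R.hist (t - 1) M.H)
    have h3 := condExp_condExp_of_le (μ := P)
      (f := fun ω => ∑ h ∈ Finset.Icc 1 M.H, ((R.trace ω).data M h).r t)
      (R.hist_pred_le (h := 0) ht0.1 (by omega)) (R.hist_le t 0)
    filter_upwards [h1, h2, h3] with ω h1 h2 h3
    change (P[(fun ω => M.optV 1 ((R.trace ω).x t 1)) - R.value t | R.hist (t - 1) M.H]) ω =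
      (P[(fun ω => M.optV 1 ((R.trace ω).x t 1)) -
        fun ω => ∑ h ∈ Finset.Icc 1 M.H, ((R.trace ω).data M h).r t | R.hist (t - 1) M.H]) ω
    rw [h2, Pi.sub_apply, ← h3]
    exact h1
  filter_upwards [key] with ω h
  exact Finset.sum_congr rfl h

/-- Serves for the episodes left out of the analysis, and when there are few episodes. -/
theorem condExp_pathRegret_le_one : ∀ᵐ ω ∂P, ∀ t ∈ Finset.Icc 1 p.T,
    (P[fun ω => (R.trace ω).pathRegret M t | R.hist (t - 1) M.H]) ω ≤ 1 := by
  refine (Finset.eventually_all _).2 fun t ht => ?_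
  have := condExp_mono (m := R.hist (t - 1) M.H) (R.integrable_pathRegret S ht)
    (integrable_const (1 : ℝ)) (Filter.Eventually.of_forall fun ω => (R.pathRegret_mem S ω).2)
  rw [condExp_const (R.hist_le _ _)] at this
  exact this

end VOQLRun

end

/-! ### From conditional expectations to observed sums -/

section

variable {X : Type u} {A : Type v} [mX : MeasurableSpace X] [mA : MeasurableSpace A]
  [Countable A] [Nonempty A] [MeasurableSingletonClass A]
  {M : EpisodicMDP X A} {F : ℕ → Finset (X × A → ℝ)} {W : Finset (X × A → ℝ)}
  {B : BonusOracle X A} {p : VOQLParams} {C : ℝ} {u : ℕ → ℝ}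
  {Ω : Type w} {mΩ : MeasurableSpace Ω} {P : Measure Ω} [IsProbabilityMeasure P]

/-- The conclusions of the probabilistic part of the analysis; `l` is the logarithm of the inverse
failure probability. -/
structure RunGood (M : EpisodicMDP X A) (F : ℕ → Finset (X × A → ℝ)) (W : Finset (X × A → ℝ))
    (p : VOQLParams) (u : ℕ → ℝ) (τ : Trace X A) (regret l : ℝ) : Prop where
  regression : RegressionGood M F W p τ
  regret_le : regret ≤ 2 + 2 * ∑ t ∈ Finset.Ico 2 p.T, τ.sumErr₁ p t +
    2 * ∑ t ∈ Finset.Ico 2 p.T, τ.sumExploreErr p u t -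
    (∑ t ∈ Finset.Ico 2 p.T, τ.switchGain p u t) / 2 + 9 * p.H * l
  gap_le : ∑ t ∈ Finset.Ico 2 p.T, τ.sumGap p t ≤ 4 * p.H * ∑ t ∈ Finset.Ico 2 p.T, τ.sumErr₁ p t +
    8 * p.H * ∑ t ∈ Finset.Ico 2 p.T, τ.sumErr₂ p t + 26 * p.H ^ 2 * l +
    2 * p.H ^ 2 * ∑ t ∈ Finset.Ico 2 p.T, min (u t) 2
  var_le : ∑ t ∈ Finset.Ico 2 p.T, τ.sumVar p M t ≤ 4 * p.T + p.H * l

namespace VOQLRun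

variable (R : VOQLRun M F B p u P) (S : VOQLSetup M F W B p C) {t h : ℕ}
include S

theorem measurableSet_forall_stepGood (ht : t ∈ Finset.Icc 2 p.T) :
    MeasurableSet[R.hist (t - 1) M.H]
      {ω | ∀ h ∈ Finset.Icc 1 p.H, StepGood M p (R.trace ω) t h} := by
  have e : {ω | ∀ h ∈ Finset.Icc 1 p.H, StepGood M p (R.trace ω) t h} =
      ⋂ h ∈ Finset.Icc 1 p.H, {ω | StepGood M p (R.trace ω) t h} := by ext; simp
  rw [e]
  exact Finset.measurableSet_biInter _ fun h hh => R.measurableSet_stepGood S ht hh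

/-- The path inequality holds on an event determined by the earlier episodes, so it can be averaged
given them, and the noise disappears. -/
theorem condExp_pathRegret_le (ht : t ∈ Finset.Ico 2 p.T) (hu : 0 ≤ u t) :
    ∀ᵐ ω ∂P, (∀ h ∈ Finset.Icc 1 p.H, StepGood M p (R.trace ω) t h) →
      (P[fun ω => (R.trace ω).pathRegret M t | R.hist (t - 1) M.H]) ω ≤
        (P[fun ω => (R.trace ω).sumErr₁ p t | R.hist (t - 1) M.H]) ω +
        (P[fun ω => (R.trace ω).sumExploreErr p u t | R.hist (t - 1) M.H]) ω -
        (P[fun ω => (R.trace ω).switchGain p u t | R.hist (t - 1) M.H]) ω := by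
  have ht2 : t ∈ Finset.Icc 2 p.T := by rw [Finset.mem_Ico] at ht; exact Finset.mem_Icc.2 (by omega)
  have ht1 : t ∈ Finset.Icc 1 p.T := by rw [Finset.mem_Ico] at ht; exact Finset.mem_Icc.2 (by omega)
  have iA := integrable_of_measurable_mem (P := P) (R.hist_le _ _) (R.measurable_sumErr₁ S ht2)
    (R.sumErr₁_mem S ht2)
  have iE := integrable_of_measurable_mem (P := P) (R.hist_le _ _) (R.measurable_sumExploreErr S ht2)
    (R.sumExploreErr_mem S ht2)
  have iG := integrable_of_measurable_mem (P := P) (R.hist_le _ _) (R.measurable_switchGain S ht2)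
    (R.switchGain_mem hu)
  have hN : CondCentered (R.hist (t - 1) M.H) P fun ω => -1 * ∑ h ∈ Finset.Icc 1 p.H,
      (R.trace ω).noise M t h ((R.trace ω).vNext p u t h) :=
    (CondCentered.sum fun h hh => R.condCentered_noise S ht1 hh (R.finiteValued_vNext S ht1 hh)
      (fun ω => (R.isVOQL ω).measurable_vNext S ht1 hh)
      fun ω x => (R.isVOQL ω).vNext_mem S ht1 hh x).const_mul _
  have h1 := condExp_le_of_le_add (R.hist_le _ _) (R.measurableSet_forall_stepGood S ht2)
    (R.integrable_pathRegret S ht1) ((iA.add iE).sub iG) hN fun ω hω => by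
      have := (R.isVOQL ω).optV_sub_sum_reward_le S ht2 hu hω
      simp only [Pi.sub_apply, Pi.add_apply]
      unfold Trace.pathRegret Trace.sumErr₁ Trace.sumExploreErr Trace.switchGain
      rw [← S.H_eq]
      linarith
  filter_upwards [h1, condExp_sub (iA.add iE) iG (R.hist (t - 1) M.H),
    condExp_add iA iE (R.hist (t - 1) M.H)] with ω h1 h2 h3 hω
  have := h1 hω
  rw [h2, Pi.sub_apply, h3] at this
  exact this

/-- Each of the `H` gaps is bounded by the errors of the whole episode and `H` thresholds; hence the
factors `H` and `H ^ 2`. -/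
theorem condExp_sumGap_le (ht : t ∈ Finset.Ico 2 p.T) (hu : 0 ≤ u t) :
    ∀ᵐ ω ∂P, (∀ h ∈ Finset.Icc 1 p.H, StepGood M p (R.trace ω) t h) →
      (P[fun ω => (R.trace ω).sumGap p t | R.hist (t - 1) M.H]) ω ≤
        p.H * (P[fun ω => (R.trace ω).sumErr₁ p t | R.hist (t - 1) M.H]) ω +
        2 * p.H * (P[fun ω => (R.trace ω).sumErr₂ p t | R.hist (t - 1) M.H]) ω +
        p.H ^ 2 * min (u t) 2 := by
  have ht2 : t ∈ Finset.Icc 2 p.T := by rw [Finset.mem_Ico] at ht; exact Finset.mem_Icc.2 (by omega)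
  have ht1 : t ∈ Finset.Icc 1 p.T := by rw [Finset.mem_Ico] at ht; exact Finset.mem_Icc.2 (by omega)
  have iA := integrable_of_measurable_mem (P := P) (R.hist_le _ _) (R.measurable_sumErr₁ S ht2)
    (R.sumErr₁_mem S ht2)
  have iE := integrable_of_measurable_mem (P := P) (R.hist_le _ _) (R.measurable_sumErr₂ S ht2)
    (R.sumErr₂_mem S ht2)
  have iG := integrable_of_measurable_mem (P := P) (R.hist_le _ _) (R.measurable_sumGap S ht2)
    R.sumGap_mem
  have hN : CondCentered (R.hist (t - 1) M.H) P fun ω => ∑ h ∈ Finset.Icc 1 p.H,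
      ∑ k ∈ Finset.Ico h (p.H + 1), ((R.trace ω).noise M t k ((R.trace ω).vNeg₂ p t (k + 1)) -
        (R.trace ω).noise M t k ((R.trace ω).v₂ p t (k + 1))) := by
    refine CondCentered.sum fun h hh => CondCentered.sum fun k hk => ?_
    rw [Finset.mem_Icc] at hh
    rw [Finset.mem_Ico] at hk
    have hH := S.H_eq
    have hk1 : k ∈ Finset.Icc 1 p.H := Finset.mem_Icc.2 (by omega)
    have hk' : k + 1 ∈ Finset.Icc 1 (p.H + 1) := Finset.mem_Icc.2 (by omega)
    have hle := R.hist_pred_le (t := t) (h := k - 1) (Finset.mem_Icc.1 ht1).1 (by omega)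
    exact (R.condCentered_noise S ht1 hk1 ((R.finiteValued_vNeg₂ S ht1 hk').mono hle)
      (fun ω => (R.isVOQL ω).measurable_vNeg₂ S ht1 hk')
      fun ω x => (R.isVOQL ω).vNeg₂_mem S ht1 hk' x).sub
      (R.condCentered_noise S ht1 hk1 ((R.finiteValued_v₂ S ht1 hk').mono hle)
      (fun ω => (R.isVOQL ω).measurable_v₂ S ht1 hk')
      fun ω x => (R.isVOQL ω).v₂_mem S ht1 hk' x)
  have h1 := condExp_le_of_le_add (R.hist_le _ _) (R.measurableSet_forall_stepGood S ht2)
    iG (((iA.smul (p.H : ℝ)).add (iE.smul (2 * p.H : ℝ))).add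
      (integrable_const ((p.H : ℝ) ^ 2 * min (u t) 2))) hN fun ω hω => by
      have e : (R.trace ω).sumGap p t = ∑ h ∈ Finset.Icc 1 p.H, (R.trace ω).gap p t h :=
        Finset.sum_congr rfl fun h hh => by
          rw [min_eq_left ((R.isVOQL ω).gap_le_two S ht2 hh (hω h hh)),
            max_eq_right ((R.isVOQL ω).gap_nonneg S ht2 hh (hω h hh))]
      have h2 := Finset.sum_le_sum fun h hh => (R.isVOQL ω).gap_le S ht2 hu hω (h := h) hh
      rw [Finset.sum_add_distrib, Finset.sum_const, Nat.card_Icc, nsmul_eq_mul, Nat.add_sub_cancel] at h2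
      have e2 : ∑ k ∈ Finset.Icc 1 p.H, ((R.trace ω).err₁ p t k ((R.trace ω).z t k) +
          2 * (R.trace ω).err₂ p t k ((R.trace ω).z t k)) =
          (R.trace ω).sumErr₁ p t + 2 * (R.trace ω).sumErr₂ p t := by
        rw [Finset.sum_add_distrib, ← Finset.mul_sum]; rfl
      rw [e2] at h2
      simp only [Pi.add_apply, Pi.smul_apply, smul_eq_mul]
      rw [e]
      linarith
  filter_upwards [h1, condExp_add ((iA.smul (p.H : ℝ)).add (iE.smul (2 * p.H : ℝ)))
      (integrable_const ((p.H : ℝ) ^ 2 * min (u t) 2)) (R.hist (t - 1) M.H),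
    condExp_add (iA.smul (p.H : ℝ)) (iE.smul (2 * p.H : ℝ)) (R.hist (t - 1) M.H),
    condExp_smul (μ := P) (p.H : ℝ) (fun ω => (R.trace ω).sumErr₁ p t) (R.hist (t - 1) M.H),
    condExp_smul (μ := P) (2 * p.H : ℝ) (fun ω => (R.trace ω).sumErr₂ p t) (R.hist (t - 1) M.H)]
    with ω h1 h2 h3 h4 h5 hω
  have := h1 hω
  rw [h2, Pi.add_apply, h3, Pi.add_apply, h4, h5, condExp_const (R.hist_le _ _)] at this
  exact this

theorem condExp_sumVar_le (ht : t ∈ Finset.Icc 2 p.T) :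
    ∀ᵐ ω ∂P, (P[fun ω => (R.trace ω).sumVar p M t | R.hist (t - 1) M.H]) ω ≤ 2 := by
  have ht1 : t ∈ Finset.Icc 1 p.T := by rw [Finset.mem_Icc] at ht ⊢; omega
  have iV := integrable_of_measurable_mem (P := P) (R.hist_le _ _) (R.measurable_sumVar S ht)
    (R.sumVar_mem S)
  have hN : CondCentered (R.hist (t - 1) M.H) P fun ω => ∑ h ∈ Finset.Icc 1 p.H,
      (3 * (R.trace ω).noise M t h (M.optV (h + 1)) - (R.trace ω).noiseSq M t h (M.optV (h + 1))) := by
    refine CondCentered.sum fun h hh => ?_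
    have hh' : h + 1 ∈ Finset.Icc 1 (p.H + 1) := by rw [Finset.mem_Icc] at hh ⊢; omega
    exact ((R.condCentered_noise S ht1 hh (FiniteValued.const (M.optV (h + 1)))
      (fun _ => measurable_optV_succ h) fun _ => S.optV_mem hh').const_mul 3).sub
      (R.condCentered_noiseSq S ht1 hh (measurable_optV_succ h) (S.optV_mem hh'))
  have h1 := condExp_le_of_le_add (R.hist_le _ _) MeasurableSet.univ iV (integrable_const (2 : ℝ)) hN
    fun ω _ => IsVOQL.sum_cvar_le S (R.trace ω) t
  filter_upwards [h1] with ω h1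
  have := h1 (mem_univ _)
  rwa [condExp_const (R.hist_le _ _)] at this

omit S in
/-- Concentration of a sum over the episodes around the sum of its conditional expectations. -/
theorem measure_condExp_sum_gt_le {Y : ℕ → Ω → ℝ} {K q r : ℝ} (hK : 0 < K)
    (hqr : ∀ x ∈ Icc (0 : ℝ) 1, Real.exp (q * x) ≤ 1 + r * x)
    (hY : ∀ t ∈ Finset.Ico 2 p.T, Measurable[R.hist t M.H] (Y t))
    (hb : ∀ t ∈ Finset.Ico 2 p.T, ∀ ω, Y t ω ∈ Icc 0 K) (l : ℝ) :
    P.real {ω | K * l < ∑ t ∈ Finset.Ico 2 p.T,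
      (q * Y t ω - r * (P[Y t | R.hist (t - 1) M.H]) ω)} ≤ Real.exp (-l) := by
  refine measure_condExp_sum_gt_le_exp (m := fun s => R.hist (s - 1) M.H) hK hqr
    (fun s => R.hist_le _ _) (fun s hs s' hs' hlt => ?_)
    (fun s hs => (hY s hs).mono (R.hist_le _ _) le_rfl) hb (fun s hs s' hs' hlt => ?_) l
  · rw [Finset.mem_Ico] at hs
    exact R.hist_le_hist_of_lt (by omega) le_rfl le_rfl
  · refine (hY s hs).mono ?_ le_rfl
    rcases (show s ≤ s' - 1 by omega).eq_or_lt with h | h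
    · rw [← h]
    · exact R.hist_le_hist_of_lt h le_rfl le_rfl

/-- Six concentration bounds fail with probability at most `δ / 12` each, the regression bounds with
`δ / 2`. Errors, bounded later along the observed path, replace their conditional means; gaps and
variances, bounded in conditional mean, are carried to the observed path; the switching gain is
bounded below by half its observed value. -/
theorem measure_not_runGood_le (hu : ∀ t ∈ Finset.Ico 2 p.T, 0 ≤ u t) :
    P.real {ω | ¬ RunGood M F W p u (R.trace ω) (R.regret ω) (Real.log (12 / p.δ))} ≤ p.δ := by
  have hδ := S.adm.δ_pos
  have hH1 := S.adm.one_le_H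
  set l := Real.log (12 / p.δ) with hl
  have hexp : Real.exp (-l) = p.δ / 12 := by
    rw [hl, ← Real.log_inv, Real.exp_log (by positivity), inv_div]
  have hT : ∀ t ∈ Finset.Ico 2 p.T, t ∈ Finset.Icc 2 p.T := fun t ht => by
    rw [Finset.mem_Ico] at ht; exact Finset.mem_Icc.2 (by omega)
  have hH2 : (0 : ℝ) < 2 * p.H := by linarith
  have c1 := R.measure_condExp_sum_gt_le hH2 (fun x => exp_neg_le_one_sub_half)
    (fun t ht => R.measurable_sumErr₁ S (hT t ht)) (fun t ht => R.sumErr₁_mem S (hT t ht)) l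
  have c2 := R.measure_condExp_sum_gt_le hH2 (fun x => exp_neg_le_one_sub_half)
    (fun t ht => R.measurable_sumErr₂ S (hT t ht)) (fun t ht => R.sumErr₂_mem S (hT t ht)) l
  have c3 := R.measure_condExp_sum_gt_le hH2 (fun x => exp_neg_le_one_sub_half)
    (fun t ht => R.measurable_sumExploreErr S (hT t ht))
    (fun t ht => R.sumExploreErr_mem S (hT t ht)) l
  have c4 := R.measure_condExp_sum_gt_le zero_lt_two (fun x => exp_le_one_add_two_mul)
    (fun t ht => R.measurable_switchGain S (hT t ht)) (fun t ht => R.switchGain_mem (hu t ht)) l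
  have c5 := R.measure_condExp_sum_gt_le hH2 (fun x => exp_le_one_add_two_mul)
    (fun t ht => R.measurable_sumGap S (hT t ht)) (fun t ht => R.sumGap_mem) l
  have c6 := R.measure_condExp_sum_gt_le (show (0 : ℝ) < 1 * p.H by linarith)
    (fun x => exp_le_one_add_two_mul)
    (fun t ht => R.measurable_sumVar S (hT t ht)) (fun t ht => R.sumVar_mem S) l
  have c7 := R.measure_not_regressionGood_le S
  rw [hexp] at c1 c2 c3 c4 c5 c6
  have a1 : ∀ᵐ ω ∂P, ∀ t ∈ Finset.Ico 2 p.T, _ :=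
    (Finset.eventually_all _).2 fun t ht => R.condExp_pathRegret_le S ht (hu t ht)
  have a2 : ∀ᵐ ω ∂P, ∀ t ∈ Finset.Ico 2 p.T, _ :=
    (Finset.eventually_all _).2 fun t ht => R.condExp_sumGap_le S ht (hu t ht)
  have a3 : ∀ᵐ ω ∂P, ∀ t ∈ Finset.Ico 2 p.T, _ :=
    (Finset.eventually_all _).2 fun t ht => R.condExp_sumVar_le S (hT t ht)
  have hall := a1.and (a2.and (a3.and ((R.regret_ae_eq S).and (R.condExp_pathRegret_le_one S))))
  have hnull := (congrArg ENNReal.toReal (ae_iff.1 hall)).le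
  rw [ENNReal.toReal_zero, ← measureReal_def] at hnull
  refine (measureReal_mono (s₂ := (((_ ∪ _) ∪ (_ ∪ _)) ∪ (_ ∪ _)) ∪ (_ ∪ _)) ?_ (measure_ne_top _ _)).trans
    ((measureReal_union_le _ _).trans (add_le_add ((measureReal_union_le _ _).trans
      (add_le_add ((measureReal_union_le _ _).trans (add_le_add ((measureReal_union_le _ _).trans
      (add_le_add c1 c2)) ((measureReal_union_le _ _).trans (add_le_add c3 c4))))
      ((measureReal_union_le _ _).trans (add_le_add c5 c6)))) ((measureReal_union_le _ _).trans
      (add_le_add c7 hnull)))) |>.trans ?_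
  · intro ω hω
    by_contra hcon
    simp only [mem_union, mem_ofPred_eq, not_or, not_not, not_lt] at hcon
    obtain ⟨⟨⟨⟨d1, d2⟩, d3, d4⟩, d5, d6⟩, d7, e1, e2, e3, e4, e5⟩ := hcon
    refine hω ?_
    have hst : ∀ t ∈ Finset.Ico 2 p.T, ∀ h ∈ Finset.Icc 1 p.H, StepGood M p (R.trace ω) t h :=
      fun t ht h hh => (R.isVOQL ω).stepGood_of_regressionGood S d7 ht hh
    rw [Finset.sum_sub_distrib, ← Finset.mul_sum, ← Finset.mul_sum] at d1 d2 d3 d4 d5 d6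
    have s1 := Finset.sum_le_sum fun t ht => e1 t ht (hst t ht)
    have s2 := Finset.sum_le_sum fun t ht => e2 t ht (hst t ht)
    have s3 := Finset.sum_le_sum fun t ht => e3 t ht
    rw [Finset.sum_sub_distrib, Finset.sum_add_distrib] at s1
    rw [Finset.sum_add_distrib, Finset.sum_add_distrib, ← Finset.mul_sum, ← Finset.mul_sum,
      ← Finset.mul_sum] at s2
    rw [Finset.sum_const, Nat.card_Ico, nsmul_eq_mul] at s3
    have hTc : ((p.T - 2 : ℕ) : ℝ) ≤ p.T := by exact_mod_cast Nat.sub_le _ _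
    -- At most two episodes lie outside `Ico 2 p.T`, each of regret at most `1`.
    have hreg : R.regret ω ≤ 2 + ∑ t ∈ Finset.Ico 2 p.T,
        (P[fun ω => (R.trace ω).pathRegret M t | R.hist (t - 1) M.H]) ω := by
      rw [e4]
      have hsub : Finset.Ico 2 p.T ⊆ Finset.Icc 1 p.T := fun t ht => by
        rw [Finset.mem_Ico] at ht; exact Finset.mem_Icc.2 (by omega)
      rw [← Finset.sum_sdiff hsub]
      refine add_le_add_left ((Finset.sum_le_card_nsmul _ _ 1 fun t ht =>
        e5 t (Finset.mem_sdiff.1 ht).1).trans ?_) _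
      have hT1 := S.adm.T_pos
      rw [Finset.card_sdiff_of_subset hsub, Nat.card_Icc, Nat.card_Ico, nsmul_eq_mul, mul_one]
      exact_mod_cast (by omega : p.T + 1 - 1 - (p.T - 2) ≤ 2)
    have hl0 : 0 ≤ l := Real.log_nonneg ((one_le_div hδ).2 (by linarith [S.adm.δ_le]))
    have hHl : l ≤ p.H * l := le_mul_of_one_le_left hl0 hH1
    refine ⟨d7, ?_, ?_, ?_⟩
    · linarith
    · have f1 := mul_le_mul_of_nonneg_left d1 hH2.le
      have f2 := mul_le_mul_of_nonneg_left d2 hH2.le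
      have f3 : (p.H : ℝ) * l ≤ p.H ^ 2 * l := by
        rw [pow_two, mul_assoc]; exact le_mul_of_one_le_left (by positivity) hH1
      nlinarith
    · linarith
  · linarith

end VOQLRun

end

/-! ### Logarithms, radii, and sums of distances -/

section

namespace VOQLParams

/-- `log (𝒩 T H / δ)` -/
noncomputable def logN (p : VOQLParams) : ℝ := Real.log (p.N * p.T * p.H / p.δ)

/-- `log (𝒩 𝒩_b T H / δ)` -/
noncomputable def logNb (p : VOQLParams) : ℝ := Real.log (p.N * p.Nb * p.T * p.H / p.δ)

/-- `log (𝒩 T H / δ) + T² H ε` -/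
noncomputable def logNε (p : VOQLParams) : ℝ := p.logN + (p.T : ℝ) ^ 2 * p.H * p.ε

/-- A constant, depending on the range `L` only, that dominates the logarithmic terms. -/
noncomputable def logConst (L : ℝ) : ℝ := Real.log (16384 * L ^ 3) + 5

namespace Admissible

variable {p : VOQLParams} (hp : p.Admissible)
include hp

theorem eight_le_ratio {n : ℝ} (hn : 1 ≤ n) : 8 ≤ n * p.T * p.H / p.δ := by
  have hδ := hp.δ_pos
  rw [le_div_iff₀ hδ, mul_assoc]
  have h1 := hp.one_le_TH
  have h2 := hp.δ_le
  nlinarith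

theorem two_le_logN : 2 ≤ p.logN :=
  two_le_log_of_eight_le (hp.eight_le_ratio (by linarith [hp.two_le_N']))

theorem logN_le_logNb : p.logN ≤ p.logNb := by
  have hδ := hp.δ_pos
  have h1 := hp.eight_le_ratio (n := p.N) (by linarith [hp.two_le_N'])
  refine Real.log_le_log (by linarith) ?_
  gcongr
  exact le_mul_of_one_le_right (by linarith [hp.two_le_N']) hp.one_le_Nb'

theorem logN_le_logNε : p.logN ≤ p.logNε := by
  have := hp.eps_nonneg
  unfold logNε
  have : 0 ≤ (p.T : ℝ) ^ 2 * p.H * p.ε := by positivity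
  linarith

theorem five_le_logConst : 5 ≤ logConst p.L := by
  have := one_le_pow₀ hp.one_le_L (n := 3)
  have := Real.log_nonneg (show 1 ≤ 16384 * p.L ^ 3 by linarith)
  unfold logConst
  linarith

/-- The argument is at most `16384 L³` times the fifth power of `n T H / δ`, whose logarithm is at
least `2`; so the constant can be absorbed into the multiple. -/
theorem log_le_logConst_mul {n c : ℝ} (hn : 1 ≤ n) (hc0 : 0 < c)
    (hc : c ≤ 4096 * p.L ^ 3 * p.T ^ 4 * p.H ^ 2) :
    Real.log (n * c / p.δth) ≤ logConst p.L * Real.log (n * p.T * p.H / p.δ) := by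
  have hδ := hp.δ_pos
  have hδ1 : p.δ ≤ 1 := hp.δ_le.trans (by norm_num)
  have hL := hp.one_le_L
  have hT := hp.one_le_T
  have hH := hp.one_le_H
  have h8 := hp.eight_le_ratio hn
  have hlog := two_le_log_of_eight_le h8
  have hth0 := hp.δth_pos
  have hth : 1 / p.δth ≤ 4 * p.T * p.H / p.δ := by
    unfold δth
    rw [one_div_div]
    exact div_le_div_of_nonneg_right (by nlinarith) hδ.le
  have h1 : n * c / p.δth ≤ 16384 * p.L ^ 3 * (n * p.T * p.H / p.δ) ^ 5 := by
    have hδ5 : p.δ ^ 5 ≤ p.δ := pow_le_of_le_one hδ.le hδ1 (by norm_num)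
    calc n * c / p.δth = n * c * (1 / p.δth) := by ring
      _ ≤ n * (4096 * p.L ^ 3 * p.T ^ 4 * p.H ^ 2) * (4 * p.T * p.H / p.δ) := by
        have : 0 ≤ 1 / p.δth := by positivity
        gcongr
      _ = 16384 * p.L ^ 3 * (n ^ 1 * p.T ^ 5 * p.H ^ 3 / p.δ) := by ring
      _ ≤ 16384 * p.L ^ 3 * (n ^ 5 * p.T ^ 5 * p.H ^ 5 / p.δ ^ 5) := by
        gcongr <;> first | assumption | norm_num
      _ = _ := by ring
  have h2 : (1 : ℝ) ≤ 16384 * p.L ^ 3 := by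
    have := one_le_pow₀ hL (n := 3); linarith
  have h3 := Real.log_le_log (by have := hp.δth_pos; positivity) h1
  rw [Real.log_mul (by linarith) (by positivity), Real.log_pow] at h3
  have h4 := Real.log_nonneg h2
  unfold logConst
  push_cast at h3
  nlinarith

theorem peel_le : p.peel ≤ 4096 * p.L ^ 3 * p.T ^ 4 * p.H ^ 2 := by
  have hL := hp.one_le_L
  have hT := hp.one_le_T
  have hH := hp.one_le_H
  obtain ⟨h1, h2⟩ := hp.log_aux
  have e1 : (1 : ℝ) ≤ p.L ^ 2 * p.T ^ 3 * p.H := one_le_mul_of_one_le_of_one_le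
    (one_le_mul_of_one_le_of_one_le (one_le_pow₀ hL) (one_le_pow₀ hT)) hH
  have e2 : (1 : ℝ) ≤ p.L * p.T * p.H :=
    one_le_mul_of_one_le_of_one_le (one_le_mul_of_one_le_of_one_le hL hT) hH
  have h3 := Real.log_le_sub_one_of_pos (show 0 < 16 * p.L ^ 2 * p.T ^ 3 * p.H by positivity)
  have h4 := Real.log_le_sub_one_of_pos (show 0 < 8 * p.L * p.T * p.H by positivity)
  rw [hp.peel_eq]
  calc (Real.log (16 * p.L ^ 2 * p.T ^ 3 * p.H) + 2) * (Real.log (8 * p.L * p.T * p.H) + 2)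
      ≤ (32 * (p.L ^ 2 * p.T ^ 3 * p.H)) * (16 * (p.L * p.T * p.H)) :=
        mul_le_mul (by linarith) (by linarith) (by linarith) (by positivity)
    _ = 512 * (p.L ^ 3 * p.T ^ 4 * p.H ^ 2) := by ring
    _ ≤ _ := by
      have : 0 ≤ p.L ^ 3 * p.T ^ 4 * p.H ^ 2 := by positivity
      linarith

theorem log_term_le {c : ℝ} (hc : 18 ≤ c) (hc' : c ≤ 32) :
    (2 * Real.log (c * p.L * p.T) + 2) * (Real.log (c * p.L) + 2) ≤
      4096 * p.L ^ 3 * p.T ^ 4 * p.H ^ 2 := by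
  have hL := hp.one_le_L
  have hT := hp.one_le_T
  have hH := hp.one_le_H
  have e1 : 18 ≤ c * p.L := by nlinarith
  have e2 : 18 ≤ c * p.L * p.T := by nlinarith
  have h3 := Real.log_le_sub_one_of_pos (show 0 < c * p.L * p.T by linarith)
  have h4 := Real.log_le_sub_one_of_pos (show 0 < c * p.L by linarith)
  have h5 := Real.log_nonneg (show 1 ≤ c * p.L by linarith)
  calc (2 * Real.log (c * p.L * p.T) + 2) * (Real.log (c * p.L) + 2)
      ≤ (2 * (c * p.L * p.T)) * (2 * (c * p.L)) :=
        mul_le_mul (by linarith) (by linarith) (by linarith) (by linarith)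
    _ = 4 * c ^ 2 * (p.L ^ 2 * p.T ^ 1 * 1) := by ring
    _ ≤ 4 * 32 ^ 2 * (p.L ^ 3 * p.T ^ 4 * p.H ^ 2) := by
      gcongr <;> first | assumption | exact one_le_pow₀ hH | exact Nat.one_le_cast.1 hH | norm_num
    _ = _ := by ring

theorem upsilon_sq_le_logN : p.υ ^ 2 ≤ 2 * logConst p.L * p.logN := by
  have hN := hp.two_le_N'
  have hδ := hp.δ_pos
  have hT := hp.one_le_T
  have hH := hp.one_le_H
  have h5 := hp.five_le_logConst
  rw [hp.upsilon_sq]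
  have h1 := hp.log_le_logConst_mul (n := (p.N : ℝ) ^ 2) (one_le_pow₀ (by linarith))
    (by linarith [hp.peel_ge_sixteen]) hp.peel_le
  have h2 : Real.log ((p.N : ℝ) ^ 2 * p.T * p.H / p.δ) ≤ 2 * p.logN := by
    unfold logN
    rw [show (2 : ℝ) * Real.log (p.N * p.T * p.H / p.δ) =
      (2 : ℕ) * Real.log (p.N * p.T * p.H / p.δ) by norm_num, ← Real.log_pow]
    refine Real.log_le_log (by positivity) ?_
    have h4 := hp.eight_le_ratio (n := 1) le_rfl
    rw [one_mul] at h4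
    calc (p.N : ℝ) ^ 2 * p.T * p.H / p.δ = p.N ^ 2 * (1 * (p.T * p.H / p.δ)) := by ring
      _ ≤ p.N ^ 2 * ((p.T * p.H / p.δ) * (p.T * p.H / p.δ)) := by gcongr; linarith
      _ = _ := by ring
  nlinarith

theorem iota_sq_le_logNb : p.ι ^ 2 ≤ 9 * logConst p.L * p.logNb := by
  rw [hp.iota_sq, mul_assoc 9]
  exact mul_le_mul_of_nonneg_left (hp.log_le_logConst_mul hp.one_le_NNb
    (by linarith [hp.peel_ge_sixteen]) hp.peel_le) (show (0 : ℝ) ≤ 9 by norm_num)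

theorem iotaDot_sq_le_logNb : p.ιDot ^ 2 ≤ 2 * logConst p.L * p.logNb := by
  rw [hp.iotaDot_sq, mul_assoc 2]
  exact mul_le_mul_of_nonneg_left (hp.log_le_logConst_mul hp.one_le_NNb
    (by linarith [hp.log_term_ge (c := 18) le_rfl]) (hp.log_term_le le_rfl (by norm_num)))
    (show (0 : ℝ) ≤ 2 by norm_num)

theorem iotaPrime_sq_le_logNb : p.ιPrime ^ 2 ≤ 2 * logConst p.L * p.logNb := by
  rw [hp.iotaPrime_sq, mul_assoc 2]
  exact mul_le_mul_of_nonneg_left (hp.log_le_logConst_mul hp.one_le_NNb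
    (by linarith [hp.log_term_ge (c := 32) (by norm_num)])
    (hp.log_term_le (by norm_num) le_rfl)) (show (0 : ℝ) ≤ 2 by norm_num)

theorem log_twelve_div_le : Real.log (12 / p.δ) ≤ 2 * p.logN := by
  have hN := hp.two_le_N'
  have hδ := hp.δ_pos
  have hTH := hp.one_le_TH
  unfold logN
  rw [show (2 : ℝ) * Real.log (p.N * p.T * p.H / p.δ) =
    (2 : ℕ) * Real.log (p.N * p.T * p.H / p.δ) by norm_num, ← Real.log_pow]
  refine Real.log_le_log (by positivity) ?_
  have h1 : 2 ≤ (p.N * p.T * p.H : ℝ) := by rw [mul_assoc]; nlinarith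
  have h2 : 11 ≤ 1 / p.δ := by rw [le_div_iff₀ hδ]; linarith [hp.δ_le]
  calc 12 / p.δ ≤ 2 ^ 2 * (11 * (1 / p.δ)) := by
        have : 0 ≤ 1 / p.δ := by positivity
        have e : 12 / p.δ = 12 * (1 / p.δ) := by ring
        linarith
    _ ≤ (p.N * p.T * p.H : ℝ) ^ 2 * (1 / p.δ * (1 / p.δ)) := by gcongr
    _ = _ := by ring

/-- The radii, in the regime where `T H ε ≤ 1`. -/
theorem radii_le (hε : p.T * p.H * p.ε ≤ 1) {t : ℕ} (ht : t ≤ p.T) :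
    p.β₁ t ^ 2 + 1 ≤ 700 * p.L * (logConst p.L + 1) * p.logNε ∧
    p.β₂ t ^ 2 + 1 ≤ 700 * p.L * (logConst p.L + 1) * p.logNb ∧
    p.βBar t ^ 2 + 1 ≤ 700 * p.L * (logConst p.L + 1) * p.logNb := by
  have hL := hp.one_le_L
  have hT := hp.one_le_T
  have hH := hp.one_le_H
  have hε0 := hp.eps_nonneg
  have hk := hp.five_le_logConst
  have hN := hp.two_le_logN
  have hNb := hp.logN_le_logNb
  have htT : (t : ℝ) ≤ p.T := by exact_mod_cast ht
  have hTε : t * p.ε ≤ 1 := by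
    have : (t : ℝ) * p.ε ≤ p.T * p.H * p.ε :=
      mul_le_mul_of_nonneg_right (htT.trans (le_mul_of_one_le_right (by linarith) hH)) hε0
    linarith
  have htε : 0 ≤ t * p.ε := by positivity
  have e1 : 0 ≤ (p.L - 1) * logConst p.L * p.logNb :=
    mul_nonneg (mul_nonneg (by linarith) (by linarith)) (by linarith)
  have e2 : 0 ≤ (p.L - 1) * p.logNb := mul_nonneg (by linarith) (by linarith)
  have e3 : t * p.ε * p.L ≤ p.L * p.logNb := by
    have h1 : t * p.ε * p.L ≤ 1 * p.L := mul_le_mul_of_nonneg_right hTε (by linarith)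
    nlinarith
  refine ⟨?_, ?_, ?_⟩
  · have h1 := hp.beta₁_sq_le t
    have h2 := hp.upsilon_sq_le_logN
    have h3 : 8 * t * p.L / p.α ^ 2 * p.ε ≤ 8 * p.L * ((p.T : ℝ) ^ 2 * p.H * p.ε) := by
      rw [hp.α_sq, div_div_eq_mul_div, div_one]
      calc 8 * t * p.L * (p.T * p.H) * p.ε ≤ 8 * p.T * p.L * (p.T * p.H) * p.ε := by gcongr
        _ = _ := by ring
    have h4 : p.logNε = p.logN + (p.T : ℝ) ^ 2 * p.H * p.ε := rfl
    have h5 : 0 ≤ (p.T : ℝ) ^ 2 * p.H * p.ε := by positivity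
    rw [h4, mul_add]
    have h6 : 0 ≤ (p.L - 1) * logConst p.L * p.logN :=
      mul_nonneg (mul_nonneg (by linarith) (by linarith)) (by linarith)
    have h7 : 0 ≤ p.L * p.logN := mul_nonneg (by linarith) (by linarith)
    have h8 : 0 ≤ p.L * logConst p.L * ((p.T : ℝ) ^ 2 * p.H * p.ε) :=
      mul_nonneg (mul_nonneg (by linarith) (by linarith)) h5
    have h9 : 0 ≤ p.L * ((p.T : ℝ) ^ 2 * p.H * p.ε) := mul_nonneg (by linarith) h5
    have h10 : 0 ≤ logConst p.L * p.logN := mul_nonneg (by linarith) (by linarith)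
    have h11 : 2 ≤ p.L * p.logN := by nlinarith
    nlinarith
  · rw [hp.beta₂_sq]
    have h2 := hp.iotaDot_sq_le_logNb
    have h3 := mul_le_mul_of_nonneg_left h2 (show 0 ≤ 2 * (24 * p.L + 21) by linarith)
    nlinarith
  · rw [hp.betaBar_sq]
    have h2 := hp.iotaPrime_sq_le_logNb
    have h3 := mul_le_mul_of_nonneg_left h2 (show 0 ≤ 8 * (11 * p.L + 9) by linarith)
    nlinarith

end Admissible

end VOQLParams

section EluderSums

/-- A Cauchy–Schwarz bound for distances whose truncated squares have a bounded sum. -/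
theorem sum_mul_le_of_min {ι : Type*} (I : Finset ι) {e D σ : ι → ℝ} {L K : ℝ} (hL : 0 ≤ L)
    (he : ∀ i ∈ I, e i ∈ Icc (0 : ℝ) 1) (hD : ∀ i ∈ I, D i ∈ Icc 0 L) (hσ : ∀ i ∈ I, 0 < σ i)
    (hK : ∑ i ∈ I, min 1 (1 / σ i ^ 2 * D i ^ 2) ≤ K) :
    ∑ i ∈ I, e i * D i ≤ √(∑ i ∈ I, (e i * σ i) ^ 2) * √K + L * K := by
  set ρ : ι → ℝ := fun i => min 1 (1 / σ i ^ 2 * D i ^ 2) with hρ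
  have hρ0 : ∀ i, 0 ≤ ρ i := fun i => le_min zero_le_one (by positivity)
  -- If `D ≤ σ`, then `D = σ √ρ` and Cauchy–Schwarz applies. Otherwise `ρ = 1`, and `D ≤ L` is
  -- charged to the sum of the `ρ`.
  have h1 : ∀ i ∈ I, e i * D i ≤ (e i * σ i) * √(ρ i) + L * ρ i := by
    intro i hi
    have e0 := he i hi
    have d0 := hD i hi
    have s0 := hσ i hi
    rcases le_total (1 / σ i ^ 2 * D i ^ 2) 1 with h | h
    · have hs : √(ρ i) = D i / σ i := by
        simp only [hρ]
        rw [min_eq_right h, show 1 / σ i ^ 2 * D i ^ 2 = (D i / σ i) ^ 2 by ring,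
          Real.sqrt_sq (div_nonneg d0.1 s0.le)]
      rw [hs, mul_assoc, mul_div_cancel₀ _ s0.ne']
      linarith [mul_nonneg hL (hρ0 i)]
    · have hs : ρ i = 1 := min_eq_left h
      rw [hs, Real.sqrt_one]
      have : e i * D i ≤ 1 * L := mul_le_mul e0.2 d0.2 d0.1 zero_le_one
      have : 0 ≤ e i * σ i := mul_nonneg e0.1 s0.le
      linarith
  calc ∑ i ∈ I, e i * D i ≤ ∑ i ∈ I, ((e i * σ i) * √(ρ i) + L * ρ i) := Finset.sum_le_sum h1
    _ = ∑ i ∈ I, (e i * σ i) * √(ρ i) + L * ∑ i ∈ I, ρ i := by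
      rw [Finset.sum_add_distrib, Finset.mul_sum]
    _ ≤ √(∑ i ∈ I, (e i * σ i) ^ 2) * √(∑ i ∈ I, √(ρ i) ^ 2) + L * ∑ i ∈ I, ρ i :=
      add_le_add_left (Real.sum_mul_le_sqrt_mul_sqrt _ _ _) _
    _ ≤ _ := by
      have h2 : ∑ i ∈ I, √(ρ i) ^ 2 = ∑ i ∈ I, ρ i :=
        Finset.sum_congr rfl fun i _ => Real.sq_sqrt (hρ0 i)
      rw [h2]
      gcongr

end EluderSums

variable {X : Type u} {A : Type v} [MeasurableSpace X] [MeasurableSpace A]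
  [Countable A] [Nonempty A] [MeasurableSingletonClass A]
  {M : EpisodicMDP X A} {F : ℕ → Finset (X × A → ℝ)} {W : Finset (X × A → ℝ)}
  {B : BonusOracle X A} {p : VOQLParams} {C : ℝ} {u : ℕ → ℝ} {τ : Trace X A}

namespace Trace

/-- `D_{F^h}(z_t^h; z_{[t-1]}^h, σ̄_{[t-1]}^h)` -/
noncomputable def dist (τ : Trace X A) (M : EpisodicMDP X A) (F : ℕ → Finset (X × A → ℝ)) (t h : ℕ) : ℝ :=
  wdist (F h) 1 (τ.data M h).z (fun s => τ.σbar s h) t (τ.z t h)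

/-- `D_{F^h}(z_t^h; z_{[t-1]}^h, 1)` -/
noncomputable def distOne (τ : Trace X A) (M : EpisodicMDP X A) (F : ℕ → Finset (X × A → ℝ))
    (t h : ℕ) : ℝ :=
  wdist (F h) 1 (τ.data M h).z (fun _ => 1) t (τ.z t h)

end Trace

namespace IsVOQL

variable (S : VOQLSetup M F W B p C) (hv : IsVOQL M F B p u τ)
include S hv

/-- One Cauchy–Schwarz inequality for all levels together, so that the total weight `∑ σ̄²` appears;
its main part will be of order `T` instead of `T H`. -/
theorem sum_dist_le : ∑ t ∈ Finset.Ico 2 p.T, ∑ h ∈ Finset.Icc 1 p.H, τ.dist M F t h ≤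
    √(∑ t ∈ Finset.Ico 2 p.T, ∑ h ∈ Finset.Icc 1 p.H, τ.σbar t h ^ 2) * √(p.H * p.avgDim F) +
      p.L * (p.H * p.avgDim F) := by
  have hH := S.adm.one_le_H
  have hL := S.adm.one_le_L
  have hdim : ∑ t ∈ Finset.Ico 2 p.T, ∑ h ∈ Finset.Icc 1 p.H,
      min 1 (1 / τ.σbar t h ^ 2 * τ.dist M F t h ^ 2) ≤ p.H * p.avgDim F := by
    unfold VOQLParams.avgDim
    rw [← mul_assoc, mul_one_div_cancel (by linarith), one_mul, Finset.sum_comm]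
    refine Finset.sum_le_sum fun h hh => ?_
    refine le_trans (Finset.sum_le_sum_of_subset_of_nonneg (t := Finset.Icc 1 p.T) (fun t ht => ?_)
      fun t _ _ => le_min zero_le_one (by positivity)) ?_
    · rw [Finset.mem_Ico] at ht; exact Finset.mem_Icc.2 (by omega)
    · have := sum_le_eluderDim (F := F h) (lam := p.lam) (zs := (τ.data M h).z)
        (σ := fun s => τ.σbar s h) (α := p.α) (T := p.T) fun s hs => hv.alpha_le hs hh
      refine le_trans (le_of_eq (Finset.sum_congr rfl fun t _ => ?_)) this
      unfold Trace.dist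
      rw [wdist_sq one_pos, S.adm.lam_eq]
      rfl
  have h1 := sum_mul_le_of_min (Finset.Ico 2 p.T ×ˢ Finset.Icc 1 p.H) (e := fun _ => 1)
    (D := fun i => τ.dist M F i.1 i.2) (σ := fun i => τ.σbar i.1 i.2) (L := p.L)
    (K := p.H * p.avgDim F) (by linarith) (fun _ _ => ⟨zero_le_one, le_rfl⟩)
    (fun i hi => ⟨wdist_nonneg, wdist_le (by linarith) fun f hf =>
      S.F_mem (Finset.mem_product.1 hi).2 hf⟩)
    (fun i hi => S.adm.α_pos.trans_le (hv.alpha_le (by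
      have := (Finset.mem_product.1 hi).1
      rw [Finset.mem_Ico] at this; exact Finset.mem_Icc.2 (by omega)) (Finset.mem_product.1 hi).2))
    (by rw [Finset.sum_product]; exact hdim)
  simpa only [Finset.sum_product, one_mul] using h1

/-- The factors `e` will either be identically `1` or select the levels of exploration. -/
theorem sum_distOne_le {e : ℕ → ℕ → ℝ} (he : ∀ t h, e t h ∈ Icc (0 : ℝ) 1) :
    ∑ t ∈ Finset.Ico 2 p.T, ∑ h ∈ Finset.Icc 1 p.H, e t h * τ.distOne M F t h ≤
    √(∑ t ∈ Finset.Ico 2 p.T, ∑ h ∈ Finset.Icc 1 p.H, e t h ^ 2) * √(p.H * p.avgDim F) +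
      p.L * (p.H * p.avgDim F) := by
  have hH := S.adm.one_le_H
  have hL := S.adm.one_le_L
  have hdim : ∑ t ∈ Finset.Ico 2 p.T, ∑ h ∈ Finset.Icc 1 p.H,
      min 1 (1 / 1 ^ 2 * τ.distOne M F t h ^ 2) ≤ p.H * p.avgDim F := by
    unfold VOQLParams.avgDim
    rw [← mul_assoc, mul_one_div_cancel (by linarith), one_mul, Finset.sum_comm]
    refine Finset.sum_le_sum fun h hh => ?_
    refine le_trans (Finset.sum_le_sum_of_subset_of_nonneg (t := Finset.Icc 1 p.T) (fun t ht => ?_)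
      fun t _ _ => le_min zero_le_one (by positivity)) ?_
    · rw [Finset.mem_Ico] at ht; exact Finset.mem_Icc.2 (by omega)
    · have := sum_le_eluderDim (F := F h) (lam := p.lam) (zs := (τ.data M h).z)
        (σ := fun _ => 1) (α := p.α) (T := p.T) fun s hs => S.adm.α_le_one
      refine le_trans (le_of_eq (Finset.sum_congr rfl fun t _ => ?_)) this
      unfold Trace.distOne
      rw [wdist_sq one_pos, S.adm.lam_eq]
      rfl
  have h1 := sum_mul_le_of_min (Finset.Ico 2 p.T ×ˢ Finset.Icc 1 p.H) (e := fun i => e i.1 i.2)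
    (D := fun i => τ.distOne M F i.1 i.2) (σ := fun _ => 1) (L := p.L)
    (K := p.H * p.avgDim F) (by linarith) (fun _ _ => he _ _)
    (fun i hi => ⟨wdist_nonneg, wdist_le (by linarith) fun f hf =>
      S.F_mem (Finset.mem_product.1 hi).2 hf⟩)
    (fun _ _ => one_pos) (by rw [Finset.sum_product]; exact hdim)
  simpa only [Finset.sum_product, mul_one] using h1

end IsVOQL

end

/-! ### Solving the recursive inequalities -/

section

section Arithmetic

theorem monomial_le_monomial {x y w q : ℝ} (hx : 1 ≤ x) (hy : 1 ≤ y) (hw : 1 ≤ w) (hq : 1 ≤ q)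
    {a b c d a' b' c' d' : ℕ} (ha : a ≤ a') (hb : b ≤ b') (hc : c ≤ c') (hd : d ≤ d') :
    x ^ a * y ^ b * w ^ c * q ^ d ≤ x ^ a' * y ^ b' * w ^ c' * q ^ d' := by
  gcongr

variable {k x y w q τ s e a b l U Γ v : ℝ}

/-- Solving the quadratic inequality for the total weight `s²`. -/
theorem sq_weight_le (hk : 1 ≤ k) (hx : 1 ≤ x) (hy : 1 ≤ y) (hw : 1 ≤ w) (hq : 1 ≤ q) (hτ : 1 ≤ τ)
    (hs0 : 0 ≤ s) (he : 0 ≤ e)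
    (ha : a ≤ k * (x * s * w * q + x * w ^ 2 * q ^ 2 + e * w ^ 2 * x + 1))
    (hb : b ≤ k * (y * w ^ 2 * τ * q + y * w ^ 2 * q ^ 2 + e * w ^ 2 * y + 1))
    (hl : l ≤ k * y ^ 2)
    (hU : U ≤ k * (τ * x * y ^ 2 * w ^ 5 * q + e * x * w ^ 4 + w ^ 2))
    (hΓ : Γ ≤ k * (w ^ 2 * a + w ^ 2 * b + w ^ 4 * l + w ^ 4 * U))
    (hv : v ≤ k * (τ ^ 2 + w ^ 2 * l))
    (hs : s ^ 2 ≤ k * (v + y ^ 2 * Γ + y * (w ^ 2 * τ * q + w ^ 2 * q ^ 2) + 1 +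
      y ^ 2 * (s * w * q + w ^ 2 * q ^ 2))) :
    s ^ 2 ≤ 38 * k ^ 6 * (τ ^ 2 + (w ^ 9 * y ^ 4 * x * q) ^ 2 + e * w ^ 8 * y ^ 4 * x) := by
  have mono : ∀ a b c d a' b' c' d' : ℕ, a ≤ a' → b ≤ b' → c ≤ c' → d ≤ d' →
      x ^ a * y ^ b * w ^ c * q ^ d ≤ x ^ a' * y ^ b' * w ^ c' * q ^ d' :=
    fun a b c d a' b' c' d' h1 h2 h3 h4 => monomial_le_monomial hx hy hw hq h1 h2 h3 h4
  -- The exponents of all monomials below are dominated by those of `Z ^ 2`, `τ * Z` or `E`, so each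
  -- is at most `P`; those containing `s` are at most `s * Z`.
  set Z := w ^ 9 * y ^ 4 * x * q with hZ
  set E := e * w ^ 8 * y ^ 4 * x with hE
  set P := τ ^ 2 + Z ^ 2 + E with hP
  have hZ0 : 0 ≤ Z := by positivity
  have hE0 : 0 ≤ E := by positivity
  have hZP : Z ^ 2 ≤ P := by rw [hP]; nlinarith only [hE0, sq_nonneg τ]
  have hEP : E ≤ P := by rw [hP]; nlinarith only [sq_nonneg τ, sq_nonneg Z]
  have hτZ : τ * Z ≤ P := by rw [hP]; nlinarith only [hE0, sq_nonneg (τ - Z), sq_nonneg τ, sq_nonneg Z]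
  have hP0 : 0 ≤ P := hE0.trans hEP
  have hsZ : 0 ≤ s * Z := by positivity
  have mZ : ∀ a b c d : ℕ, a ≤ 2 → b ≤ 8 → c ≤ 18 → d ≤ 2 →
      x ^ a * y ^ b * w ^ c * q ^ d ≤ P := fun a b c d h1 h2 h3 h4 =>
    ((mono a b c d 2 8 18 2 h1 h2 h3 h4).trans (by rw [hZ]; ring_nf; exact le_rfl)).trans hZP
  have mS : ∀ a b c d : ℕ, a ≤ 1 → b ≤ 4 → c ≤ 9 → d ≤ 1 →
      s * (x ^ a * y ^ b * w ^ c * q ^ d) ≤ s * Z := fun a b c d h1 h2 h3 h4 =>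
    mul_le_mul_of_nonneg_left ((mono a b c d 1 4 9 1 h1 h2 h3 h4).trans
      (by rw [hZ]; ring_nf; exact le_rfl)) hs0
  have mT : ∀ a b c d : ℕ, a ≤ 1 → b ≤ 4 → c ≤ 9 → d ≤ 1 →
      τ * (x ^ a * y ^ b * w ^ c * q ^ d) ≤ P := fun a b c d h1 h2 h3 h4 =>
    (mul_le_mul_of_nonneg_left ((mono a b c d 1 4 9 1 h1 h2 h3 h4).trans
      (by rw [hZ]; ring_nf; exact le_rfl)) (by linarith only [hk, hτ])).trans hτZ
  have mE : ∀ a b c : ℕ, a ≤ 1 → b ≤ 4 → c ≤ 8 →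
      e * (x ^ a * y ^ b * w ^ c) ≤ P := fun a b c h1 h2 h3 => by
    have := mono a b c 0 1 4 8 0 h1 h2 h3 le_rfl
    rw [pow_zero, mul_one, mul_one] at this
    exact ((mul_le_mul_of_nonneg_left this he).trans (by rw [hE]; ring_nf; exact le_rfl)).trans hEP
    -- the terms of `y² Γ`
  have ha' : y ^ 2 * w ^ 2 * a ≤ k * (s * Z + 3 * P) := by
    calc y ^ 2 * w ^ 2 * a ≤ y ^ 2 * w ^ 2 * _ := mul_le_mul_of_nonneg_left ha (by positivity)
      _ = k * (s * (x ^ 1 * y ^ 2 * w ^ 3 * q ^ 1) + x ^ 1 * y ^ 2 * w ^ 4 * q ^ 2 +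
          e * (x ^ 1 * y ^ 2 * w ^ 4) + x ^ 0 * y ^ 2 * w ^ 2 * q ^ 0) := by ring
      _ ≤ _ := by
        refine mul_le_mul_of_nonneg_left ?_ (by linarith only [hk, hτ])
        linarith only [mS 1 2 3 1 (by simp) (by simp) (by simp) (by simp),
          mZ 1 2 4 2 (by simp) (by simp) (by simp) (by simp),
          mE 1 2 4 (by simp) (by simp) (by simp), mZ 0 2 2 0 (by simp) (by simp) (by simp) (by simp)]
  have hb' : y ^ 2 * w ^ 2 * b ≤ k * (4 * P) := by
    calc y ^ 2 * w ^ 2 * b ≤ y ^ 2 * w ^ 2 * _ := mul_le_mul_of_nonneg_left hb (by positivity)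
      _ = k * (τ * (x ^ 0 * y ^ 3 * w ^ 4 * q ^ 1) + x ^ 0 * y ^ 3 * w ^ 4 * q ^ 2 +
          e * (x ^ 0 * y ^ 3 * w ^ 4) + x ^ 0 * y ^ 2 * w ^ 2 * q ^ 0) := by ring
      _ ≤ _ := by
        refine mul_le_mul_of_nonneg_left ?_ (by linarith only [hk, hτ])
        linarith only [mT 0 3 4 1 (by simp) (by simp) (by simp) (by simp),
          mZ 0 3 4 2 (by simp) (by simp) (by simp) (by simp),
          mE 0 3 4 (by simp) (by simp) (by simp), mZ 0 2 2 0 (by simp) (by simp) (by simp) (by simp)]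
  have hl' : y ^ 2 * w ^ 4 * l ≤ k * P := by
    calc y ^ 2 * w ^ 4 * l ≤ y ^ 2 * w ^ 4 * _ := mul_le_mul_of_nonneg_left hl (by positivity)
      _ = k * (x ^ 0 * y ^ 4 * w ^ 4 * q ^ 0) := by ring
      _ ≤ _ := mul_le_mul_of_nonneg_left (mZ 0 4 4 0 (by simp) (by simp) (by simp) (by simp))
        (by linarith only [hk, hτ])
  have hU' : y ^ 2 * w ^ 4 * U ≤ k * (3 * P) := by
    calc y ^ 2 * w ^ 4 * U ≤ y ^ 2 * w ^ 4 * _ := mul_le_mul_of_nonneg_left hU (by positivity)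
      _ = k * (τ * (x ^ 1 * y ^ 4 * w ^ 9 * q ^ 1) + e * (x ^ 1 * y ^ 2 * w ^ 8) +
          x ^ 0 * y ^ 2 * w ^ 6 * q ^ 0) := by ring
      _ ≤ _ := by
        refine mul_le_mul_of_nonneg_left ?_ (by linarith only [hk, hτ])
        linarith only [mT 1 4 9 1 (by simp) (by simp) (by simp) (by simp),
          mE 1 2 8 (by simp) (by simp) (by simp), mZ 0 2 6 0 (by simp) (by simp) (by simp) (by simp)]
  have hΓ' : y ^ 2 * Γ ≤ k ^ 2 * (s * Z + 11 * P) := by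
    calc y ^ 2 * Γ ≤ y ^ 2 * _ := mul_le_mul_of_nonneg_left hΓ (by positivity)
      _ = k * (y ^ 2 * w ^ 2 * a + y ^ 2 * w ^ 2 * b + y ^ 2 * w ^ 4 * l + y ^ 2 * w ^ 4 * U) := by
        ring
      _ ≤ k * (k * (s * Z + 3 * P) + k * (4 * P) + k * P + k * (3 * P)) := by gcongr
      _ = _ := by ring
  have hv' : v ≤ k ^ 2 * (2 * P) := by
    have h1 : w ^ 2 * l ≤ k * P := by
      calc w ^ 2 * l ≤ w ^ 2 * _ := mul_le_mul_of_nonneg_left hl (by positivity)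
        _ = k * (x ^ 0 * y ^ 2 * w ^ 2 * q ^ 0) := by ring
        _ ≤ _ := mul_le_mul_of_nonneg_left (mZ 0 2 2 0 (by simp) (by simp) (by simp) (by simp))
          (by linarith only [hk, hτ])
    have h2 : τ ^ 2 ≤ k * P := by
      have : τ ^ 2 ≤ P := by rw [hP]; nlinarith only [hE0, sq_nonneg Z]
      exact this.trans (le_mul_of_one_le_left hP0 hk)
    calc v ≤ _ := hv
      _ ≤ k * (k * P + k * P) := by gcongr
      _ = _ := by ring
  have h3 : y * (w ^ 2 * τ * q + w ^ 2 * q ^ 2) + 1 + y ^ 2 * (s * w * q + w ^ 2 * q ^ 2) ≤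
      k ^ 2 * (s * Z + 4 * P) := by
    calc y * (w ^ 2 * τ * q + w ^ 2 * q ^ 2) + 1 + y ^ 2 * (s * w * q + w ^ 2 * q ^ 2)
        = τ * (x ^ 0 * y ^ 1 * w ^ 2 * q ^ 1) + x ^ 0 * y ^ 1 * w ^ 2 * q ^ 2 +
          x ^ 0 * y ^ 0 * w ^ 0 * q ^ 0 + (s * (x ^ 0 * y ^ 2 * w ^ 1 * q ^ 1) +
          x ^ 0 * y ^ 2 * w ^ 2 * q ^ 2) := by ring
      _ ≤ s * Z + 4 * P := by
        linarith only [mT 0 1 2 1 (by simp) (by simp) (by simp) (by simp),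
          mZ 0 1 2 2 (by simp) (by simp) (by simp) (by simp),
          mZ 0 0 0 0 (by simp) (by simp) (by simp) (by simp),
          mS 0 2 1 1 (by simp) (by simp) (by simp) (by simp),
          mZ 0 2 2 2 (by simp) (by simp) (by simp) (by simp)]
      _ ≤ _ := le_mul_of_one_le_left (by positivity) (one_le_pow₀ hk)
  have h4 : s ^ 2 ≤ k ^ 3 * (2 * (s * Z) + 17 * P) := by
    calc s ^ 2 ≤ _ := hs
      _ = k * (v + y ^ 2 * Γ + (y * (w ^ 2 * τ * q + w ^ 2 * q ^ 2) + 1 +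
        y ^ 2 * (s * w * q + w ^ 2 * q ^ 2))) := by ring
      _ ≤ k * (k ^ 2 * (2 * P) + k ^ 2 * (s * Z + 11 * P) + k ^ 2 * (s * Z + 4 * P)) := by gcongr
      _ = _ := by ring
  -- Absorbing the linear term into `s ^ 2 / 2` resolves the circularity between weights and
  -- bonuses.
  have h5 : 2 * k ^ 3 * (s * Z) ≤ s ^ 2 / 2 + 2 * k ^ 6 * Z ^ 2 := by
    nlinarith only [sq_nonneg (s - 2 * k ^ 3 * Z)]
  have h6 : k ^ 3 * P ≤ k ^ 6 * P :=
    mul_le_mul_of_nonneg_right (pow_le_pow_right₀ hk (by norm_num)) hP0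
  have h7 : k ^ 6 * Z ^ 2 ≤ k ^ 6 * P := mul_le_mul_of_nonneg_left hZP (by positivity)
  linarith only [h4, h5, h6, h7]

/-- The regret bound, from the recursive relations between the sums of the bonuses, of the gaps
and of the weights. -/
theorem regret_arithmetic {m bs su R : ℝ} (hk : 1 ≤ k) (hx : 1 ≤ x) (hy : 1 ≤ y) (hw : 1 ≤ w)
    (hq : 1 ≤ q) (hτ : 1 ≤ τ) (hs0 : 0 ≤ s) (he : 0 ≤ e)
    (ha : a ≤ k * (x * s * w * q + x * w ^ 2 * q ^ 2 + e * w ^ 2 * x + 1))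
    (hb : b ≤ k * (y * w ^ 2 * τ * q + y * w ^ 2 * q ^ 2 + e * w ^ 2 * y + 1))
    (hbs : bs ≤ k * (y * w ^ 2 * m * q + y * w ^ 2 * q ^ 2 + e * w ^ 2 * y + 1))
    (hsu : m ^ 2 * (x * y ^ 2 * w ^ 5 * q) / τ ≤ su)
    (hl : l ≤ k * y ^ 2)
    (hU : U ≤ k * (τ * x * y ^ 2 * w ^ 5 * q + e * x * w ^ 4 + w ^ 2))
    (hΓ : Γ ≤ k * (w ^ 2 * a + w ^ 2 * b + w ^ 4 * l + w ^ 4 * U))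
    (hv : v ≤ k * (τ ^ 2 + w ^ 2 * l))
    (hs : s ^ 2 ≤ k * (v + y ^ 2 * Γ + y * (w ^ 2 * τ * q + w ^ 2 * q ^ 2) + 1 +
      y ^ 2 * (s * w * q + w ^ 2 * q ^ 2)))
    (hR : R ≤ k * (1 + a + w ^ 2 * l) + 2 * bs - su / 2) :
    R ≤ 34 * k ^ 5 * (x * (τ * w * q) + x ^ 2 * (y ^ 4 * w ^ 10 * q ^ 2 + e ^ 2)) := by
  have hs2 := sq_weight_le hk hx hy hw hq hτ hs0 he ha hb hl hU hΓ hv hs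
  -- `N` is the lower-order and `G` the main term of the bound. The powers in `sq_weight_le` are
  -- such that `x w q Z = N`, while the part `τ` of `s` gives `G` and the part from `E` a geometric
  -- mean of `N` and `x e`.
  set N := x ^ 2 * y ^ 4 * w ^ 10 * q ^ 2 with hN
  set G := x * w * q * τ with hG
  have hG0 : 0 ≤ G := by positivity
  have hN1 : 0 ≤ N := by positivity
  have hxe : 0 ≤ x * e := by positivity
  have mN : ∀ a b c d : ℕ, a ≤ 2 → b ≤ 4 → c ≤ 10 → d ≤ 2 →
      x ^ a * y ^ b * w ^ c * q ^ d ≤ N := fun a b c d h1 h2 h3 h4 =>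
    monomial_le_monomial hx hy hw hq h1 h2 h3 h4
  have hkey : x * s * w * q ≤ 7 * k ^ 3 * (G + N + x * e) := by
    refine le_of_sq_le_sq ?_ (by positivity)
    calc (x * s * w * q) ^ 2 = (x * w * q) ^ 2 * s ^ 2 := by ring
      _ ≤ (x * w * q) ^ 2 * _ := mul_le_mul_of_nonneg_left hs2 (by positivity)
      _ = 38 * k ^ 6 * (G ^ 2 + N ^ 2 + N * (x * e)) := by rw [hG, hN]; ring
      _ ≤ 49 * k ^ 6 * (G + N + x * e) ^ 2 := by
        gcongr
        · norm_num
        · nlinarith only [mul_nonneg hG0 hN1, mul_nonneg hG0 hxe, mul_nonneg hN1 hxe, sq_nonneg (x * e)]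
      _ = _ := by ring
  set Bd := G + N + x ^ 2 * e ^ 2 with hBd
  have hxe2 : 0 ≤ x ^ 2 * e ^ 2 := by positivity
  have hBd0 : 0 ≤ Bd := by positivity
  have hNB : N ≤ Bd := by rw [hBd]; linarith only [hG0, hxe2]
  have mB : ∀ a b c d : ℕ, a ≤ 2 → b ≤ 4 → c ≤ 10 → d ≤ 2 →
      x ^ a * y ^ b * w ^ c * q ^ d ≤ Bd := fun a b c d h1 h2 h3 h4 =>
    (mN a b c d h1 h2 h3 h4).trans hNB
  have me : ∀ z : ℝ, z ^ 2 ≤ N → x * e * z ≤ Bd := fun z hz => by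
    nlinarith only [hz, hNB, hBd, hG0, sq_nonneg (x * e - z)]
  have e1 : x * e ≤ Bd := by
    have := me 1 (by simpa using mN 0 0 0 0 (by simp) (by simp) (by simp) (by simp))
    linarith only [this]
  have e2 : e * w ^ 2 * x ≤ Bd := by
    have := me (w ^ 2) (by
      have := mN 0 0 4 0 (by simp) (by simp) (by simp) (by simp)
      calc (w ^ 2) ^ 2 = x ^ 0 * y ^ 0 * w ^ 4 * q ^ 0 := by ring
        _ ≤ N := this)
    linarith only [this]
  have e3 : e * w ^ 2 * y ≤ Bd := by
    have := me (w ^ 2 * y) (by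
      have := mN 0 2 4 0 (by simp) (by simp) (by simp) (by simp)
      calc (w ^ 2 * y) ^ 2 = x ^ 0 * y ^ 2 * w ^ 4 * q ^ 0 := by ring
        _ ≤ N := this)
    have h1 : e * w ^ 2 * y * 1 ≤ e * w ^ 2 * y * x :=
      mul_le_mul_of_nonneg_left hx (by positivity)
    linarith only [this, h1]
  have hone : 1 ≤ Bd := by simpa using mB 0 0 0 0 (by simp) (by simp) (by simp) (by simp)
  have k1 : k ≤ k ^ 4 := le_self_pow₀ hk (by norm_num)
  have ha' : a ≤ 24 * k ^ 4 * Bd := by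
    have h1 : x * w ^ 2 * q ^ 2 ≤ Bd := by
      have := mB 1 0 2 2 (by simp) (by simp) (by simp) (by simp)
      rwa [pow_one, pow_zero, mul_one] at this
    have h2 : 7 * k ^ 3 * (G + N + x * e) ≤ 7 * k ^ 3 * (2 * Bd) :=
      mul_le_mul_of_nonneg_left (by linarith only [e1, hBd, hxe2]) (by positivity)
    have h3 : Bd ≤ k ^ 3 * Bd := le_mul_of_one_le_left hBd0 (one_le_pow₀ hk)
    calc a ≤ _ := ha
      _ ≤ k * (24 * k ^ 3 * Bd) := mul_le_mul_of_nonneg_left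
        (by linarith only [hkey, h1, h2, h3, e2, hone]) (by linarith only [hk])
      _ = _ := by ring
  have hl' : w ^ 2 * l ≤ k * Bd := by
    calc w ^ 2 * l ≤ w ^ 2 * _ := mul_le_mul_of_nonneg_left hl (by positivity)
      _ = k * (x ^ 0 * y ^ 2 * w ^ 2 * q ^ 0) := by ring
      _ ≤ _ := mul_le_mul_of_nonneg_left (mB 0 2 2 0 (by simp) (by simp) (by simp) (by simp))
        (by linarith only [hk, hτ])
  -- Exploration pays for itself: its cost is linear in `m`, the root of the number of exploring
  -- episodes, and its gain `D` is quadratic. Since `D * G` dominates the squared cost, the cost is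
  -- at most `D / 2` plus a multiple of `G`, whatever `m` is.
  have hamgm : 2 * (k * (y * w ^ 2 * m * q)) ≤
      m ^ 2 * (x * y ^ 2 * w ^ 5 * q) / τ / 2 + 2 * k ^ 2 * G := by
    set D := m ^ 2 * (x * y ^ 2 * w ^ 5 * q) / τ with hD
    have hD0 : 0 ≤ D := by positivity
    have h1 : (y * w ^ 2 * m * q) ^ 2 ≤ D * G := by
      have : D * G = (y * w ^ 2 * m * q) ^ 2 * (x ^ 2 * w ^ 2) := by
        rw [hD, hG]; field_simp
      rw [this]
      exact le_mul_of_one_le_right (sq_nonneg _)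
        (one_le_mul_of_one_le_of_one_le (one_le_pow₀ hx) (one_le_pow₀ hw))
    refine le_of_sq_le_sq ?_ (by positivity)
    have h2 := mul_le_mul_of_nonneg_left h1 (show 0 ≤ 4 * k ^ 2 by positivity)
    nlinarith only [h2, sq_nonneg (D / 2 - 2 * k ^ 2 * G)]
  have hbs' : 2 * bs - su / 2 ≤ 2 * k ^ 2 * Bd + 6 * k * Bd := by
    have h1 : y * w ^ 2 * q ^ 2 ≤ Bd := by
      have := mB 0 1 2 2 (by simp) (by simp) (by simp) (by simp)
      rwa [pow_one, pow_zero, one_mul] at this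
    have h2 : k * (y * w ^ 2 * q ^ 2 + e * w ^ 2 * y + 1) ≤ k * (3 * Bd) :=
      mul_le_mul_of_nonneg_left (by linarith only [h1, e3, hone]) (by linarith only [hk])
    have h3 : 2 * k ^ 2 * G ≤ 2 * k ^ 2 * Bd :=
      mul_le_mul_of_nonneg_left (by linarith only [hBd, hN1, hxe2]) (by positivity)
    have h4 : k * (y * w ^ 2 * m * q + y * w ^ 2 * q ^ 2 + e * w ^ 2 * y + 1) =
      k * (y * w ^ 2 * m * q) + k * (y * w ^ 2 * q ^ 2 + e * w ^ 2 * y + 1) := by ring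
    linarith only [hbs, hsu, hamgm, h2, h3, h4]
  have hfin : R ≤ 34 * k ^ 5 * Bd := by
    have h1 : k * (1 + a + w ^ 2 * l) ≤ k * (Bd + 24 * k ^ 4 * Bd + k * Bd) :=
      mul_le_mul_of_nonneg_left (by linarith only [hone, ha', hl']) (by linarith only [hk])
    have h2 : k * Bd ≤ k ^ 5 * Bd := mul_le_mul_of_nonneg_right (le_self_pow₀ hk (by norm_num)) hBd0
    have h3 : k ^ 2 * Bd ≤ k ^ 5 * Bd :=
      mul_le_mul_of_nonneg_right (pow_le_pow_right₀ hk (by norm_num)) hBd0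
    linarith only [hR, h1, h2, h3, hbs']
  calc R ≤ _ := hfin
    _ = _ := by rw [hBd, hG, hN]; ring

end Arithmetic

end

/-! ### Sums of bonuses and of squared weights -/

section

/-- A constant, depending on the range `L` only, that controls the confidence radii. -/
noncomputable def radiusConst (L : ℝ) : ℝ := √(700 * L * (VOQLParams.logConst L + 1))

theorem sqrt_add_le_of_le {β c l : ℝ} (h : β ^ 2 + 1 ≤ c * l) (hc : 0 ≤ c) :
    √(β ^ 2 + 1) ≤ √c * √l ∧ β ≤ √c * √l := by
  rw [← Real.sqrt_mul hc]
  exact ⟨Real.sqrt_le_sqrt h, Real.le_sqrt_of_sq_le (by linarith)⟩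

theorem sum_Ico_sum_Icc_const_le (T H : ℕ) {c : ℝ} (hc : 0 ≤ c) :
    ∑ _t ∈ Finset.Ico 2 T, ∑ _h ∈ Finset.Icc 1 H, c ≤ T * H * c := by
  rw [Finset.sum_const, Finset.sum_const, Nat.card_Ico, Nat.card_Icc, nsmul_eq_mul, nsmul_eq_mul,
    ← mul_assoc]
  have h1 : ((T - 2 : ℕ) : ℝ) ≤ T := by exact_mod_cast Nat.sub_le _ _
  have h2 : ((H + 1 - 1 : ℕ) : ℝ) = H := by simp
  rw [h2]
  gcongr

theorem sum_one_div_sqrt_le (T : ℕ) : ∑ t ∈ Finset.Ico 2 T, 1 / √(t : ℝ) ≤ 2 * √T := by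
  have key : ∀ n : ℕ, ∑ t ∈ Finset.Ico 2 (n + 1), 1 / √(t : ℝ) ≤ 2 * √n := by
    intro n
    induction n with
    | zero => simp
    | succ n ih =>
      rcases Nat.lt_or_ge (n + 1) 2 with h | h
      · rw [Finset.Ico_eq_empty (by omega), Finset.sum_empty]; positivity
      · rw [Finset.sum_Ico_succ_top h]
        have h1 : 0 < √((n + 1 : ℕ) : ℝ) := Real.sqrt_pos.2 (by positivity)
        have h2 := Real.sq_sqrt (show (0 : ℝ) ≤ n by positivity)
        have h3 := Real.sq_sqrt (show (0 : ℝ) ≤ (n + 1 : ℕ) by positivity)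
        push_cast at h1 h3 ih ⊢
        have h4 : 1 / √(n + 1 : ℝ) ≤ 2 * (√(n + 1 : ℝ) - √(n : ℝ)) := by
          rw [div_le_iff₀ h1]
          nlinarith [sq_nonneg (√(n + 1 : ℝ) - √(n : ℝ))]
        linarith
  cases T with
  | zero => simp
  | succ n =>
    refine (key n).trans ?_
    gcongr
    simp

variable {X : Type u} {A : Type v} [MeasurableSpace X] [MeasurableSpace A]
  [Countable A] [Nonempty A] [MeasurableSingletonClass A]
  {M : EpisodicMDP X A} {F : ℕ → Finset (X × A → ℝ)} {W : Finset (X × A → ℝ)}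
  {B : BonusOracle X A} {p : VOQLParams} {C : ℝ} {u : ℕ → ℝ} {τ : Trace X A}

theorem Trace.explore_mono (τ : Trace X A) (t : ℕ) {h h' : ℕ} (hh : h ≤ h') :
    τ.explore p u t h ≤ τ.explore p u t h' := by
  unfold Trace.explore
  split_ifs with h1 h2 h2
  · exact le_rfl
  · exact zero_le_one
  · exact absurd (fun k hk => h2 k (Finset.Icc_subset_Icc_right hh hk)) h1
  · exact le_rfl

namespace IsVOQL

variable (S : VOQLSetup M F W B p C) (hv : IsVOQL M F B p u τ)
include S hv

/-- The oracle bounds the bonus by the distance times the radius; `T H ε ≤ 1` keeps the radius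
logarithmic, up to the part of `ε` inside `Λ`, and the sum of the `2 ε` below `2`. -/
theorem sum_sumErr₁_le (hε : p.T * p.H * p.ε ≤ 1) :
    ∑ t ∈ Finset.Ico 2 p.T, τ.sumErr₁ p t ≤ 2 * C * radiusConst p.L * √p.logNε *
      (∑ t ∈ Finset.Ico 2 p.T, ∑ h ∈ Finset.Icc 1 p.H, τ.dist M F t h + p.T * p.H * p.εb) + 2 := by
  have hC := S.C_pos
  have hL := S.adm.one_le_L
  have hεb := S.adm.epsb_nonneg
  have hε0 := S.adm.eps_nonneg
  have hk := S.adm.five_le_logConst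
  set r := radiusConst p.L * √p.logNε with hr
  have hr0 : 0 ≤ r := mul_nonneg (Real.sqrt_nonneg _) (Real.sqrt_nonneg _)
  have hterm : ∀ t ∈ Finset.Ico 2 p.T, ∀ h ∈ Finset.Icc 1 p.H,
      τ.err₁ p t h (τ.z t h) ≤ 2 * C * r * τ.dist M F t h + (2 * C * r * p.εb + 2 * p.ε) := by
    intro t ht h hh
    rw [Finset.mem_Ico] at ht
    have h1 := hv.bonus₁_upper S (Finset.mem_Icc.2 ⟨ht.1, ht.2.le⟩) hh (τ.z t h)
    obtain ⟨h2, h3⟩ := sqrt_add_le_of_le (S.adm.radii_le hε ht.2.le).1 (by positivity)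
    have h4 : τ.b₁ t h (τ.z t h) ≤ C * (τ.dist M F t h * r + p.εb * r) := by
      refine h1.trans (mul_le_mul_of_nonneg_left (add_le_add ?_ ?_) hC.le)
      · exact mul_le_mul_of_nonneg_left h2 wdist_nonneg
      · exact mul_le_mul_of_nonneg_left h3 hεb
    calc τ.err₁ p t h (τ.z t h) ≤ 2 * τ.b₁ t h (τ.z t h) + 2 * p.ε := min_le_left _ _
      _ ≤ 2 * (C * (τ.dist M F t h * r + p.εb * r)) + 2 * p.ε := by linarith
      _ = _ := by ring
  calc ∑ t ∈ Finset.Ico 2 p.T, τ.sumErr₁ p t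
      ≤ ∑ t ∈ Finset.Ico 2 p.T, ∑ h ∈ Finset.Icc 1 p.H,
        (2 * C * r * τ.dist M F t h + (2 * C * r * p.εb + 2 * p.ε)) :=
        Finset.sum_le_sum fun t ht => Finset.sum_le_sum fun h hh => hterm t ht h hh
    _ = 2 * C * r * ∑ t ∈ Finset.Ico 2 p.T, ∑ h ∈ Finset.Icc 1 p.H, τ.dist M F t h +
        ∑ t ∈ Finset.Ico 2 p.T, ∑ h ∈ Finset.Icc 1 p.H, (2 * C * r * p.εb + 2 * p.ε) := by
      simp only [Finset.sum_add_distrib, Finset.mul_sum]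
    _ ≤ 2 * C * r * ∑ t ∈ Finset.Ico 2 p.T, ∑ h ∈ Finset.Icc 1 p.H, τ.dist M F t h +
        p.T * p.H * (2 * C * r * p.εb + 2 * p.ε) := by
      gcongr
      exact sum_Ico_sum_Icc_const_le _ _ (by positivity)
    _ = 2 * C * r * (∑ t ∈ Finset.Ico 2 p.T, ∑ h ∈ Finset.Icc 1 p.H, τ.dist M F t h +
        p.T * p.H * p.εb) + 2 * (p.T * p.H * p.ε) := by ring
    _ ≤ 2 * C * r * (∑ t ∈ Finset.Ico 2 p.T, ∑ h ∈ Finset.Icc 1 p.H, τ.dist M F t h +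
        p.T * p.H * p.εb) + 2 := by linarith
    _ = _ := by rw [hr]; ring

theorem sum_mul_err₂_le (hε : p.T * p.H * p.ε ≤ 1) {e : ℕ → ℕ → ℝ}
    (he : ∀ t h, e t h ∈ Icc (0 : ℝ) 1) :
    ∑ t ∈ Finset.Ico 2 p.T, ∑ h ∈ Finset.Icc 1 p.H, e t h * τ.err₂ p t h (τ.z t h) ≤
      2 * C * radiusConst p.L * √p.logNb *
      (√(∑ t ∈ Finset.Ico 2 p.T, ∑ h ∈ Finset.Icc 1 p.H, e t h ^ 2) * √(p.H * p.avgDim F) +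
        p.L * (p.H * p.avgDim F) + p.T * p.H * p.εb) + 2 := by
  have hC := S.C_pos
  have hL := S.adm.one_le_L
  have hεb := S.adm.epsb_nonneg
  have hε0 := S.adm.eps_nonneg
  have hk := S.adm.five_le_logConst
  set r := radiusConst p.L * √p.logNb with hr
  have hr0 : 0 ≤ r := mul_nonneg (Real.sqrt_nonneg _) (Real.sqrt_nonneg _)
  have hterm : ∀ t ∈ Finset.Ico 2 p.T, ∀ h ∈ Finset.Icc 1 p.H,
      e t h * τ.err₂ p t h (τ.z t h) ≤
        2 * C * r * (e t h * τ.distOne M F t h) + (2 * C * r * p.εb + 2 * p.ε) := by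
    intro t ht h hh
    rw [Finset.mem_Ico] at ht
    have h1 := hv.bonus₂_upper S (Finset.mem_Icc.2 ⟨ht.1, ht.2.le⟩) hh (τ.z t h)
    obtain ⟨h2, h3⟩ := sqrt_add_le_of_le (S.adm.radii_le hε ht.2.le).2.1 (by positivity)
    have h4 : τ.b₂ t h (τ.z t h) ≤ C * (τ.distOne M F t h * r + p.εb * r) := by
      refine h1.trans (mul_le_mul_of_nonneg_left (add_le_add ?_ ?_) hC.le)
      · exact mul_le_mul_of_nonneg_left h2 wdist_nonneg
      · exact mul_le_mul_of_nonneg_left h3 hεb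
    obtain ⟨e0, e1⟩ := he t h
    have h5 : 0 ≤ 2 * C * r * p.εb + 2 * p.ε := by positivity
    calc e t h * τ.err₂ p t h (τ.z t h) ≤ e t h * (2 * τ.b₂ t h (τ.z t h) + 2 * p.ε) :=
        mul_le_mul_of_nonneg_left (min_le_left _ _) e0
      _ ≤ e t h * (2 * (C * (τ.distOne M F t h * r + p.εb * r)) + 2 * p.ε) := by gcongr
      _ = 2 * C * r * (e t h * τ.distOne M F t h) + e t h * (2 * C * r * p.εb + 2 * p.ε) := by ring
      _ ≤ _ := by linarith [mul_le_mul_of_nonneg_right e1 h5]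
  calc ∑ t ∈ Finset.Ico 2 p.T, ∑ h ∈ Finset.Icc 1 p.H, e t h * τ.err₂ p t h (τ.z t h)
      ≤ ∑ t ∈ Finset.Ico 2 p.T, ∑ h ∈ Finset.Icc 1 p.H,
        (2 * C * r * (e t h * τ.distOne M F t h) + (2 * C * r * p.εb + 2 * p.ε)) :=
        Finset.sum_le_sum fun t ht => Finset.sum_le_sum fun h hh => hterm t ht h hh
    _ = 2 * C * r * ∑ t ∈ Finset.Ico 2 p.T, ∑ h ∈ Finset.Icc 1 p.H, e t h * τ.distOne M F t h +
        ∑ t ∈ Finset.Ico 2 p.T, ∑ h ∈ Finset.Icc 1 p.H, (2 * C * r * p.εb + 2 * p.ε) := by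
      simp only [Finset.sum_add_distrib, Finset.mul_sum]
    _ ≤ 2 * C * r * (√(∑ t ∈ Finset.Ico 2 p.T, ∑ h ∈ Finset.Icc 1 p.H, e t h ^ 2) *
          √(p.H * p.avgDim F) + p.L * (p.H * p.avgDim F)) +
        p.T * p.H * (2 * C * r * p.εb + 2 * p.ε) := by
      gcongr
      · exact hv.sum_distOne_le S he
      · exact sum_Ico_sum_Icc_const_le _ _ (by positivity)
    _ = 2 * C * r * (√(∑ t ∈ Finset.Ico 2 p.T, ∑ h ∈ Finset.Icc 1 p.H, e t h ^ 2) *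
          √(p.H * p.avgDim F) + p.L * (p.H * p.avgDim F) + p.T * p.H * p.εb) +
        2 * (p.T * p.H * p.ε) := by ring
    _ ≤ 2 * C * r * (√(∑ t ∈ Finset.Ico 2 p.T, ∑ h ∈ Finset.Icc 1 p.H, e t h ^ 2) *
          √(p.H * p.avgDim F) + p.L * (p.H * p.avgDim F) + p.T * p.H * p.εb) + 2 := by linarith
    _ = _ := by rw [hr]; ring

/-- The sum of the squared weights. -/
theorem sum_sq_weight_le (hg : RegressionGood M F W p τ) (hε : p.T * p.H * p.ε ≤ 1) :
    ∑ t ∈ Finset.Ico 2 p.T, ∑ h ∈ Finset.Icc 1 p.H, τ.σbar t h ^ 2 ≤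
      ∑ t ∈ Finset.Ico 2 p.T, τ.sumVar p M t +
      72 * VOQLParams.logConst p.L * p.logNb * ∑ t ∈ Finset.Ico 2 p.T, τ.sumGap p t +
      6 * p.L * radiusConst p.L * √p.logNb *
        ∑ t ∈ Finset.Ico 2 p.T, ∑ h ∈ Finset.Icc 1 p.H, τ.distOne M F t h +
      144 * VOQLParams.logConst p.L * p.logNb *
        ∑ t ∈ Finset.Ico 2 p.T, ∑ h ∈ Finset.Icc 1 p.H, τ.dist M F t h + 8 * p.L := by
  have hL := S.adm.one_le_L
  have hε0 := S.adm.eps_nonneg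
  have hTH := S.adm.one_le_TH
  have hk := S.adm.five_le_logConst
  have hυ := S.adm.one_le_upsilon_sq
  have hι := S.adm.iota_sq_le_logNb
  have hι1 := S.adm.one_le_iota_sq
  have hυι := S.adm.upsilon_sq_le
  have hι0 : 0 ≤ p.ι := by unfold VOQLParams.ι; positivity
  have hυ0 : 0 ≤ p.υ := Real.sqrt_nonneg _
  have hweight : (√p.υ + p.ι) ^ 2 ≤ 4 * p.ι ^ 2 := by
    have h1 : p.υ ≤ p.υ ^ 2 := by nlinarith
    nlinarith [sq_nonneg (√p.υ - p.ι), Real.sq_sqrt hυ0]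
  set ℓ := VOQLParams.logConst p.L * p.logNb with hℓ
  set r := radiusConst p.L * √p.logNb with hr
  have hr0 : 0 ≤ r := mul_nonneg (Real.sqrt_nonneg _) (Real.sqrt_nonneg _)
  have hterm : ∀ t ∈ Finset.Ico 2 p.T, ∀ h ∈ Finset.Icc 1 p.H,
      τ.σbar t h ^ 2 ≤ M.cvar h (M.target h (M.optV (h + 1))) (τ.z t h) +
        72 * ℓ * max 0 (min (τ.gap p t h) 2) + 6 * p.L * r * τ.distOne M F t h +
        144 * ℓ * τ.dist M F t h + ((5 + 2 * p.L) * p.ε + 1 / (p.T * p.H)) := by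
    intro t ht h hh
    have ht' := Finset.mem_Ico.1 ht
    have hh' := Finset.mem_Icc.1 hh
    have h1 := hv.sq_le S (t := t) (h := h) (Finset.mem_Icc.2 (by omega)) hh
    have h2 := (hv.sigmaSq_bounds S hg (hv.levelGood S hg (Finset.mem_Icc.2 (by omega))) ht hh).2
    have h3 := hv.gap_le_two S (Finset.mem_Icc.2 ⟨ht'.1, ht'.2.le⟩) hh
      (hv.stepGood_of_regressionGood S hg ht hh)
    have hbar := (sqrt_add_le_of_le (S.adm.radii_le hε ht'.2.le).2.2 (by positivity)).1
    have htwo := (sqrt_add_le_of_le (S.adm.radii_le hε ht'.2.le).2.1 (by positivity)).1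
    change √(p.βBar t ^ 2 + 1) ≤ r at hbar
    change √(p.β₂ t ^ 2 + 1) ≤ r at htwo
    rw [min_eq_left h3]
    rw [S.adm.α_sq] at h1
    change τ.σbar t h ^ 2 ≤ max 0 (τ.sigmaSq p M F t h) + 1 / (p.T * p.H) +
      2 * p.ι ^ 2 * max 0 (τ.gap p t h) + 4 * (√p.υ + p.ι) ^ 2 * τ.dist M F t h at h1
    change _ ≤ _ + 6 * τ.gap p t h + τ.distOne M F t h * _ + _ at h2
    have hD : 0 ≤ τ.dist M F t h := wdist_nonneg
    have hD1 : 0 ≤ τ.distOne M F t h := wdist_nonneg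
    have hcv := EpisodicMDP.cvar_nonneg (M := M) (h := h) (φ := M.target h (M.optV (h + 1))) (τ.z t h)
    set G := max 0 (τ.gap p t h) with hG
    have hG0 : 0 ≤ G := le_max_left _ _
    have hG1 : τ.gap p t h ≤ G := le_max_right _ _
    have h4 : τ.distOne M F t h * (2 * √(p.βBar t ^ 2 + 1) + (2 + 2 * p.L) * √(p.β₂ t ^ 2 + 1)) ≤
        6 * p.L * r * τ.distOne M F t h := by
      rw [mul_comm]
      refine mul_le_mul_of_nonneg_right ?_ hD1
      have : (2 + 2 * p.L) * √(p.β₂ t ^ 2 + 1) ≤ (2 + 2 * p.L) * r :=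
        mul_le_mul_of_nonneg_left htwo (by linarith)
      nlinarith [mul_nonneg (show 0 ≤ p.L - 1 by linarith) hr0]
    have h5 : max 0 (τ.sigmaSq p M F t h) ≤
        M.cvar h (M.target h (M.optV (h + 1))) (τ.z t h) + 6 * G +
          6 * p.L * r * τ.distOne M F t h + (5 + 2 * p.L) * p.ε :=
      max_le (by positivity) (by linarith)
    have h6 : 4 * (√p.υ + p.ι) ^ 2 * τ.dist M F t h ≤ 144 * ℓ * τ.dist M F t h :=
      mul_le_mul_of_nonneg_right (by linarith) hD
    have h7 : (6 + 2 * p.ι ^ 2) * G ≤ 72 * ℓ * G :=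
      mul_le_mul_of_nonneg_right (by linarith) hG0
    linarith
  have hconst : p.T * p.H * ((5 + 2 * p.L) * p.ε + 1 / (p.T * p.H)) ≤ 8 * p.L := by
    have h1 : (p.T * p.H : ℝ) * (1 / (p.T * p.H)) = 1 := mul_one_div_cancel (by linarith)
    have h2 : (5 + 2 * p.L) * (p.T * p.H * p.ε) ≤ (5 + 2 * p.L) * 1 :=
      mul_le_mul_of_nonneg_left hε (by linarith)
    rw [mul_add, h1]
    linarith
  calc ∑ t ∈ Finset.Ico 2 p.T, ∑ h ∈ Finset.Icc 1 p.H, τ.σbar t h ^ 2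
      ≤ ∑ t ∈ Finset.Ico 2 p.T, ∑ h ∈ Finset.Icc 1 p.H,
        (M.cvar h (M.target h (M.optV (h + 1))) (τ.z t h) +
        72 * ℓ * max 0 (min (τ.gap p t h) 2) + 6 * p.L * r * τ.distOne M F t h +
        144 * ℓ * τ.dist M F t h + ((5 + 2 * p.L) * p.ε + 1 / (p.T * p.H))) :=
        Finset.sum_le_sum fun t ht => Finset.sum_le_sum fun h hh => hterm t ht h hh
    _ = ∑ t ∈ Finset.Ico 2 p.T, τ.sumVar p M t + 72 * ℓ * ∑ t ∈ Finset.Ico 2 p.T, τ.sumGap p t +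
        6 * p.L * r * ∑ t ∈ Finset.Ico 2 p.T, ∑ h ∈ Finset.Icc 1 p.H, τ.distOne M F t h +
        144 * ℓ * ∑ t ∈ Finset.Ico 2 p.T, ∑ h ∈ Finset.Icc 1 p.H, τ.dist M F t h +
        ∑ _t ∈ Finset.Ico 2 p.T, ∑ _h ∈ Finset.Icc 1 p.H,
          ((5 + 2 * p.L) * p.ε + 1 / (p.T * p.H)) := by
      simp only [Finset.sum_add_distrib, Finset.mul_sum, Trace.sumVar, Trace.sumGap]
    _ ≤ ∑ t ∈ Finset.Ico 2 p.T, τ.sumVar p M t + 72 * ℓ * ∑ t ∈ Finset.Ico 2 p.T, τ.sumGap p t +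
        6 * p.L * r * ∑ t ∈ Finset.Ico 2 p.T, ∑ h ∈ Finset.Icc 1 p.H, τ.distOne M F t h +
        144 * ℓ * ∑ t ∈ Finset.Ico 2 p.T, ∑ h ∈ Finset.Icc 1 p.H, τ.dist M F t h + 8 * p.L := by
      gcongr
      exact (sum_Ico_sum_Icc_const_le _ _ (by positivity)).trans hconst
    _ = _ := by rw [hℓ, hr]; ring

end IsVOQL

end

/-! ### The regret bound on the good event -/

section

/-- The constant of the regret bound in the regime of many episodes; the thresholds enter
through `c`. -/
noncomputable def regretConst (L C c : ℝ) : ℝ :=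
  144 * VOQLParams.logConst L * L + 6 * L ^ 2 * radiusConst L + 2 * C * radiusConst L * L +
    26 + 2 * c + 8 * L

theorem regretConst_ge {L C c : ℝ} (hL : 1 ≤ L) (hC : 0 ≤ C) (hr : 0 ≤ radiusConst L)
    (hl : 5 ≤ VOQLParams.logConst L) (hc : 0 ≤ c) :
    144 * VOQLParams.logConst L * L ≤ regretConst L C c ∧
    6 * L ^ 2 * radiusConst L ≤ regretConst L C c ∧
    2 * C * radiusConst L * L ≤ regretConst L C c ∧ 26 ≤ regretConst L C c ∧
    2 * c ≤ regretConst L C c ∧ 8 * L ≤ regretConst L C c := by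
  have h1 : 0 ≤ 144 * VOQLParams.logConst L * L := by positivity
  have h2 : 0 ≤ 6 * L ^ 2 * radiusConst L := by positivity
  have h3 : 0 ≤ 2 * C * radiusConst L * L := by positivity
  unfold regretConst
  refine ⟨?_, ?_, ?_, ?_, ?_, ?_⟩ <;> linarith

variable {X : Type u} {A : Type v} [MeasurableSpace X] [MeasurableSpace A]
  [Countable A] [Nonempty A] [MeasurableSingletonClass A]
  {M : EpisodicMDP X A} {F : ℕ → Finset (X × A → ℝ)} {W : Finset (X × A → ℝ)}
  {B : BonusOracle X A} {p : VOQLParams} {C : ℝ} {u : ℕ → ℝ} {τ : Trace X A}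

/-- `T² H ε` is a part of `Λ`, so `Λ ≤ T` bounds it by `T`. -/
theorem VOQLParams.Admissible.eps_le_of_regime (hp : p.Admissible)
    (h : p.logNε ≤ p.T) : p.T * p.H * p.ε ≤ 1 := by
  have hT := hp.one_le_T
  have h1 := hp.two_le_logN
  unfold VOQLParams.logNε at h
  have h2 : (p.T : ℝ) * (p.T * p.H * p.ε) ≤ p.T * 1 := by
    calc (p.T : ℝ) * (p.T * p.H * p.ε) = (p.T : ℝ) ^ 2 * p.H * p.ε := by ring
      _ ≤ _ := by linarith
  exact le_of_mul_le_mul_left h2 (by linarith)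

set_option maxHeartbeats 1000000 in
/-- The regret bound on the event `RunGood`, for many episodes. -/
theorem RunGood.regret_le_bound (S : VOQLSetup M F W B p C) (hv : IsVOQL M F B p u τ) {R : ℝ}
    (hg : RunGood M F W p u τ R (Real.log (12 / p.δ))) {d c : ℝ} (hd : d = p.avgDim F) (hd1 : 1 ≤ d)
    (hc : 0 ≤ c) (hreg : √p.logNε * p.logNb * (√p.H ^ 5 * √d) ≤ √p.T)
    (hlow : ∀ t ∈ Finset.Ico 2 p.T, √p.logNε * p.logNb * (√p.H ^ 5 * √d) / √t ≤ u t)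
    (hup : ∀ t ∈ Finset.Ico 2 p.T, u t ≤ c * (√p.logNε * p.logNb * (√p.H ^ 5 * √d) / √t +
      √p.logNε * p.H ^ 2 * p.εb + p.H / p.T)) :
    R ≤ 34 * regretConst p.L C c ^ 5 * p.bound d := by
  have hC := S.C_pos
  have hL := S.adm.one_le_L
  have hT := S.adm.one_le_T
  have hH := S.adm.one_le_H
  have hεb := S.adm.epsb_nonneg
  have hL5 := S.adm.five_le_logConst
  have hN := S.adm.two_le_logN
  have hNb := S.adm.logN_le_logNb
  have hNε := S.adm.logN_le_logNε
  -- Square roots are the variables of the arithmetic, so that all exponents are integers; `n`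
  -- counts the exploring episodes.
  set x := √p.logNε with hx
  set y := √p.logNb with hy
  set w := √(p.H : ℝ) with hw
  set q := √d with hq
  set T' := √(p.T : ℝ) with hT'
  set e := p.T * p.εb with he
  set r := radiusConst p.L with hr
  set k := regretConst p.L C c with hk
  set S' := ∑ t ∈ Finset.Ico 2 p.T, ∑ h ∈ Finset.Icc 1 p.H, τ.σbar t h ^ 2 with hS'
  set s := √S' with hs
  set n := ∑ t ∈ Finset.Ico 2 p.T, τ.explore p u t p.H with hn
  have hr0 : 0 ≤ r := Real.sqrt_nonneg _
  have x2 : x ^ 2 = p.logNε := Real.sq_sqrt (by linarith)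
  have y2 : y ^ 2 = p.logNb := Real.sq_sqrt (by linarith)
  have w2 : w ^ 2 = p.H := Real.sq_sqrt (by linarith)
  have q2 : q ^ 2 = d := Real.sq_sqrt (by linarith)
  have t2 : T' ^ 2 = p.T := Real.sq_sqrt (by linarith)
  have hx1 : 1 ≤ x := Real.one_le_sqrt.2 (by linarith)
  have hy1 : 1 ≤ y := Real.one_le_sqrt.2 (by linarith)
  have hw1 : 1 ≤ w := Real.one_le_sqrt.2 hH
  have hq1 : 1 ≤ q := Real.one_le_sqrt.2 hd1
  have ht1 : 1 ≤ T' := Real.one_le_sqrt.2 hT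
  have he0 : 0 ≤ e := by positivity
  have hexp : ∀ t h, τ.explore p u t h ∈ Icc (0 : ℝ) 1 := fun t h => τ.explore_mem t h
  have hn0 : 0 ≤ n := Finset.sum_nonneg fun t _ => (hexp t _).1
  have s2 : s ^ 2 = S' := Real.sq_sqrt (by positivity)
  have m2 : √n ^ 2 = n := Real.sq_sqrt hn0
  rw [← y2] at hreg hlow hup
  have hε : p.T * p.H * p.ε ≤ 1 := by
    refine S.adm.eps_le_of_regime ?_
    rw [← x2, ← t2]
    refine pow_le_pow_left₀ (by linarith) (le_trans ?_ hreg) 2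
    have h1 : 1 ≤ y ^ 2 * (w ^ 5 * q) := one_le_mul_of_one_le_of_one_le (one_le_pow₀ hy1)
      (one_le_mul_of_one_le_of_one_le (one_le_pow₀ hw1) hq1)
    rw [mul_assoc]
    exact le_mul_of_one_le_right (by linarith) h1
  have hHd : √(p.H * p.avgDim F) = w * q := by rw [← hd, Real.sqrt_mul (by linarith)]
  have hHd' : (p.H : ℝ) * p.avgDim F = w ^ 2 * q ^ 2 := by rw [← hd, w2, q2]
  -- the sums of the bonuses
  have hdist := hv.sum_dist_le S
  rw [hHd, hHd'] at hdist
  have hdistOne := hv.sum_distOne_le S (e := fun _ _ => 1) fun _ _ => ⟨zero_le_one, le_rfl⟩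
  have ha := hv.sum_sumErr₁_le S hε
  have hb := hv.sum_mul_err₂_le S hε (e := fun _ _ => 1) fun _ _ => ⟨zero_le_one, le_rfl⟩
  have hbs := hv.sum_mul_err₂_le S hε hexp
  have hone : √(∑ t ∈ Finset.Ico 2 p.T, ∑ h ∈ Finset.Icc 1 p.H, (1 : ℝ) ^ 2) ≤ T' * w := by
    rw [hT', hw, ← Real.sqrt_mul (by linarith)]
    refine Real.sqrt_le_sqrt ?_
    simpa only [one_pow, mul_one] using sum_Ico_sum_Icc_const_le p.T p.H zero_le_one
  -- Exploration, once begun, lasts until level `H`; so at most `H n` pairs of episode and level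
  -- belong to it.
  have hexplore : √(∑ t ∈ Finset.Ico 2 p.T, ∑ h ∈ Finset.Icc 1 p.H, τ.explore p u t h ^ 2) ≤
      w * √n := by
    rw [hw, ← Real.sqrt_mul (by linarith)]
    refine Real.sqrt_le_sqrt ?_
    rw [hn, Finset.mul_sum]
    refine Finset.sum_le_sum fun t _ => ?_
    refine (Finset.sum_le_card_nsmul _ _ (τ.explore p u t p.H) fun h hh => ?_).trans_eq (by simp)
    have h1 := τ.explore_mono (p := p) (u := u) t (Finset.mem_Icc.1 hh).2
    obtain ⟨h2, h3⟩ := hexp t h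
    exact (pow_le_of_le_one h2 h3 two_ne_zero).trans h1
  simp only [one_mul] at hdistOne hb
  rw [hHd, hHd'] at hdistOne hb hbs
  have heH : (p.T : ℝ) * p.H * p.εb = e * w ^ 2 := by rw [w2, he]; ring
  rw [heH] at ha hb hbs
  obtain ⟨k1, k2, k3, k4, k5, k6⟩ := regretConst_ge hL hC.le hr0 hL5 hc
  rw [← hk] at k1 k2 k3 k4 k5 k6
  have k7 : 2 * C * r ≤ k := (le_mul_of_one_le_right (by positivity) hL).trans k3
  have hk1 : 1 ≤ k := by linarith only [k4]
  have sc : ∀ {c z : ℝ}, c ≤ k → 0 ≤ z → c * z ≤ k * z := fun h1 h2 =>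
    mul_le_mul_of_nonneg_right h1 h2
  have hs0 : 0 ≤ s := Real.sqrt_nonneg _
  set a := ∑ t ∈ Finset.Ico 2 p.T, τ.sumErr₁ p t with ha'
  have ha1 : a ≤ k * (x * s * w * q + x * w ^ 2 * q ^ 2 + e * w ^ 2 * x + 1) := by
    calc a ≤ 2 * C * r * x * (s * (w * q) + p.L * (w ^ 2 * q ^ 2) + e * w ^ 2) + 2 := by
          refine ha.trans ?_
          gcongr
      _ = 2 * C * r * (x * s * w * q) + 2 * C * r * p.L * (x * w ^ 2 * q ^ 2) +
          2 * C * r * (e * w ^ 2 * x) + 2 * 1 := by ring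
      _ ≤ k * (x * s * w * q) + k * (x * w ^ 2 * q ^ 2) + k * (e * w ^ 2 * x) + k * 1 :=
          add_le_add (add_le_add (add_le_add (sc k7 (by positivity)) (sc k3 (by positivity)))
            (sc k7 (by positivity))) (sc (by linarith only [k4]) zero_le_one)
      _ = _ := by ring
  have hb1 : ∑ t ∈ Finset.Ico 2 p.T, τ.sumErr₂ p t ≤
      k * (y * w ^ 2 * T' * q + y * w ^ 2 * q ^ 2 + e * w ^ 2 * y + 1) := by
    calc ∑ t ∈ Finset.Ico 2 p.T, τ.sumErr₂ p t
        ≤ 2 * C * r * y * (T' * w * (w * q) + p.L * (w ^ 2 * q ^ 2) + e * w ^ 2) + 2 := by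
          refine hb.trans ?_
          gcongr
      _ = 2 * C * r * (y * w ^ 2 * T' * q) + 2 * C * r * p.L * (y * w ^ 2 * q ^ 2) +
          2 * C * r * (e * w ^ 2 * y) + 2 * 1 := by ring
      _ ≤ k * (y * w ^ 2 * T' * q) + k * (y * w ^ 2 * q ^ 2) + k * (e * w ^ 2 * y) + k * 1 :=
          add_le_add (add_le_add (add_le_add (sc k7 (by positivity)) (sc k3 (by positivity)))
            (sc k7 (by positivity))) (sc (by linarith only [k4]) zero_le_one)
      _ = _ := by ring
  have hbs1 : ∑ t ∈ Finset.Ico 2 p.T, τ.sumExploreErr p u t ≤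
      k * (y * w ^ 2 * √n * q + y * w ^ 2 * q ^ 2 + e * w ^ 2 * y + 1) := by
    calc ∑ t ∈ Finset.Ico 2 p.T, τ.sumExploreErr p u t
        ≤ 2 * C * r * y * (w * √n * (w * q) + p.L * (w ^ 2 * q ^ 2) + e * w ^ 2) + 2 := by
          refine hbs.trans ?_
          gcongr
      _ = 2 * C * r * (y * w ^ 2 * √n * q) + 2 * C * r * p.L * (y * w ^ 2 * q ^ 2) +
          2 * C * r * (e * w ^ 2 * y) + 2 * 1 := by ring
      _ ≤ k * (y * w ^ 2 * √n * q) + k * (y * w ^ 2 * q ^ 2) + k * (e * w ^ 2 * y) + k * 1 :=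
          add_le_add (add_le_add (add_le_add (sc k7 (by positivity)) (sc k3 (by positivity)))
            (sc k7 (by positivity))) (sc (by linarith only [k4]) zero_le_one)
      _ = _ := by ring
  -- the thresholds
  have hT'0 : 0 < T' := by linarith only [ht1]
  -- `1 / √t ≥ 1 / √T`, and by `hreg` the cap `2` of the gain does not interfere.
  have hgain : √n ^ 2 * (x * y ^ 2 * w ^ 5 * q) / T' ≤
      ∑ t ∈ Finset.Ico 2 p.T, τ.switchGain p u t := by
    rw [m2, hn, mul_div_assoc, Finset.sum_mul]
    refine Finset.sum_le_sum fun t ht => ?_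
    unfold Trace.switchGain
    rw [mul_comm]
    refine mul_le_mul_of_nonneg_right (le_min ?_ ?_) (hexp t _).1
    · refine le_trans ?_ (hlow t ht)
      rw [mul_assoc (x * y ^ 2)]
      refine div_le_div_of_nonneg_left (by positivity) ?_ ?_
      · exact Real.sqrt_pos.2 (by exact_mod_cast (by have := Finset.mem_Ico.1 ht; omega : 0 < t))
      · exact Real.sqrt_le_sqrt (by exact_mod_cast (Finset.mem_Ico.1 ht).2.le)
    · rw [div_le_iff₀ hT'0, mul_assoc (x * y ^ 2)]
      linarith only [hreg, hT'0]
  have hU : ∑ t ∈ Finset.Ico 2 p.T, min (u t) 2 ≤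
      k * (T' * x * y ^ 2 * w ^ 5 * q + e * x * w ^ 4 + w ^ 2) := by
    have hcard : ((Finset.Ico 2 p.T).card : ℝ) ≤ p.T := by
      rw [Nat.card_Ico]; exact_mod_cast Nat.sub_le _ _
    calc ∑ t ∈ Finset.Ico 2 p.T, min (u t) 2
        ≤ ∑ t ∈ Finset.Ico 2 p.T, c * (x * y ^ 2 * (w ^ 5 * q) / √t + x * p.H ^ 2 * p.εb +
          p.H / p.T) := Finset.sum_le_sum fun t ht => (min_le_left _ _).trans (hup t ht)
      _ = c * (x * y ^ 2 * (w ^ 5 * q) * ∑ t ∈ Finset.Ico 2 p.T, 1 / √(t : ℝ) +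
          (Finset.Ico 2 p.T).card * (x * p.H ^ 2 * p.εb + p.H / p.T)) := by
        rw [← nsmul_eq_mul, ← Finset.sum_const, Finset.mul_sum, ← Finset.sum_add_distrib,
          Finset.mul_sum]
        exact Finset.sum_congr rfl fun t _ => by ring
      _ ≤ c * (x * y ^ 2 * (w ^ 5 * q) * (2 * T') +
          p.T * (x * p.H ^ 2 * p.εb + p.H / p.T)) := by
        gcongr
        exact sum_one_div_sqrt_le _
      _ = 2 * c * (T' * x * y ^ 2 * w ^ 5 * q) + c * (e * x * w ^ 4) + c * w ^ 2 := by
        rw [mul_add (p.T : ℝ), mul_div_cancel₀ _ (by linarith only [hT]), he,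
          show w ^ 4 = (p.H : ℝ) ^ 2 by rw [← w2]; ring, w2]
        ring
      _ ≤ k * (T' * x * y ^ 2 * w ^ 5 * q) + k * (e * x * w ^ 4) + k * w ^ 2 :=
        add_le_add (add_le_add (sc k5 (by positivity))
          (sc (by linarith only [k5, hc]) (by positivity)))
          (sc (by linarith only [k5, hc]) (by positivity))
      _ = _ := by ring
  set l := Real.log (12 / p.δ) with hl
  have hl0 : l ≤ 2 * p.logN := S.adm.log_twelve_div_le
  have hl1 : l ≤ k * y ^ 2 := by
    have h1 : 2 * y ^ 2 ≤ k * y ^ 2 := sc (by linarith only [k4]) (by positivity)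
    rw [y2] at h1 ⊢
    linarith only [h1, hl0, hNb]
  have hlpos : 0 ≤ l := by
    refine Real.log_nonneg ?_
    rw [le_div_iff₀ S.adm.δ_pos]
    linarith only [S.adm.δ_le]
  have ha0 : 0 ≤ a := Finset.sum_nonneg fun t ht => Finset.sum_nonneg fun h hh =>
    (hv.err₁_mem S (Finset.mem_Icc.2 ⟨(Finset.mem_Ico.1 ht).1, (Finset.mem_Ico.1 ht).2.le⟩) hh _).1
  have hb0 : 0 ≤ ∑ t ∈ Finset.Ico 2 p.T, τ.sumErr₂ p t :=
    Finset.sum_nonneg fun t ht => Finset.sum_nonneg fun h hh =>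
    (hv.err₂_mem S (Finset.mem_Icc.2 ⟨(Finset.mem_Ico.1 ht).1, (Finset.mem_Ico.1 ht).2.le⟩) hh _).1
  have hU0 : 0 ≤ ∑ t ∈ Finset.Ico 2 p.T, min (u t) 2 :=
    Finset.sum_nonneg fun t ht => le_min (le_trans (by positivity) (hlow t ht)) zero_le_two
  have hΓ := hg.gap_le
  rw [← ha', ← w2] at hΓ
  have hΓ1 : ∑ t ∈ Finset.Ico 2 p.T, τ.sumGap p t ≤ k * (w ^ 2 * a +
      w ^ 2 * ∑ t ∈ Finset.Ico 2 p.T, τ.sumErr₂ p t + w ^ 4 * l +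
      w ^ 4 * ∑ t ∈ Finset.Ico 2 p.T, min (u t) 2) := by
    refine hΓ.trans ?_
    have e1 := sc (c := 4) (z := w ^ 2 * a) (by linarith only [k4]) (by positivity)
    have e2 := sc (c := 8) (z := w ^ 2 * ∑ t ∈ Finset.Ico 2 p.T, τ.sumErr₂ p t)
      (by linarith only [k4]) (by positivity)
    have e3 := sc (c := 26) (z := w ^ 4 * l) k4 (by positivity)
    have e4 := sc (c := 2) (z := w ^ 4 * ∑ t ∈ Finset.Ico 2 p.T, min (u t) 2)
      (by linarith only [k4]) (by positivity)
    linarith only [e1, e2, e3, e4]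
  have hv1 : ∑ t ∈ Finset.Ico 2 p.T, τ.sumVar p M t ≤ k * (T' ^ 2 + w ^ 2 * l) := by
    have h1 := hg.var_le
    rw [← w2, ← t2] at h1
    have e1 := sc (c := 4) (z := T' ^ 2) (by linarith only [k4]) (by positivity)
    have e2 := sc (c := 1) (z := w ^ 2 * l) (by linarith only [k4]) (by positivity)
    linarith only [h1, e1, e2]
  have hv0 : 0 ≤ ∑ t ∈ Finset.Ico 2 p.T, τ.sumVar p M t :=
    Finset.sum_nonneg fun t _ => Finset.sum_nonneg fun h _ => EpisodicMDP.cvar_nonneg _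
  have hΓ0 : 0 ≤ ∑ t ∈ Finset.Ico 2 p.T, τ.sumGap p t :=
    Finset.sum_nonneg fun t _ => Finset.sum_nonneg fun h _ => le_max_left _ _
  have hs1 : s ^ 2 ≤ k * (∑ t ∈ Finset.Ico 2 p.T, τ.sumVar p M t +
      y ^ 2 * ∑ t ∈ Finset.Ico 2 p.T, τ.sumGap p t + y * (w ^ 2 * T' * q + w ^ 2 * q ^ 2) + 1 +
      y ^ 2 * (s * w * q + w ^ 2 * q ^ 2)) := by
    have h1 := hv.sum_sq_weight_le S hg.regression hε
    rw [← hS', ← s2, ← hy, ← y2, ← hr] at h1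
    set Γ := ∑ t ∈ Finset.Ico 2 p.T, τ.sumGap p t
    set Vs := ∑ t ∈ Finset.Ico 2 p.T, τ.sumVar p M t
    have h2 : ∑ t ∈ Finset.Ico 2 p.T, ∑ h ∈ Finset.Icc 1 p.H, τ.distOne M F t h ≤
        T' * w * (w * q) + p.L * (w ^ 2 * q ^ 2) := by
      refine hdistOne.trans ?_
      gcongr
    have c1 : 144 * VOQLParams.logConst p.L ≤ k :=
      (le_mul_of_one_le_right (by positivity) hL).trans k1
    have c2 : 6 * p.L * r ≤ k := by
      refine le_trans ?_ k2
      have : 6 * p.L * r * 1 ≤ 6 * p.L * r * p.L := mul_le_mul_of_nonneg_left hL (by positivity)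
      linarith only [this]
    calc s ^ 2 ≤ Vs + 72 * VOQLParams.logConst p.L * y ^ 2 * Γ +
          6 * p.L * r * y * (T' * w * (w * q) + p.L * (w ^ 2 * q ^ 2)) +
          144 * VOQLParams.logConst p.L * y ^ 2 * (s * (w * q) + p.L * (w ^ 2 * q ^ 2)) +
          8 * p.L := by
          refine h1.trans ?_
          gcongr
      _ = 1 * Vs + 72 * VOQLParams.logConst p.L * (y ^ 2 * Γ) + 6 * p.L * r * (y * (w ^ 2 * T' * q)) +
          6 * p.L ^ 2 * r * (y * (w ^ 2 * q ^ 2)) +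
          144 * VOQLParams.logConst p.L * (y ^ 2 * (s * w * q)) +
          144 * VOQLParams.logConst p.L * p.L * (y ^ 2 * (w ^ 2 * q ^ 2)) + 8 * p.L * 1 := by ring
      _ ≤ k * Vs + k * (y ^ 2 * Γ) + k * (y * (w ^ 2 * T' * q)) + k * (y * (w ^ 2 * q ^ 2)) +
          k * (y ^ 2 * (s * w * q)) + k * (y ^ 2 * (w ^ 2 * q ^ 2)) + k * 1 := by
        refine add_le_add (add_le_add (add_le_add (add_le_add (add_le_add (add_le_add
          (sc hk1 hv0) (sc (by linarith only [c1, hL5]) (by positivity))) (sc c2 (by positivity)))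
          (sc k2 (by positivity))) (sc c1 (by positivity))) (sc k1 (by positivity)))
          (sc k6 zero_le_one)
      _ = _ := by ring
  have hR : R ≤ k * (1 + a + w ^ 2 * l) + 2 * ∑ t ∈ Finset.Ico 2 p.T, τ.sumExploreErr p u t -
      (∑ t ∈ Finset.Ico 2 p.T, τ.switchGain p u t) / 2 := by
    have h1 := hg.regret_le
    rw [← ha', ← w2] at h1
    have e1 := sc (c := 2) (z := 1 + a) (by linarith only [k4]) (by positivity)
    have e2 := sc (c := 9) (z := w ^ 2 * l) (by linarith only [k4]) (by positivity)
    linarith only [h1, e1, e2]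
  have hfin := regret_arithmetic hk1 hx1 hy1 hw1 hq1 ht1 hs0 he0 ha1 hb1 hbs1 hgain hl1 hU hΓ1
    hv1 hs1 hR
  refine hfin.trans_eq ?_
  congr 1
  have hb : p.bound d = x * √(p.T * p.H * d) +
      p.logNε * (p.logNb ^ 2 * (p.H : ℝ) ^ 5 * d + (p.T : ℝ) ^ 2 * p.εb ^ 2) := rfl
  rw [hb, Real.sqrt_mul (by positivity), Real.sqrt_mul (by positivity), ← x2, ← y2, ← w2, ← q2, he]
  simp only [Real.sqrt_sq (Real.sqrt_nonneg _), hT', hw, hq]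
  ring

end

/-! ### Thresholds, short runs, and the final bounds -/

section

section EluderDegenerate

variable {Z : Type*}

/-- All differences vanish in such a class. This converts the assumption `d_α ≥ 1` into `𝒩 ≥ 2`. -/
theorem eluderDim_eq_zero_of_card_le_one {F : Finset (Z → ℝ)} (hF : F.card ≤ 1) (lam α : ℝ) (T : ℕ) :
    eluderDim F lam α T = 0 := by
  have h0 : ∀ zs σ t z, wdistSq F lam zs σ t z = 0 := by
    intro zs σ t z
    unfold wdistSq
    have : ∀ q : F × F, (q.1.1 z - q.2.1 z) ^ 2 /
        (∑ s ∈ Finset.Ico 1 t, 1 / σ s ^ 2 * (q.1.1 (zs s) - q.2.1 (zs s)) ^ 2 + lam) = 0 := by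
      intro q
      rw [Finset.card_le_one.1 hF q.1.1 q.1.2 q.2.1 q.2.2, sub_self]
      simp
    simp only [this]
    exact Real.iSup_const_zero
  unfold eluderDim
  simp only [h0, mul_zero, min_eq_right zero_le_one, Finset.sum_const_zero]
  exact Real.iSup_const_zero

end EluderDegenerate

namespace VOQLParams.Admissible

variable {p : VOQLParams} (hp : p.Admissible)
include hp

/-- The square of the quantity that separates long from short runs is the lower-order term of the
bound. In a short run the bound therefore exceeds `T`. -/
theorem sqrt_mul_sqrt_le_bound {d : ℝ} (hd : 1 ≤ d) :
    (√p.logNε * p.logNb * (√p.H ^ 5 * √d)) ^ 2 ≤ p.boundAcc d ∧ p.boundAcc d ≤ p.bound d ∧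
      1 ≤ p.boundAcc d := by
  have hH := hp.one_le_H
  have h1 := hp.two_le_logN
  have h2 := hp.logN_le_logNb
  have h3 := hp.logN_le_logNε
  have e1 : (√p.logNε * p.logNb * (√p.H ^ 5 * √d)) ^ 2 =
      p.logNε * (p.logNb ^ 2 * (p.H : ℝ) ^ 5 * d) := by
    rw [mul_pow, mul_pow, mul_pow, Real.sq_sqrt (by linarith), Real.sq_sqrt (by linarith), ← pow_mul,
      mul_comm 5 2, pow_mul, Real.sq_sqrt (by linarith)]
    ring
  have eAcc : p.boundAcc d = √p.logNε * √(p.T * p.H * d) +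
      p.logNε * (p.logNb ^ 2 * (p.H : ℝ) ^ 5 * d) := rfl
  have eb : p.bound d = √p.logNε * √(p.T * p.H * d) +
      p.logNε * (p.logNb ^ 2 * (p.H : ℝ) ^ 5 * d + (p.T : ℝ) ^ 2 * p.εb ^ 2) := rfl
  have h4 : 0 ≤ √p.logNε * √(p.T * p.H * d) := by positivity
  have h5 : 0 ≤ p.logNε * ((p.T : ℝ) ^ 2 * p.εb ^ 2) := mul_nonneg (by linarith) (by positivity)
  have h6 : 1 ≤ p.logNε * (p.logNb ^ 2 * (p.H : ℝ) ^ 5 * d) :=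
    one_le_mul_of_one_le_of_one_le (by linarith) (one_le_mul_of_one_le_of_one_le
      (one_le_mul_of_one_le_of_one_le (one_le_pow₀ (by linarith)) (one_le_pow₀ hH)) hd)
  refine ⟨?_, ?_, ?_⟩
  · rw [e1, eAcc]; linarith
  · rw [eAcc, eb]; linarith
  · rw [eAcc]; linarith

/-- The additional term contains `T² ε_b² ≤ K²`, and the term it is compared with contains a factor
that is at least `1`. -/
theorem bound_le_boundAcc {d K : ℝ} (hd : 1 ≤ d) (hK : p.T * p.H * p.εb ≤ K) :
    p.bound d ≤ (1 + K ^ 2) * p.boundAcc d := by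
  have hT := hp.one_le_T
  have hH := hp.one_le_H
  have hεb := hp.epsb_nonneg
  have h1 := hp.two_le_logN
  have h2 := hp.logN_le_logNb
  have h3 := hp.logN_le_logNε
  have h4 : (p.T : ℝ) ^ 2 * p.εb ^ 2 ≤ K ^ 2 := by
    rw [← mul_pow]
    refine pow_le_pow_left₀ (by positivity) (le_trans ?_ hK) 2
    exact mul_le_mul_of_nonneg_right (le_mul_of_one_le_right (by linarith) hH) hεb
  have h5 : 1 ≤ p.logNb ^ 2 * (p.H : ℝ) ^ 5 * d :=
    one_le_mul_of_one_le_of_one_le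
      (one_le_mul_of_one_le_of_one_le (one_le_pow₀ (by linarith)) (one_le_pow₀ hH)) hd
  have eAcc : p.boundAcc d = √p.logNε * √(p.T * p.H * d) +
      p.logNε * (p.logNb ^ 2 * (p.H : ℝ) ^ 5 * d) := rfl
  have eb : p.bound d = √p.logNε * √(p.T * p.H * d) +
      p.logNε * (p.logNb ^ 2 * (p.H : ℝ) ^ 5 * d + (p.T : ℝ) ^ 2 * p.εb ^ 2) := rfl
  have h6 : 0 ≤ K ^ 2 * (√p.logNε * √(p.T * p.H * d)) := by positivity
  have h7 : p.logNε * ((p.T : ℝ) ^ 2 * p.εb ^ 2) ≤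
      p.logNε * (K ^ 2 * (p.logNb ^ 2 * (p.H : ℝ) ^ 5 * d)) := by
    refine mul_le_mul_of_nonneg_left (h4.trans ?_) (by linarith)
    exact le_mul_of_one_le_right (sq_nonneg _) h5
  rw [eAcc, eb]
  linarith

/-- `1 / α` is at most `T H`, hence at most `n T H / δ`; so `α` inside the logarithm costs a factor
of at most `2`. -/
theorem log_div_alpha {n : ℝ} (hn : 1 ≤ n) :
    Real.log (n * p.T * p.H / p.δ) ≤ Real.log (n * p.T * p.H / (p.α * p.δ)) ∧
    Real.log (n * p.T * p.H / (p.α * p.δ)) ≤ 2 * Real.log (n * p.T * p.H / p.δ) := by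
  have hδ := hp.δ_pos
  have hα := hp.α_pos
  have hα1 := hp.α_le_one
  have hTH := hp.one_le_TH
  have h8 := hp.eight_le_ratio hn
  have hδ1 : p.δ ≤ 1 := hp.δ_le.trans (by norm_num)
  have e : n * p.T * p.H / (p.α * p.δ) = (n * p.T * p.H / p.δ) * (1 / p.α) := by
    field_simp
  have h1 : 1 ≤ 1 / p.α := by rwa [le_div_iff₀ hα, one_mul]
  have h2 : 1 / p.α ≤ n * p.T * p.H / p.δ := by
    have h3 : 1 / p.α ≤ (1 / p.α) ^ 2 := le_self_pow₀ h1 two_ne_zero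
    have h4 : (1 / p.α) ^ 2 = p.T * p.H := by rw [div_pow, hp.α_sq]; simp
    have h5 : (p.T * p.H : ℝ) ≤ n * p.T * p.H / p.δ := by
      rw [le_div_iff₀ hδ, mul_assoc n]
      have : (p.T * p.H : ℝ) * p.δ ≤ p.T * p.H * 1 := mul_le_mul_of_nonneg_left hδ1 (by linarith)
      have : 1 * (p.T * p.H : ℝ) ≤ n * (p.T * p.H) := mul_le_mul_of_nonneg_right hn (by linarith)
      linarith
    linarith
  rw [e, Real.log_mul (by linarith) (by linarith)]
  have h3 := Real.log_nonneg h1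
  have h4 := Real.log_le_log (by linarith) h2
  constructor <;> linarith

theorem sqrt_log_alpha :
    √p.logNε ≤ √(Real.log (p.N * p.T * p.H / (p.α * p.δ)) + p.T / p.α ^ 2 * p.ε) ∧
    √(Real.log (p.N * p.T * p.H / (p.α * p.δ)) + p.T / p.α ^ 2 * p.ε) ≤ 2 * √p.logNε := by
  have hTH := hp.one_le_TH
  have hε := hp.eps_nonneg
  have h0 := hp.two_le_logN
  obtain ⟨h1, h2⟩ := hp.log_div_alpha (n := p.N) (by linarith [hp.two_le_N'])
  have e : (p.T : ℝ) / p.α ^ 2 * p.ε = (p.T : ℝ) ^ 2 * p.H * p.ε := by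
    rw [hp.α_sq, div_div_eq_mul_div, div_one]; ring
  have h3 : 0 ≤ (p.T : ℝ) ^ 2 * p.H * p.ε := by positivity
  rw [e]
  change p.logN ≤ _ at h1
  change _ ≤ 2 * p.logN at h2
  have e2 : p.logNε = p.logN + (p.T : ℝ) ^ 2 * p.H * p.ε := rfl
  refine ⟨Real.sqrt_le_sqrt (by linarith), ?_⟩
  rw [Real.sqrt_le_left (by positivity), mul_pow, Real.sq_sqrt (by linarith)]
  linarith

theorem levelTerms_le (hε : p.T * p.H * p.ε ≤ 1) : (p.H : ℝ) ^ 2 * p.ε ≤ p.H / p.T := by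
  have hT := hp.one_le_T
  have hH := hp.one_le_H
  rw [le_div_iff₀ (by linarith)]
  calc (p.H : ℝ) ^ 2 * p.ε * p.T = p.H * (p.T * p.H * p.ε) := by ring
    _ ≤ p.H * 1 := mul_le_mul_of_nonneg_left hε (by linarith)
    _ = p.H := mul_one _

theorem level_mul_delta_le (hδ : p.T * p.δ ≤ 1) : (p.H : ℝ) * p.δ ≤ p.H / p.T := by
  have hT := hp.one_le_T
  have hH := hp.one_le_H
  rw [le_div_iff₀ (by linarith)]
  calc (p.H : ℝ) * p.δ * p.T = p.H * (p.T * p.δ) := by ring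
    _ ≤ p.H * 1 := mul_le_mul_of_nonneg_left hδ (by linarith)
    _ = p.H := mul_one _

end VOQLParams.Admissible

/-- What the regret analysis uses of the threshold sequence. -/
structure IsThreshold (p : VOQLParams) (d c : ℝ) (u : ℕ → ℝ) : Prop where
  le : ∀ t ∈ Finset.Ico 2 p.T, √p.logNε * p.logNb * (√p.H ^ 5 * √d) / √t ≤ u t
  ge : p.T * p.H * p.ε ≤ 1 → ∀ t ∈ Finset.Ico 2 p.T,
    u t ≤ c * (√p.logNε * p.logNb * (√p.H ^ 5 * √d) / √t + √p.logNε * p.H ^ 2 * p.εb + p.H / p.T)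

theorem IsThreshold.of_le {p : VOQLParams} (hp : p.Admissible) {d Cu : ℝ} (hd : 1 ≤ d) (hCu : 1 ≤ Cu)
    {θ : ℕ → ℝ}
    (h1 : ∀ t ∈ Finset.Ico 2 p.T, √p.logNε * p.logNb * (√p.H ^ 5 * √d) / √t ≤ θ t)
    (h2 : p.T * p.H * p.ε ≤ 1 → ∀ t ∈ Finset.Ico 2 p.T, θ t ≤
      4 * (√p.logNε * p.logNb * (√p.H ^ 5 * √d) / √t + √p.logNε * p.H ^ 2 * p.εb + p.H / p.T)) :
    IsThreshold p d (4 * Cu) fun t => Cu * θ t where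
  le t ht := by
    have h0 : 0 ≤ √p.logNε * p.logNb * (√p.H ^ 5 * √d) / √t := by
      have := hp.two_le_logN
      have := hp.logN_le_logNb
      have h : 0 ≤ p.logNb := by linarith
      positivity
    exact (h1 t ht).trans (le_mul_of_one_le_left (h0.trans (h1 t ht)) hCu)
  ge hε t ht := by
    calc Cu * θ t ≤ Cu * _ := mul_le_mul_of_nonneg_left (h2 hε t ht) (by linarith)
      _ = _ := by ring

section Thresholds

theorem rpow_five_halves {x : ℝ} (hx : 0 ≤ x) : x ^ (5 / 2 : ℝ) = √x ^ 5 := by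
  rw [Real.sqrt_eq_rpow, ← Real.rpow_natCast, ← Real.rpow_mul hx]; norm_num


variable {p : VOQLParams} (hp : p.Admissible) {d Cu : ℝ} (hd : 1 ≤ d) (hCu : 1 ≤ Cu)
include hp hd hCu

/-- Covers the thresholds of the first two statements, which differ in the power of `H` before `ε_b`
and in the term `b`. Removing `α` from the two logarithmic factors loses `2` each, hence the `4`. -/
theorem isThreshold_general {a : ℝ} (ha : a ≤ (p.H : ℝ) ^ 2) (ha0 : 0 ≤ a) {b : ℝ} (hb0 : 0 ≤ b)
    (hb : b ≤ p.H / p.T) :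
    IsThreshold p d (4 * Cu) fun t => Cu *
      (√(Real.log (p.N * p.T * p.H / (p.α * p.δ)) + p.T / p.α ^ 2 * p.ε) *
        (Real.log (p.N * p.Nb * p.T * p.H / (p.α * p.δ)) * (p.H : ℝ) ^ (5 / 2 : ℝ) * √d +
          √t * a * p.εb) / √t + (p.H : ℝ) ^ 2 * p.ε + b) := by
  have hεb := hp.epsb_nonneg
  have hε0 := hp.eps_nonneg
  have hH := hp.one_le_H
  have h0 := hp.two_le_logN
  have h0' := hp.logN_le_logNb
  obtain ⟨x1, x2⟩ := hp.sqrt_log_alpha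
  obtain ⟨y1, y2⟩ := hp.log_div_alpha hp.one_le_NNb
  change p.logNb ≤ _ at y1
  change _ ≤ 2 * p.logNb at y2
  set xα := √(Real.log (p.N * p.T * p.H / (p.α * p.δ)) + p.T / p.α ^ 2 * p.ε)
  set yα := Real.log (p.N * p.Nb * p.T * p.H / (p.α * p.δ))
  rw [rpow_five_halves (by linarith)]
  have hx0 : 0 ≤ √p.logNε := Real.sqrt_nonneg _
  have hy0 : 0 ≤ p.logNb := by linarith
  have hyα : 0 ≤ yα := by linarith
  have hxα : 0 ≤ xα := by linarith
  have e : ∀ t ∈ Finset.Ico 2 p.T, xα * (yα * √p.H ^ 5 * √d + √t * a * p.εb) / √t =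
      xα * yα * (√p.H ^ 5 * √d) / √t + xα * a * p.εb := by
    intro t ht
    have : 0 < √(t : ℝ) := Real.sqrt_pos.2 (by
      have := (Finset.mem_Ico.1 ht).1
      exact_mod_cast (by omega : 0 < t))
    field_simp
  refine IsThreshold.of_le hp hd hCu (fun t ht => ?_) fun hε t ht => ?_
  · have h1 : √p.logNε * p.logNb * (√p.H ^ 5 * √d) / √t ≤ xα * yα * (√p.H ^ 5 * √d) / √t := by
      gcongr
    rw [e t ht]
    have : 0 ≤ xα * a * p.εb := by positivity
    have : 0 ≤ (p.H : ℝ) ^ 2 * p.ε := by positivity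
    linarith
  · have h1 : xα * yα * (√p.H ^ 5 * √d) / √t ≤
        (2 * √p.logNε) * (2 * p.logNb) * (√p.H ^ 5 * √d) / √t := by
      gcongr
    have h2 : xα * a * p.εb ≤ (2 * √p.logNε) * p.H ^ 2 * p.εb := by gcongr
    have h3 := hp.levelTerms_le hε
    have h4 : 0 ≤ √p.logNε * p.H ^ 2 * p.εb := by positivity
    have h5 : (2 * √p.logNε) * (2 * p.logNb) * (√p.H ^ 5 * √d) / √t =
      4 * (√p.logNε * p.logNb * (√p.H ^ 5 * √d) / √t) := by ring
    rw [e t ht]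
    linarith

theorem isThreshold_exp (hδ : p.T * p.δ ≤ 1) :
    IsThreshold p d (4 * Cu) fun t => Cu * p.thresholdExp d t :=
  isThreshold_general hp hd hCu (le_self_pow₀ hp.one_le_H two_ne_zero) (by positivity)
    (mul_nonneg (by positivity) hp.δ_pos.le) (hp.level_mul_delta_le hδ)

theorem isThreshold_prob : IsThreshold p d (4 * Cu) fun t => Cu * p.thresholdProb d t := by
  have h := isThreshold_general hp hd hCu (a := (p.H : ℝ) ^ 2) le_rfl (by positivity) (b := 0) le_rfl
    (by positivity)
  simp only [add_zero] at h
  exact h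

theorem isThreshold_acc (hδ : p.T * p.δ ≤ 1) :
    IsThreshold p d (4 * Cu) fun t => Cu * p.thresholdAcc d t := by
  have hεb := hp.epsb_nonneg
  have hε0 := hp.eps_nonneg
  have hH := hp.one_le_H
  have hδ0 := hp.δ_pos
  have h0 := hp.two_le_logN
  have h0' := hp.logN_le_logNb
  have hy0 : 0 ≤ p.logNb := by linarith
  have e5 : √((p.H : ℝ) ^ 5 * d) = √p.H ^ 5 * √d := by
    rw [Real.sqrt_mul (by positivity)]
    congr 1
    rw [Real.sqrt_eq_iff_mul_self_eq (by positivity) (by positivity), ← pow_two, ← pow_mul, mul_comm 5 2, pow_mul,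
      Real.sq_sqrt (by linarith)]
  have e : ∀ t, p.thresholdAcc d t = √p.logNε * p.logNb * (√p.H ^ 5 * √d) / √t +
      (p.H : ℝ) ^ 2 * p.ε + p.H * p.δ := fun t => by
    rw [← e5, mul_assoc]; rfl
  refine IsThreshold.of_le hp hd hCu (fun t ht => ?_) fun hε t ht => ?_
  · rw [e]
    have : 0 ≤ (p.H : ℝ) ^ 2 * p.ε := by positivity
    have : 0 ≤ (p.H : ℝ) * p.δ := by positivity
    linarith
  · rw [e]
    have h3 := hp.levelTerms_le hε
    have h4 := hp.level_mul_delta_le hδ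
    have h5 : 0 ≤ √p.logNε * p.H ^ 2 * p.εb := by positivity
    have h6 : 0 ≤ √p.logNε * p.logNb * (√p.H ^ 5 * √d) / √t := by positivity
    have h7 : 0 ≤ (p.H : ℝ) / p.T := by positivity
    linarith

end Thresholds

variable {X : Type u} {A : Type v} [MeasurableSpace X] [MeasurableSpace A]
  [Countable A] [Nonempty A] [MeasurableSingletonClass A]
  {M : EpisodicMDP X A} {F : ℕ → Finset (X × A → ℝ)} {W : Finset (X × A → ℝ)}
  {B : BonusOracle X A} {p : VOQLParams} {C : ℝ} {u : ℕ → ℝ}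

namespace VOQLRun

variable {Ω : Type w} [mΩ : MeasurableSpace Ω] {P : Measure Ω} [IsProbabilityMeasure P]
  (R : VOQLRun M F B p u P)

theorem integrable_regret : Integrable R.regret P :=
  integrable_finsetSum _ fun _ _ => integrable_condExp

theorem measurable_regret : Measurable R.regret :=
  Finset.measurable_fun_sum _ fun _ _ => (stronglyMeasurable_condExp.mono (R.hist_le _ _)).measurable

variable (S : VOQLSetup M F W B p C)
include S

theorem regret_le_episodes : ∀ᵐ ω ∂P, R.regret ω ≤ p.T := by
  filter_upwards [R.regret_ae_eq S, R.condExp_pathRegret_le_one S] with ω h1 h2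
  rw [h1]
  refine (Finset.sum_le_card_nsmul _ _ 1 h2).trans_eq ?_
  simp

variable {d c : ℝ} (hd : d = p.avgDim F) (hd1 : 1 ≤ d) (hc : 0 ≤ c) (hu : IsThreshold p d c u)
include hd hd1 hc hu

/-- In a long run the good event implies the bound. In a short one the regret is almost surely at
most `T`, which the bound exceeds. -/
theorem measure_lt_regret_le :
    P.real {ω | 34 * regretConst p.L C c ^ 5 * p.bound d < R.regret ω} ≤ p.δ := by
  have hp := S.adm
  have h0 := hp.two_le_logN
  have h0' := hp.logN_le_logNb
  have hy0 : 0 ≤ p.logNb := by linarith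
  rcases le_or_gt (√p.logNε * p.logNb * (√p.H ^ 5 * √d)) (√p.T) with hreg | hreg
  · refine le_trans (measureReal_mono fun ω hω => ?_) (R.measure_not_runGood_le S fun t ht => ?_)
    · intro hg
      refine absurd (show _ < R.regret ω from hω) (not_lt.2 ?_)
      refine hg.regret_le_bound S (R.isVOQL ω) hd hd1 hc hreg hu.le (hu.ge ?_)
      refine hp.eps_le_of_regime ?_
      have h1 : 1 ≤ p.logNb * (√p.H ^ 5 * √d) :=
        one_le_mul_of_one_le_of_one_le (by linarith) (one_le_mul_of_one_le_of_one_le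
          (one_le_pow₀ (Real.one_le_sqrt.2 hp.one_le_H)) (Real.one_le_sqrt.2 hd1))
      refine (Real.sqrt_le_sqrt_iff (by positivity)).1 (le_trans ?_ hreg)
      rw [mul_assoc]
      exact le_mul_of_one_le_right (Real.sqrt_nonneg _) h1
    · exact le_trans (by positivity) (hu.le t ht)
  · have hk := (regretConst_ge (C := C) hp.one_le_L S.C_pos.le (Real.sqrt_nonneg _)
      hp.five_le_logConst hc).2.2.2.1
    obtain ⟨h1, h2, h3⟩ := hp.sqrt_mul_sqrt_le_bound hd1
    have h4 : (p.T : ℝ) ≤ p.bound d := by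
      have h5 := pow_le_pow_left₀ (Real.sqrt_nonneg _) hreg.le 2
      rw [Real.sq_sqrt (by positivity)] at h5
      linarith
    have h5 : 1 ≤ 34 * regretConst p.L C c ^ 5 := by
      have := one_le_pow₀ (n := 5) (show 1 ≤ regretConst p.L C c by linarith)
      linarith
    have h6 : p.bound d ≤ 34 * regretConst p.L C c ^ 5 * p.bound d :=
      le_mul_of_one_le_left (by linarith) h5
    have h7 : P {ω | 34 * regretConst p.L C c ^ 5 * p.bound d < R.regret ω} = 0 := by
      refine measure_mono_null (t := {ω | ¬ R.regret ω ≤ p.T}) (fun ω hω => ?_)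
        (ae_iff.1 (R.regret_le_episodes S))
      have h8 : 34 * regretConst p.L C c ^ 5 * p.bound d < R.regret ω := hω
      exact not_le.2 (by linarith)
    rw [measureReal_def, h7]
    simpa using hp.δ_pos.le

theorem le_measure_regret_le :
    1 - p.δ ≤ P.real {ω | R.regret ω ≤ 34 * regretConst p.L C c ^ 5 * p.bound d} := by
  have h1 := R.measure_lt_regret_le S hd hd1 hc hu
  have h2 := probReal_add_probReal_compl (μ := P)
    (measurableSet_le R.measurable_regret
      (measurable_const (a := 34 * regretConst p.L C c ^ 5 * p.bound d)))
  have e : {ω | R.regret ω ≤ 34 * regretConst p.L C c ^ 5 * p.bound d}ᶜ =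
    {ω | 34 * regretConst p.L C c ^ 5 * p.bound d < R.regret ω} := by
      ext ω; simp
  rw [e] at h2
  linarith

/-- The exceptional event contributes at most `T δ ≤ 1`, which one more copy of the bound absorbs.
-/
theorem integral_regret_le (hδ : p.T * p.δ ≤ 1) :
    ∫ ω, R.regret ω ∂P ≤ (34 * regretConst p.L C c ^ 5 + 1) * p.bound d := by
  have hp := S.adm
  obtain ⟨_, h2, h3⟩ := hp.sqrt_mul_sqrt_le_bound hd1
  set b := 34 * regretConst p.L C c ^ 5 * p.bound d with hb
  have hk := (regretConst_ge (C := C) hp.one_le_L S.C_pos.le (Real.sqrt_nonneg _)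
      hp.five_le_logConst hc).2.2.2.1
  have hb0 : 0 ≤ b := mul_nonneg (mul_nonneg (by norm_num) (pow_nonneg (by linarith) _)) (by linarith)
  set E := {ω | b < R.regret ω} with hE
  have hEm : MeasurableSet E := measurableSet_lt measurable_const R.measurable_regret
  have h1 : ∫ ω, R.regret ω ∂P ≤ ∫ ω, (b + E.indicator (fun _ => (p.T : ℝ)) ω) ∂P := by
    refine integral_mono_ae R.integrable_regret
      ((integrable_const _).add ((integrable_const _).indicator hEm)) ?_
    filter_upwards [R.regret_le_episodes S] with ω hω
    by_cases h : ω ∈ E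
    · rw [indicator_of_mem h]; linarith
    · rw [indicator_of_notMem h, add_zero]
      exact not_lt.1 h
  rw [integral_add (integrable_const _) ((integrable_const _).indicator hEm), integral_const,
    integral_indicator_const _ hEm] at h1
  simp only [probReal_univ, smul_eq_mul] at h1
  have h4 := R.measure_lt_regret_le S hd hd1 hc hu
  have h5 : P.real E * p.T ≤ p.δ * p.T := mul_le_mul_of_nonneg_right h4 (by positivity)
  rw [add_mul]
  linarith

end VOQLRun

/-- Completeness for the constant function `2` produces a member of the class with values at least
`2 - ε ≥ 1`. -/
theorem EpisodicMDP.Complete.one_le_range {L ε : ℝ} (hF : M.Complete F L ε) (hε : ε ≤ 1) : 1 ≤ L := by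
  have := M.start_prob
  obtain ⟨x⟩ := nonempty_of_isProbabilityMeasure M.start
  obtain ⟨a⟩ := ‹Nonempty A›
  have := M.trans_markov 1
  have h1 : 1 ∈ Finset.Icc 1 M.H := Finset.mem_Icc.2 ⟨le_rfl, M.H_pos⟩
  obtain ⟨f, hf, h⟩ := hF.first_moment 1 h1 (fun _ => 2) measurable_const fun _ => by norm_num
  have h2 : 2 ≤ M.bellman 1 (fun _ => 2) (x, a) := by
    have hm : Measurable fun x' => M.reward 1 x a x' :=
      (M.reward_measurable 1).comp (measurable_const.prodMk (measurable_const.prodMk measurable_id))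
    have hi : Integrable (fun x' => M.reward 1 x a x' + 2) (M.trans 1 (x, a)) :=
      (Integrable.of_mem_Icc 0 1 hm.aemeasurable
        (Filter.Eventually.of_forall fun x' => M.reward_mem 1 x a x')).add (integrable_const _)
    have := integral_mono (integrable_const (2 : ℝ)) hi fun x' => by
      have := (M.reward_mem 1 x a x').1
      simpa using this
    simpa [EpisodicMDP.bellman] using this
  have h3 := (abs_le.1 (h (x, a))).1
  have h4 := (hF.range 1 h1 f hf (x, a)).2
  linarith

/-- Only the nondegeneracy conditions need an argument: `𝒩 ≥ 2` follows from `d_α ≥ 1`, and `L ≥ 1`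
from completeness. -/
theorem voqlSetup_stdParams {T : ℕ} {L ε εb δ : ℝ} (hC : 0 < C) (hT : 0 < T)
    (hM : M.SparseReward) (hε : 0 ≤ ε) (hε1 : ε ≤ 1) (hεb : 0 ≤ εb) (hδ : 0 < δ) (hδ1 : δ ≤ 1 / 11)
    (hF : M.Complete F L ε) (hW : ∀ w ∈ W, Measurable w)
    (hB₁ : IsConsistentBonusOracle B F W (stdParams M F W T L ε εb δ) C
      (stdParams M F W T L ε εb δ).β₁)
    (hB₂ : IsConsistentBonusOracle B F W (stdParams M F W T L ε εb δ) C
      (stdParams M F W T L ε εb δ).β₂)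
    (hd : 1 ≤ (stdParams M F W T L ε εb δ).avgDim F) :
    VOQLSetup M F W B (stdParams M F W T L ε εb δ) C := by
  have hH := M.H_pos
  have h1 : 1 ∈ Finset.Icc 1 M.H := Finset.mem_Icc.2 ⟨le_rfl, M.H_pos⟩
  have hN : 2 ≤ M.classSize F := by
    by_contra hlt
    have hcard : ∀ h ∈ Finset.Icc 1 M.H, (F h).card ≤ 1 := fun h hh =>
      (Finset.le_sup (f := fun h => (F h).card) hh).trans (by
        change M.classSize F ≤ 1; omega)
    have : (stdParams M F W T L ε εb δ).avgDim F = 0 :=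
      mul_eq_zero_of_right _ (Finset.sum_eq_zero fun h hh =>
        eluderDim_eq_zero_of_card_le_one (hcard h hh) _ _ _)
    linarith
  have hNb : 1 ≤ W.card := by
    have := M.start_prob
    obtain ⟨x⟩ := nonempty_of_isProbabilityMeasure M.start
    obtain ⟨a⟩ := ‹Nonempty A›
    obtain ⟨f, hf, -⟩ := hF.optimal 1 h1
    -- Any call of the oracle, here on constant data, returns an element of `W`.
    refine Finset.card_pos.2 ⟨_, hB₁.mem 1 h1 1 (Finset.mem_Icc.2 ⟨le_rfl, hT⟩) (fun _ => 1)
      (fun _ => ?_) ⟨fun _ => (x, a), fun _ => 0, fun _ => x⟩ f hf⟩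
    change √(1 / (T * M.H : ℝ)) ≤ 1
    rw [Real.sqrt_le_one, div_le_one (by positivity)]
    exact_mod_cast Nat.mul_pos hT hH
  exact
    { adm :=
        { T_pos := hT
          H_pos := hH
          one_le_L := hF.one_le_range hε1
          eps_nonneg := hε
          epsb_nonneg := hεb
          α_eq := rfl
          lam_eq := rfl
          δ_pos := hδ
          δ_le := hδ1
          two_le_N := hN
          one_le_Nb := hNb }
      H_eq := rfl
      N_eq := rfl
      Nb_eq := rfl
      sparse := hM
      complete := hF
      W_meas := hW
      C_pos := hC
      oracle₁ := hB₁
      oracle₂ := hB₂ }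

theorem mainTheorem1 (L C K : ℝ) (hC : 0 < C) (hK : 0 ≤ K) :
    ∃ C₀ : ℝ, 0 < C₀ ∧ ∀ Cu : ℝ, C₀ ≤ Cu → ∃ CR : ℝ, 0 < CR ∧
    ∀ (X : Type u) (A : Type v) [MeasurableSpace X] [MeasurableSpace A] [Countable A] [Nonempty A]
      [MeasurableSingletonClass A] (M : EpisodicMDP X A) (T : ℕ) (F : ℕ → Finset (X × A → ℝ))
      (W : Finset (X × A → ℝ)) (B : BonusOracle X A) (ε εb δ : ℝ) (p : VOQLParams) (d : ℝ),
    p = stdParams M F W T L ε εb δ → d = p.avgDim F →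
    0 < T → M.SparseReward → 0 ≤ ε → ε ≤ 1 → 0 ≤ εb → 0 < δ → M.Complete F L ε →
    (∀ w ∈ W, Measurable w) →
    IsConsistentBonusOracle B F W p C p.β₁ → IsConsistentBonusOracle B F W p C p.β₂ → 1 ≤ d →
    (δ < 1 / (T + 10) →
      ∀ (Ω : Type w) [MeasurableSpace Ω] (P : Measure Ω) [IsProbabilityMeasure P]
        (R : VOQLRun M F B p (fun t => Cu * p.thresholdExp d t) P),
        ∫ ω, R.regret ω ∂P ≤ CR * p.bound d) ∧
    (δ ≤ 1 / ((M.H : ℝ) ^ 2 + 11) →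
      ∀ (Ω : Type w) [MeasurableSpace Ω] (P : Measure Ω) [IsProbabilityMeasure P]
        (R : VOQLRun M F B p (fun t => Cu * p.thresholdProb d t) P),
        1 - δ ≤ P.real {ω | R.regret ω ≤ CR * p.bound d}) ∧
    (T * M.H * εb ≤ K → δ < 1 / (T + (M.H : ℝ) ^ 2 + 11) →
      ∀ (Ω : Type w) [MeasurableSpace Ω] (P : Measure Ω) [IsProbabilityMeasure P]
        (R : VOQLRun M F B p (fun t => Cu * p.thresholdAcc d t) P),
        ∫ ω, R.regret ω ∂P ≤ CR * p.boundAcc d ∧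
          1 - δ ≤ P.real {ω | R.regret ω ≤ CR * p.boundAcc d}) := by
  -- The thresholds without a constant are already large enough, so `C₀ = 1` works; `C_R` grows with
  -- `Cu` through `regretConst`, and `K` enters only when `bound` is replaced by `boundAcc`.
  refine ⟨1, one_pos, fun Cu hCu => ?_⟩
  set c₁ := 34 * regretConst L C (4 * Cu) ^ 5 + 1 with hc₁
  refine ⟨max 1 c₁ * (1 + K ^ 2), by positivity, ?_⟩
  intro X A _ _ _ _ _ M T F W B ε εb δ p d hp hd hT hM hε hε1 hεb hδ hF hW hB₁ hB₂ hd1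
  have hT1 : (1 : ℝ) ≤ T := by exact_mod_cast hT
  have hH1 : (1 : ℝ) ≤ (M.H : ℝ) ^ 2 := one_le_pow₀ (by exact_mod_cast M.H_pos)
  have hcu : 0 ≤ 4 * Cu := by linarith
  have setup : δ ≤ 1 / 11 → VOQLSetup M F W B p C := by
    subst hp hd
    exact fun h => voqlSetup_stdParams hC hT hM hε hε1 hεb hδ h hF hW hB₁ hB₂ hd1
  have hpL : p.L = L := by rw [hp]; rfl
  have hpT : p.T = T := by rw [hp]; rfl
  have hpδ : p.δ = δ := by rw [hp]; rfl
  have hpH : p.H = M.H := by rw [hp]; rfl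
  have hpb : p.εb = εb := by rw [hp]; rfl
  have hK1 : 1 ≤ 1 + K ^ 2 := by linarith [sq_nonneg K]
  have hc₁K : max 1 c₁ ≤ max 1 c₁ * (1 + K ^ 2) := le_mul_of_one_le_right (by positivity) hK1
  have hc₁m : c₁ ≤ max 1 c₁ := le_max_right _ _
  have bnd : VOQLSetup M F W B p C → 0 ≤ p.bound d := fun S => by
    obtain ⟨_, h2, h3⟩ := S.adm.sqrt_mul_sqrt_le_bound hd1
    linarith
  have small : ∀ y : ℝ, T ≤ y → 11 ≤ y → δ < 1 / y → δ ≤ 1 / 11 ∧ T * δ ≤ 1 := fun y h1 h2 h3 => by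
    have h4 : δ * y < 1 := by rwa [lt_div_iff₀ (by linarith)] at h3
    refine ⟨?_, by nlinarith⟩
    rw [le_div_iff₀ (by norm_num)]
    nlinarith
  refine ⟨fun hδ1 Ω _ P _ R => ?_, fun hδ1 Ω _ P _ R => ?_, fun hKb hδ1 Ω _ P _ R => ?_⟩
  · obtain ⟨h1, h2⟩ := small _ (by linarith) (by linarith) hδ1
    have S := setup h1
    have h3 := R.integral_regret_le S hd hd1 hcu
      (isThreshold_exp S.adm hd1 hCu (by rwa [hpT, hpδ])) (by rwa [hpT, hpδ])
    rw [hpL] at h3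
    exact h3.trans (mul_le_mul_of_nonneg_right (hc₁m.trans hc₁K) (bnd S))
  · have h1 : δ ≤ 1 / 11 := hδ1.trans (one_div_le_one_div_of_le (by norm_num) (by linarith))
    have S := setup h1
    have h3 := R.le_measure_regret_le S hd hd1 hcu (isThreshold_prob S.adm hd1 hCu)
    rw [hpL, hpδ] at h3
    refine h3.trans (measureReal_mono fun ω hω => ?_)
    have h4 : R.regret ω ≤ 34 * regretConst L C (4 * Cu) ^ 5 * p.bound d := hω
    exact h4.trans (mul_le_mul_of_nonneg_right (by linarith) (bnd S))
  · obtain ⟨h1, h2⟩ := small _ (by linarith) (by linarith) hδ1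
    have S := setup h1
    have hu := isThreshold_acc S.adm hd1 hCu (by rwa [hpT, hpδ])
    have hacc : max 1 c₁ * p.bound d ≤ max 1 c₁ * (1 + K ^ 2) * p.boundAcc d := by
      rw [mul_assoc]
      refine mul_le_mul_of_nonneg_left ?_ (by positivity)
      exact S.adm.bound_le_boundAcc hd1 (by rwa [hpT, hpH, hpb])
    constructor
    · have h3 := R.integral_regret_le S hd hd1 hcu hu (by rwa [hpT, hpδ])
      rw [hpL] at h3
      exact (h3.trans (mul_le_mul_of_nonneg_right hc₁m (bnd S))).trans hacc
    · have h3 := R.le_measure_regret_le S hd hd1 hcu hu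
      rw [hpL, hpδ] at h3
      refine h3.trans (measureReal_mono fun ω hω => ?_)
      have h4 : R.regret ω ≤ 34 * regretConst L C (4 * Cu) ^ 5 * p.bound d := hω
      exact (h4.trans (mul_le_mul_of_nonneg_right (by linarith) (bnd S))).trans hacc

end
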